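/- Consider a chain of $N\ge 1$ hyperbolic subsystems, $i=1,\dots,N$, on $t>0$, $x\in[0,1]$, $$\partial_t u_i+\Lambda_i^+\partial_x u_i=\Sigma_i^{++}(x)u_i+\Sigma_i^{+-}(x)v_i,\qquad \partial_t v_i-\Lambda_i^-\partial_x v_i=\Sigma_i^{-+}(x)u_i+\Sigma_i^{--}(x)v_i,$$ $$u_i(t,0)=Q_{i,i}v_i(t,0)+Q_{i,i-1}u_{i-1}(t,1),\qquad v_i(t,1)=R_{i,i}u_i(t,1)+R_{i,i+1}v_{i+1}(t,0),$$ with $u_i(t,x)\in\mathbb R^{n_i}$, $v_i(t,x)\in\mathbb R^{m_i}$, $n_i,m_i\ge1$, $\Lambda_i^+=\mathrm{diag}(\lambda_i^j)$, $\Lambda_i^-=\mathrm{diag}(\mu_i^j)$, $0<\lambda_i^1<\dots<\lambda_i^{n_i}$, $0<\mu_i^1<\dots<\mu_i^{m_i}$, continuous $\Sigma_i^{\cdot\cdot}$, zero diagonals of $\Sigma_i^{++}$ and $\Sigma_i^{--}$, $R_{N,N+1}=0$, $Q_{1,0}=\mathrm{Id}$, control input $U(t)=u_0(t,1)\in\mathbb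 R^{n_1}$ and measurement $y(t)=u_N(t,1)$. Assume that $\operatorname{rank}Q_{i+1,i}=n_{i+1}=n_i$ for $1\le i<N$. Let $\tau>\sum_{j=1}^N 1/\lambda_j^1$, $\tau_j=1/\lambda_j^1+1/\mu_j^1$, $\theta_i=\tau+\sum_{j<i}1/\lambda_j^1$, $T=2\tau+\sum_{j=1}^N2\tau_j$. Solutions are bounded Borel functions (locally in time) which satisfy the equations integrated along characteristics; initial data are arbitrary bounded Borel functions (this contains all $H^1$ data). *(Observer.)* There is an operator $O$ such that $(Oy)(t)$ depends only on $y|_{[0,t]}$ and, for every input and every solution, $(Oy)(t)=(u_i(t-\tau,\cdot),v_i(t-\tau,\cdot))_{i\le N}$ for all $t>\tau+\sum_{j}1/\mu_j^1$. *(Kernels.)* There are bounded measurable kernels $K_i^{uu},K_i^{uv}$ on $\{0\le x\le y\le1\}$ $(1\le i\le N)$ and $F_i$ on $\{0\le x\le1,\,0\le y\le x/\lambda_i^1\}$ $(1\le i<N)$ which, integrated along characteristics, solve $$\Lambda_i^+\partial_xK_i^{uu}+\partial_yK_i^{uu}\Lambda_i^+=-K_i^{uu}\Sigma_i^{++}(y)-K_i^{uv}\Sigma_i^{-+}(y)+G_i(x)K_i^{uu},$$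 $$\Lambda_i^+\partial_xK_i^{uv}-\partial_yK_i^{uv}\Lambda_i^-=-K_i^{uu}\Sigma_i^{+-}(y)-K_i^{uv}\Sigma_i^{--}(y)+G_i(x)K_i^{uv},\qquad \Lambda_i^+\partial_xF_i+\partial_yF_i=G_i(x)F_i,$$ $$(K_i^{uu}(x,x))_{k\ell}=\tfrac{(\Sigma_i^{++}(x))_{k\ell}}{\lambda_i^k-\lambda_i^\ell}\ (k>\ell),\quad \Lambda_i^+K_i^{uv}(x,x)+K_i^{uv}(x,x)\Lambda_i^-=\Sigma_i^{+-}(x),\quad K_i^{uu}(x,1)\Lambda_i^+=K_i^{uv}(x,1)\Lambda_i^-R_{i,i},$$ $$F_i(x,0)=-K_i^{uv}(x,1)\Lambda_i^-R_{i,i+1},\qquad (F_i(x,x/\lambda_i^1))_{k\ell}=0\ (k>1),$$ where $G_i$ is strictly upper triangular, $(G_i)_{k\ell}=(\Sigma_i^{++})_{k\ell}+(\lambda_i^\ell-\lambda_i^k)(K_i^{uu}(x,x))_{k\ell}$ for $k<\ell$. (Where two of these conditions on one entry meet at a corner of the domain, one of them is kept there.) *(Control law.)* Given such an $O$ and such kernels,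 define $\hat U_1,\dots,\hat U_N$ (locally bounded, measurable) by $\hat U_i(t)=0$ for $t<T$ and, for $t\ge T$, as follows. Let $(p_{u_j},p_{v_j})_{j\ge i}$ be equal to the estimate $(Oy)(r)$ for $r\in[t-\max_k\tau_k,t]$, and on $[t,t+\theta_i]$ let it solve subsystems $i,\dots,N$ with left boundary condition $p_{u_i}(r,0)=Q_{i,i}p_{v_i}(r,0)+\hat U_i(r-\theta_i)-M_i(r)$, where $M_1=0$ and $M_i(r)=Q_{i,i-1}\int_0^{1/\lambda_{i-1}^1}F_{i-1}(1,s)p_{v_i}(r-s,0)\,ds$ for $i>1$. Then, with $r=t+\theta_i$, $$\hat U_i(t)=A_i(r,0)-Q_{i,i}p_{v_i}(r,0)-\int_0^1\big(K_i^{uu}(0,x)p_{u_i}(r,x)+K_i^{uv}(0,x)p_{v_i}(r,x)\big)dx+M_i(r),$$ where $A_i$ is the solution of $\partial_tA_i+\Lambda_i^+\partial_xA_i=G_iA_i$ with right boundary value $A_i(s,1)=\zeta_i(s)$, $\zeta_N=0$ and $\zeta_i(s)=Q_{i+1,i}^\top(Q_{i+1,i}Q_{i+1,i}^\top)^{-1}\hat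 U_{i+1}(s-\theta_{i+1})$ for $i<N$. *(Conclusion.)* An observer $O$ and kernels as above exist. For all of them, the output-feedback controller $U=\hat U_1$, which uses only the measurement $y$, exponentially stabilizes the chain: for every initial state the closed loop has a solution on $[0,\infty)$, its state and its input are unique, and there are $c,\gamma>0$, independent of the initial state, such that for all $t\ge0$ $$\|(u,v)(t,\cdot)\|_{L^2}\le c\,e^{-\gamma t}\,\|(u,v)(0,\cdot)\|_{L^2}.$$ -/

import Mathlib

open Set MeasureTheory
open scoped Matrix

noncomputable section

/-- Data of a chain of `N` linear hyperbolic subsystems, indexed by `i = 1, …, N`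
(values at other indices are irrelevant).  `Q i` is the matrix `Q_{i+1,i}`, `R i` is the
matrix `R_{i,i+1}` (both used for `1 ≤ i < N` only), `Qd i` and `Rd i` are the matrices
`Q_{i,i}` and `R_{i,i}`.  The index `0 : Fin (n i)` stands for the superscript `1`. -/
structure Chain where
  N : ℕ
  n : ℕ → ℕ
  m : ℕ → ℕ
  n_pos : ∀ i, 0 < n i
  m_pos : ∀ i, 0 < m i
  lam : (i : ℕ) → Fin (n i) → ℝ
  mu : (i : ℕ) → Fin (m i) → ℝ
  Spp : (i : ℕ) → ℝ → Matrix (Fin (n i)) (Fin (n i)) ℝ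
  Spm : (i : ℕ) → ℝ → Matrix (Fin (n i)) (Fin (m i)) ℝ
  Smp : (i : ℕ) → ℝ → Matrix (Fin (m i)) (Fin (n i)) ℝ
  Smm : (i : ℕ) → ℝ → Matrix (Fin (m i)) (Fin (m i)) ℝ
  Qd : (i : ℕ) → Matrix (Fin (n i)) (Fin (m i)) ℝ
  Q : (i : ℕ) → Matrix (Fin (n (i + 1))) (Fin (n i)) ℝ
  Rd : (i : ℕ) → Matrix (Fin (m i)) (Fin (n i)) ℝ
  R : (i : ℕ) → Matrix (Fin (m i)) (Fin (m (i + 1))) ℝ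

namespace Chain

variable (C : Chain)

/-- The first component of a rightward block. -/
def fst (i : ℕ) : Fin (C.n i) := ⟨0, C.n_pos i⟩

/-- The slowest rightward velocity of subsystem `i`. -/
def lam1 (i : ℕ) : ℝ := C.lam i ⟨0, C.n_pos i⟩

/-- The slowest leftward velocity of subsystem `i`. -/
def mu1 (i : ℕ) : ℝ := C.mu i ⟨0, C.m_pos i⟩

/-- The maximum transport delay of subsystem `i`. -/
def delay (i : ℕ) : ℝ := 1 / C.lam1 i + 1 / C.mu1 i

/-- The standing hypotheses on the class of systems. -/
structure Standing : Prop where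
  N_pos : 0 < C.N
  lam_pos : ∀ i ∈ Finset.Icc 1 C.N, ∀ k, 0 < C.lam i k
  lam_mono : ∀ i ∈ Finset.Icc 1 C.N, StrictMono (C.lam i)
  mu_pos : ∀ i ∈ Finset.Icc 1 C.N, ∀ k, 0 < C.mu i k
  mu_mono : ∀ i ∈ Finset.Icc 1 C.N, StrictMono (C.mu i)
  Spp_cont : ∀ i ∈ Finset.Icc 1 C.N, ContinuousOn (C.Spp i) (Icc 0 1)
  Spm_cont : ∀ i ∈ Finset.Icc 1 C.N, ContinuousOn (C.Spm i) (Icc 0 1)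
  Smp_cont : ∀ i ∈ Finset.Icc 1 C.N, ContinuousOn (C.Smp i) (Icc 0 1)
  Smm_cont : ∀ i ∈ Finset.Icc 1 C.N, ContinuousOn (C.Smm i) (Icc 0 1)
  Spp_diag : ∀ i ∈ Finset.Icc 1 C.N, ∀ x ∈ Icc (0 : ℝ) 1, ∀ k, C.Spp i x k k = 0
  Smm_diag : ∀ i ∈ Finset.Icc 1 C.N, ∀ x ∈ Icc (0 : ℝ) 1, ∀ k, C.Smm i x k k = 0

/-- A state of the chain: the spatial profiles `(u_i, v_i)` on `[0,1]`. -/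
structure State where
  u : (i : ℕ) → ℝ → Fin (C.n i) → ℝ
  v : (i : ℕ) → ℝ → Fin (C.m i) → ℝ

/-- Two states have the same subsystems `i, …, N`. -/
def State.Agree {C : Chain} (i : ℕ) (a b : C.State) : Prop :=
  ∀ j ∈ Finset.Icc i C.N, ∀ x ∈ Icc (0 : ℝ) 1, a.u j x = b.u j x ∧ a.v j x = b.v j x

/-- Bounded Borel states. -/
structure State.Admissible {C : Chain} (a : C.State) : Prop where
  meas_u : ∀ i ∈ Finset.Icc 1 C.N, ∀ k, Measurable fun x => a.u i x k
  meas_v : ∀ i ∈ Finset.Icc 1 C.N, ∀ k, Measurable fun x => a.v i x k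
  bdd : ∃ M : ℝ, ∀ i ∈ Finset.Icc 1 C.N, ∀ x ∈ Icc (0 : ℝ) 1,
    (∀ k, |a.u i x k| ≤ M) ∧ (∀ k, |a.v i x k| ≤ M)

/-- The `L²` norm of the whole state. -/
def State.l2norm {C : Chain} (a : C.State) : ℝ :=
  Real.sqrt (∑ i ∈ Finset.Icc 1 C.N,
    ∫ x in (0 : ℝ)..1, ((∑ k, (a.u i x k) ^ 2) + ∑ k, (a.v i x k) ^ 2))

/-- `z` is a (broad) solution, for the times in the interval `J` with left end `t₀`, of the
subsystems `i₀, …, N` of the chain, where `b` is the signal that enters subsystem `i₀` from its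
left: `u_{i₀}(t,0) = Q_{i₀,i₀} v_{i₀}(t,0) + b(t)`.  The differential equations
`∂ₜu + Λ⁺ ∂ₓu = Σ⁺⁺u + Σ⁺⁻v` and `∂ₜv - Λ⁻ ∂ₓv = Σ⁻⁺u + Σ⁻⁻v` are integrated along
characteristics.  The boundary conditions are imposed after `t₀`, so no compatibility of the
state at `t₀` is needed. -/
structure IsSol (i₀ : ℕ) (t₀ : ℝ) (J : Set ℝ) (b : ℝ → Fin (C.n i₀) → ℝ)
    (z : ℝ → C.State) : Prop where
  meas_u : ∀ i ∈ Finset.Icc i₀ C.N, ∀ k, Measurable fun q : ℝ × ℝ => (z q.1).u i q.2 k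
  meas_v : ∀ i ∈ Finset.Icc i₀ C.N, ∀ k, Measurable fun q : ℝ × ℝ => (z q.1).v i q.2 k
  bdd : ∀ T : ℝ, ∃ M : ℝ, ∀ t ∈ J, t ≤ T → ∀ i ∈ Finset.Icc i₀ C.N, ∀ x ∈ Icc (0 : ℝ) 1,
    (∀ k, |(z t).u i x k| ≤ M) ∧ (∀ k, |(z t).v i x k| ≤ M)
  eq_u : ∀ i ∈ Finset.Icc i₀ C.N, ∀ k, ∀ t ∈ J, ∀ x ∈ Icc (0 : ℝ) 1, ∀ s : ℝ, 0 ≤ s →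
    t + s ∈ J → x + C.lam i k * s ≤ 1 →
    (z (t + s)).u i (x + C.lam i k * s) k = (z t).u i x k +
      ∫ r in (0 : ℝ)..s,
        ((C.Spp i (x + C.lam i k * r) *ᵥ (z (t + r)).u i (x + C.lam i k * r)) k +
          (C.Spm i (x + C.lam i k * r) *ᵥ (z (t + r)).v i (x + C.lam i k * r)) k)
  eq_v : ∀ i ∈ Finset.Icc i₀ C.N, ∀ k, ∀ t ∈ J, ∀ x ∈ Icc (0 : ℝ) 1, ∀ s : ℝ, 0 ≤ s →
    t + s ∈ J → 0 ≤ x - C.mu i k * s →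
    (z (t + s)).v i (x - C.mu i k * s) k = (z t).v i x k +
      ∫ r in (0 : ℝ)..s,
        ((C.Smp i (x - C.mu i k * r) *ᵥ (z (t + r)).u i (x - C.mu i k * r)) k +
          (C.Smm i (x - C.mu i k * r) *ᵥ (z (t + r)).v i (x - C.mu i k * r)) k)
  left_in : ∀ t ∈ J, t₀ < t → (z t).u i₀ 0 = C.Qd i₀ *ᵥ (z t).v i₀ 0 + b t
  left : ∀ i ∈ Finset.Ico i₀ C.N, ∀ t ∈ J, t₀ < t →
    (z t).u (i + 1) 0 = C.Qd (i + 1) *ᵥ (z t).v (i + 1) 0 + C.Q i *ᵥ (z t).u i 1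
  right : ∀ i ∈ Finset.Ico i₀ C.N, ∀ t ∈ J, t₀ < t →
    (z t).v i 1 = C.Rd i *ᵥ (z t).u i 1 + C.R i *ᵥ (z t).v (i + 1) 0
  right_end : ∀ t ∈ J, t₀ < t → (z t).v C.N 1 = C.Rd C.N *ᵥ (z t).u C.N 1

/-- The measured output `y(t) = u_N(t,1)`. -/
def output (z : ℝ → C.State) : ℝ → Fin (C.n C.N) → ℝ := fun t => (z t).u C.N 1

/-! ### The observer of the delayed state -/

/-- `O` is an exact observer of the `τ`-delayed state: its value at time `t` depends only on the
measurement on `[0,t]`, and along every solution, for every input `U`, it is equal to the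
delayed state `z (t - τ)` as soon as `t > τ + ∑ 1/μ_j^1`. -/
structure IsDelayedObserver (τ : ℝ) (O : (ℝ → Fin (C.n C.N) → ℝ) → ℝ → C.State) : Prop where
  causal : ∀ (t : ℝ) (y y' : ℝ → Fin (C.n C.N) → ℝ), (∀ s ∈ Icc 0 t, y s = y' s) →
    (O y t).Agree 1 (O y' t)
  exact : ∀ (U : ℝ → Fin (C.n 1) → ℝ) (z : ℝ → C.State), C.IsSol 1 0 (Ici 0) U z →
    ∀ t : ℝ, τ + ∑ j ∈ Finset.Icc 1 C.N, 1 / C.mu1 j < t →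
      (O (C.output z) t).Agree 1 (z (t - τ))

/-! ### Backstepping kernels -/

/-- The kernels `K_i^{uu}`, `K_i^{uv}` (on `0 ≤ x ≤ y ≤ 1`) and `F_i`
(on `0 ≤ x ≤ 1`, `0 ≤ y ≤ x / λ_i^1`) of the transformation
`α_i(t,x) = u_i(t,x) + ∫₀^{x/λ_i^1} F_i(x,y) v_{i+1}(t-y,0) dy
  + ∫ₓ¹ (K_i^{uu}(x,y) u_i(t,y) + K_i^{uv}(x,y) v_i(t,y)) dy`. -/
structure Kernels where
  Kuu : (i : ℕ) → ℝ → ℝ → Matrix (Fin (C.n i)) (Fin (C.n i)) ℝ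
  Kuv : (i : ℕ) → ℝ → ℝ → Matrix (Fin (C.n i)) (Fin (C.m i)) ℝ
  F : (i : ℕ) → ℝ → ℝ → Matrix (Fin (C.n i)) (Fin (C.m (i + 1))) ℝ

variable {C}

/-- The strictly upper-triangular matrix `G_i(x)` of the target system
`∂ₜα_i + Λ_i⁺ ∂ₓα_i = G_i α_i`. -/
def Kernels.G (D : C.Kernels) (i : ℕ) (x : ℝ) : Matrix (Fin (C.n i)) (Fin (C.n i)) ℝ :=
  fun k l => if k < l then C.Spp i x k l + (C.lam i l - C.lam i k) * D.Kuu i x x k l else 0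

/-- The kernel equations
`Λ⁺ ∂ₓK^{uu} + ∂_yK^{uu} Λ⁺ = -(K^{uu} Σ⁺⁺ + K^{uv} Σ⁻⁺) + G K^{uu}`,
`Λ⁺ ∂ₓK^{uv} - ∂_yK^{uv} Λ⁻ = -(K^{uu} Σ⁺⁻ + K^{uv} Σ⁻⁻) + G K^{uv}`,
`Λ⁺ ∂ₓF + ∂_yF = G F`, each integrated along its characteristics, with their boundary
conditions.  At a corner where two conditions on the same entry meet, only one is kept. -/
structure Kernels.Solve (D : C.Kernels) : Prop where
  meas_uu : ∀ i ∈ Finset.Icc 1 C.N, ∀ k l, Measurable fun q : ℝ × ℝ => D.Kuu i q.1 q.2 k l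
  meas_uv : ∀ i ∈ Finset.Icc 1 C.N, ∀ k l, Measurable fun q : ℝ × ℝ => D.Kuv i q.1 q.2 k l
  meas_F : ∀ i ∈ Finset.Ico 1 C.N, ∀ k l, Measurable fun q : ℝ × ℝ => D.F i q.1 q.2 k l
  bdd_K : ∃ M : ℝ, ∀ i ∈ Finset.Icc 1 C.N, ∀ x y : ℝ, 0 ≤ x → x ≤ y → y ≤ 1 →
    (∀ k l, |D.Kuu i x y k l| ≤ M) ∧ (∀ k l, |D.Kuv i x y k l| ≤ M)
  bdd_F : ∃ M : ℝ, ∀ i ∈ Finset.Ico 1 C.N, ∀ x y : ℝ, 0 ≤ x → x ≤ 1 → 0 ≤ y →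
    y ≤ x / C.lam1 i → ∀ k l, |D.F i x y k l| ≤ M
  eq_uu : ∀ i ∈ Finset.Icc 1 C.N, ∀ k l, ∀ x y s : ℝ, 0 ≤ x → x ≤ y → 0 ≤ s →
    x + C.lam i k * s ≤ y + C.lam i l * s → y + C.lam i l * s ≤ 1 →
    D.Kuu i (x + C.lam i k * s) (y + C.lam i l * s) k l = D.Kuu i x y k l +
      ∫ r in (0 : ℝ)..s,
        (-(D.Kuu i (x + C.lam i k * r) (y + C.lam i l * r) * C.Spp i (y + C.lam i l * r)
            + D.Kuv i (x + C.lam i k * r) (y + C.lam i l * r) * C.Smp i (y + C.lam i l * r))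
          + D.G i (x + C.lam i k * r) *
            D.Kuu i (x + C.lam i k * r) (y + C.lam i l * r)) k l
  eq_uv : ∀ i ∈ Finset.Icc 1 C.N, ∀ k l, ∀ x y s : ℝ, 0 ≤ x → y ≤ 1 → 0 ≤ s →
    x + C.lam i k * s ≤ y - C.mu i l * s →
    D.Kuv i (x + C.lam i k * s) (y - C.mu i l * s) k l = D.Kuv i x y k l +
      ∫ r in (0 : ℝ)..s,
        (-(D.Kuu i (x + C.lam i k * r) (y - C.mu i l * r) * C.Spm i (y - C.mu i l * r)
            + D.Kuv i (x + C.lam i k * r) (y - C.mu i l * r) * C.Smm i (y - C.mu i l * r))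
          + D.G i (x + C.lam i k * r) *
            D.Kuv i (x + C.lam i k * r) (y - C.mu i l * r)) k l
  diag_uu : ∀ i ∈ Finset.Icc 1 C.N, ∀ k l, l < k → ∀ x ∈ Icc (0 : ℝ) 1,
    D.Kuu i x x k l = C.Spp i x k l / (C.lam i k - C.lam i l)
  diag_uv : ∀ i ∈ Finset.Icc 1 C.N, ∀ k l, ∀ x ∈ Icc (0 : ℝ) 1,
    C.lam i k * D.Kuv i x x k l + D.Kuv i x x k l * C.mu i l = C.Spm i x k l
  right_K : ∀ i ∈ Finset.Icc 1 C.N, ∀ k l, ∀ x ∈ Icc (0 : ℝ) 1, x < 1 ∨ k ≤ l →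
    (D.Kuu i x 1 * Matrix.diagonal (C.lam i)) k l =
      (D.Kuv i x 1 * Matrix.diagonal (C.mu i) * C.Rd i) k l
  eq_F : ∀ i ∈ Finset.Ico 1 C.N, ∀ k l, ∀ x y s : ℝ, 0 ≤ x → 0 ≤ y → y ≤ x / C.lam1 i →
    0 ≤ s → x + C.lam i k * s ≤ 1 →
    D.F i (x + C.lam i k * s) (y + s) k l = D.F i x y k l +
      ∫ r in (0 : ℝ)..s, (D.G i (x + C.lam i k * r) * D.F i (x + C.lam i k * r) (y + r)) k l
  init_F : ∀ i ∈ Finset.Ico 1 C.N, ∀ k l, ∀ x ∈ Icc (0 : ℝ) 1, 0 < x ∨ k = C.fst i →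
    D.F i x 0 k l = -(D.Kuv i x 1 * Matrix.diagonal (C.mu i) * C.R i) k l
  hyp_F : ∀ i ∈ Finset.Ico 1 C.N, ∀ k l, k ≠ C.fst i → ∀ x ∈ Icc (0 : ℝ) 1,
    D.F i x (x / C.lam1 i) k l = 0

/-! ### The recursive state-feedback law for the delayed system

The delayed state `w t = z (t - τ)` solves the chain with input `U (t - τ)`.  The delayed input is
the output of one more, purely transporting, upstream subsystem of transport time `τ`; the total
transport time from the control input to subsystem `i` is then `theta τ i`. -/

/-- `τ + ∑_{j<i} 1/λ_j^1`. -/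
def theta (C : Chain) (τ : ℝ) (i : ℕ) : ℝ := τ + ∑ j ∈ Finset.Ico 1 i, 1 / C.lam1 j

/-- The time `2 τ + ∑_j 2 τ_j` after which the law is active. -/
def startTime (C : Chain) (τ : ℝ) : ℝ := 2 * τ + ∑ j ∈ Finset.Icc 1 C.N, 2 * C.delay j

/-- The reference `ζ_i`: `ζ_N = 0`, and
`ζ_i(s) = Qᵀ (Q Qᵀ)⁻¹ Û_{i+1}(s - θ_{i+1})` with `Q = Q_{i+1,i}` for `i < N`. -/
def reference (C : Chain) (τ : ℝ) (W : (i : ℕ) → ℝ → Fin (C.n i) → ℝ) (i : ℕ) (s : ℝ) :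
    Fin (C.n i) → ℝ :=
  if i < C.N then
    ((C.Q i)ᵀ * (C.Q i * (C.Q i)ᵀ)⁻¹) *ᵥ W (i + 1) (s - C.theta τ (i + 1))
  else 0

/-- The flatness-based parametrization: component `k` at `(s, x)` of the solution of
`∂ₜα + Λ_i⁺ ∂ₓα = G_i α` on the strip whose right boundary value is `α(·,1) = ζ`, computed along
characteristics from the last component upwards. -/
def Kernels.flat (D : C.Kernels) (i : ℕ) (ζ : ℝ → Fin (C.n i) → ℝ) (k : Fin (C.n i))
    (s x : ℝ) : ℝ :=
  ζ (s + (1 - x) / C.lam i k) k -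
    ∫ r in (0 : ℝ)..(1 - x) / C.lam i k,
      ∑ l : {l : Fin (C.n i) // k < l},
        D.G i (x + C.lam i k * r) k l.1 * D.flat i ζ l.1 (s + r) (x + C.lam i k * r)
termination_by C.n i - k.1
decreasing_by
  have := l.2
  have := l.1.2
  omega

/-- `Q_{i,i-1} ∫₀^{1/λ_{i-1}^1} F_{i-1}(1,y) v_i(r-y,0) dy`, which is `0` for the first
subsystem. -/
def Kernels.memory (D : C.Kernels) (p : ℝ → C.State) (r : ℝ) : (i : ℕ) → Fin (C.n i) → ℝ
  | 0 => 0
  | 1 => 0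
  | j + 2 => C.Q (j + 1) *ᵥ fun l =>
      ∫ y in (0 : ℝ)..1 / C.lam1 (j + 1), (D.F (j + 1) 1 y *ᵥ (p (r - y)).v (j + 2) 0) l

/-- `p` is the prediction computed at time `t` for the subsystems `i, …, N` of the delayed system:
it is the known delayed state `w` up to time `t`, and from `t` to `t + θ_i` it solves the
subsystems `i, …, N` driven by the virtual input `Û_i(· - θ_i)`. -/
structure Kernels.IsPrediction (D : C.Kernels) (τ : ℝ) (w : ℝ → C.State)
    (W : (i : ℕ) → ℝ → Fin (C.n i) → ℝ) (i : ℕ) (t : ℝ) (p : ℝ → C.State) : Prop where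
  past : ∀ j ∈ Finset.Icc 1 C.N, ∀ r ∈ Icc (t - C.delay j) t, (p r).Agree i (w r)
  future : C.IsSol i t (Icc t (t + C.theta τ i))
    (fun r => W i (r - C.theta τ i) - D.memory p r i) p

/-- The value at time `t` of the virtual input `Û_i`, computed from a prediction `p`: the tracking
term minus `Q_{i,i} v_i(·,0)` and `∫₀¹ (K^{uu}(0,y) u_i + K^{uv}(0,y) v_i) dy`, plus the memory
term, all at the predicted time `t + θ_i`. -/
def Kernels.virtualInput (D : C.Kernels) (τ : ℝ) (W : (i : ℕ) → ℝ → Fin (C.n i) → ℝ)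
    (i : ℕ) (t : ℝ) (p : ℝ → C.State) : Fin (C.n i) → ℝ := fun k =>
  D.flat i (C.reference τ W i) k (t + C.theta τ i) 0
    - (C.Qd i *ᵥ (p (t + C.theta τ i)).v i 0) k
    - (∫ y in (0 : ℝ)..1,
        ((D.Kuu i 0 y *ᵥ (p (t + C.theta τ i)).u i y) k +
          (D.Kuv i 0 y *ᵥ (p (t + C.theta τ i)).v i y) k))
    + D.memory p (t + C.theta τ i) i k

/-- The family `W` of virtual inputs `Û_1, …, Û_N` is generated by the recursive law from the
delayed-state signal `w`.  The law starts at `startTime τ`; the signals are `0` before. -/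
structure Kernels.IsFeedback (D : C.Kernels) (τ : ℝ) (w : ℝ → C.State)
    (W : (i : ℕ) → ℝ → Fin (C.n i) → ℝ) : Prop where
  meas : ∀ i ∈ Finset.Icc 1 C.N, Measurable (W i)
  bdd : ∀ T : ℝ, ∃ M : ℝ, ∀ i ∈ Finset.Icc 1 C.N, ∀ t ≤ T, ∀ k, |W i t k| ≤ M
  before : ∀ i ∈ Finset.Icc 1 C.N, ∀ t < C.startTime τ, W i t = 0
  after : ∀ i ∈ Finset.Icc 1 C.N, ∀ t, C.startTime τ ≤ t →
    ∃ p : ℝ → C.State, D.IsPrediction τ w W i t p ∧ W i t = D.virtualInput τ W i t p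

/-! ### The output-feedback closed loop -/

/-- `z` is a trajectory of the original chain with initial state `z₀`, whose input is
`U = Û_1`, where the virtual inputs `W` are generated by the law for the delayed system from the
estimate `O y` of the delayed state; `y = u_N(·,1)` is the measurement along `z`. -/
structure Kernels.IsClosedLoop (D : C.Kernels) (τ : ℝ)
    (O : (ℝ → Fin (C.n C.N) → ℝ) → ℝ → C.State) (z₀ : C.State) (z : ℝ → C.State)
    (W : (i : ℕ) → ℝ → Fin (C.n i) → ℝ) : Prop where
  init : (z 0).Agree 1 z₀
  plant : C.IsSol 1 0 (Ici 0) (W 1) z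
  law : D.IsFeedback τ (O (C.output z)) W

end Chain

end

/-!
All existence and size estimates rest on one device. A chain, with or without a memory term at its
inflow, is a network of scalar transport equations with signed speeds (`Net`). On the right-hand
side of its equations integrated along characteristics, the weight `exp (β s - κ pos)`, with `pos`
the distance from the inflow end, makes every term small once `κ` and then `β` are large: outflow
values gain `exp (-κ)`, integrals along characteristics gain `1 / β`. Hence this right-hand side is
a contraction, not only for the supremum norm but, for families of solutions that depend on a
parameter, in every norm of functions of the parameter in the class `ParamNorm`, such as the `L²`
norm over a time window. Points of measure zero matter throughout, since solutions are Borel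
functions that satisfy their equations everywhere.

*Observer.* Since all `Q_{i+1,i}` are injective, the equations can be solved sideways in `x`, from
the measured end to the actuated one. Two solutions with equal output on a window therefore agree
in the part of the domain that the window determines, and an observer exists by choice
(`exists_delayedObserver`).

*Kernels.* As `G_i` is strictly upper triangular, the rows of the kernel equations can be solved
one after the other, from the last to the first. Each is linear along characteristics that all end
on the boundary of the triangle, and is solved by the same fixed point argument (`exists_kernels`).

*Rest in finite time.* By Green's formula for functions transported along characteristics, the
kernel equations say that
`α_i(t,x) = u_i + ∫ F_i(x,y) v_{i+1}(t-y,0) dy + ∫_x^1 (K_i^{uu} u_i + K_i^{uv} v_i) dy` solves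
`∂_t α_i + Λ_i^+ ∂_x α_i = G_i α_i` (`Kernels.Solve.alpha_char`). This system is flat: its
values at `x = 0` and at `x = 1` determine each other (`Kernels.flat_injective`). When the law is
active, the estimate is the delayed state, and each prediction is the true trajectory as soon as the
virtual input upstream enters it correctly. The law then says that the left boundary values of `α_i`
are those produced by the reference `ζ_i` at the right end, so that `α_i(r,1) = ζ_i(r)`, which is
the statement that the virtual input `i + 1` enters subsystem `i + 1` correctly, by surjectivity of
`Q_{i+1,i}`. For `i = N` the reference is zero: the output vanishes, and by the observability used
for the observer so does the state (`Kernels.Solve.exists_rest_time`).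

*The closed loop.* The law only uses the delayed state, and past values of `Û_i` enter `Û_i` itself
only after a positive travel time or under an integral, so that a large exponent `β` makes them
small. Hence, in every norm of the class that a delay by `a` multiplies by `exp (-β a)`, the
right-hand side of the law is of size at most a quarter of `Û_i` plus a multiple of `Û_{i+1}` and of
the delayed state (`Kernels.Solve.exists_response_bd`). In a weighted supremum norm this gives
existence and uniqueness (`Kernels.Solve.exists_closedLoop`, `Kernels.Law.unique`). In `L²([0,T])`
with weight `exp (-β t)` the delay `τ` makes the loop of the law and the energy estimate of the
plant a contraction, and the state on `[0,T]` is bounded by its initial value in `L²`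
(`Kernels.Solve.exists_l2_bound`). Together with rest after a time `T` that does not depend on the
initial state, this is exponential decay (`Kernels.Solve.exists_decay`).
-/


noncomputable section

open Real (exp exp_pos exp_add exp_le_exp exp_zero one_le_exp exp_le_one_iff sqrt sqrt_nonneg)
open intervalIntegral (integral_congr integral_finsetSum integral_of_le integral_same
  integral_interval_sub_left integral_add_adjacent_intervals)
open Finset (sum_congr measurable_sum sum_nonneg sum_le_sum abs_sum_le_sum_abs single_le_sum
  sum_sub_distrib sum_add_distrib sum_neg_distrib sum_const_zero Icc_subset_Icc_left sum_mul sum_eq_zero)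

/-! ### Integrals of bounded Borel functions -/

theorem integral_congr_Icc {f g : ℝ → ℝ} {a b : ℝ} (h : a ≤ b) (hfg : ∀ r ∈ Icc a b, f r = g r) :
    ∫ r in a..b, f r = ∫ r in a..b, g r :=
  integral_congr fun r hr => hfg r (uIcc_of_le h ▸ hr)

/-- Banach's fixed point theorem for Borel functions with the norm `sup |f| / ω`. -/
theorem exists_fixedPoint_of_weight {X : Type*} [MeasurableSpace X] (ω : X → ℝ)
    (hω : ∀ x, 0 < ω x) (Φ : (X → ℝ) → X → ℝ) (M₀ : ℝ)
    (hmeas : ∀ f, Measurable f → (∃ M, ∀ x, |f x| ≤ M * ω x) → Measurable (Φ f))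
    (hzero : ∀ x, |Φ (fun _ => 0) x| ≤ M₀ * ω x)
    (hcontr : ∀ f g, Measurable f → Measurable g → (∃ M, ∀ x, |f x| ≤ M * ω x) →
      (∃ M, ∀ x, |g x| ≤ M * ω x) → ∀ M, 0 < M → (∀ x, |f x - g x| ≤ M * ω x) →
      ∀ x, |Φ f x - Φ g x| ≤ M / 2 * ω x) :
    ∃ f, Measurable f ∧ (∃ M, ∀ x, |f x| ≤ M * ω x) ∧ Φ f = f := by
  set M := max M₀ 1 with hM
  have hMpos : 0 < M := lt_of_lt_of_le one_pos (le_max_right _ _)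
  let F : ℕ → X → ℝ := fun n => Φ^[n] fun _ => 0
  have hF0 : F 0 = fun _ => 0 := rfl
  have hFs : ∀ n, F (n + 1) = Φ (F n) := fun n => Function.iterate_succ_apply' _ _ _
  have hwt : ∀ {a b : ℝ} (x), a ≤ b → a * ω x ≤ b * ω x := fun x h =>
    mul_le_mul_of_nonneg_right h (hω x).le
  have key : ∀ n, Measurable (F n) ∧ (∃ C, ∀ x, |F n x| ≤ C * ω x) ∧
      ∀ x, |F (n + 1) x - F n x| ≤ M / 2 ^ n * ω x := by
    intro n
    induction n with
    | zero =>
      refine ⟨measurable_const, ⟨0, fun x => by simp [hF0]⟩, fun x => ?_⟩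
      rw [hFs, hF0]
      simpa using (hzero x).trans (hwt x (le_max_left _ _))
    | succ n ih =>
      obtain ⟨h1, ⟨C, hC⟩, h3⟩ := ih
      have hm : Measurable (F (n + 1)) := by rw [hFs]; exact hmeas _ h1 ⟨C, hC⟩
      have hb : ∃ C, ∀ x, |F (n + 1) x| ≤ C * ω x := by
        refine ⟨M / 2 ^ n + C, fun x => ?_⟩
        have := abs_sub_abs_le_abs_sub (F (n + 1) x) (F n x)
        rw [add_mul]
        linarith [h3 x, hC x]
      refine ⟨hm, hb, fun x => ?_⟩
      have := hcontr _ _ hm h1 hb ⟨C, hC⟩ _ (by positivity) h3 x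
      rw [← hFs, ← hFs] at this
      calc _ ≤ _ := this
        _ = _ := by rw [pow_succ]; ring
  have hdist : ∀ x n, dist (F n x) (F (n + 1) x) ≤ (2 * M * ω x) / 2 / 2 ^ n := by
    intro x n
    rw [dist_comm, Real.dist_eq]
    calc _ ≤ _ := (key n).2.2 x
      _ = _ := by ring
  choose f hf using fun x => cauchySeq_tendsto_of_complete (cauchySeq_of_le_geometric_two (hdist x))
  have hle : ∀ n x, |F n x - f x| ≤ 2 * M / 2 ^ n * ω x := by
    intro n x
    have := dist_le_of_le_geometric_two_of_tendsto (hdist x) (hf x) n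
    rw [Real.dist_eq] at this
    calc _ ≤ _ := this
      _ = _ := by ring
  have hfm : Measurable f :=
    measurable_of_tendsto_metrizable (fun n => (key n).1) (tendsto_pi_nhds.2 hf)
  have hfb : ∃ C, ∀ x, |f x| ≤ C * ω x := ⟨2 * M, fun x => by
    have := hle 0 x
    simpa [hF0] using this⟩
  refine ⟨f, hfm, hfb, funext fun x => ?_⟩
  have hlim : Filter.Tendsto (fun n => F (n + 1) x) Filter.atTop (nhds (Φ f x)) := by
    rw [tendsto_iff_dist_tendsto_zero]
    have hz : Filter.Tendsto (fun n : ℕ => M * ω x * (1 / 2 : ℝ) ^ n) Filter.atTop (nhds 0) := by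
      simpa using (tendsto_pow_atTop_nhds_zero_of_lt_one (by norm_num : (0 : ℝ) ≤ 1 / 2)
        (by norm_num)).const_mul (M * ω x)
    refine squeeze_zero (fun _ => dist_nonneg) (fun n => ?_) hz
    rw [Real.dist_eq, hFs]
    calc _ ≤ _ := hcontr _ _ (key n).1 hfm (key n).2.1 hfb _ (by positivity) (hle n) x
      _ = _ := by rw [one_div, inv_pow]; ring
  exact tendsto_nhds_unique hlim ((hf x).comp (Filter.tendsto_add_atTop_nat 1))

/-- An integral with measurable limits depends measurably on parameters. -/
theorem measurable_intervalIntegral {α : Type*} [MeasurableSpace α] {g : α → ℝ → ℝ}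
    (hg : Measurable fun q : α × ℝ => g q.1 q.2) {a b : α → ℝ} (ha : Measurable a)
    (hb : Measurable b) : Measurable fun p => ∫ r in a p..b p, g p r := by
  have key : ∀ a b : α → ℝ, Measurable a → Measurable b →
      Measurable fun p => ∫ r in Ioc (a p) (b p), g p r := by
    intro a b ha hb
    have hset : MeasurableSet {q : α × ℝ | a q.1 < q.2 ∧ q.2 ≤ b q.1} :=
      (measurableSet_lt (ha.comp measurable_fst) measurable_snd).inter
        (measurableSet_le measurable_snd (hb.comp measurable_fst))
    have h2 : (fun p => ∫ r in Ioc (a p) (b p), g p r) =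
        fun p => ∫ r, ({q : α × ℝ | a q.1 < q.2 ∧ q.2 ≤ b q.1}.indicator
          (fun q => g q.1 q.2)) (p, r) := by
      funext p
      rw [← integral_indicator measurableSet_Ioc]
      rfl
    rw [h2]
    exact ((hg.indicator hset).stronglyMeasurable.integral_prod_right').measurable
  simp only [intervalIntegral]
  exact (key a b ha hb).sub (key b a hb ha)

theorem intervalIntegrable_of_abs_le {f : ℝ → ℝ} {a b M : ℝ} (hf : Measurable f)
    (h : ∀ x ∈ uIcc a b, |f x| ≤ M) : IntervalIntegrable f volume a b := by
  rw [intervalIntegrable_iff]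
  refine IntegrableOn.of_bound (C := M) (by simp) hf.aestronglyMeasurable.restrict ?_
  refine (ae_restrict_iff' measurableSet_uIoc).2 (ae_of_all _ fun x hx => ?_)
  exact h x (uIoc_subset_uIcc hx)

theorem abs_intervalIntegral_le {f : ℝ → ℝ} {a b M : ℝ} (hab : a ≤ b)
    (h : ∀ x ∈ Icc a b, |f x| ≤ M) : |∫ x in a..b, f x| ≤ M * (b - a) := by
  have := intervalIntegral.norm_integral_le_of_norm_le_const (a := a) (b := b) (C := M) (f := f)
    (fun x hx => h x (by rw [uIoc_of_le hab] at hx; exact ⟨hx.1.le, hx.2⟩))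
  rwa [abs_of_nonneg (sub_nonneg.2 hab)] at this

/-- The product of two integral functions is the integral of the derivative of the product. -/
theorem mul_integral_eq_add_integral {f' g' : ℝ → ℝ} {f₀ g₀ h M : ℝ} (hh : 0 ≤ h)
    (hf : Measurable f') (hg : Measurable g') (hfM : ∀ r ∈ Icc 0 h, |f' r| ≤ M)
    (hgM : ∀ r ∈ Icc 0 h, |g' r| ≤ M) :
    (f₀ + ∫ r in 0..h, f' r) * (g₀ + ∫ r in 0..h, g' r) = f₀ * g₀ +
      ∫ r in 0..h, (f' r * (g₀ + ∫ s in 0..r, g' s) + (f₀ + ∫ s in 0..r, f' s) * g' r) := by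
  have hfi : IntervalIntegrable f' volume 0 h :=
    intervalIntegrable_of_abs_le hf (by rwa [uIcc_of_le hh])
  have hgi : IntervalIntegrable g' volume 0 h :=
    intervalIntegrable_of_abs_le hg (by rwa [uIcc_of_le hh])
  have ac : ∀ {k : ℝ → ℝ} (c : ℝ), IntervalIntegrable k volume 0 h →
      AbsolutelyContinuousOnInterval (fun r => c + ∫ s in 0..r, k s) 0 h := by
    intro k c hk
    have h1 := hk.absolutelyContinuousOnInterval_intervalIntegral (c := 0) (by simp)
    have h2 : AbsolutelyContinuousOnInterval (fun _ : ℝ => c) 0 h :=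
      (LipschitzWith.const c).lipschitzOnWith.absolutelyContinuousOnInterval
    exact h2.add h1
  have hp := AbsolutelyContinuousOnInterval.integral_deriv_mul_eq_sub (ac f₀ hfi) (ac g₀ hgi)
  simp only [integral_same, add_zero] at hp
  rw [← sub_eq_iff_eq_add', ← hp]
  apply intervalIntegral.integral_congr_ae
  filter_upwards [hfi.ae_hasDerivAt_integral, hgi.ae_hasDerivAt_integral] with x h1 h2 h3
  have hx := uIoc_subset_uIcc h3
  rw [((h1 hx 0 (by simp)).const_add f₀).deriv, ((h2 hx 0 (by simp)).const_add g₀).deriv]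

/-! ### Green's formula for functions transported along characteristics -/

theorem integrableOn_uIoc_prod_of_abs_le {f : ℝ × ℝ → ℝ} {a b c d M : ℝ} (hf : Measurable f)
    (hM : ∀ q, |f q| ≤ M) :
    IntegrableOn f (uIoc a b ×ˢ uIoc c d) (volume.prod volume) := by
  refine IntegrableOn.of_bound (C := M) ?_ hf.aestronglyMeasurable.restrict (ae_of_all _ hM)
  rw [Measure.prod_prod]
  exact ENNReal.mul_lt_top (by simp [uIoc]) (by simp [uIoc])

/-- Exchange of the order of integration on a triangle. -/
theorem integral_triangle_swap {G : ℝ → ℝ → ℝ} {S M : ℝ} (hS : 0 ≤ S)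
    (hG : Measurable fun q : ℝ × ℝ => G q.1 q.2) (hM : ∀ s q, |G s q| ≤ M) :
    ∫ s in 0..S, ∫ q in s..S, G s q = ∫ q in 0..S, ∫ s in 0..q, G s q := by
  set E : ℝ × ℝ → ℝ := {p : ℝ × ℝ | p.1 < p.2}.indicator fun p => G p.1 p.2 with hE
  have hEm : Measurable E := hG.indicator (measurableSet_lt measurable_fst measurable_snd)
  have e1 : ∀ s ∈ uIcc 0 S, ∫ q in s..S, G s q = ∫ q in 0..S, E (s, q) := by
    intro s hs
    rw [uIcc_of_le hS] at hs
    rw [integral_of_le hS, integral_of_le hs.2,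
      show (fun q => E (s, q)) = (Ioi s).indicator (G s) from rfl,
      setIntegral_indicator measurableSet_Ioi, Ioc_inter_Ioi, max_eq_right hs.1]
  have e2 : ∀ q ∈ uIcc 0 S, ∫ s in 0..q, G s q = ∫ s in 0..S, E (s, q) := by
    intro q hq
    rw [uIcc_of_le hS] at hq
    rw [integral_of_le hS, integral_of_le hq.1,
      show (fun s => E (s, q)) = (Iio q).indicator (fun s => G s q) from rfl,
      setIntegral_indicator measurableSet_Iio, integral_Ioc_eq_integral_Ioo]
    congr 2
    ext s
    simp only [mem_Ioo, mem_inter_iff, mem_Ioc, mem_Iio]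
    exact ⟨fun h => ⟨⟨h.1, h.2.le.trans hq.2⟩, h.2⟩, fun h => ⟨h.1.1, h.2⟩⟩
  rw [integral_congr e1, integral_congr e2, intervalIntegral_intervalIntegral_swap]
  refine integrableOn_uIoc_prod_of_abs_le (M := M) hEm fun p => ?_
  show |E p| ≤ M
  by_cases h : p ∈ {p : ℝ × ℝ | p.1 < p.2}
  · rw [hE, indicator_of_mem h]; exact hM _ _
  · rw [hE, indicator_of_notMem h, abs_zero]; exact (abs_nonneg _).trans (hM 0 0)

/-- Balance between a fixed end point and the moving end point `e₀ + e₁ s`, for the function with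
initial values `Ψ` and time derivative `g`. -/
theorem moving_end {Ψ : ℝ → ℝ} {g : ℝ → ℝ → ℝ} {e₀ e₁ S M : ℝ} (hS : 0 ≤ S)
    (hΨ : Measurable Ψ) (hg : Measurable fun q : ℝ × ℝ => g q.1 q.2)
    (hΨM : ∀ y, |Ψ y| ≤ M) (hgM : ∀ s y, |g s y| ≤ M) :
    IntervalIntegrable (fun s => e₁ * (Ψ (e₀ + e₁ * s) + ∫ r in 0..s, g r (e₀ + e₁ * s)) +
      ∫ y in 0..e₀ + e₁ * s, g s y) volume 0 S ∧
    (∫ y in 0..e₀ + e₁ * S, (Ψ y + ∫ r in 0..S, g r y)) - ∫ y in 0..e₀, Ψ y =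
      ∫ s in 0..S, (e₁ * (Ψ (e₀ + e₁ * s) + ∫ r in 0..s, g r (e₀ + e₁ * s)) +
        ∫ y in 0..e₀ + e₁ * s, g s y) := by
  have hM : 0 ≤ M := (abs_nonneg _).trans (hΨM 0)
  have hII : ∀ {f : ℝ → ℝ} {a b : ℝ}, Measurable f → (∀ y, |f y| ≤ M) →
      IntervalIntegrable f volume a b := fun hf h => intervalIntegrable_of_abs_le hf fun y _ => h y
  have hgs : ∀ s, Measurable (g s) := fun s => hg.comp measurable_prodMk_left
  have hint : ∀ {f : ℝ → ℝ} (a b : ℝ), (∀ y, |f y| ≤ M) → |∫ y in a..b, f y| ≤ M * |b - a| :=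
    fun a b h => by
      rw [← Real.norm_eq_abs (∫ _ in _.._, _)]
      exact intervalIntegral.norm_integral_le_of_norm_le_const fun y _ => h y
  have hsub : ∀ (f : ℝ → ℝ) (a b : ℝ), ∫ y in e₀ + e₁ * a..e₀ + e₁ * b, f y =
      ∫ s in a..b, e₁ * f (e₀ + e₁ * s) := fun f a b => by
    rw [intervalIntegral.integral_const_mul, intervalIntegral.mul_integral_comp_add_mul]
  have hG : Measurable fun q : ℝ × ℝ => e₁ * g q.1 (e₀ + e₁ * q.2) :=
    (hg.comp (by fun_prop : Measurable fun q : ℝ × ℝ => (q.1, e₀ + e₁ * q.2))).const_mul _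
  have hGM : ∀ s q, |e₁ * g s (e₀ + e₁ * q)| ≤ |e₁| * M := fun s q => by
    rw [abs_mul]; exact mul_le_mul_of_nonneg_left (hgM _ _) (abs_nonneg _)
  have m3 : Measurable fun s => ∫ y in 0..e₀ + e₁ * s, g s y :=
    measurable_intervalIntegral hg measurable_const (by fun_prop)
  have m2 : Measurable fun q => ∫ s in 0..q, e₁ * g s (e₀ + e₁ * q) :=
    measurable_intervalIntegral (g := fun q s => e₁ * g s (e₀ + e₁ * q))
      (hG.comp measurable_swap) measurable_const measurable_id
  have i1 : IntervalIntegrable (fun s => e₁ * Ψ (e₀ + e₁ * s)) volume 0 S :=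
    (hII (hΨ.comp (by fun_prop : Measurable fun s : ℝ => e₀ + e₁ * s)) fun s => hΨM _).const_mul _
  have i2 : IntervalIntegrable (fun q => ∫ s in 0..q, e₁ * g s (e₀ + e₁ * q)) volume 0 S := by
    refine intervalIntegrable_of_abs_le (M := |e₁| * M * S) m2 fun q hq => ?_
    rw [uIcc_of_le hS] at hq
    refine (abs_intervalIntegral_le hq.1 fun s _ => hGM s q).trans ?_
    exact mul_le_mul_of_nonneg_left (by linarith [hq.2]) (by positivity)
  have i3 : IntervalIntegrable (fun s => ∫ y in 0..e₀ + e₁ * s, g s y) volume 0 S := by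
    refine intervalIntegrable_of_abs_le (M := M * (|e₀| + |e₁| * S)) m3 fun s hs => ?_
    rw [uIcc_of_le hS] at hs
    refine (hint _ _ (hgM s)).trans (mul_le_mul_of_nonneg_left ?_ hM)
    rw [sub_zero]
    refine (abs_add_le _ _).trans (add_le_add le_rfl ?_)
    rw [abs_mul, abs_of_nonneg hs.1]
    exact mul_le_mul_of_nonneg_left hs.2 (abs_nonneg _)
  have hsplit : (fun s => e₁ * (Ψ (e₀ + e₁ * s) + ∫ r in 0..s, g r (e₀ + e₁ * s)) +
      ∫ y in 0..e₀ + e₁ * s, g s y) = fun s => (e₁ * Ψ (e₀ + e₁ * s) +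
      ∫ r in 0..s, e₁ * g r (e₀ + e₁ * s)) + ∫ y in 0..e₀ + e₁ * s, g s y := by
    funext s
    rw [intervalIntegral.integral_const_mul]; ring
  rw [hsplit]
  refine ⟨(i1.add i2).add i3, ?_⟩
  rw [intervalIntegral.integral_add (by exact i1.add i2) i3, intervalIntegral.integral_add i1 i2,
    ← hsub Ψ, mul_zero, add_zero, ← integral_triangle_swap hS hG hGM,
    intervalIntegral.integral_add (hII hΨ hΨM),
    intervalIntegral_intervalIntegral_swap (F := fun y r => g r y)
      (integrableOn_uIoc_prod_of_abs_le (hg.comp measurable_swap) fun q => hgM _ _),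
    ← integral_interval_sub_left (hII hΨ hΨM) (hII hΨ hΨM)]
  · have : (∫ s in 0..S, ∫ q in s..S, e₁ * g s (e₀ + e₁ * q)) =
        (∫ s in 0..S, ∫ y in 0..e₀ + e₁ * S, g s y) -
        ∫ s in 0..S, ∫ y in 0..e₀ + e₁ * s, g s y := by
      rw [← intervalIntegral.integral_sub _ i3]
      · refine integral_congr fun s _ => ?_
        rw [← hsub (g s), integral_interval_sub_left (hII (hgs s) (hgM s)) (hII (hgs s) (hgM s))]
      · exact intervalIntegrable_of_abs_le (measurable_intervalIntegral hg measurable_const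
          measurable_const) fun s _ => hint _ _ (hgM s)
    rw [this, intervalIntegral.integral_symm 0 e₀]; ring
  · exact intervalIntegrable_of_abs_le (measurable_intervalIntegral (g := fun y r => g r y)
      (hg.comp measurable_swap) measurable_const measurable_const)
      fun y _ => hint 0 S fun r => hgM r y

/-- Green's formula in a frame that moves with the characteristics: `φ(·, y)` has derivative
`g(·, y)`, on a domain between two moving end points. -/
theorem green_static {φ g : ℝ → ℝ → ℝ} {l₀ l₁ r₀ r₁ S M : ℝ} (hS : 0 ≤ S)
    (hφ : Measurable fun q : ℝ × ℝ => φ q.1 q.2) (hg : Measurable fun q : ℝ × ℝ => g q.1 q.2)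
    (h0 : l₀ ≤ r₀) (h1 : l₀ + l₁ * S ≤ r₀ + r₁ * S)
    (hφM : ∀ s y, 0 ≤ s → s ≤ S → l₀ + l₁ * s ≤ y → y ≤ r₀ + r₁ * s → |φ s y| ≤ M)
    (hgM : ∀ s y, 0 ≤ s → s ≤ S → l₀ + l₁ * s ≤ y → y ≤ r₀ + r₁ * s → |g s y| ≤ M)
    (htr : ∀ s y h, 0 ≤ s → 0 ≤ h → s + h ≤ S → l₀ + l₁ * s ≤ y → y ≤ r₀ + r₁ * s →
      l₀ + l₁ * (s + h) ≤ y → y ≤ r₀ + r₁ * (s + h) →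
      φ (s + h) y = φ s y + ∫ r in 0..h, g (s + r) y) :
    (∫ y in l₀ + l₁ * S..r₀ + r₁ * S, φ S y) - ∫ y in l₀..r₀, φ 0 y =
      ∫ s in 0..S, (-l₁ * φ s (l₀ + l₁ * s) + r₁ * φ s (r₀ + r₁ * s) +
        ∫ y in l₀ + l₁ * s..r₀ + r₁ * s, g s y) := by
  have hM : 0 ≤ M := (abs_nonneg _).trans (hφM 0 l₀ le_rfl hS (by simp) (by simpa using h0))
  -- the width of the domain is an affine function of `s`
  have hw : ∀ s, 0 ≤ s → s ≤ S → l₀ + l₁ * s ≤ r₀ + r₁ * s := by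
    intro s hs hs'
    by_contra hcon
    push Not at hcon
    have hSpos : 0 < S := by
      rcases hS.lt_or_eq with h | h
      · exact h
      · have : s = 0 := le_antisymm (h ▸ hs') hs
        rw [this] at hcon; linarith
    nlinarith [mul_nonneg hs (sub_nonneg.2 h1), mul_nonneg (sub_nonneg.2 hs') (sub_nonneg.2 h0)]
  set D : Set (ℝ × ℝ) := {q | 0 ≤ q.1 ∧ q.1 ≤ S ∧ l₀ + l₁ * q.1 ≤ q.2 ∧ q.2 ≤ r₀ + r₁ * q.1} with hD
  have hDm : MeasurableSet D := (measurableSet_le measurable_const measurable_fst).inter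
      ((measurableSet_le measurable_fst measurable_const).inter
        ((measurableSet_le (by fun_prop) measurable_snd).inter
          (measurableSet_le measurable_snd (by fun_prop))))
  have hconv : ∀ s t r y, (s, y) ∈ D → (t, y) ∈ D → s ≤ r → r ≤ t → (r, y) ∈ D := by
    rintro s t r y ⟨a1, -, a3, a4⟩ ⟨-, b2, b3, b4⟩ hsr hrt
    dsimp only at *
    refine ⟨a1.trans hsr, hrt.trans b2, ?_, ?_⟩ <;> dsimp only
    · rcases le_total 0 l₁ with h | h
      · linarith [mul_le_mul_of_nonneg_left hrt h]
      · linarith [mul_le_mul_of_nonpos_left hsr h]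
    · rcases le_total 0 r₁ with h | h
      · linarith [mul_le_mul_of_nonneg_left hsr h]
      · linarith [mul_le_mul_of_nonpos_left hrt h]
  -- a time `p y` at which the line through `y` meets the domain, if it meets it at all
  set p : ℝ → ℝ := fun y => if l₀ ≤ y ∧ y ≤ r₀ then 0
    else if l₀ + l₁ * S ≤ y ∧ y ≤ r₀ + r₁ * S then S else (y - l₀) / l₁ with hp
  have hpm : Measurable p := by
    refine Measurable.ite (measurableSet_Icc (a := l₀) (b := r₀)) measurable_const
      (Measurable.ite measurableSet_Icc measurable_const (by fun_prop))
  have hpD : ∀ s y, (s, y) ∈ D → (p y, y) ∈ D := by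
    rintro s y ⟨a1, a2, a3, a4⟩
    dsimp only at a1 a2 a3 a4
    simp only [hp]
    split_ifs with c1 c2
    · exact ⟨le_rfl, hS, by simpa using c1.1, by simpa using c1.2⟩
    · exact ⟨hS, le_rfl, c2.1, c2.2⟩
    -- the line enters or leaves through the left end point
    suffices h : ∃ q, 0 ≤ q ∧ q ≤ S ∧ l₁ ≠ 0 ∧ l₀ + l₁ * q = y by
      obtain ⟨q, q1, q2, q3, rfl⟩ := h
      rw [show (l₀ + l₁ * q - l₀) / l₁ = q by field_simp; ring]
      exact ⟨q1, q2, le_rfl, hw q q1 q2⟩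
    have hcont : Continuous fun q : ℝ => l₀ + l₁ * q := by fun_prop
    rcases lt_or_ge y l₀ with h | h
    · obtain ⟨q, hq, e⟩ := intermediate_value_Icc' a1 hcont.continuousOn ⟨a3, by simpa using h.le⟩
      exact ⟨q, hq.1, hq.2.trans a2, fun h0 => by rw [h0] at e; linarith, e⟩
    · have h2 : r₀ < y := not_le.1 fun hh => c1 ⟨h, hh⟩
      have h3 : 0 ≤ r₁ := by
        by_contra hcon
        nlinarith
      have h4 : y < l₀ + l₁ * S := not_le.1 fun hh => c2 ⟨hh, by nlinarith⟩
      obtain ⟨q, hq, e⟩ := intermediate_value_Icc a2 hcont.continuousOn ⟨a3, h4.le⟩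
      refine ⟨q, a1.trans hq.1, hq.2, fun h0 => ?_, e⟩
      rw [h0] at e h4; linarith
  set γ : ℝ → ℝ → ℝ := fun s y => D.indicator (fun q => g q.1 q.2) (s, y) with hγ
  have hγm : Measurable fun q : ℝ × ℝ => γ q.1 q.2 := hg.indicator hDm
  have hγD : ∀ s y, (s, y) ∈ D → γ s y = g s y := fun s y h => by
    simp only [hγ, indicator_of_mem h]
  have hγM : ∀ s y, |γ s y| ≤ M := fun s y => by
    by_cases h : (s, y) ∈ D
    · rw [hγD s y h]; exact hgM s y h.1 h.2.1 h.2.2.1 h.2.2.2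
    · simp only [hγ, indicator_of_notMem h, abs_zero]; exact hM
  -- the values at time `0` of the extension of `φ` that is constant in time outside the domain
  set Ψ : ℝ → ℝ := fun y => (if (p y, y) ∈ D then φ (p y) y - ∫ r in 0..p y, γ r y else 0) with hΨ
  have hpp : Measurable fun y => (p y, y) := hpm.prodMk measurable_id
  have hΨm : Measurable Ψ := by
    refine Measurable.ite (hDm.preimage hpp) ((hφ.comp hpp).sub ?_) measurable_const
    exact measurable_intervalIntegral (g := fun y r => γ r y) (hγm.comp measurable_swap)
      measurable_const hpm
  have hΨM : ∀ y, |Ψ y| ≤ M + M * S := fun y => by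
    simp only [hΨ]
    split_ifs with h
    · refine (abs_sub _ _).trans (add_le_add (hφM _ _ h.1 h.2.1 h.2.2.1 h.2.2.2) ?_)
      refine (abs_intervalIntegral_le h.1 fun r _ => hγM r y).trans ?_
      exact mul_le_mul_of_nonneg_left (by linarith [h.2.1]) hM
    · rw [abs_zero]; positivity
  have hstep : ∀ s t y, (s, y) ∈ D → (t, y) ∈ D → s ≤ t → φ t y = φ s y + ∫ r in s..t, γ r y := by
    intro s t y hs ht hst
    have e := htr s y (t - s) hs.1 (by linarith) (by linarith [ht.2.1]) hs.2.2.1 hs.2.2.2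
      (by rw [add_sub_cancel]; exact ht.2.2.1) (by rw [add_sub_cancel]; exact ht.2.2.2)
    rw [add_sub_cancel, intervalIntegral.integral_comp_add_left (fun r => g r y), add_zero,
      add_sub_cancel] at e
    rw [e]
    congr 1
    refine integral_congr_Icc hst fun r hr => ?_
    exact (hγD r y (hconv s t r y hs ht hr.1 hr.2)).symm
  have hγi : ∀ y a b, IntervalIntegrable (fun r => γ r y) volume a b := fun y a b =>
    intervalIntegrable_of_abs_le (hγm.comp measurable_prodMk_right) fun r _ => hγM r y
  have hext : ∀ s y, (s, y) ∈ D → Ψ y + ∫ r in 0..s, γ r y = φ s y := by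
    intro s y hs
    have hpy := hpD s y hs
    simp only [hΨ, if_pos hpy]
    have e := integral_add_adjacent_intervals (hγi y 0 (p y)) (hγi y (p y) s)
    rw [← e]
    rcases le_total (p y) s with h | h
    · rw [hstep _ _ y hpy hs h]; ring
    · rw [hstep _ _ y hs hpy h, intervalIntegral.integral_symm s (p y)]; ring
  have hMM : M ≤ M + M * S := by nlinarith [mul_nonneg hM hS]
  have fin := fun e₀ e₁ => moving_end (e₀ := e₀) (e₁ := e₁) hS hΨm hγm hΨM
    fun s y => (hγM s y).trans hMM
  have hΨi : ∀ a b, IntervalIntegrable Ψ volume a b := fun a b =>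
    intervalIntegrable_of_abs_le hΨm fun y _ => hΨM y
  have hΦi : ∀ a b, IntervalIntegrable (fun y => Ψ y + ∫ r in 0..S, γ r y) volume a b :=
    fun a b => (hΨi a b).add (intervalIntegrable_of_abs_le (M := M * S)
      (measurable_intervalIntegral (g := fun y r => γ r y) (hγm.comp measurable_swap)
        measurable_const measurable_const) fun y _ => by
          simpa using abs_intervalIntegral_le hS fun r _ => hγM r y)
  have e1 : ∫ y in l₀..r₀, φ 0 y = (∫ y in 0..r₀, Ψ y) - ∫ y in 0..l₀, Ψ y := by
    rw [integral_interval_sub_left (hΨi _ _) (hΨi _ _)]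
    refine integral_congr_Icc h0 fun y hy => ?_
    simpa using (hext 0 y ⟨le_rfl, hS, by simpa using hy.1, by simpa using hy.2⟩).symm
  have e2 : ∫ y in l₀ + l₁ * S..r₀ + r₁ * S, φ S y =
      (∫ y in 0..r₀ + r₁ * S, (Ψ y + ∫ r in 0..S, γ r y)) -
        ∫ y in 0..l₀ + l₁ * S, (Ψ y + ∫ r in 0..S, γ r y) := by
    rw [integral_interval_sub_left (hΦi _ _) (hΦi _ _)]
    refine integral_congr_Icc h1 fun y hy => ?_
    exact (hext S y ⟨hS, le_rfl, hy.1, hy.2⟩).symm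
  rw [e1, e2, sub_sub_sub_comm, (fin r₀ r₁).2, (fin l₀ l₁).2,
    ← intervalIntegral.integral_sub (fin r₀ r₁).1 (fin l₀ l₁).1]
  refine integral_congr_Icc hS fun s hs => ?_
  have hls := hw s hs.1 hs.2
  have hγs : ∀ a b, IntervalIntegrable (γ s) volume a b := fun a b =>
    intervalIntegrable_of_abs_le (hγm.comp measurable_prodMk_left) fun y _ => hγM s y
  have e3 : ∫ y in l₀ + l₁ * s..r₀ + r₁ * s, g s y =
      (∫ y in 0..r₀ + r₁ * s, γ s y) - ∫ y in 0..l₀ + l₁ * s, γ s y := by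
    rw [integral_interval_sub_left (hγs _ _) (hγs _ _)]
    refine integral_congr_Icc hls fun y hy => ?_
    exact (hγD s y ⟨hs.1, hs.2, hy.1, hy.2⟩).symm
  show _ - _ = _
  rw [hext s _ ⟨hs.1, hs.2, hls, le_rfl⟩, hext s _ ⟨hs.1, hs.2, le_rfl, hls⟩, e3]
  ring

/-- Green's formula for a function `φ` that is transported with speed `c` and has the source `g`
along the characteristics, on a domain between two moving end points. -/
theorem green {φ g : ℝ → ℝ → ℝ} {c l₀ l₁ r₀ r₁ S M : ℝ} (hS : 0 ≤ S)
    (hφ : Measurable fun q : ℝ × ℝ => φ q.1 q.2) (hg : Measurable fun q : ℝ × ℝ => g q.1 q.2)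
    (h0 : l₀ ≤ r₀) (h1 : l₀ + l₁ * S ≤ r₀ + r₁ * S)
    (hφM : ∀ s y, 0 ≤ s → s ≤ S → l₀ + l₁ * s ≤ y → y ≤ r₀ + r₁ * s → |φ s y| ≤ M)
    (hgM : ∀ s y, 0 ≤ s → s ≤ S → l₀ + l₁ * s ≤ y → y ≤ r₀ + r₁ * s → |g s y| ≤ M)
    (htr : ∀ s y h, 0 ≤ s → 0 ≤ h → s + h ≤ S → l₀ + l₁ * s ≤ y → y ≤ r₀ + r₁ * s →
      l₀ + l₁ * (s + h) ≤ y + c * h → y + c * h ≤ r₀ + r₁ * (s + h) →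
      φ (s + h) (y + c * h) = φ s y + ∫ r in 0..h, g (s + r) (y + c * r)) :
    (∫ y in l₀ + l₁ * S..r₀ + r₁ * S, φ S y) - ∫ y in l₀..r₀, φ 0 y =
      ∫ s in 0..S, ((c - l₁) * φ s (l₀ + l₁ * s) - (c - r₁) * φ s (r₀ + r₁ * s) +
        ∫ y in l₀ + l₁ * s..r₀ + r₁ * s, g s y) := by
  have key := green_static (φ := fun s y => φ s (y + c * s)) (g := fun s y => g s (y + c * s))
    (l₀ := l₀) (l₁ := l₁ - c) (r₀ := r₀) (r₁ := r₁ - c) (M := M) hS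
    (hφ.comp (by fun_prop : Measurable fun q : ℝ × ℝ => (q.1, q.2 + c * q.1)))
    (hg.comp (by fun_prop : Measurable fun q : ℝ × ℝ => (q.1, q.2 + c * q.1)))
    h0 (by linarith)
    (fun s y q1 q2 q3 q4 => hφM _ _ q1 q2 (by linarith) (by linarith))
    (fun s y q1 q2 q3 q4 => hgM _ _ q1 q2 (by linarith) (by linarith))
    (fun s y h q1 q2 q3 q4 q5 q6 q7 => by
      have := htr s (y + c * s) h q1 q2 q3 (by linarith) (by linarith) (by linarith) (by linarith)
      rw [show y + c * (s + h) = y + c * s + c * h by ring, this]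
      congr 1
      refine integral_congr fun r _ => ?_
      congr 1; ring)
  have sub : ∀ (f : ℝ → ℝ) (s : ℝ), ∫ y in l₀ + (l₁ - c) * s..r₀ + (r₁ - c) * s, f (y + c * s) =
      ∫ y in l₀ + l₁ * s..r₀ + r₁ * s, f y := by
    intro f s
    rw [intervalIntegral.integral_comp_add_right (fun y => f y)]
    congr 1 <;> ring
  simp only [sub] at key
  simp only [mul_zero, add_zero] at key
  rw [key]
  refine integral_congr fun s _ => ?_
  rw [show l₀ + (l₁ - c) * s + c * s = l₀ + l₁ * s by ring,
    show r₀ + (r₁ - c) * s + c * s = r₀ + r₁ * s by ring]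
  ring

/-! ### Size of functions of a parameter -/

/-- An abstract norm on functions of a parameter `θ`: `Bd f M` says that the norm of `f` is at
most `M`.  Minkowski's inequality for integrals is one of the axioms.  The estimates for networks
are used both for weighted supremum norms and for weighted `L²` norms in the parameter. -/
structure ParamNorm (Θ : Type*) [MeasurableSpace Θ] where
  Bd : (Θ → ℝ) → ℝ → Prop
  zero : Bd (fun _ => 0) 0
  mono : ∀ {f : Θ → ℝ} {M M' : ℝ}, Bd f M → M ≤ M' → Bd f M'
  add : ∀ {f g : Θ → ℝ} {M M' : ℝ}, Bd f M → Bd g M' → Bd (fun θ => f θ + g θ) (M + M')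
  smul : ∀ {f : Θ → ℝ} {M : ℝ} (a : ℝ), Bd f M → Bd (fun θ => a * f θ) (|a| * M)
  integral : ∀ {g : Θ → ℝ → ℝ} {m : ℝ → ℝ} {a : ℝ}, 0 ≤ a →
    (Measurable fun p : Θ × ℝ => g p.1 p.2) → Continuous m → (∀ r, 0 < m r) →
    (∀ r ∈ Icc 0 a, Bd (fun θ => g θ r) (m r)) →
    Bd (fun θ => ∫ r in 0..a, g θ r) (∫ r in 0..a, m r)
  closed : ∀ {f : Θ → ℝ} {M : ℝ}, (∀ ε, 0 < ε → Bd f (M + ε)) → Bd f M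

namespace ParamNorm

variable {Θ : Type*} [MeasurableSpace Θ] (ν : ParamNorm Θ)

theorem sum {ι : Type*} (s : Finset ι) {f : ι → Θ → ℝ} {M : ι → ℝ}
    (h : ∀ i ∈ s, ν.Bd (f i) (M i)) : ν.Bd (fun θ => ∑ i ∈ s, f i θ) (∑ i ∈ s, M i) := by
  classical
  induction s using Finset.induction_on with
  | empty => simpa using ν.zero
  | insert i s hi ih =>
    simp only [Finset.sum_insert hi]
    exact ν.add (h i (Finset.mem_insert_self _ _))
      (ih fun j hj => h j (Finset.mem_insert_of_mem hj))

/-- A finite linear combination with coefficients bounded by `A`. -/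
theorem sum_mul {ι : Type*} [Fintype ι] {a : ι → ℝ} {f : ι → Θ → ℝ} {A M : ℝ} (hM : 0 ≤ M)
    (ha : ∀ i, |a i| ≤ A) (h : ∀ i, ν.Bd (f i) M) :
    ν.Bd (fun θ => ∑ i, a i * f i θ) (Fintype.card ι * (A * M)) := by
  refine ν.mono (ν.sum Finset.univ (M := fun i => |a i| * M) fun i _ => ν.smul (a i) (h i)) ?_
  calc ∑ i, |a i| * M ≤ ∑ _i : ι, A * M :=
        sum_le_sum fun i _ => mul_le_mul_of_nonneg_right (ha i) hM
    _ = _ := by simp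

/-- The weighted supremum norm `sup |f| / d` over the set `A`. -/
def sup (d : Θ → ℝ) (A : Set Θ) : ParamNorm Θ where
  Bd f M := ∀ θ ∈ A, 0 ≤ d θ → |f θ| ≤ M * d θ
  zero := fun θ _ _ => by simp
  mono := fun h hM θ hθ hd => (h θ hθ hd).trans (mul_le_mul_of_nonneg_right hM hd)
  add := fun hf hg θ hθ hd => by
    rw [add_mul]
    exact (abs_add_le _ _).trans (add_le_add (hf θ hθ hd) (hg θ hθ hd))
  smul := fun a hf θ hθ hd => by
    rw [abs_mul, mul_assoc]
    exact mul_le_mul_of_nonneg_left (hf θ hθ hd) (abs_nonneg _)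
  integral := fun {g m a} ha _ hm _ h θ hθ hd => by
    rw [← intervalIntegral.integral_mul_const, ← Real.norm_eq_abs]
    refine intervalIntegral.norm_integral_le_of_norm_le ha (ae_of_all _ fun r hr => ?_)
      ((hm.mul continuous_const).intervalIntegrable _ _)
    exact h r ⟨hr.1.le, hr.2⟩ θ hθ hd
  closed := fun {f M} h θ hθ hd => by
    refine le_of_forall_pos_le_add fun ε hε => ?_
    have := h (ε / (d θ + 1)) (by positivity) θ hθ hd
    rw [add_mul] at this
    have h2 : ε / (d θ + 1) * d θ ≤ ε := by
      rw [div_mul_eq_mul_div, div_le_iff₀ (by positivity)]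
      nlinarith
    linarith

end ParamNorm

theorem integral_exp_add_mul_le {c β a : ℝ} (hβ : 0 < β) :
    ∫ r in 0..a, exp (c + β * r) ≤ exp (c + β * a) / β := by
  rw [intervalIntegral.integral_comp_add_mul (fun x => exp x) hβ.ne', integral_exp,
    smul_eq_mul, inv_mul_eq_div]
  gcongr
  have := exp_pos (c + β * 0)
  linarith

theorem integral_exp_sub_mul_le {c β a : ℝ} (hβ : 0 < β) :
    ∫ r in 0..a, exp (c - β * r) ≤ exp c / β := by
  rw [intervalIntegral.integral_comp_sub_mul (fun x => exp x) hβ.ne', integral_exp,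
    smul_eq_mul, inv_mul_eq_div]
  gcongr
  have := exp_pos (c - β * a)
  simp only [mul_zero, sub_zero]
  linarith

/-! ### Networks of transport equations -/

/-- A network of transport equations on `[0,1]`.  Component `j` moves with the signed speed `c j`,
has the source `∑ l, S x j l * q l`, and enters with the value `∑ l, B j l * (outflow of l)` plus
the memory term `∑ l, ∫₀ʰ F y j l * (outflow of l at time t - y) dy` plus an input. -/
structure Net (J : Type) where
  c : J → ℝ
  S : ℝ → J → J → ℝ
  B : J → J → ℝ
  F : ℝ → J → J → ℝ
  h : ℝ

namespace Net

variable {J : Type} [Fintype J] (P : Net J)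

/-- All data of the network are Borel and bounded by `M`. -/
structure Regular (M : ℝ) : Prop where
  c_ne : ∀ j, P.c j ≠ 0
  h_nonneg : 0 ≤ P.h
  M_pos : 0 < M
  S_meas : ∀ j l, Measurable fun x => P.S x j l
  S_le : ∀ x j l, |P.S x j l| ≤ M
  B_le : ∀ j l, |P.B j l| ≤ M
  F_meas : ∀ j l, Measurable fun y => P.F y j l
  F_le : ∀ y j l, |P.F y j l| ≤ M

/-- The distance of `x` from the inflow end of component `j`. -/
def pos (j : J) (x : ℝ) : ℝ := if 0 < P.c j then x else 1 - x

/-- The time that component `j` needs from its inflow end to `x`. -/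
def age (j : J) (x : ℝ) : ℝ := P.pos j x / |P.c j|

/-- The outflow end of component `j`. -/
def xout (j : J) : ℝ := if 0 < P.c j then 1 else 0

/-- The source term. -/
def source (q : J → ℝ → ℝ → ℝ) (j : J) (s x : ℝ) : ℝ := ∑ l, P.S x j l * q l s x

/-- The values at the outflow ends, prescribed by `past` for negative times. -/
def outflow (past : J → ℝ → ℝ) (q : J → ℝ → ℝ → ℝ) (l : J) (s : ℝ) : ℝ :=
  if s < 0 then past l s else q l s (P.xout l)

/-- The values at the inflow ends. -/
def inflow (past b : J → ℝ → ℝ) (q : J → ℝ → ℝ → ℝ) (j : J) (s : ℝ) : ℝ :=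
  (∑ l, P.B j l * q l s (P.xout l)) +
    (∑ l, ∫ y in 0..P.h, P.F y j l * P.outflow past q l (s - y)) + b j s

/-- The right-hand side of the equations of the network, integrated along characteristics, with
initial values `q₀`, past outflow `past` and input `b`. -/
def mild (q₀ past b : J → ℝ → ℝ) (q : J → ℝ → ℝ → ℝ) (j : J) (s x : ℝ) : ℝ :=
  (if s ≤ P.age j x then q₀ j (x - P.c j * s) else P.inflow past b q j (s - P.age j x)) +
    ∫ r in 0..min s (P.age j x), P.source q j (s - min s (P.age j x) + r)
      (x - P.c j * min s (P.age j x) + P.c j * r)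

variable {P} {M : ℝ}

omit [Fintype J] in
theorem pos_mem {j : J} {x : ℝ} : P.pos j x ∈ Icc 0 1 ↔ x ∈ Icc 0 1 := by
  unfold pos
  split_ifs
  · rfl
  · constructor <;> rintro ⟨h1, h2⟩ <;> constructor <;> linarith

omit [Fintype J] in
theorem pos_xout (j : J) : P.pos j (P.xout j) = 1 := by
  unfold pos xout
  split_ifs <;> simp

omit [Fintype J] in
theorem xout_mem (j : J) : P.xout j ∈ Icc 0 1 := by
  unfold xout
  split_ifs <;> simp

omit [Fintype J] in
theorem pos_add {j : J} (x r : ℝ) : P.pos j (x + P.c j * r) = P.pos j x + |P.c j| * r := by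
  unfold pos
  split_ifs with h
  · rw [abs_of_pos h]
  · rw [abs_of_nonpos (not_lt.1 h)]; ring

namespace Regular

variable (hP : P.Regular M)
include hP

omit [Fintype J] in
theorem abs_c_pos (j : J) : 0 < |P.c j| := abs_pos.2 (hP.c_ne j)

omit [Fintype J] in
theorem abs_c_mul_age (j : J) (x : ℝ) : |P.c j| * P.age j x = P.pos j x := by
  unfold age
  field_simp [(hP.abs_c_pos j).ne']

omit [Fintype J] in
theorem age_nonneg {j : J} {x : ℝ} (hx : x ∈ Icc 0 1) : 0 ≤ P.age j x :=
  div_nonneg (pos_mem.2 hx).1 (abs_nonneg _)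

omit [Fintype J] in
theorem age_add {j : J} (x r : ℝ) : P.age j (x + P.c j * r) = P.age j x + r := by
  have := (hP.abs_c_pos j).ne'
  unfold age
  rw [pos_add]
  field_simp

omit [Fintype J] in
/-- The characteristic that ends in `(s, x)` stays in `[0,1]` up to its foot. -/
theorem foot_mem {j : J} {x s r : ℝ} (hs : 0 ≤ s) (hx : x ∈ Icc 0 1)
    (hr : r ∈ Icc 0 (min s (P.age j x))) :
    x - P.c j * min s (P.age j x) + P.c j * r ∈ Icc 0 1 ∧ s - min s (P.age j x) + r ∈ Icc 0 s := by
  set a := min s (P.age j x)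
  have h1 : x - P.c j * a + P.c j * r = x + P.c j * (r - a) := by ring
  have h2 : |P.c j| * a ≤ P.pos j x := by
    rw [← hP.abs_c_mul_age]
    exact mul_le_mul_of_nonneg_left (min_le_right _ _) (abs_nonneg _)
  have h3 : a ≤ s := min_le_left _ _
  refine ⟨?_, by linarith [hr.1], by linarith [hr.2]⟩
  rw [h1, ← pos_mem (P := P) (j := j), pos_add]
  have h4 := (pos_mem (P := P) (j := j)).2 hx
  have h5 : |P.c j| * (r - a) ≤ 0 := mul_nonpos_of_nonneg_of_nonpos (abs_nonneg _)
      (by linarith [hr.2])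
  have h6 : 0 ≤ |P.c j| * r := mul_nonneg (abs_nonneg _) hr.1
  constructor
  · nlinarith
  · linarith [h4.2]

theorem min_age_nonneg {j : J} {x s : ℝ} (hs : 0 ≤ s) (hx : x ∈ Icc 0 1) :
    0 ≤ min s (P.age j x) := le_min hs (hP.age_nonneg hx)

section Measurability

variable {Θ : Type*} [MeasurableSpace Θ] {q : Θ → J → ℝ → ℝ → ℝ} {past b q₀ : Θ → J → ℝ → ℝ}

omit [Fintype J] hP in
theorem _root_.Net.measurable_age (P : Net J) (j : J) : Measurable (P.age j) := by
  unfold age pos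
  split_ifs <;> fun_prop

theorem measurable_source (hq : ∀ j, Measurable fun p : Θ × ℝ × ℝ => q p.1 j p.2.1 p.2.2) (j : J) :
    Measurable fun p : Θ × ℝ × ℝ => P.source (q p.1) j p.2.1 p.2.2 := by
  unfold source
  refine measurable_sum _ fun l _ => Measurable.mul ?_ (hq l)
  exact (hP.S_meas j l).comp (by fun_prop : Measurable fun p : Θ × ℝ × ℝ => p.2.2)

omit hP in
theorem measurable_outflow (hq : ∀ j, Measurable fun p : Θ × ℝ × ℝ => q p.1 j p.2.1 p.2.2)
    (hpast : ∀ j, Measurable fun p : Θ × ℝ => past p.1 j p.2) (l : J) :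
    Measurable fun p : Θ × ℝ => P.outflow (past p.1) (q p.1) l p.2 := by
  unfold outflow
  refine Measurable.ite (measurableSet_lt measurable_snd measurable_const) (hpast l) ?_
  exact (hq l).comp (by fun_prop : Measurable fun p : Θ × ℝ => (p.1, p.2, P.xout l))

theorem measurable_inflow (hq : ∀ j, Measurable fun p : Θ × ℝ × ℝ => q p.1 j p.2.1 p.2.2)
    (hpast : ∀ j, Measurable fun p : Θ × ℝ => past p.1 j p.2)
    (hb : ∀ j, Measurable fun p : Θ × ℝ => b p.1 j p.2) (j : J) :
    Measurable fun p : Θ × ℝ => P.inflow (past p.1) (b p.1) (q p.1) j p.2 := by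
  unfold inflow
  refine (Measurable.add ?_ ?_).add (hb j)
  · refine measurable_sum _ fun l _ => measurable_const.mul ?_
    exact (hq l).comp (by fun_prop : Measurable fun p : Θ × ℝ => (p.1, p.2, P.xout l))
  · refine measurable_sum _ fun l _ => ?_
    refine measurable_intervalIntegral (α := Θ × ℝ) ?_ measurable_const measurable_const
    refine ((hP.F_meas j l).comp measurable_snd).mul ?_
    exact (measurable_outflow (P := P) hq hpast l).comp
      (by fun_prop : Measurable fun p : (Θ × ℝ) × ℝ => (p.1.1, p.1.2 - p.2))

theorem measurable_mild (hq : ∀ j, Measurable fun p : Θ × ℝ × ℝ => q p.1 j p.2.1 p.2.2)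
    (hpast : ∀ j, Measurable fun p : Θ × ℝ => past p.1 j p.2)
    (hb : ∀ j, Measurable fun p : Θ × ℝ => b p.1 j p.2)
    (hq₀ : ∀ j, Measurable fun p : Θ × ℝ => q₀ p.1 j p.2) (j : J) :
    Measurable fun p : Θ × ℝ × ℝ =>
      P.mild (q₀ p.1) (past p.1) (b p.1) (q p.1) j p.2.1 p.2.2 := by
  have hage : Measurable fun p : Θ × ℝ × ℝ => P.age j p.2.2 :=
    (P.measurable_age j).comp (by fun_prop : Measurable fun p : Θ × ℝ × ℝ => p.2.2)
  have hs : Measurable fun p : Θ × ℝ × ℝ => p.2.1 := by fun_prop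
  have hmin : Measurable fun p : Θ × ℝ × ℝ => min p.2.1 (P.age j p.2.2) := hs.min hage
  unfold mild
  refine Measurable.add (Measurable.ite (measurableSet_le hs hage) ?_ ?_) ?_
  · exact (hq₀ j).comp (by fun_prop : Measurable fun p : Θ × ℝ × ℝ => (p.1, p.2.2 - P.c j * p.2.1))
  · exact (hP.measurable_inflow hq hpast hb j).comp (measurable_fst.prodMk (hs.sub hage))
  · refine measurable_intervalIntegral (α := Θ × ℝ × ℝ) ?_ measurable_const hmin
    have hm : Measurable fun p : (Θ × ℝ × ℝ) × ℝ => min p.1.2.1 (P.age j p.1.2.2) :=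
      hmin.comp measurable_fst
    have e : Measurable fun p : (Θ × ℝ × ℝ) × ℝ =>
        ((p.1.1, p.1.2.1 - min p.1.2.1 (P.age j p.1.2.2) + p.2,
          p.1.2.2 - P.c j * min p.1.2.1 (P.age j p.1.2.2) + P.c j * p.2) : Θ × ℝ × ℝ) := by
      refine Measurable.prodMk (by fun_prop) (Measurable.prodMk ?_ ?_)
      · exact ((by fun_prop : Measurable fun p : (Θ × ℝ × ℝ) × ℝ => p.1.2.1).sub hm).add
          measurable_snd
      · exact ((by fun_prop : Measurable fun p : (Θ × ℝ × ℝ) × ℝ => p.1.2.2).sub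
          (hm.const_mul _)).add (measurable_snd.const_mul _)
    exact (hP.measurable_source hq j).comp e

end Measurability

/-- The contraction factor of the right-hand side with respect to the weight
`exp (β s - κ pos)`. -/
def _root_.Net.factor (J : Type) [Fintype J] (M κ β : ℝ) : ℝ :=
  (Fintype.card J : ℝ) * M * (2 * exp (-κ) + exp κ / β)

/-- The gain from the initial and past values to the solution. -/
def _root_.Net.gain (P : Net J) (M κ : ℝ) : ℝ := exp κ + Fintype.card J * M * P.h

theorem gain_nonneg (κ : ℝ) : 0 ≤ P.gain M κ := by
  have := hP.M_pos
  have := hP.h_nonneg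
  unfold gain
  positivity

/-- For the weight `exp (β s - κ pos)` the right-hand side is a contraction. -/
structure _root_.Net.Exponents (P : Net J) (M κ β : ℝ) : Prop where
  κ_nonneg : 0 ≤ κ
  one_le : 1 ≤ β
  speed : ∀ j, κ * |P.c j| ≤ β
  half : factor J M κ β ≤ 1 / 2

variable {κ β : ℝ}

theorem _root_.Net.Exponents.mono {β' : ℝ} (h : P.Exponents M κ β) (hβ : β ≤ β') :
    P.Exponents M κ β' := by
  refine ⟨h.κ_nonneg, h.one_le.trans hβ, fun j => (h.speed j).trans hβ, le_trans ?_ h.half⟩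
  have := hP.M_pos
  have := h.one_le
  unfold factor
  gcongr

omit hP in
theorem _root_.Net.Exponents.exp_le (h : P.Exponents M κ β) (j : J) {s x : ℝ}
    (hx : x ∈ Icc 0 1) : exp (β * s - κ * P.pos j x) ≤ exp (β * s) :=
  exp_le_exp.2 (sub_le_self _ (mul_nonneg h.κ_nonneg ((pos_mem (j := j)).2 hx).1))

omit hP in
theorem _root_.Net.Exponents.le_exp (h : P.Exponents M κ β) (j : J) {s x : ℝ}
    (hx : x ∈ Icc 0 1) : exp (β * s) ≤ exp κ * exp (β * s - κ * P.pos j x) := by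
  rw [← exp_add]
  have := mul_le_mul_of_nonneg_left ((pos_mem (P := P) (j := j)).2 hx).2 h.κ_nonneg
  exact exp_le_exp.2 (by linarith)

/-- The weight for outflow values is `exp κ` times as large as for inflow values, and the weight
`exp (β s)` makes source terms small: one application of the right-hand side contracts. -/
theorem mild_bd {Θ : Type*} [MeasurableSpace Θ] (ν : ParamNorm Θ)
    {q : Θ → J → ℝ → ℝ → ℝ} {q₀ past b : Θ → J → ℝ → ℝ} {L D Nb N : ℝ}
    (he : P.Exponents M κ β) (hN : 0 < N) (hD : 0 ≤ D)
    (hqm : ∀ j, Measurable fun p : Θ × ℝ × ℝ => q p.1 j p.2.1 p.2.2)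
    (hpm : ∀ j, Measurable fun p : Θ × ℝ => past p.1 j p.2)
    (hq : ∀ j s x, 0 ≤ s → s ≤ L → x ∈ Icc 0 1 →
      ν.Bd (fun θ => q θ j s x) (N * exp (β * s - κ * P.pos j x)))
    (hq₀ : ∀ j x, x ∈ Icc 0 1 → ν.Bd (fun θ => q₀ θ j x) D)
    (hpast : ∀ j s, -P.h ≤ s → s < 0 → ν.Bd (fun θ => past θ j s) D)
    (hb : ∀ j s, 0 < s → s ≤ L → ν.Bd (fun θ => b θ j s) (Nb * exp (β * s)))
    (hNb : 0 ≤ Nb) (j : J) (s x : ℝ) (hs : 0 ≤ s) (hsL : s ≤ L) (hx : x ∈ Icc 0 1) :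
    ν.Bd (fun θ => P.mild (q₀ θ) (past θ) (b θ) (q θ) j s x)
      ((N / 2 + Nb + P.gain M κ * D) * exp (β * s - κ * P.pos j x)) := by
  have hM := hP.M_pos
  have hβ0 : 0 < β := one_pos.trans_le he.one_le
  set n : ℝ := (Fintype.card J : ℝ) with hn
  have hwκ := he.le_exp j (s := s) hx
  set w := exp (β * s - κ * P.pos j x) with hw
  have hwpos : 0 < w := exp_pos _
  have hh := hP.h_nonneg
  have hhalf : n * M * (2 * exp (-κ) + exp κ / β) * (N * w) ≤ 1 / 2 * (N * w) :=
    mul_le_mul_of_nonneg_right he.half (by positivity)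
  -- the source term
  have hsrc : ν.Bd (fun θ => ∫ r in 0..min s (P.age j x),
      P.source (q θ) j (s - min s (P.age j x) + r)
      (x - P.c j * min s (P.age j x) + P.c j * r)) (n * M * (exp κ / β) * (N * w)) := by
    set a := min s (P.age j x) with ha
    refine ν.mono (ν.integral (m := fun r => n * (M * (N * exp (β * (s - a) + β * r))))
      (hP.min_age_nonneg hs hx) ?_ (by fun_prop) (fun r => ?_) fun r hr => ?_) ?_
    · exact (hP.measurable_source hqm j).comp (by fun_prop : Measurable fun p : Θ × ℝ =>
        (p.1, s - a + p.2, x - P.c j * a + P.c j * p.2))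
    · have : 0 < n := Nat.cast_pos.2 (Fintype.card_pos_iff.2 ⟨j⟩)
      positivity
    · obtain ⟨f1, f2⟩ := hP.foot_mem hs hx hr
      refine ν.sum_mul (by positivity) (hP.S_le _ j) fun l => ?_
      refine ν.mono (hq l _ _ f2.1 (f2.2.trans hsL) f1) (mul_le_mul_of_nonneg_left ?_ hN.le)
      rw [← mul_add]
      exact he.exp_le l f1
    · simp only [intervalIntegral.integral_const_mul]
      have e1 := integral_exp_add_mul_le (c := β * (s - a)) (a := a) hβ0
      rw [← mul_add, sub_add_cancel] at e1
      calc n * (M * (N * ∫ r in 0..a, exp (β * (s - a) + β * r)))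
          ≤ n * (M * (N * (exp κ * w / β))) := by
            have := e1.trans (div_le_div_of_nonneg_right hwκ hβ0.le)
            gcongr
        _ = _ := by ring
  by_cases hc : s ≤ P.age j x
  · have h1 := hq₀ j (x - P.c j * s) (by
      have := (hP.foot_mem (j := j) (r := 0) hs hx ⟨le_rfl, hP.min_age_nonneg hs hx⟩).1
      rwa [min_eq_left hc, mul_zero, add_zero] at this)
    simp only [mild, if_pos hc]
    refine ν.mono (ν.add h1 hsrc) ?_
    have e2 := mul_le_mul_of_nonneg_left ((one_le_exp (by positivity)).trans hwκ) hD
    have e3 : 0 ≤ n * M * (2 * exp (-κ)) * (N * w) := by positivity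
    have e4 : 0 ≤ Nb * w := by positivity
    have e5 : 0 ≤ n * M * P.h * D * w := by positivity
    unfold gain
    rw [← hn]
    linarith
  · set s' := s - P.age j x with hs'
    have hs'0 : 0 < s' := sub_pos.2 (not_le.1 hc)
    have hage := hP.age_nonneg hx (j := j)
    have hs'L : s' ≤ L := by linarith
    have hwt : exp (β * s') ≤ w := by
      refine exp_le_exp.2 ?_
      rw [hs', ← hP.abs_c_mul_age]
      nlinarith [mul_le_mul_of_nonneg_right (he.speed j) hage]
    have hwt' : exp (β * s' - κ) ≤ exp (-κ) * w := by
      rw [sub_eq_neg_add, exp_add]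
      exact mul_le_mul_of_nonneg_left hwt (exp_pos _).le
    have g1 : ν.Bd (fun θ => ∑ l, P.B j l * q θ l s' (P.xout l))
        (n * (M * (N * (exp (-κ) * w)))) := by
      refine ν.sum_mul (by positivity) (hP.B_le j) fun l =>
        ν.mono (hq l s' _ hs'0.le hs'L (xout_mem l)) (mul_le_mul_of_nonneg_left ?_ hN.le)
      rwa [pos_xout, mul_one]
    have g2 : ν.Bd (fun θ => ∑ l, ∫ y in 0..P.h, P.F y j l * P.outflow (past θ) (q θ) l (s' - y))
        (n * (M * (N * (exp (-κ) * w) + P.h * D * w))) := by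
      have : ∀ l ∈ (Finset.univ : Finset J), ν.Bd (fun θ => ∫ y in 0..P.h,
          P.F y j l * P.outflow (past θ) (q θ) l (s' - y))
          (M * (N * (exp (-κ) * w) + P.h * D * w)) := by
        intro l _
        refine ν.mono (ν.integral (m := fun y => M * (N * exp ((β * s' - κ) - β * y) + D)) hh
          ?_ (by fun_prop) (fun y => by positivity) fun y hy => ?_) ?_
        · refine ((hP.F_meas j l).comp measurable_snd).mul ?_
          exact (measurable_outflow (P := P) hqm hpm l).comp
            (by fun_prop : Measurable fun p : Θ × ℝ => (p.1, s' - p.2))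
        · refine ν.mono (ν.smul (P.F y j l) (M := N * exp ((β * s' - κ) - β * y) + D) ?_)
            (mul_le_mul_of_nonneg_right (hP.F_le y j l) (by positivity))
          by_cases hy' : s' - y < 0
          · simp only [outflow, if_pos hy']
            exact ν.mono (hpast l _ (by linarith [hy.2]) hy')
                (le_add_of_nonneg_left (by positivity))
          · simp only [outflow, if_neg hy']
            refine ν.mono (hq l _ _ (not_lt.1 hy') (by linarith [hy.1]) (xout_mem l)) ?_
            rw [pos_xout, show β * (s' - y) - κ * 1 = (β * s' - κ) - β * y by ring]
            linarith
        · rw [intervalIntegral.integral_const_mul, intervalIntegral.integral_add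
            (Continuous.intervalIntegrable (by fun_prop) _ _) (by simp),
            intervalIntegral.integral_const_mul, intervalIntegral.integral_const, sub_zero,
            smul_eq_mul]
          have e1 := (integral_exp_sub_mul_le (c := β * s' - κ) (a := P.h) hβ0).trans
            ((div_le_self (exp_pos _).le he.one_le).trans hwt')
          have e3 : P.h * D ≤ P.h * D * w :=
            le_mul_of_one_le_right (by positivity) ((one_le_exp (by positivity)).trans hwt)
          gcongr
      refine ν.mono (ν.sum _ this) (le_of_eq ?_)
      simp [hn]
    simp only [mild, if_neg hc, inflow]
    refine ν.mono (ν.add (ν.add (ν.add g1 g2) (hb j s' hs'0 hs'L)) hsrc) ?_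
    have e1 := mul_le_mul_of_nonneg_left hwt hNb
    have e2 : 0 ≤ exp κ * D * w := by positivity
    unfold gain
    rw [← hn]
    linarith

/-- A-priori estimate for a family of solutions of the network. -/
theorem family_bd {Θ : Type*} [MeasurableSpace Θ] (ν : ParamNorm Θ)
    {q : Θ → J → ℝ → ℝ → ℝ} {q₀ past b : Θ → J → ℝ → ℝ} {L D Nb N₀ : ℝ}
    (he : P.Exponents M κ β) (hD : 0 ≤ D)
    (hqm : ∀ j, Measurable fun p : Θ × ℝ × ℝ => q p.1 j p.2.1 p.2.2)
    (hpm : ∀ j, Measurable fun p : Θ × ℝ => past p.1 j p.2)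
    (hsol : ∀ j s x, 0 ≤ s → s ≤ L → x ∈ Icc 0 1 → ∀ θ,
      q θ j s x = P.mild (q₀ θ) (past θ) (b θ) (q θ) j s x)
    (hN₀ : ∀ j s x, 0 ≤ s → s ≤ L → x ∈ Icc 0 1 → ν.Bd (fun θ => q θ j s x) N₀)
    (hq₀ : ∀ j x, x ∈ Icc 0 1 → ν.Bd (fun θ => q₀ θ j x) D)
    (hpast : ∀ j s, -P.h ≤ s → s < 0 → ν.Bd (fun θ => past θ j s) D)
    (hb : ∀ j s, 0 < s → s ≤ L → ν.Bd (fun θ => b θ j s) (Nb * exp (β * s)))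
    (hNb : 0 ≤ Nb) (j : J) (s x : ℝ) (hs : 0 ≤ s) (hsL : s ≤ L) (hx : x ∈ Icc 0 1) :
    ν.Bd (fun θ => q θ j s x) (2 * (Nb + P.gain M κ * D) * exp (β * s - κ * P.pos j x)) := by
  set A := Nb + P.gain M κ * D with hA
  have hA0 : 0 ≤ A := add_nonneg hNb (mul_nonneg (hP.gain_nonneg κ) hD)
  set N₁ := (|N₀| + 1) * exp κ with hN₁
  have hN₁0 : 0 < N₁ := by positivity
  have claim : ∀ n : ℕ, ∀ j s x, 0 ≤ s → s ≤ L → x ∈ Icc 0 1 →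
      ν.Bd (fun θ => q θ j s x) ((2 * A + N₁ / 2 ^ n) * exp (β * s - κ * P.pos j x)) := by
    intro n
    induction n with
    | zero =>
      intro j s x hs hsL hx
      refine ν.mono (hN₀ j s x hs hsL hx) ?_
      have hβ : 0 ≤ β := zero_le_one.trans he.one_le
      calc N₀ ≤ |N₀| + 1 := by linarith [le_abs_self N₀]
        _ ≤ (|N₀| + 1) * (exp κ * exp (β * s - κ * P.pos j x)) :=
          le_mul_of_one_le_right (by positivity) ((one_le_exp (by positivity)).trans
              (he.le_exp j hx))
        _ = N₁ * exp (β * s - κ * P.pos j x) := by rw [hN₁]; ring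
        _ ≤ _ := by
          rw [pow_zero, div_one]
          gcongr
          linarith
    | succ n ih =>
      intro j s x hs hsL hx
      have := hP.mild_bd ν he (by positivity : 0 < 2 * A + N₁ / 2 ^ n) hD hqm hpm ih
        hq₀ hpast hb hNb j s x hs hsL hx
      simp only [← hsol j s x hs hsL hx] at this
      refine ν.mono this (mul_le_mul_of_nonneg_right (le_of_eq ?_) (exp_pos _).le)
      rw [pow_succ, hA]
      ring
  refine ν.closed fun ε hε => ?_
  set w := exp (β * s - κ * P.pos j x)
  have hw : 0 < w := exp_pos _
  obtain ⟨n, hn⟩ := pow_unbounded_of_one_lt (N₁ * w / ε) (by norm_num : (1 : ℝ) < 2)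
  refine ν.mono (claim n j s x hs hsL hx) ?_
  rw [add_mul]
  have : N₁ / 2 ^ n * w ≤ ε := by
    rw [div_mul_eq_mul_div, div_le_iff₀ (by positivity)]
    rw [div_lt_iff₀ hε] at hn
    linarith
  linarith

/-- The exponents `κ` and `β` can be chosen arbitrarily large. -/
theorem exists_exponents (κ₀ : ℝ) : ∃ κ β : ℝ, κ₀ ≤ κ ∧ P.Exponents M κ β := by
  have hM := hP.M_pos
  set A := (Fintype.card J : ℝ) * M + 1 with hA
  have hA0 : 0 < A := by positivity
  obtain ⟨κ, hκ1, hκ2, hκ3⟩ := ((Real.tendsto_exp_neg_atTop_nhds_zero.eventually (gt_mem_nhds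
    (by positivity : 0 < 1 / (8 * A)))).and ((Filter.eventually_ge_atTop κ₀).and
    (Filter.eventually_ge_atTop 0))).exists
  set β := max 1 (max (exp κ * (4 * A)) (∑ j, κ * |P.c j|)) with hβ
  have hβ0 : 0 < β := one_pos.trans_le (le_max_left _ _)
  refine ⟨κ, β, hκ2, hκ3, le_max_left _ _, fun j => ?_, ?_⟩
  · refine le_trans ?_ ((le_max_right _ _).trans (le_max_right _ _))
    exact single_le_sum (f := fun j => κ * |P.c j|) (fun i _ => by positivity) (Finset.mem_univ j)
  · have h2 : exp κ / β ≤ 1 / (4 * A) := by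
      rw [div_le_div_iff₀ hβ0 (by positivity), one_mul]
      exact (le_max_left _ _).trans (le_max_right _ _)
    unfold factor
    have h3 : 2 * exp (-κ) + exp κ / β ≤ 1 / (2 * A) := by
      have : 1 / (2 * A) = 2 * (1 / (8 * A)) + 1 / (4 * A) := by field_simp; norm_num
      linarith
    calc (Fintype.card J : ℝ) * M * (2 * exp (-κ) + exp κ / β)
        ≤ A * (1 / (2 * A)) := mul_le_mul (by linarith) h3 (by positivity) hA0.le
      _ = 1 / 2 := by field_simp

end Regular

end Net

namespace Net

variable {J : Type} [Fintype J] {P : Net J} {M : ℝ}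

/-- `q` is Borel, and bounded up to time `L`. -/
structure Tame (q : J → ℝ → ℝ → ℝ) (L : ℝ) : Prop where
  meas : ∀ j, Measurable fun p : ℝ × ℝ => q j p.1 p.2
  bdd : ∃ B, ∀ j s x, 0 ≤ s → s ≤ L → x ∈ Icc 0 1 → |q j s x| ≤ B

/-- The past outflow is Borel, and bounded on the memory interval. -/
structure TamePast (P : Net J) (past : J → ℝ → ℝ) : Prop where
  meas : ∀ j, Measurable (past j)
  bdd : ∃ B, ∀ j s, -P.h ≤ s → s < 0 → |past j s| ≤ B

omit [Fintype J] in
theorem tamePast_zero (P : Net J) : P.TamePast fun _ _ => 0 :=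
  ⟨fun _ => measurable_const, 0, fun _ _ _ _ => abs_zero.le⟩

namespace Regular

variable (hP : P.Regular M) {κ β L : ℝ} {q q' : J → ℝ → ℝ → ℝ} {q₀ q₀' past past' b b' : J → ℝ → ℝ}
include hP

theorem intervalIntegrable_source (hq : Tame q L) (j : J) {s x : ℝ}
    (hs : 0 ≤ s) (hsL : s ≤ L) (hx : x ∈ Icc 0 1) :
    IntervalIntegrable (fun r => P.source q j (s - min s (P.age j x) + r)
      (x - P.c j * min s (P.age j x) + P.c j * r)) volume 0 (min s (P.age j x)) := by
  obtain ⟨B, hB⟩ := hq.bdd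
  have ha := hP.min_age_nonneg (j := j) hs hx
  refine intervalIntegrable_of_abs_le (M := Fintype.card J * (M * B)) ?_ fun r hr => ?_
  · unfold source
    refine measurable_sum _ fun l _ => Measurable.mul ?_ ?_
    · exact (hP.S_meas j l).comp (by fun_prop)
    · exact (hq.meas l).comp (by fun_prop : Measurable fun r : ℝ =>
        ((s - min s (P.age j x) + r, x - P.c j * min s (P.age j x) + P.c j * r) : ℝ × ℝ))
  · rw [uIcc_of_le ha] at hr
    obtain ⟨f1, f2⟩ := hP.foot_mem hs hx hr
    unfold source
    refine (abs_sum_le_sum_abs _ _).trans ?_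
    calc _ ≤ ∑ _l : J, M * B := sum_le_sum fun l _ => by
          rw [abs_mul]
          exact mul_le_mul (hP.S_le _ _ _) (hB l _ _ f2.1 (f2.2.trans hsL) f1) (abs_nonneg _)
            hP.M_pos.le
      _ = _ := by simp

theorem intervalIntegrable_memory (hq : Tame q L) (hp : P.TamePast past) (j l : J) {s : ℝ}
    (hs : 0 ≤ s) (hsL : s ≤ L) :
    IntervalIntegrable (fun y => P.F y j l * P.outflow past q l (s - y)) volume 0 P.h := by
  obtain ⟨B, hB⟩ := hq.bdd
  obtain ⟨B', hB'⟩ := hp.bdd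
  refine intervalIntegrable_of_abs_le (M := M * max B B') ?_ fun y hy => ?_
  · refine (hP.F_meas j l).mul ?_
    unfold outflow
    refine Measurable.ite (measurableSet_lt (by fun_prop) measurable_const)
      ((hp.meas l).comp (by fun_prop)) ?_
    exact (hq.meas l).comp (by fun_prop : Measurable fun y : ℝ => ((s - y, P.xout l) : ℝ × ℝ))
  · rw [uIcc_of_le hP.h_nonneg] at hy
    rw [abs_mul]
    refine mul_le_mul (hP.F_le _ _ _) ?_ (abs_nonneg _) hP.M_pos.le
    unfold outflow
    split_ifs with hc
    · exact (hB' _ _ (by linarith [hy.2]) hc).trans (le_max_right _ _)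
    · exact (hB _ _ _ (not_lt.1 hc) (by linarith [hy.1]) (xout_mem _)).trans (le_max_left _ _)

/-- The right-hand side depends linearly on the data and the solution. -/
theorem mild_sub (hq : Tame q L) (hq' : Tame q' L) (hp : P.TamePast past) (hp' : P.TamePast past')
    (j : J) {s x : ℝ} (hs : 0 ≤ s) (hsL : s ≤ L) (hx : x ∈ Icc 0 1) :
    P.mild q₀ past b q j s x - P.mild q₀' past' b' q' j s x =
      P.mild (fun j x => q₀ j x - q₀' j x) (fun j s => past j s - past' j s)
        (fun j s => b j s - b' j s) (fun j s x => q j s x - q' j s x) j s x := by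
  have h2 : ∀ t, 0 ≤ t → t ≤ L → P.inflow past b q j t - P.inflow past' b' q' j t =
      P.inflow (fun j s => past j s - past' j s) (fun j s => b j s - b' j s)
        (fun j s x => q j s x - q' j s x) j t := by
    intro t ht htL
    have h3 : ∀ l, (∫ y in 0..P.h, P.F y j l * P.outflow past q l (t - y)) -
        (∫ y in 0..P.h, P.F y j l * P.outflow past' q' l (t - y)) =
        ∫ y in 0..P.h, P.F y j l * P.outflow (fun j s => past j s - past' j s)
          (fun j s x => q j s x - q' j s x) l (t - y) := by
      intro l
      rw [← intervalIntegral.integral_sub (hP.intervalIntegrable_memory hq hp j l ht htL)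
        (hP.intervalIntegrable_memory hq' hp' j l ht htL)]
      refine integral_congr fun y _ => ?_
      simp only [outflow]
      split_ifs <;> ring
    simp only [inflow, ← h3, mul_sub, sum_sub_distrib]
    ring
  have h1 := intervalIntegral.integral_sub (hP.intervalIntegrable_source hq j hs hsL hx)
    (hP.intervalIntegrable_source hq' j hs hsL hx)
  simp only [source, ← sum_sub_distrib, ← mul_sub] at h1
  simp only [mild, source]
  rw [h1]
  split_ifs with hc
  · ring
  · rw [← h2 _ (by linarith [not_le.1 hc]) (by linarith [hP.age_nonneg hx (j := j)])]
    ring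

/-- Existence of families of solutions, with exponential growth in time. -/
theorem exists_family {Θ : Type*} [MeasurableSpace Θ] {q₀ past b : Θ → J → ℝ → ℝ} {d : Θ → ℝ}
    {D Nb : ℝ} (he : P.Exponents M κ β) (hD : 0 ≤ D) (hNb : 0 ≤ Nb) (hd : ∀ θ, 0 < d θ)
    (hpm : ∀ j, Measurable fun p : Θ × ℝ => past p.1 j p.2)
    (hbm : ∀ j, Measurable fun p : Θ × ℝ => b p.1 j p.2)
    (hqm : ∀ j, Measurable fun p : Θ × ℝ => q₀ p.1 j p.2)
    (hq₀ : ∀ θ j x, x ∈ Icc 0 1 → |q₀ θ j x| ≤ D * d θ)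
    (hpast : ∀ θ j s, -P.h ≤ s → s < 0 → |past θ j s| ≤ D * d θ)
    (hb : ∀ θ j s, 0 < s → |b θ j s| ≤ Nb * exp (β * s) * d θ) :
    ∃ q : Θ → J → ℝ → ℝ → ℝ, (∀ j, Measurable fun p : Θ × ℝ × ℝ => q p.1 j p.2.1 p.2.2) ∧
      (∃ G, 0 ≤ G ∧ ∀ θ j s x, 0 ≤ s → x ∈ Icc 0 1 → |q θ j s x| ≤ G * exp (β * s) * d θ) ∧
      ∀ θ j s x, 0 ≤ s → x ∈ Icc 0 1 → q θ j s x = P.mild (q₀ θ) (past θ) (b θ) (q θ) j s x := by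
  classical
  let _ : MeasurableSpace J := ⊤
  have hβ0 : 0 ≤ β := zero_le_one.trans he.one_le
  let cur : (J × Θ × ℝ × ℝ → ℝ) → Θ → J → ℝ → ℝ → ℝ := fun f θ j s x => f (j, θ, s, x)
  let ω : J × Θ × ℝ × ℝ → ℝ := fun p => exp (β * p.2.2.1 - κ * P.pos p.1 p.2.2.2) * d p.2.1
  have hω : ∀ p, 0 < ω p := fun p => mul_pos (exp_pos _) (hd _)
  let Dom : Set (Θ × ℝ × ℝ) := {p | 0 ≤ p.2.1 ∧ p.2.2 ∈ Icc 0 1}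
  have hDom : MeasurableSet Dom :=
    (measurableSet_le measurable_const (by fun_prop : Measurable fun p : Θ × ℝ × ℝ => p.2.1)).inter
      ((by fun_prop : Measurable fun p : Θ × ℝ × ℝ => p.2.2) measurableSet_Icc)
  let Φ : (J × Θ × ℝ × ℝ → ℝ) → J × Θ × ℝ × ℝ → ℝ := fun f p =>
    if p.2 ∈ Dom then P.mild (q₀ p.2.1) (past p.2.1) (b p.2.1) (cur f p.2.1) p.1 p.2.2.1 p.2.2.2
    else 0
  have hcur : ∀ f, Measurable f → ∀ j, Measurable fun p : Θ × ℝ × ℝ => cur f p.1 j p.2.1 p.2.2 :=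
    fun f hf j => hf.comp (measurable_const.prodMk (by fun_prop))
  have hpt : ∀ θ, P.TamePast (past θ) := fun θ =>
    ⟨fun j => (hpm j).comp measurable_prodMk_left, _, hpast θ⟩
  have hcb : ∀ (f : J × Θ × ℝ × ℝ → ℝ) (N : ℝ), (∀ p, |f p| ≤ N * ω p) → ∀ θ l t y,
      y ∈ Icc 0 1 → |cur f θ l t y| ≤ |N| * exp (β * t) * d θ := fun f N hN θ l t y hy => by
    refine (hN (l, θ, t, y)).trans ?_
    rw [mul_assoc]
    exact mul_le_mul (le_abs_self _) (mul_le_mul_of_nonneg_right (he.exp_le l hy) (hd θ).le)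
      (hω _).le (abs_nonneg _)
  have htame : ∀ f, Measurable f → (∃ N, ∀ p, |f p| ≤ N * ω p) → ∀ θ L, Tame (cur f θ) L := by
    rintro f hf ⟨N, hN⟩ θ L
    refine ⟨fun j => (hcur f hf j).comp measurable_prodMk_left, |N| * exp (β * L) * d θ,
      fun j s x _ hsL hx => (hcb f N hN θ j s x hx).trans ?_⟩
    have := (hd θ).le
    gcongr
  obtain ⟨f, hfm, ⟨N, hfN⟩, hf⟩ := exists_fixedPoint_of_weight ω hω Φ
    (1 / 2 + Nb + P.gain M κ * D) (by
      intro f hf _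
      refine measurable_from_prod_countable_right fun j => ?_
      exact Measurable.ite hDom (hP.measurable_mild (hcur f hf) hpm hbm hqm j) measurable_const) (by
      rintro ⟨j, θ, s, x⟩
      by_cases hp : (θ, s, x) ∈ Dom
      · have := hP.mild_bd (ParamNorm.sup d univ) (q := fun _ _ _ _ => 0) (L := s) he
          one_pos hD (fun _ => measurable_const) hpm (fun j s x _ _ _ θ _ _ => by
            have := hd θ
            rw [abs_zero]
            positivity) (fun j x hx θ _ _ => hq₀ θ j x hx)
          (fun j s h1 h2 θ _ _ => hpast θ j s h1 h2)
          (fun j s h1 _ θ _ _ => hb θ j s h1) hNb j s x hp.1 le_rfl hp.2 θ (mem_univ _) (hd θ).le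
        simp only [Φ, if_pos hp, ω]
        rwa [← mul_assoc]
      · simp only [Φ, if_neg hp, abs_zero]
        have := hω (j, θ, s, x)
        have := hP.gain_nonneg κ
        positivity) (by
      rintro f g hf hg hNf hNg N hN hfg ⟨j, θ, s, x⟩
      by_cases hp : (θ, s, x) ∈ Dom
      · have := hP.mild_bd (ParamNorm.sup d univ) (D := 0) (Nb := 0)
          (q₀ := fun θ j x => q₀ θ j x - q₀ θ j x) (past := fun θ j x => past θ j x - past θ j x)
          (b := fun θ j x => b θ j x - b θ j x)
          (q := fun θ l t y => cur f θ l t y - cur g θ l t y) (L := s) he hN le_rfl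
          (fun l => (hcur f hf l).sub (hcur g hg l)) (by simp)
          (fun l t y h1 h2 h3 θ _ _ => (hfg (l, θ, t, y)).trans (le_of_eq (mul_assoc _ _ _).symm))
          (fun j x _ θ _ _ => by simp)
          (fun j s _ _ θ _ _ => by simp) (fun j s _ _ θ _ _ => by simp) le_rfl j s x hp.1 le_rfl
          hp.2 θ (mem_univ _) (hd θ).le
        simp only [Φ, if_pos hp]
        rw [hP.mild_sub (htame f hf hNf θ s) (htame g hg hNg θ s) (hpt θ) (hpt θ) j hp.1
            le_rfl hp.2]
        rwa [mul_zero, add_zero, add_zero, mul_assoc] at this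
      · simp only [Φ, if_neg hp, sub_zero, abs_zero]
        have := hω (j, θ, s, x)
        positivity)
  refine ⟨cur f, hcur f hfm, ⟨_, abs_nonneg N, fun θ j s x _ hx => hcb f N hfN θ j s x hx⟩,
    fun θ j s x hs hx => ?_⟩
  have := congrFun hf (j, θ, s, x)
  simp only [Φ] at this
  rw [if_pos (show (θ, s, x) ∈ Dom from ⟨hs, hx⟩)] at this
  exact this.symm

/-- The influence of the input on bounded solutions with the same initial and past values. -/
theorem abs_sub_le_of_mild {Nb : ℝ} (he : P.Exponents M κ β) (hq : Tame q L) (hq' : Tame q' L)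
    (hp : P.TamePast past)
    (e : ∀ j s x, 0 ≤ s → s ≤ L → x ∈ Icc 0 1 → q j s x = P.mild q₀ past b q j s x)
    (e' : ∀ j s x, 0 ≤ s → s ≤ L → x ∈ Icc 0 1 → q' j s x = P.mild q₀ past b' q' j s x)
    (hNb : 0 ≤ Nb) (hb : ∀ j s, 0 < s → s ≤ L → |b j s - b' j s| ≤ Nb * exp (β * s)) (j : J)
    (s x : ℝ) (hs : 0 ≤ s) (hsL : s ≤ L) (hx : x ∈ Icc 0 1) :
    |q j s x - q' j s x| ≤ 2 * Nb * exp (β * s) := by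
  obtain ⟨B, hB⟩ := hq.bdd
  obtain ⟨B', hB'⟩ := hq'.bdd
  have := hP.family_bd (ParamNorm.sup (fun _ : Unit => 1) univ) (D := 0) (Nb := Nb) (L := L)
    (N₀ := B + B') (q := fun _ l t y => q l t y - q' l t y) (q₀ := fun _ j x => q₀ j x - q₀ j x)
    (past := fun _ j x => past j x - past j x) (b := fun _ j x => b j x - b' j x) he le_rfl
    (fun l => ((hq.meas l).sub (hq'.meas l)).comp measurable_snd) (by simp)
    (fun l t y h1 h2 h3 _ => by
      rw [← hP.mild_sub hq hq' hp hp l h1 h2 h3, ← e l t y h1 h2 h3, ← e' l t y h1 h2 h3])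
    (fun l t y h1 h2 h3 _ _ _ => by
      rw [mul_one]
      exact (abs_sub _ _).trans (add_le_add (hB l t y h1 h2 h3) (hB' l t y h1 h2 h3)))
    (fun _ _ _ _ _ _ => by simp) (fun _ _ _ _ _ _ _ => by simp)
    (fun j s h1 h2 _ _ _ => by rw [mul_one]; exact hb j s h1 h2) hNb j s x hs hsL hx ()
    (mem_univ _) zero_le_one
  rw [mul_zero, add_zero, mul_one] at this
  exact this.trans (mul_le_mul_of_nonneg_left (he.exp_le j hx) (by positivity))

/-- Two bounded solutions with the same data coincide. -/
theorem mild_unique (hq : Tame q L) (hq' : Tame q' L) (hp : P.TamePast past)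
    (e : ∀ j s x, 0 ≤ s → s ≤ L → x ∈ Icc 0 1 → q j s x = P.mild q₀ past b q j s x)
    (e' : ∀ j s x, 0 ≤ s → s ≤ L → x ∈ Icc 0 1 → q' j s x = P.mild q₀ past b q' j s x)
    (j : J) (s x : ℝ) (hs : 0 ≤ s) (hsL : s ≤ L) (hx : x ∈ Icc 0 1) :
    q j s x = q' j s x := by
  obtain ⟨κ, β, -, he⟩ := hP.exists_exponents 0
  have := hP.abs_sub_le_of_mild he hq hq' hp e e' le_rfl (fun _ _ _ _ => by simp) j s x hs hsL hx
  rw [mul_zero, zero_mul] at this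
  exact sub_eq_zero.1 (abs_nonpos_iff.1 this)

end Regular

end Net

namespace Net

variable {J : Type} [Fintype J] (P : Net J) {M : ℝ}

/-- The inflow end of component `j`. -/
def xin (j : J) : ℝ := if 0 < P.c j then 0 else 1

/-- The transport equations, integrated along the characteristics, up to time `L`. -/
def CharEq (q : J → ℝ → ℝ → ℝ) (L : ℝ) : Prop :=
  ∀ j s x r, 0 ≤ s → 0 ≤ r → s + r ≤ L → x ∈ Icc 0 1 → x + P.c j * r ∈ Icc 0 1 →
    q j (s + r) (x + P.c j * r) = q j s x + ∫ ρ in 0..r, P.source q j (s + ρ) (x + P.c j * ρ)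

variable {P}

omit [Fintype J] in
theorem xin_mem (j : J) : P.xin j ∈ Icc 0 1 := by
  unfold xin
  split_ifs <;> simp

omit [Fintype J] in
theorem age_xin (j : J) : P.age j (P.xin j) = 0 := by
  unfold age pos xin
  split_ifs <;> simp

namespace Regular

variable (hP : P.Regular M)
include hP

omit [Fintype J] in
theorem sub_mul_age (j : J) (x : ℝ) : x - P.c j * P.age j x = P.xin j := by
  have h := hP.abs_c_mul_age j x
  unfold pos at h
  unfold xin
  split_ifs at h ⊢ with hc
  · rw [abs_of_pos hc] at h; linarith
  · rw [abs_of_nonpos (not_lt.1 hc)] at h; linarith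

theorem mild_of_charEq {q : J → ℝ → ℝ → ℝ} {past b : J → ℝ → ℝ} {L : ℝ} (hq : P.CharEq q L)
    (hin : ∀ j s, 0 < s → s ≤ L → q j s (P.xin j) = P.inflow past b q j s) (j : J) {s x : ℝ}
    (hs : 0 ≤ s) (hsL : s ≤ L) (hx : x ∈ Icc 0 1) :
    q j s x = P.mild (fun j x => q j 0 x) past b q j s x := by
  have hage := hP.age_nonneg hx (j := j)
  have hfoot := (hP.foot_mem (j := j) (r := 0) hs hx ⟨le_rfl, hP.min_age_nonneg hs hx⟩).1
  rw [mul_zero, add_zero] at hfoot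
  unfold mild
  split_ifs with hc
  · rw [min_eq_left hc] at hfoot ⊢
    have := hq j 0 (x - P.c j * s) s le_rfl hs (by linarith) hfoot (by simpa using hx)
    simp only [zero_add, sub_add_cancel] at this
    simp only [sub_self, zero_add]
    exact this
  · have hc' := (not_le.1 hc).le
    rw [min_eq_right hc'] at hfoot ⊢
    have := hq j (s - P.age j x) (x - P.c j * P.age j x) (P.age j x) (by linarith) hage
      (by linarith) hfoot (by simpa using hx)
    rw [sub_add_cancel, sub_add_cancel] at this
    rw [← hin j _ (by linarith [not_le.1 hc]) (by linarith), ← hP.sub_mul_age j x]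
    exact this

theorem charEq_of_mild {q : J → ℝ → ℝ → ℝ} {q₀ past b : J → ℝ → ℝ} {L : ℝ} (hqt : Tame q L)
    (hq : ∀ j s x, 0 ≤ s → s ≤ L → x ∈ Icc 0 1 → q j s x = P.mild q₀ past b q j s x) :
    P.CharEq q L ∧ ∀ j s, 0 < s → s ≤ L → q j s (P.xin j) = P.inflow past b q j s := by
  refine ⟨fun j s x r hs hr hsr hx hxr => ?_, fun j s hs hsL => ?_⟩
  · have hage := hP.age_add (j := j) x r
    have hmin : min (s + r) (P.age j (x + P.c j * r)) = min s (P.age j x) + r := by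
      rw [hage, min_add_add_right]
    have hc : (s + r ≤ P.age j (x + P.c j * r)) ↔ s ≤ P.age j x := by
      rw [hage]; constructor <;> intro <;> linarith
    set a := min s (P.age j x) with ha
    have ha0 := hP.min_age_nonneg (j := j) hs hx
    have e1 : x + P.c j * r - P.c j * (a + r) = x - P.c j * a := by ring
    have e2 : s + r - (a + r) = s - a := by ring
    have hint := hP.intervalIntegrable_source hqt j (by linarith : 0 ≤ s + r) hsr hxr
    rw [hmin, e1, e2] at hint
    rw [hq j (s + r) _ (by linarith) hsr hxr, hq j s x hs (by linarith) hx]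
    unfold mild
    rw [hmin, e1, e2]
    have e3 : x + P.c j * r - P.c j * (s + r) = x - P.c j * s := by ring
    have e4 : s + r - P.age j (x + P.c j * r) = s - P.age j x := by rw [hage]; ring
    simp only [hc]
    rw [e3, e4, add_assoc]
    congr 1
    rw [← integral_add_adjacent_intervals (a := 0) (b := a) (c := a + r) (hint.mono_set (by
        rw [uIcc_of_le ha0, uIcc_of_le (by linarith)]
        exact Icc_subset_Icc_right (by linarith)))
      (hint.mono_set (by
        rw [uIcc_of_le (by linarith : a ≤ a + r), uIcc_of_le (by linarith)]
        exact Icc_subset_Icc_left ha0))]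
    congr 1
    have := intervalIntegral.integral_comp_add_left (a := 0) (b := r)
      (fun ρ => P.source q j (s - a + ρ) (x - P.c j * a + P.c j * ρ)) a
    rw [add_zero] at this
    rw [← this]
    refine integral_congr fun ρ _ => ?_
    congr 1 <;> ring
  · rw [hq j s _ hs.le hsL (xin_mem j)]
    unfold mild
    rw [age_xin, if_neg (not_le.2 hs), min_eq_right hs.le]
    simp

end Regular

end Net

theorem exists_bound_of_finite {ι X : Type*} [Finite ι] {f : ι → X → ℝ}
    (h : ∀ i, ∃ M, ∀ x, |f i x| ≤ M) : ∃ M, 0 < M ∧ ∀ i x, |f i x| ≤ M := by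
  have := Fintype.ofFinite ι
  choose M hM using h
  refine ⟨∑ i, |M i| + 1, by positivity, fun i x => ?_⟩
  have := single_le_sum (f := fun i => |M i|) (fun i _ => abs_nonneg _) (Finset.mem_univ i)
  linarith [hM i x, le_abs_self (M i)]

/-- A linear map on `ι → ℝ` in coordinates. -/
theorem LinearMap.sum_single_mul {ι κ : Type*} [Fintype ι] [DecidableEq ι]
    (T : (ι → ℝ) →ₗ[ℝ] (κ → ℝ)) (w : ι → ℝ) (j : κ) :
    ∑ l, T (Pi.single l 1) j * w l = T w j := by
  conv_rhs => rw [← Finset.univ_sum_single w, map_sum, Finset.sum_apply]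
  refine sum_congr rfl fun l _ => ?_
  have : (Pi.single l (w l) : ι → ℝ) = w l • Pi.single l 1 := by
    rw [← Pi.single_smul, smul_eq_mul, mul_one]
  rw [this, map_smul, Pi.smul_apply, smul_eq_mul, mul_comm]

/-- The nearest point of `[0,1]`.  The coefficients of the chain are only controlled on `[0,1]`;
they are composed with this map to get functions on the line. -/
def clamp (x : ℝ) : ℝ := max 0 (min 1 x)

theorem clamp_mem (x : ℝ) : clamp x ∈ Icc 0 1 :=
  ⟨le_max_left _ _, max_le zero_le_one (min_le_left _ _)⟩

theorem clamp_of_mem {x : ℝ} (hx : x ∈ Icc 0 1) : clamp x = x := by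
  unfold clamp
  rw [min_eq_right hx.2, max_eq_right hx.1]

theorem continuous_clamp : Continuous clamp := by
  unfold clamp; fun_prop

theorem continuous_comp_clamp {ι κ : Type*} {S : ℝ → Matrix ι κ ℝ}
    (hS : ContinuousOn S (Icc 0 1)) (k : ι) (l : κ) : Continuous fun x => S (clamp x) k l :=
  (continuous_apply l).comp ((continuous_apply k).comp
    (hS.comp_continuous continuous_clamp clamp_mem))

namespace Chain

variable (C : Chain)

/-! ### The chain as a network -/

/-- The components of subsystem `i`: those of `u_i`, followed by those of `v_i`. -/
abbrev Comp (i : ℕ) : Type := Fin (C.n i) ⊕ Fin (C.m i)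

/-- A signal with values in `ℝ^{n_i}` for every subsystem, for instance the virtual inputs. -/
abbrev Inputs : Type := (i : ℕ) → ℝ → Fin (C.n i) → ℝ

/-- Kernels of integral operators that map past values of `v_i` to `ℝ^{n_i}`. -/
abbrev Memory : Type := (i : ℕ) → ℝ → Matrix (Fin (C.n i)) (Fin (C.m i)) ℝ

/-- The scalar components of the subsystems `i₀, …, N`. -/
abbrev Idx (i₀ : ℕ) : Type := (i : ↥(Finset.Icc i₀ C.N)) × C.Comp i

variable {C} {i₀ : ℕ}

/-- The rightward components of subsystem `i`, and `0` if `i` is not in `[i₀, N]`. -/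
def uPart (i : ℕ) : (C.Idx i₀ → ℝ) →ₗ[ℝ] (Fin (C.n i) → ℝ) :=
  if h : i ∈ Finset.Icc i₀ C.N then LinearMap.funLeft ℝ ℝ fun k => ⟨⟨i, h⟩, Sum.inl k⟩ else 0

/-- The leftward components of subsystem `i`, and `0` if `i` is not in `[i₀, N]`. -/
def vPart (i : ℕ) : (C.Idx i₀ → ℝ) →ₗ[ℝ] (Fin (C.m i) → ℝ) :=
  if h : i ∈ Finset.Icc i₀ C.N then LinearMap.funLeft ℝ ℝ fun k => ⟨⟨i, h⟩, Sum.inr k⟩ else 0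

theorem uPart_of_mem {i : ℕ} (h : i ∈ Finset.Icc i₀ C.N) (w : C.Idx i₀ → ℝ) (k : Fin (C.n i)) :
    uPart i w k = w ⟨⟨i, h⟩, Sum.inl k⟩ := by
  simp [uPart, h, LinearMap.funLeft_apply]

theorem vPart_of_mem {i : ℕ} (h : i ∈ Finset.Icc i₀ C.N) (w : C.Idx i₀ → ℝ) (k : Fin (C.m i)) :
    vPart i w k = w ⟨⟨i, h⟩, Sum.inr k⟩ := by
  simp [vPart, h, LinearMap.funLeft_apply]

theorem uPart_of_notMem {i : ℕ} (h : i ∉ Finset.Icc i₀ C.N) (w : C.Idx i₀ → ℝ) : uPart i w = 0 := by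
  simp [uPart, h]

theorem vPart_of_notMem {i : ℕ} (h : i ∉ Finset.Icc i₀ C.N) (w : C.Idx i₀ → ℝ) : vPart i w = 0 := by
  simp [vPart, h]

/-- The outflow of the preceding subsystem, as it enters subsystem `i`. -/
def upstreamMap : (i : ℕ) → (C.Idx i₀ → ℝ) →ₗ[ℝ] (Fin (C.n i) → ℝ)
  | 0 => 0
  | i + 1 => (C.Q i).mulVecLin ∘ₗ uPart i

/-- The boundary conditions, from outflow values to inflow values. -/
def inMap : (C.Idx i₀ → ℝ) →ₗ[ℝ] (C.Idx i₀ → ℝ) := LinearMap.pi fun j => match j with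
    | ⟨i, Sum.inl k⟩ => LinearMap.proj k ∘ₗ
        ((C.Qd i).mulVecLin ∘ₗ vPart (i : ℕ) + upstreamMap (i : ℕ))
    | ⟨i, Sum.inr k⟩ => LinearMap.proj k ∘ₗ
        ((C.Rd i).mulVecLin ∘ₗ uPart (i : ℕ) + (C.R i).mulVecLin ∘ₗ vPart (i + 1 : ℕ))

/-- The source terms at the point `x`. -/
def srcMap (x : ℝ) : (C.Idx i₀ → ℝ) →ₗ[ℝ] (C.Idx i₀ → ℝ) := LinearMap.pi fun j => match j with
    | ⟨i, Sum.inl k⟩ => LinearMap.proj k ∘ₗ ((C.Spp i (clamp x)).mulVecLin ∘ₗ uPart (i : ℕ) +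
          (C.Spm i (clamp x)).mulVecLin ∘ₗ vPart (i : ℕ))
    | ⟨i, Sum.inr k⟩ => LinearMap.proj k ∘ₗ ((C.Smp i (clamp x)).mulVecLin ∘ₗ uPart (i : ℕ) +
          (C.Smm i (clamp x)).mulVecLin ∘ₗ vPart (i : ℕ))

/-- The density of the memory term at the left end of subsystem `i₀`. -/
def memMap (K : C.Memory) (y : ℝ) : (C.Idx i₀ → ℝ) →ₗ[ℝ] (C.Idx i₀ → ℝ) :=
  LinearMap.pi fun j => match j with
    | ⟨i, Sum.inl k⟩ => if (i : ℕ) = i₀ then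
        -(LinearMap.proj k ∘ₗ (K i y).mulVecLin ∘ₗ vPart (i : ℕ)) else 0
    | ⟨_, Sum.inr _⟩ => 0

variable (C)

/-- The subsystems `i₀, …, N` as a network, with a memory term
`-∫₀ʰ K i₀ y v_{i₀}(t - y, 0) dy` at the left end of subsystem `i₀`. -/
def toNet (i₀ : ℕ) (K : C.Memory) (h : ℝ) : Net (C.Idx i₀) where
  c j := Sum.elim (fun k => C.lam j.1 k) (fun k => -C.mu j.1 k) j.2
  S x j l := srcMap x (Pi.single l 1) j
  B j l := inMap (Pi.single l 1) j
  F y j l := if y ∈ Icc 0 h then memMap K y (Pi.single l 1) j else 0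
  h := h

/-- A memory kernel is admissible if it is Borel and bounded on `[0,h]`. -/
structure MemKernel (i₀ : ℕ) (K : C.Memory) (h : ℝ) : Prop where
  nonneg : 0 ≤ h
  meas : ∀ k l, Measurable fun y => K i₀ y k l
  bdd : ∃ M, ∀ y ∈ Icc 0 h, ∀ k l, |K i₀ y k l| ≤ M

variable {C} {K : C.Memory} {h : ℝ}

theorem MemKernel.zero (i₀ : ℕ) : C.MemKernel i₀ (fun _ _ => 0) 0 :=
  ⟨le_rfl, fun _ _ => measurable_const, 0, fun _ _ _ _ => by simp⟩

theorem continuous_srcMap (hC : C.Standing) (h₀ : 1 ≤ i₀) (w : C.Idx i₀ → ℝ) (j : C.Idx i₀) :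
    Continuous fun x => srcMap x w j := by
  rcases j with ⟨⟨i, hi⟩, k | k⟩
  · have hi' : i ∈ Finset.Icc 1 C.N := Icc_subset_Icc_left h₀ hi
    simp only [srcMap, LinearMap.pi_apply, LinearMap.comp_apply, LinearMap.add_apply,
      Matrix.mulVecLin_apply, LinearMap.proj_apply, Pi.add_apply, Matrix.mulVec, dotProduct]
    refine Continuous.add (continuous_finset_sum _ fun l _ => ?_)
      (continuous_finset_sum _ fun l _ => ?_)
    · exact (continuous_comp_clamp (hC.Spp_cont i hi') k l).mul continuous_const
    · exact (continuous_comp_clamp (hC.Spm_cont i hi') k l).mul continuous_const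
  · have hi' : i ∈ Finset.Icc 1 C.N := Icc_subset_Icc_left h₀ hi
    simp only [srcMap, LinearMap.pi_apply, LinearMap.comp_apply, LinearMap.add_apply,
      Matrix.mulVecLin_apply, LinearMap.proj_apply, Pi.add_apply, Matrix.mulVec, dotProduct]
    refine Continuous.add (continuous_finset_sum _ fun l _ => ?_)
      (continuous_finset_sum _ fun l _ => ?_)
    · exact (continuous_comp_clamp (hC.Smp_cont i hi') k l).mul continuous_const
    · exact (continuous_comp_clamp (hC.Smm_cont i hi') k l).mul continuous_const

theorem srcMap_clamp (x : ℝ) (w : C.Idx i₀ → ℝ) : srcMap (clamp x) w = srcMap x w := by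
  unfold srcMap
  rw [clamp_of_mem (clamp_mem x)]

theorem exists_regular (hC : C.Standing) (h₀ : 1 ≤ i₀) (hK : C.MemKernel i₀ K h) :
    ∃ M, (C.toNet i₀ K h).Regular M := by
  obtain ⟨MS, hMS0, hMS⟩ := exists_bound_of_finite (ι := C.Idx i₀ × C.Idx i₀)
    (f := fun p x => (C.toNet i₀ K h).S x p.1 p.2) (fun p => by
      obtain ⟨B, hB⟩ := isCompact_Icc.exists_bound_of_continuousOn
        (continuous_srcMap hC h₀ (Pi.single p.2 1) p.1).continuousOn (s := Icc (0 : ℝ) 1)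
      refine ⟨B, fun x => ?_⟩
      have := hB _ (clamp_mem x)
      rwa [srcMap_clamp] at this)
  obtain ⟨MB, hMB0, hMB⟩ := exists_bound_of_finite (ι := C.Idx i₀ × C.Idx i₀) (X := Unit)
    (f := fun p _ => (C.toNet i₀ K h).B p.1 p.2) (fun p => ⟨_, fun _ => le_rfl⟩)
  obtain ⟨BK, hBK⟩ := hK.bdd
  have hmem : ∀ j l : C.Idx i₀, (Measurable fun y => (C.toNet i₀ K h).F y j l) ∧
      ∃ B, ∀ y, |(C.toNet i₀ K h).F y j l| ≤ B := by
    rintro ⟨⟨i, hi⟩, k | k⟩ l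
    · by_cases hii : i = i₀
      · subst hii
        simp only [toNet, memMap, LinearMap.pi_apply, if_true, LinearMap.neg_apply,
          LinearMap.comp_apply, Matrix.mulVecLin_apply, LinearMap.proj_apply, Matrix.mulVec,
          dotProduct]
        set w := vPart i (Pi.single l 1 : C.Idx i → ℝ)
        constructor
        · refine Measurable.ite measurableSet_Icc (Measurable.neg (measurable_sum _
            fun a _ => (hK.meas k a).mul_const _)) measurable_const
        · refine ⟨∑ a, |BK| * |w a|, fun y => ?_⟩
          split_ifs with hy
          · rw [abs_neg]
            refine (abs_sum_le_sum_abs _ _).trans (sum_le_sum fun a _ => ?_)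
            rw [abs_mul]
            exact mul_le_mul_of_nonneg_right ((hBK y hy k a).trans (le_abs_self _)) (abs_nonneg _)
          · rw [abs_zero]
            positivity
      · simp only [toNet, memMap, LinearMap.pi_apply, if_neg hii, LinearMap.zero_apply, ite_self]
        exact ⟨measurable_const, 0, fun _ => by simp⟩
    · simp only [toNet, memMap, LinearMap.pi_apply, LinearMap.zero_apply, ite_self]
      exact ⟨measurable_const, 0, fun _ => by simp⟩
  obtain ⟨MF, hMF0, hMF⟩ := exists_bound_of_finite (ι := C.Idx i₀ × C.Idx i₀)
    (f := fun p y => (C.toNet i₀ K h).F y p.1 p.2) (fun p => (hmem p.1 p.2).2)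
  refine ⟨MS + MB + MF, ⟨?_, hK.nonneg, by positivity, fun j l => ?_, fun x j l => ?_,
    fun j l => ?_, fun j l => (hmem j l).1, fun y j l => ?_⟩⟩
  · rintro ⟨⟨i, hi⟩, k | k⟩
    · exact (hC.lam_pos i (Icc_subset_Icc_left h₀ hi) k).ne'
    · exact neg_ne_zero.2 (hC.mu_pos i (Icc_subset_Icc_left h₀ hi) k).ne'
  · exact (continuous_srcMap hC h₀ _ _).measurable
  · linarith [hMS (j, l) x]
  · linarith [hMB (j, l) ()]
  · linarith [hMF (j, l) y]

/-- The components of a signal of states, with the time counted from `t₀`. -/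
def toFam (i₀ : ℕ) (z : ℝ → C.State) (t₀ : ℝ) (j : C.Idx i₀) (s x : ℝ) : ℝ :=
  Sum.elim (fun k => (z (t₀ + s)).u j.1 x k) (fun k => (z (t₀ + s)).v j.1 x k) j.2

/-- The input enters at the left end of subsystem `i₀`. -/
def netInput (i₀ : ℕ) (β : C.Inputs) (t₀ : ℝ) (j : C.Idx i₀) (s : ℝ) : ℝ :=
  Sum.elim (fun k => if (j.1 : ℕ) = i₀ then β j.1 (t₀ + s) k else 0) (fun _ => 0) j.2

/-- The memory term. -/
def memTerm (K : C.Memory) (h : ℝ) (z : ℝ → C.State) (i : ℕ) (r : ℝ) : Fin (C.n i) → ℝ := fun k =>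
  ∫ y in 0..h, (K i y *ᵥ (z (r - y)).v i 0) k

/-- The outflow of the preceding subsystem, as it enters subsystem `i`. -/
def State.feed (a : C.State) (i₀ : ℕ) : (i : ℕ) → Fin (C.n i) → ℝ
  | 0 => 0
  | i + 1 => if i₀ ≤ i then C.Q i *ᵥ a.u i 1 else 0

theorem uPart_toFam {z : ℝ → C.State} {t₀ s : ℝ} {x : C.Idx i₀ → ℝ} {i : ℕ} {X : ℝ}
    (hi : i ∈ Finset.Icc i₀ C.N) (hx : ∀ k, x ⟨⟨i, hi⟩, Sum.inl k⟩ = X) :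
    uPart i (fun j => toFam i₀ z t₀ j s (x j)) = (z (t₀ + s)).u i X := by
  funext k
  rw [uPart_of_mem hi]
  simp [toFam, hx]

theorem vPart_toFam {z : ℝ → C.State} {t₀ s : ℝ} {x : C.Idx i₀ → ℝ} {i : ℕ} {X : ℝ}
    (hi : i ∈ Finset.Icc i₀ C.N) (hx : ∀ k, x ⟨⟨i, hi⟩, Sum.inr k⟩ = X) :
    vPart i (fun j => toFam i₀ z t₀ j s (x j)) = (z (t₀ + s)).v i X := by
  funext k
  rw [vPart_of_mem hi]
  simp [toFam, hx]

section

variable (hC : C.Standing) (h₀ : 1 ≤ i₀)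
include hC h₀

theorem xout_inl {i : ℕ} (hi : i ∈ Finset.Icc i₀ C.N) (k : Fin (C.n i)) :
    (C.toNet i₀ K h).xout ⟨⟨i, hi⟩, Sum.inl k⟩ = 1 := by
  simp [Net.xout, toNet, hC.lam_pos i (Icc_subset_Icc_left h₀ hi) k]

theorem xout_inr {i : ℕ} (hi : i ∈ Finset.Icc i₀ C.N) (k : Fin (C.m i)) :
    (C.toNet i₀ K h).xout ⟨⟨i, hi⟩, Sum.inr k⟩ = 0 := by
  simp [Net.xout, toNet, (hC.mu_pos i (Icc_subset_Icc_left h₀ hi) k).le]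

theorem xin_inl {i : ℕ} (hi : i ∈ Finset.Icc i₀ C.N) (k : Fin (C.n i)) :
    (C.toNet i₀ K h).xin ⟨⟨i, hi⟩, Sum.inl k⟩ = 0 := by
  simp [Net.xin, toNet, hC.lam_pos i (Icc_subset_Icc_left h₀ hi) k]

theorem xin_inr {i : ℕ} (hi : i ∈ Finset.Icc i₀ C.N) (k : Fin (C.m i)) :
    (C.toNet i₀ K h).xin ⟨⟨i, hi⟩, Sum.inr k⟩ = 1 := by
  simp [Net.xin, toNet, (hC.mu_pos i (Icc_subset_Icc_left h₀ hi) k).le]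

theorem inflow_inl {z : ℝ → C.State} {t₀ s : ℝ} {β : C.Inputs}
    {past : C.Idx i₀ → ℝ → ℝ} {i : ℕ} (hi : i ∈ Finset.Icc i₀ C.N)
    (hpast : ∀ k r, -h ≤ r → r < 0 →
      past ⟨⟨i, hi⟩, Sum.inr k⟩ r = (z (t₀ + r)).v i 0 k) (hs : 0 ≤ s)
    (hint : ∀ j l, IntervalIntegrable (fun y => (C.toNet i₀ K h).F y j l *
      (C.toNet i₀ K h).outflow past (toFam i₀ z t₀) l (s - y)) volume 0 h) (hh : 0 ≤ h)
    (k : Fin (C.n i)) :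
    (C.toNet i₀ K h).inflow past (netInput i₀ β t₀) (toFam i₀ z t₀) ⟨⟨i, hi⟩, Sum.inl k⟩ s =
      (C.Qd i *ᵥ (z (t₀ + s)).v i 0 + (z (t₀ + s)).feed i₀ i) k +
        if i = i₀ then β i (t₀ + s) k - memTerm K h z i (t₀ + s) k else 0 := by
  have h1 : ∑ l, (C.toNet i₀ K h).B ⟨⟨i, hi⟩, Sum.inl k⟩ l *
      toFam i₀ z t₀ l s ((C.toNet i₀ K h).xout l) =
      (C.Qd i *ᵥ (z (t₀ + s)).v i 0 + (z (t₀ + s)).feed i₀ i) k := by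
    refine (LinearMap.sum_single_mul inMap _ _).trans ?_
    simp only [inMap, LinearMap.pi_apply, LinearMap.comp_apply, LinearMap.add_apply,
      Matrix.mulVecLin_apply, LinearMap.proj_apply]
    rw [vPart_toFam hi (xout_inr hC h₀ hi)]
    congr 2
    cases i with
    | zero => rfl
    | succ i =>
      simp only [upstreamMap, State.feed, LinearMap.comp_apply, Matrix.mulVecLin_apply]
      split_ifs with hc
      · have hi' : i ∈ Finset.Icc i₀ C.N := by
          rw [Finset.mem_Icc] at hi ⊢; omega
        rw [uPart_toFam hi' (xout_inl hC h₀ hi')]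
      · rw [uPart_of_notMem (by rw [Finset.mem_Icc]; omega), Matrix.mulVec_zero]
  have h2 : ∑ l, ∫ y in 0..h, (C.toNet i₀ K h).F y ⟨⟨i, hi⟩, Sum.inl k⟩ l *
      (C.toNet i₀ K h).outflow past (toFam i₀ z t₀) l (s - y) =
      if i = i₀ then -memTerm K h z i (t₀ + s) k else 0 := by
    rw [← integral_finsetSum fun l _ => hint _ l]
    have e : ∀ y ∈ uIcc 0 h, ∑ l, (C.toNet i₀ K h).F y ⟨⟨i, hi⟩, Sum.inl k⟩ l *
        (C.toNet i₀ K h).outflow past (toFam i₀ z t₀) l (s - y) =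
        if i = i₀ then -(K i y *ᵥ (z (t₀ + s - y)).v i 0) k else 0 := by
      intro y hy
      rw [uIcc_of_le hh] at hy
      have hF : ∀ j l, (C.toNet i₀ K h).F y j l = memMap K y (Pi.single l 1) j := fun j l =>
        if_pos hy
      simp only [hF]
      rw [LinearMap.sum_single_mul (memMap K y)]
      simp only [memMap, LinearMap.pi_apply]
      split_ifs with hii
      · simp only [LinearMap.neg_apply, LinearMap.comp_apply, Matrix.mulVecLin_apply,
          LinearMap.proj_apply]
        congr 3
        funext a
        rw [vPart_of_mem hi]
        unfold Net.outflow
        split_ifs with hsy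
        · rw [hpast _ _ (by linarith [hy.2]) hsy, add_sub_assoc]
        · rw [xout_inr hC h₀ hi a, add_sub_assoc]
          rfl
      · rfl
    rw [integral_congr e]
    split_ifs with hii
    · rw [intervalIntegral.integral_neg]; rfl
    · simp
  unfold Net.inflow
  rw [h1]
  change _ + (∑ l, ∫ y in 0..h, _) + _ = _
  rw [h2]
  simp only [netInput, Sum.elim_inl]
  split_ifs <;> ring

theorem inflow_inr {z : ℝ → C.State} {t₀ s : ℝ} {β : C.Inputs}
    {past : C.Idx i₀ → ℝ → ℝ} {i : ℕ} (hi : i ∈ Finset.Icc i₀ C.N) (k : Fin (C.m i)) :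
    (C.toNet i₀ K h).inflow past (netInput i₀ β t₀) (toFam i₀ z t₀) ⟨⟨i, hi⟩, Sum.inr k⟩ s =
      (C.Rd i *ᵥ (z (t₀ + s)).u i 1 +
        if i < C.N then C.R i *ᵥ (z (t₀ + s)).v (i + 1) 0 else 0) k := by
  have h1 : ∑ l, (C.toNet i₀ K h).B ⟨⟨i, hi⟩, Sum.inr k⟩ l *
      toFam i₀ z t₀ l s ((C.toNet i₀ K h).xout l) = (C.Rd i *ᵥ (z (t₀ + s)).u i 1 +
        if i < C.N then C.R i *ᵥ (z (t₀ + s)).v (i + 1) 0 else 0) k := by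
    refine (LinearMap.sum_single_mul inMap _ _).trans ?_
    simp only [inMap, LinearMap.pi_apply, LinearMap.comp_apply, LinearMap.add_apply,
      Matrix.mulVecLin_apply, LinearMap.proj_apply]
    rw [uPart_toFam hi (xout_inl hC h₀ hi)]
    congr 2
    split_ifs with hc
    · have hi' : i + 1 ∈ Finset.Icc i₀ C.N := by
        rw [Finset.mem_Icc] at hi ⊢; omega
      rw [vPart_toFam hi' (xout_inr hC h₀ hi')]
    · rw [vPart_of_notMem (by rw [Finset.mem_Icc]; omega), Matrix.mulVec_zero]
  have h2 : ∀ l, ∫ y in 0..h, (C.toNet i₀ K h).F y ⟨⟨i, hi⟩, Sum.inr k⟩ l *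
      (C.toNet i₀ K h).outflow past (toFam i₀ z t₀) l (s - y) = 0 := by
    intro l
    simp [toNet, memMap]
  unfold Net.inflow
  rw [h1]
  change _ + (∑ l, ∫ y in 0..h, _) + _ = _
  simp [h2, netInput]

omit hC h₀ in
theorem source_inl {z : ℝ → C.State} {t₀ s x : ℝ} {i : ℕ} (hi : i ∈ Finset.Icc i₀ C.N)
    (k : Fin (C.n i)) :
    (C.toNet i₀ K h).source (toFam i₀ z t₀) ⟨⟨i, hi⟩, Sum.inl k⟩ s x =
      (C.Spp i (clamp x) *ᵥ (z (t₀ + s)).u i x) k +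
          (C.Spm i (clamp x) *ᵥ (z (t₀ + s)).v i x) k := by
  refine (LinearMap.sum_single_mul (srcMap x) _ _).trans ?_
  simp only [srcMap, LinearMap.pi_apply, LinearMap.comp_apply, LinearMap.add_apply,
      Matrix.mulVecLin_apply, LinearMap.proj_apply]
  rw [uPart_toFam (x := fun _ => x) hi (fun _ => rfl),
      vPart_toFam (x := fun _ => x) hi (fun _ => rfl)]
  rfl

omit hC h₀ in
theorem source_inr {z : ℝ → C.State} {t₀ s x : ℝ} {i : ℕ} (hi : i ∈ Finset.Icc i₀ C.N)
    (k : Fin (C.m i)) :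
    (C.toNet i₀ K h).source (toFam i₀ z t₀) ⟨⟨i, hi⟩, Sum.inr k⟩ s x =
      (C.Smp i (clamp x) *ᵥ (z (t₀ + s)).u i x) k +
          (C.Smm i (clamp x) *ᵥ (z (t₀ + s)).v i x) k := by
  refine (LinearMap.sum_single_mul (srcMap x) _ _).trans ?_
  simp only [srcMap, LinearMap.pi_apply, LinearMap.comp_apply, LinearMap.add_apply,
      Matrix.mulVecLin_apply, LinearMap.proj_apply]
  rw [uPart_toFam (x := fun _ => x) hi (fun _ => rfl),
      vPart_toFam (x := fun _ => x) hi (fun _ => rfl)]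
  rfl

end

end Chain

namespace Net

variable {J : Type} [Fintype J] {P : Net J}

/-- The inflow only depends on the values of the solution at nonnegative times. -/
theorem inflow_congr {past b : J → ℝ → ℝ} {q q' : J → ℝ → ℝ → ℝ}
    (h : ∀ j s x, 0 ≤ s → q j s x = q' j s x) (j : J) {s : ℝ} (hs : 0 ≤ s) :
    P.inflow past b q j s = P.inflow past b q' j s := by
  unfold inflow outflow
  congr 2
  · exact sum_congr rfl fun l _ => by rw [h _ _ _ hs]
  · refine sum_congr rfl fun l _ => integral_congr fun y _ => ?_
    split_ifs with hc
    · rfl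
    · rw [h _ _ _ (not_lt.1 hc)]

end Net

theorem Net.Regular.mild_congr {J : Type} [Fintype J] {P : Net J} {M : ℝ} (hP : P.Regular M)
    {q₀ q₀' past b : J → ℝ → ℝ} {q : J → ℝ → ℝ → ℝ}
    (h : ∀ j, ∀ x ∈ Icc (0 : ℝ) 1, q₀ j x = q₀' j x) (j : J) {s x : ℝ} (hs : 0 ≤ s)
    (hx : x ∈ Icc 0 1) : P.mild q₀ past b q j s x = P.mild q₀' past b q j s x := by
  unfold mild
  congr 1
  split_ifs with hc
  · have := (hP.foot_mem (j := j) (r := 0) hs hx ⟨le_rfl, hP.min_age_nonneg hs hx⟩).1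
    rw [min_eq_left hc, mul_zero, add_zero] at this
    exact h _ _ this
  · rfl

namespace Chain

variable {C : Chain} {i₀ : ℕ} {K : C.Memory} {h : ℝ}

theorem measurable_toFam {z : ℝ → C.State} (t₀ : ℝ)
    (hu : ∀ i ∈ Finset.Icc i₀ C.N, ∀ k, Measurable fun q : ℝ × ℝ => (z q.1).u i q.2 k)
    (hv : ∀ i ∈ Finset.Icc i₀ C.N, ∀ k, Measurable fun q : ℝ × ℝ => (z q.1).v i q.2 k)
    (j : C.Idx i₀) : Measurable fun p : ℝ × ℝ => toFam i₀ z t₀ j p.1 p.2 := by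
  rcases j with ⟨⟨i, hi⟩, k | k⟩
  · exact (hu i hi k).comp (by fun_prop : Measurable fun p : ℝ × ℝ => (t₀ + p.1, p.2))
  · exact (hv i hi k).comp (by fun_prop : Measurable fun p : ℝ × ℝ => (t₀ + p.1, p.2))

theorem IsSol.tame {t₀ L : ℝ} {J : Set ℝ} {b : ℝ → Fin (C.n i₀) → ℝ} {z : ℝ → C.State}
    (hz : C.IsSol i₀ t₀ J b z) (hJ : Icc t₀ (t₀ + L) ⊆ J) : Net.Tame (toFam i₀ z t₀) L := by
  obtain ⟨B, hB⟩ := hz.bdd (t₀ + L)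
  refine ⟨measurable_toFam t₀ hz.meas_u hz.meas_v, B, ?_⟩
  rintro ⟨⟨i, hi⟩, k | k⟩ s x hs hsL hx
  · exact (hB (t₀ + s) (hJ ⟨by linarith, by linarith⟩) (by linarith) i hi x hx).1 k
  · exact (hB (t₀ + s) (hJ ⟨by linarith, by linarith⟩) (by linarith) i hi x hx).2 k

/-- A solution satisfies the characteristic equations of the network. -/
theorem IsSol.charEq (hC : C.Standing) (h₀ : 1 ≤ i₀) {t₀ L : ℝ} {J : Set ℝ}
    {b : ℝ → Fin (C.n i₀) → ℝ} {z : ℝ → C.State} (hz : C.IsSol i₀ t₀ J b z)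
    (hJ : Icc t₀ (t₀ + L) ⊆ J) : (C.toNet i₀ K h).CharEq (toFam i₀ z t₀) L := by
  have hmem : ∀ s, 0 ≤ s → s ≤ L → t₀ + s ∈ J := fun s h1 h2 => hJ ⟨by linarith, by linarith⟩
  rintro ⟨⟨i, hi⟩, k | k⟩ s x r hs hr hsr hx hxr
  · simp only [source_inl hi]
    have := hz.eq_u i hi k (t₀ + s) (hmem s hs (by linarith)) x hx r hr
      (by rw [add_assoc]; exact hmem _ (by linarith) hsr) hxr.2
    simp only [toFam, Sum.elim_inl]
    simp only [toNet, Sum.elim_inl] at hxr ⊢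
    rw [← add_assoc, this]
    congr 1
    refine integral_congr_Icc hr fun ρ hρ => ?_
    have hl := hC.lam_pos i (Icc_subset_Icc_left h₀ hi) k
    rw [clamp_of_mem, add_assoc]
    constructor
    · have := mul_nonneg hl.le hρ.1; linarith [hx.1]
    · have := mul_le_mul_of_nonneg_left hρ.2 hl.le; linarith [hxr.2]
  · simp only [source_inr hi]
    have h1 := hz.eq_v i hi k (t₀ + s) (hmem s hs (by linarith)) x hx r hr
      (by rw [add_assoc]; exact hmem _ (by linarith) hsr) (by
        have := hxr.1
        simp only [toNet, Sum.elim_inr] at this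
        linarith)
    simp only [toFam, Sum.elim_inr]
    simp only [toNet, Sum.elim_inr, neg_mul, ← sub_eq_add_neg] at hxr ⊢
    rw [← add_assoc, h1]
    congr 1
    refine integral_congr_Icc hr fun ρ hρ => ?_
    have hl := hC.mu_pos i (Icc_subset_Icc_left h₀ hi) k
    rw [clamp_of_mem, add_assoc]
    constructor
    · have := mul_le_mul_of_nonneg_left hρ.2 hl.le; linarith [hxr.1]
    · have := mul_nonneg hl.le hρ.1; linarith [hx.2]

/-- A solution of the chain solves the equations of the network. -/
theorem IsSol.toFam_mild (hC : C.Standing) (h₀ : 1 ≤ i₀) (hK : C.MemKernel i₀ K h) {t₀ L : ℝ}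
    {J : Set ℝ} {z : ℝ → C.State} {β : C.Inputs} {past : C.Idx i₀ → ℝ → ℝ}
    (hz : C.IsSol i₀ t₀ J (fun r => β i₀ r - memTerm K h z i₀ r) z) (hJ : Icc t₀ (t₀ + L) ⊆ J)
    (hp : (C.toNet i₀ K h).TamePast past)
    (hpast : ∀ j r, -h ≤ r → r < 0 → past j r = toFam i₀ z t₀ j r ((C.toNet i₀ K h).xout j))
    (j : C.Idx i₀) {s x : ℝ}
    (hs : 0 ≤ s) (hsL : s ≤ L) (hx : x ∈ Icc 0 1) :
    toFam i₀ z t₀ j s x = (C.toNet i₀ K h).mild (fun j x => toFam i₀ z t₀ j 0 x) past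
      (netInput i₀ β t₀) (toFam i₀ z t₀) j s x := by
  obtain ⟨M, hP⟩ := exists_regular hC h₀ hK
  have hmem : ∀ s, 0 ≤ s → s ≤ L → t₀ + s ∈ J := fun s h1 h2 => hJ ⟨by linarith, by linarith⟩
  refine hP.mild_of_charEq (L := L) (hz.charEq hC h₀ hJ) ?_ j hs hsL hx
  · rintro ⟨⟨i, hi⟩, k | k⟩ s hs hsL
    · rw [inflow_inl hC h₀ hi (fun k r h1 h2 => by
          rw [hpast _ _ h1 h2, xout_inr hC h₀ hi]; rfl) hs.le
        (fun j l => hP.intervalIntegrable_memory (hz.tame hJ) hp j l hs.le hsL) hK.nonneg,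
        xin_inl hC h₀ hi]
      simp only [toFam, Sum.elim_inl]
      have hi1 := Finset.mem_Icc.1 hi
      split_ifs with hii
      · subst hii
        rw [hz.left_in _ (hmem s hs.le hsL) (by linarith)]
        have hf : (z (t₀ + s)).feed i i = 0 := by
          cases i with
          | zero => rfl
          | succ i => simp [State.feed]
        rw [hf, add_zero]
        rfl
      · cases i with
        | zero => omega
        | succ i =>
          rw [hz.left i (Finset.mem_Ico.2 ⟨by omega, by omega⟩) _ (hmem s hs.le hsL) (by linarith),
            add_zero]
          simp only [State.feed]
          rw [if_pos (by omega)]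
    · rw [inflow_inr hC h₀ hi, xin_inr hC h₀ hi]
      simp only [toFam, Sum.elim_inr]
      have hi1 := Finset.mem_Icc.1 hi
      split_ifs with hc
      · rw [hz.right i (Finset.mem_Ico.2 ⟨hi1.1, hc⟩) _ (hmem s hs.le hsL) (by linarith)]
      · have : i = C.N := by omega
        subst this
        rw [hz.right_end _ (hmem s hs.le hsL) (by linarith), add_zero]

/-- The signal that is `zp` before `t₀` and has the components `q` from `t₀` on. -/
def glue (i₀ : ℕ) (zp : ℝ → C.State) (q : C.Idx i₀ → ℝ → ℝ → ℝ) (t₀ r : ℝ) : C.State where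
  u i x k := if r < t₀ then (zp r).u i x k else
    if hi : i ∈ Finset.Icc i₀ C.N then q ⟨⟨i, hi⟩, Sum.inl k⟩ (r - t₀) x else 0
  v i x k := if r < t₀ then (zp r).v i x k else
    if hi : i ∈ Finset.Icc i₀ C.N then q ⟨⟨i, hi⟩, Sum.inr k⟩ (r - t₀) x else 0

theorem glue_of_lt {zp : ℝ → C.State} {q : C.Idx i₀ → ℝ → ℝ → ℝ} {t₀ r : ℝ} (hr : r < t₀) :
    glue i₀ zp q t₀ r = zp r := by
  simp [glue, hr]

theorem toFam_glue {zp : ℝ → C.State} {q : C.Idx i₀ → ℝ → ℝ → ℝ} {t₀ : ℝ} (j : C.Idx i₀)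
    {s : ℝ} (x : ℝ) (hs : 0 ≤ s) : toFam i₀ (glue i₀ zp q t₀) t₀ j s x = q j s x := by
  rcases j with ⟨⟨i, hi⟩, k | k⟩ <;>
  simp only [toFam, glue, Sum.elim_inl, Sum.elim_inr, add_sub_cancel_left, dif_pos hi,
    if_neg (not_lt.2 (by linarith : t₀ ≤ t₀ + s))]

/-- A solution of the equations of the network is a solution of the chain. -/
theorem isSol_glue (hC : C.Standing) (h₀ : 1 ≤ i₀) (h₁ : i₀ ≤ C.N) (hK : C.MemKernel i₀ K h)
    {t₀ : ℝ} {zp : ℝ → C.State} {q : C.Idx i₀ → ℝ → ℝ → ℝ} {q₀ past : C.Idx i₀ → ℝ → ℝ}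
    {β : C.Inputs}
    (hzu : ∀ i ∈ Finset.Icc i₀ C.N, ∀ k, Measurable fun q : ℝ × ℝ => (zp q.1).u i q.2 k)
    (hzv : ∀ i ∈ Finset.Icc i₀ C.N, ∀ k, Measurable fun q : ℝ × ℝ => (zp q.1).v i q.2 k)
    (hqt : ∀ L, Net.Tame q L) (hp : (C.toNet i₀ K h).TamePast past)
    (hpast : ∀ j r, -h ≤ r → r < 0 → past j r = toFam i₀ zp t₀ j r ((C.toNet i₀ K h).xout j))
    (hq : ∀ j s x, 0 ≤ s → x ∈ Icc 0 1 →
      q j s x = (C.toNet i₀ K h).mild q₀ past (netInput i₀ β t₀) q j s x) :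
    C.IsSol i₀ t₀ (Ici t₀)
      (fun r => β i₀ r - memTerm K h (glue i₀ zp q t₀) i₀ r) (glue i₀ zp q t₀) := by
  obtain ⟨M, hP⟩ := exists_regular hC h₀ hK
  have hqm := (hqt 0).meas
  set z := glue i₀ zp q t₀ with hz
  have hzq : ∀ j s x, 0 ≤ s → q j s x = toFam i₀ z t₀ j s x := fun j s x hs =>
    (toFam_glue j x hs).symm
  have htl : MeasurableSet {p : ℝ × ℝ | p.1 < t₀} :=
      measurableSet_lt measurable_fst measurable_const
  have hmu : ∀ i ∈ Finset.Icc i₀ C.N, ∀ k, Measurable fun q : ℝ × ℝ => (z q.1).u i q.2 k := by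
    intro i hi k
    simp only [hz, glue, dif_pos hi]
    exact Measurable.ite htl (hzu i hi k) ((hqm _).comp
      (by fun_prop : Measurable fun p : ℝ × ℝ => (p.1 - t₀, p.2)))
  have hmv : ∀ i ∈ Finset.Icc i₀ C.N, ∀ k, Measurable fun q : ℝ × ℝ => (z q.1).v i q.2 k := by
    intro i hi k
    simp only [hz, glue, dif_pos hi]
    exact Measurable.ite htl (hzv i hi k) ((hqm _).comp
      (by fun_prop : Measurable fun p : ℝ × ℝ => (p.1 - t₀, p.2)))
  have hzt : ∀ L, Net.Tame (toFam i₀ z t₀) L := fun L => ⟨measurable_toFam t₀ hmu hmv,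
    (hqt L).bdd.imp fun B hB j s x h1 h2 h3 => hzq j s x h1 ▸ hB j s x h1 h2 h3⟩
  have hchar : ∀ j s x r, 0 ≤ s → 0 ≤ r → x ∈ Icc 0 1 → x + (C.toNet i₀ K h).c j * r ∈ Icc 0 1 →
      toFam i₀ z t₀ j (s + r) (x + (C.toNet i₀ K h).c j * r) = toFam i₀ z t₀ j s x +
        ∫ ρ in 0..r, (C.toNet i₀ K h).source (toFam i₀ z t₀) j (s + ρ)
          (x + (C.toNet i₀ K h).c j * ρ) := by
    intro j s x r hs hr hx hxr
    have := (hP.charEq_of_mild (hqt (s + r)) fun j s x h1 _ h3 => hq j s x h1 h3).1 j s x r hs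
        hr le_rfl
      hx hxr
    rw [← hzq _ _ _ (by linarith), ← hzq _ _ _ hs, this]
    congr 1
    refine integral_congr_Icc hr fun ρ hρ => ?_
    exact sum_congr rfl fun l _ => by rw [hzq _ _ _ (by linarith [hρ.1])]
  have hin : ∀ j s, 0 < s → toFam i₀ z t₀ j s ((C.toNet i₀ K h).xin j) =
      (C.toNet i₀ K h).inflow past (netInput i₀ β t₀) (toFam i₀ z t₀) j s := by
    intro j s hs
    have := (hP.charEq_of_mild (hqt s) fun j s x h1 _ h3 => hq j s x h1 h3).2 j s hs le_rfl
    rw [← hzq _ _ _ hs.le, this]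
    exact Net.inflow_congr hzq j hs.le
  have hinl : ∀ i (hi : i ∈ Finset.Icc i₀ C.N) k t, t₀ < t → (z t).u i 0 k =
      (C.Qd i *ᵥ (z t).v i 0 + (z t).feed i₀ i) k +
        if i = i₀ then β i t k - memTerm K h z i t k else 0 := by
    intro i hi k t ht
    have h1 := hin ⟨⟨i, hi⟩, Sum.inl k⟩ (t - t₀) (by linarith)
    rw [inflow_inl hC h₀ hi (fun k r h1 h2 => by
          rw [hpast _ _ h1 h2, xout_inr hC h₀ hi, hz, glue_of_lt (by linarith)]; rfl)
        (by linarith) (fun j l => hP.intervalIntegrable_memory (L := t - t₀) (hzt _) hp j l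
          (by linarith) le_rfl) hK.nonneg, xin_inl hC h₀ hi] at h1
    simpa only [toFam, Sum.elim_inl, add_sub_cancel] using h1
  have hinr : ∀ i (hi : i ∈ Finset.Icc i₀ C.N) k t, t₀ < t → (z t).v i 1 k =
      (C.Rd i *ᵥ (z t).u i 1 + if i < C.N then C.R i *ᵥ (z t).v (i + 1) 0 else 0) k := by
    intro i hi k t ht
    have h1 := hin ⟨⟨i, hi⟩, Sum.inr k⟩ (t - t₀) (by linarith)
    rw [inflow_inr hC h₀ hi, xin_inr hC h₀ hi] at h1
    simpa only [toFam, Sum.elim_inr, add_sub_cancel] using h1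
  refine ⟨hmu, hmv, fun T => ?_, ?_, ?_, ?_, ?_, ?_, ?_⟩
  · obtain ⟨B, hB⟩ := (hzt (T - t₀)).bdd
    have hB' := fun j t (h1 : t₀ ≤ t) (h2 : t ≤ T) x => hB j (t - t₀) x (by linarith) (by linarith)
    refine ⟨B, fun t ht htT i hi x hx => ⟨fun k => ?_, fun k => ?_⟩⟩
    · simpa only [toFam, Sum.elim_inl, add_sub_cancel] using hB' ⟨⟨i, hi⟩, Sum.inl k⟩ t ht htT x hx
    · simpa only [toFam, Sum.elim_inr, add_sub_cancel] using hB' ⟨⟨i, hi⟩, Sum.inr k⟩ t ht htT x hx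
  · intro i hi k t ht x hx s hs _ hxs
    have ht' : t₀ ≤ t := ht
    have hl := hC.lam_pos i (Icc_subset_Icc_left h₀ hi) k
    have := hchar ⟨⟨i, hi⟩, Sum.inl k⟩ (t - t₀) x s (by linarith) hs hx
      ⟨by simp only [toNet, Sum.elim_inl]; have := mul_nonneg hl.le hs; linarith [hx.1],
        by simpa only [toNet, Sum.elim_inl] using hxs⟩
    simp only [source_inl hi] at this
    simp only [toFam, Sum.elim_inl, toNet] at this
    rw [show t₀ + (t - t₀ + s) = t + s by ring, add_sub_cancel] at this
    rw [this]
    congr 1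
    refine integral_congr_Icc hs fun ρ hρ => ?_
    rw [clamp_of_mem, show t₀ + (t - t₀ + ρ) = t + ρ by ring]
    constructor
    · have := mul_nonneg hl.le hρ.1; linarith [hx.1]
    · have := mul_le_mul_of_nonneg_left hρ.2 hl.le; linarith
  · intro i hi k t ht x hx s hs _ hxs
    have ht' : t₀ ≤ t := ht
    have hl := hC.mu_pos i (Icc_subset_Icc_left h₀ hi) k
    have := hchar ⟨⟨i, hi⟩, Sum.inr k⟩ (t - t₀) x s (by linarith) hs hx
      ⟨by simp only [toNet, Sum.elim_inr]; linarith,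
        by simp only [toNet, Sum.elim_inr]; have := mul_nonneg hl.le hs; linarith [hx.2]⟩
    simp only [source_inr hi] at this
    simp only [toFam, Sum.elim_inr, toNet, neg_mul, ← sub_eq_add_neg] at this
    rw [show t₀ + (t - t₀ + s) = t + s by ring, add_sub_cancel] at this
    rw [this]
    congr 1
    refine integral_congr_Icc hs fun ρ hρ => ?_
    rw [clamp_of_mem, show t₀ + (t - t₀ + ρ) = t + ρ by ring]
    constructor
    · have := mul_le_mul_of_nonneg_left hρ.2 hl.le; linarith
    · have := mul_nonneg hl.le hρ.1; linarith [hx.2]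
  · intro t _ ht
    funext k
    rw [hinl i₀ (Finset.mem_Icc.2 ⟨le_rfl, h₁⟩) k t ht, if_pos rfl]
    have hf : (z t).feed i₀ i₀ = 0 := by
      cases i₀ with
      | zero => rfl
      | succ i => simp [State.feed]
    rw [hf, add_zero]
    rfl
  · intro i hi t _ ht
    rw [Finset.mem_Ico] at hi
    funext k
    rw [hinl (i + 1) (Finset.mem_Icc.2 ⟨by omega, by omega⟩) k t ht, if_neg (by omega), add_zero]
    simp only [State.feed]
    rw [if_pos hi.1]
  · intro i hi t _ ht
    rw [Finset.mem_Ico] at hi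
    funext k
    rw [hinr i (Finset.mem_Icc.2 ⟨hi.1, hi.2.le⟩) k t ht, if_pos hi.2]
  · intro t _ ht
    funext k
    rw [hinr C.N (Finset.mem_Icc.2 ⟨h₁, le_rfl⟩) k t ht, if_neg (lt_irrefl _), add_zero]

theorem agree_iff_toFam {a b : ℝ → C.State} {t s : ℝ} : (a (t + s)).Agree i₀ (b (t + s)) ↔
      ∀ (j : C.Idx i₀), ∀ x ∈ Icc (0 : ℝ) 1, toFam i₀ a t j s x = toFam i₀ b t j s x := by
  constructor
  · rintro h ⟨⟨i, hi⟩, k | k⟩ x hx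
    · exact congrFun (h i hi x hx).1 k
    · exact congrFun (h i hi x hx).2 k
  · intro h i hi x hx
    exact ⟨funext fun k => h ⟨⟨i, hi⟩, Sum.inl k⟩ x hx, funext fun k => h ⟨⟨i, hi⟩, Sum.inr k⟩ x hx⟩

/-- Uniqueness for the Cauchy problem with memory. -/
theorem IsSol.unique (hC : C.Standing) (h₀ : 1 ≤ i₀) (hK : C.MemKernel i₀ K h) {t₀ L : ℝ}
    {J J' : Set ℝ} {z z' : ℝ → C.State} {β : C.Inputs}
    (hz : C.IsSol i₀ t₀ J (fun r => β i₀ r - memTerm K h z i₀ r) z)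
    (hz' : C.IsSol i₀ t₀ J' (fun r => β i₀ r - memTerm K h z' i₀ r) z')
    (hJ : Icc t₀ (t₀ + L) ⊆ J) (hJ' : Icc t₀ (t₀ + L) ⊆ J')
    (h0 : (z t₀).Agree i₀ (z' t₀))
    (hpast : ∀ r, -h ≤ r → r < 0 → (z (t₀ + r)).Agree i₀ (z' (t₀ + r)))
    (hpB : ∃ B, ∀ j r, -h ≤ r → r < 0 → |toFam i₀ z t₀ j r ((C.toNet i₀ K h).xout j)| ≤ B) :
    ∀ t ∈ Icc t₀ (t₀ + L), (z t).Agree i₀ (z' t) := by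
  intro t ht
  obtain ⟨M, hP⟩ := exists_regular hC h₀ hK
  have hp : (C.toNet i₀ K h).TamePast fun j r => toFam i₀ z t₀ j r ((C.toNet i₀ K h).xout j) :=
    ⟨fun j => ((hz.tame hJ).meas j).comp
      (by fun_prop : Measurable fun r : ℝ => ((r, (C.toNet i₀ K h).xout j) : ℝ × ℝ)), hpB⟩
  have e0 : ∀ (j : C.Idx i₀), ∀ x ∈ Icc (0 : ℝ) 1, toFam i₀ z t₀ j 0 x = toFam i₀ z' t₀ j 0 x := by
    rw [← agree_iff_toFam, add_zero]; exact h0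
  have key : ∀ j s x, 0 ≤ s → s ≤ L → x ∈ Icc 0 1 → toFam i₀ z t₀ j s x = toFam i₀ z' t₀ j s x := by
    refine hP.mild_unique (hz.tame hJ) (hz'.tame hJ') hp
      (fun j s x h1 h2 h3 => hz.toFam_mild hC h₀ hK hJ hp (fun _ _ _ _ => rfl) j h1 h2 h3)
      (fun j s x h1 h2 h3 => ?_)
    rw [hz'.toFam_mild hC h₀ hK hJ' hp (fun j r h1 h2 =>
      agree_iff_toFam.1 (hpast r h1 h2) j _ (Net.xout_mem _)) j h1 h2 h3]
    exact hP.mild_congr (fun j x hx => (e0 j x hx).symm) j h1 h3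
  have := (agree_iff_toFam (a := z) (b := z') (t := t₀) (s := t - t₀)).2 fun j x hx =>
    key j (t - t₀) x (by linarith [ht.1]) (by linarith [ht.2]) hx
  rwa [add_sub_cancel] at this

@[simp] theorem memTerm_zero (z : ℝ → C.State) (i : ℕ) (r : ℝ) :
    memTerm (C := C) (fun _ _ => 0) 0 z i r = 0 := by
  funext k
  simp [memTerm]

theorem IsSol.congr_input {t₀ : ℝ} {J J' : Set ℝ} {b b' : ℝ → Fin (C.n i₀) → ℝ} {z : ℝ → C.State}
    (hz : C.IsSol i₀ t₀ J b z) (hJ : J' ⊆ J) (hb : ∀ t ∈ J', t₀ < t → b t = b' t) :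
    C.IsSol i₀ t₀ J' b' z where
  meas_u := hz.meas_u
  meas_v := hz.meas_v
  bdd T := by
    obtain ⟨M, hM⟩ := hz.bdd T
    exact ⟨M, fun t ht => hM t (hJ ht)⟩
  eq_u i hi k t ht x hx s hs hts := hz.eq_u i hi k t (hJ ht) x hx s hs (hJ hts)
  eq_v i hi k t ht x hx s hs hts := hz.eq_v i hi k t (hJ ht) x hx s hs (hJ hts)
  left_in t ht htt := by rw [← hb t ht htt]; exact hz.left_in t (hJ ht) htt
  left i hi t ht := hz.left i hi t (hJ ht)
  right i hi t ht := hz.right i hi t (hJ ht)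
  right_end t ht := hz.right_end t (hJ ht)

/-- Uniqueness for the Cauchy problem of the chain without memory. -/
theorem IsSol.unique_of_input (hC : C.Standing) {L : ℝ} {J J' : Set ℝ} {z z' : ℝ → C.State}
    {t₀ : ℝ} {U U' : ℝ → Fin (C.n i₀) → ℝ} (h₀ : 1 ≤ i₀) (hz : C.IsSol i₀ t₀ J U z)
    (hz' : C.IsSol i₀ t₀ J' U' z') (hJ : Icc t₀ (t₀ + L) ⊆ J) (hJ' : Icc t₀ (t₀ + L) ⊆ J')
    (hU : ∀ t, t₀ < t → t ≤ t₀ + L → U t = U' t)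
    (h0 : (z t₀).Agree i₀ (z' t₀)) : ∀ t ∈ Icc t₀ (t₀ + L), (z t).Agree i₀ (z' t) := by
  -- the input as a family over all subsystems
  let β : C.Inputs := fun i => if hi : i = i₀ then hi ▸ U else 0
  have hβ : β i₀ = U := by simp [β]
  refine IsSol.unique (K := fun _ _ => 0) (h := 0) (β := β) (J := Icc t₀ (t₀ + L))
    (J' := Icc t₀ (t₀ + L)) hC h₀ (MemKernel.zero i₀) ?_ ?_ subset_rfl subset_rfl h0
    (fun r h1 h2 => by linarith) ⟨0, fun j r h1 h2 => by linarith⟩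
  · refine hz.congr_input hJ fun t ht htt => ?_
    rw [memTerm_zero, sub_zero, hβ]
  · refine hz'.congr_input hJ' fun t ht htt => ?_
    rw [memTerm_zero, sub_zero, hβ, hU t htt ht.2]

end Chain

/-! ### Sideways uniqueness and the observer -/

theorem integral_exp_mul_one_sub_le {κ x : ℝ} (hκ : 0 < κ) :
    ∫ y in x..1, exp (κ * (1 - y)) ≤ exp (κ * (1 - x)) / κ := by
  have h := intervalIntegral.integral_comp_sub_left (a := x) (b := 1) (fun y => exp (0 + κ * y)) 1
  have h2 := integral_exp_add_mul_le (c := 0) (a := 1 - x) hκ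
  simp only [zero_add, sub_self] at h h2
  rwa [h]

/-- Uniqueness for the Cauchy problem in the `x` direction with data at `x = 1`: zero data for
`a < s ≤ b` give a zero solution in the domain of determinacy. -/
theorem sideways_eq_zero {J : Type*} [Fintype J] {c : J → ℝ} {w g : J → ℝ → ℝ → ℝ}
    {a b A B M : ℝ} (hc : ∀ j, c j ≠ 0) (hA : ∀ j, c j < 0 → 1 / |c j| ≤ A)
    (hB : ∀ j, 0 < c j → 1 / |c j| ≤ B) (hM : 0 ≤ M) (hA0 : 0 ≤ A) (hB0 : 0 ≤ B)
    (hchar : ∀ j s x, x ∈ Icc 0 1 → a < s → s ≤ b → a < s + (1 - x) / c j →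
      s + (1 - x) / c j ≤ b → w j s x = w j (s + (1 - x) / c j) 1 - 1 / c j * ∫ y in x..1,
          g j (s + (y - x) / c j) y)
    (hg : ∀ j s x N, a < s → s ≤ b → x ∈ Icc 0 1 → (∀ l, |w l s x| ≤ N) →
      |g j s x| ≤ M * N)
    (hend : ∀ j s, a < s → s ≤ b → w j s 1 = 0)
    (hbdd : ∃ N, ∀ j s x, a < s → s ≤ b → x ∈ Icc 0 1 → |w j s x| ≤ N)
    (j : J) {s x : ℝ} (hx : x ∈ Icc 0 1) (hs : a + A * (1 - x) < s)
    (hs' : s ≤ b - B * (1 - x)) : w j s x = 0 := by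
  obtain ⟨N', hN'⟩ := hbdd
  set N := |N'| with hN
  have hN0 : 0 ≤ N := abs_nonneg _
  set κ := 2 * (M * ∑ j, 1 / |c j|) + 1 with hκ
  have hS : ∀ j, 1 / |c j| ≤ ∑ j, 1 / |c j| := fun j =>
    single_le_sum (f := fun j => 1 / |c j|) (fun i _ => by positivity) (Finset.mem_univ j)
  have hS0 : 0 ≤ ∑ j, 1 / |c j| := sum_nonneg fun i _ => by positivity
  have hκ0 : 0 < κ := by positivity
  have claim : ∀ n : ℕ, ∀ j s x, x ∈ Icc 0 1 → a + A * (1 - x) < s →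
      s ≤ b - B * (1 - x) → |w j s x| ≤ N * (1 / 2) ^ n * exp (κ * (1 - x)) := by
    intro n
    induction n with
    | zero =>
      intro j s x hx hs hs'
      have h1 : 0 ≤ A * (1 - x) := mul_nonneg hA0 (by linarith [hx.2])
      have h2 : 0 ≤ B * (1 - x) := mul_nonneg hB0 (by linarith [hx.2])
      have h3 : 0 ≤ κ * (1 - x) := mul_nonneg hκ0.le (by linarith [hx.2])
      rw [pow_zero, mul_one]
      exact ((hN' j s x (by linarith) (by linarith) hx).trans (le_abs_self _)).trans
        (le_mul_of_one_le_right hN0 (one_le_exp h3))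
    | succ n ih =>
      intro j s x hx hs hs'
      have hreg : ∀ y ∈ Icc x 1, a + A * (1 - y) < s + (y - x) / c j ∧
          s + (y - x) / c j ≤ b - B * (1 - y) := by
        intro y hy
        have hyx : 0 ≤ y - x := by linarith [hy.1]
        have hAy : 0 ≤ A * (y - x) := mul_nonneg hA0 hyx
        have hBy : 0 ≤ B * (y - x) := mul_nonneg hB0 hyx
        rcases lt_or_gt_of_ne (hc j) with hj | hj
        · have h1 := mul_le_mul_of_nonneg_right (hA j hj) hyx
          have h2 : (y - x) / c j = -(1 / |c j| * (y - x)) := by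
            rw [abs_of_neg hj]; field_simp
          have h3 : 0 ≤ 1 / |c j| * (y - x) := by positivity
          rw [h2]
          constructor <;> linarith
        · have h1 := mul_le_mul_of_nonneg_right (hB j hj) hyx
          have h2 : (y - x) / c j = 1 / |c j| * (y - x) := by
            rw [abs_of_pos hj]; field_simp
          have h3 : 0 ≤ 1 / |c j| * (y - x) := by positivity
          rw [h2]
          constructor <;> linarith
      have hwide : ∀ y ∈ Icc x 1, a < s + (y - x) / c j ∧ s + (y - x) / c j ≤ b := by
        intro y hy
        have h1 := hreg y hy
        have h2 : 0 ≤ A * (1 - y) := mul_nonneg hA0 (by linarith [hy.2])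
        have h3 : 0 ≤ B * (1 - y) := mul_nonneg hB0 (by linarith [hy.2])
        constructor <;> linarith [h1.1, h1.2]
      have h1 := hwide 1 ⟨hx.2, le_rfl⟩
      have h0 := hwide x ⟨le_rfl, hx.2⟩
      rw [sub_self, zero_div, add_zero] at h0
      rw [hchar j s x hx h0.1 h0.2 h1.1 h1.2, hend j _ h1.1 h1.2, zero_sub, abs_neg, abs_mul,
          abs_div, abs_one]
      have h2 : |∫ y in x..1, g j (s + (y - x) / c j) y| ≤
          ∫ y in x..1, M * (N * (1 / 2) ^ n) * exp (κ * (1 - y)) := by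
        have hcont : Continuous fun y => M * (N * (1 / 2) ^ n) * exp (κ * (1 - y)) := by
          fun_prop
        rw [← Real.norm_eq_abs]
        refine intervalIntegral.norm_integral_le_of_norm_le hx.2 (ae_of_all _ fun y hy => ?_)
          (hcont.intervalIntegrable _ _)
        have hy' : y ∈ Icc x 1 := ⟨hy.1.le, hy.2⟩
        have hy01 : y ∈ Icc 0 1 := ⟨by linarith [hx.1, hy.1], hy.2⟩
        rw [Real.norm_eq_abs, mul_assoc M]
        exact hg j _ y _ (hwide y hy').1 (hwide y hy').2 hy01 fun l =>
          ih l _ y hy01 (hreg y hy').1 (hreg y hy').2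
      rw [intervalIntegral.integral_const_mul] at h2
      have h3 := integral_exp_mul_one_sub_le (x := x) hκ0
      have h4 : M * (1 / |c j|) / κ ≤ 1 / 2 := by
        rw [div_le_iff₀ hκ0, hκ]
        linarith [mul_le_mul_of_nonneg_left (hS j) hM]
      calc 1 / |c j| * |∫ y in x..1, g j (s + (y - x) / c j) y|
          ≤ 1 / |c j| * (M * (N * (1 / 2) ^ n) * (exp (κ * (1 - x)) / κ)) := by
            refine mul_le_mul_of_nonneg_left (h2.trans ?_) (by positivity)
            exact mul_le_mul_of_nonneg_left h3 (by positivity)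
        _ = (M * (1 / |c j|) / κ) * (N * (1 / 2) ^ n * exp (κ * (1 - x))) := by ring
        _ ≤ 1 / 2 * (N * (1 / 2) ^ n * exp (κ * (1 - x))) :=
            mul_le_mul_of_nonneg_right h4 (by positivity)
        _ = _ := by rw [pow_succ]; ring
  have hlim : Filter.Tendsto (fun n : ℕ => N * (1 / 2 : ℝ) ^ n * exp (κ * (1 - x)))
      Filter.atTop (nhds 0) := by
    simpa using ((tendsto_pow_atTop_nhds_zero_of_lt_one (by norm_num : (0 : ℝ) ≤ 1 / 2)
        (by norm_num)).const_mul N).mul_const (exp (κ * (1 - x)))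
  exact abs_nonpos_iff.1 (ge_of_tendsto' hlim fun n => claim n j s x hx hs hs')

namespace Net

variable {J : Type} [Fintype J] {P : Net J} {M : ℝ}

/-- A characteristic followed, forward or backward in time, up to the end `x = 1`. -/
theorem CharEq.to_end {q : J → ℝ → ℝ → ℝ} {L : ℝ} (hq : P.CharEq q L) {j : J} (hc : P.c j ≠ 0)
    {s x : ℝ} (hx : x ∈ Icc 0 1) (hs : 0 ≤ s) (hsL : s ≤ L)
    (hs' : 0 ≤ s + (1 - x) / P.c j) (hsL' : s + (1 - x) / P.c j ≤ L) :
    q j s x = q j (s + (1 - x) / P.c j) 1 -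
      ∫ ρ in 0..(1 - x) / P.c j, P.source q j (s + ρ) (x + P.c j * ρ) := by
  have e : P.c j * ((1 - x) / P.c j) = 1 - x := by field_simp
  rcases lt_or_gt_of_ne hc with hj | hj
  · set r := -((1 - x) / P.c j) with hr
    have hr0 : 0 ≤ r := by
      rw [hr, ← div_neg]; exact div_nonneg (by linarith [hx.2]) (by linarith)
    have e' : (1 - x) / P.c j = -r := by rw [hr]; ring
    have e'' : P.c j * r = -(1 - x) := by rw [hr]; linarith
    rw [e'] at hs' hsL' ⊢
    have := hq j (s + -r) 1 r hs' hr0 (by linarith) (by simp) (by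
      rw [e'']; exact ⟨by linarith [hx.1], by linarith [hx.2]⟩)
    rw [e'', show s + -r + r = s by ring, show 1 + -(1 - x) = x by ring] at this
    rw [this, intervalIntegral.integral_symm (-r) 0, sub_neg_eq_add]
    congr 1
    have h2 := intervalIntegral.integral_comp_sub_right (a := 0) (b := r)
      (fun ρ => P.source q j (s + ρ) (x + P.c j * ρ)) r
    rw [zero_sub, sub_self] at h2
    rw [← h2]
    refine integral_congr fun ρ _ => ?_
    congr 1
    · ring
    · rw [mul_sub, e'']; ring
  · have hr0 : 0 ≤ (1 - x) / P.c j := div_nonneg (by linarith [hx.2]) hj.le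
    have := hq j s x _ hs hr0 hsL' hx (by rw [e]; exact ⟨by linarith, by linarith⟩)
    rw [e, add_sub_cancel] at this
    rw [this]; ring

variable {q q' : J → ℝ → ℝ → ℝ} {L : ℝ}

/-- Sources of bounded Borel functions are integrable along characteristics. -/
theorem Regular.intervalIntegrable_char (hP : P.Regular M) (hq : Tame q L) (j : J) {s x r : ℝ}
    (hs : 0 ≤ s) (hr : 0 ≤ r) (hsr : s + r ≤ L) (hx : x ∈ Icc 0 1)
    (hxr : x + P.c j * r ∈ Icc 0 1) :
    IntervalIntegrable (fun ρ => P.source q j (s + ρ) (x + P.c j * ρ)) volume 0 r := by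
  obtain ⟨B, hB⟩ := hq.bdd
  refine intervalIntegrable_of_abs_le (M := Fintype.card J * (M * B)) ?_ fun ρ hρ => ?_
  · refine measurable_sum _ fun l _ => Measurable.mul ?_ ?_
    · exact (hP.S_meas j l).comp (by fun_prop)
    · exact (hq.meas l).comp (by fun_prop : Measurable fun r : ℝ => (s + r, x + P.c j * r))
  · rw [uIcc_of_le hr] at hρ
    have f1 : x + P.c j * ρ ∈ Icc 0 1 := by
      rcases le_total 0 (P.c j) with h | h <;>
      constructor <;> nlinarith [hρ.1, hρ.2, hx.1, hx.2, hxr.1, hxr.2]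
    refine (abs_sum_le_sum_abs _ _).trans ?_
    calc _ ≤ ∑ _l : J, M * B := sum_le_sum fun l _ => by
          rw [abs_mul]
          exact mul_le_mul (hP.S_le _ _ _) (hB l _ _ (by linarith [hρ.1]) (by linarith [hρ.2]) f1)
            (abs_nonneg _) hP.M_pos.le
      _ = _ := by simp

theorem Regular.charEq_sub (hP : P.Regular M) (hq : P.CharEq q L) (hq' : P.CharEq q' L)
    (ht : Tame q L) (ht' : Tame q' L) : P.CharEq (fun j s x => q j s x - q' j s x) L := by
  intro j s x r hs hr hsr hx hxr
  beta_reduce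
  rw [hq j s x r hs hr hsr hx hxr, hq' j s x r hs hr hsr hx hxr, add_sub_add_comm,
    ← intervalIntegral.integral_sub (hP.intervalIntegrable_char ht j hs hr hsr hx hxr)
      (hP.intervalIntegrable_char ht' j hs hr hsr hx hxr)]
  simp only [source, mul_sub, sum_sub_distrib]

end Net

namespace Chain

variable {C : Chain}

theorem sum_Icc_eq_add {f : ℕ → ℝ} {i N : ℕ} (h : i ≤ N) :
    ∑ j ∈ Finset.Icc i N, f j = f i + ∑ j ∈ Finset.Icc (i + 1) N, f j := by
  rw [← Finset.add_sum_Ioc_eq_sum_Icc h]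
  exact congrArg (f i + ·) (sum_congr (by ext; simp [Nat.succ_le_iff]) fun _ _ => rfl)

theorem mulVec_injective_of_rank {a b : ℕ} {A : Matrix (Fin a) (Fin b) ℝ} (h : A.rank = b) :
    Function.Injective A.mulVec := by
  have h1 := A.mulVecLin.finrank_range_add_finrank_ker
  rw [← Matrix.rank, h, Module.finrank_fin_fun, Nat.add_eq_left, Submodule.finrank_eq_zero] at h1
  exact LinearMap.ker_eq_bot.1 h1

theorem lam1_pos (hC : C.Standing) {i : ℕ} (hi : i ∈ Finset.Icc 1 C.N) : 0 < C.lam1 i :=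
  hC.lam_pos i hi _

theorem mu1_pos (hC : C.Standing) {i : ℕ} (hi : i ∈ Finset.Icc 1 C.N) : 0 < C.mu1 i :=
  hC.mu_pos i hi _

theorem lam1_le (hC : C.Standing) {i : ℕ} (hi : i ∈ Finset.Icc 1 C.N) (k : Fin (C.n i)) :
    C.lam1 i ≤ C.lam i k := (hC.lam_mono i hi).monotone (Nat.zero_le _)

theorem mu1_le (hC : C.Standing) {i : ℕ} (hi : i ∈ Finset.Icc 1 C.N) (k : Fin (C.m i)) :
    C.mu1 i ≤ C.mu i k := (hC.mu_mono i hi).monotone (Nat.zero_le _)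

/-- The coefficients of the source terms of subsystem `i`. -/
def block (C : Chain) (i : ℕ) (y : ℝ) : Matrix (C.Comp i) (C.Comp i) ℝ :=
  Matrix.fromBlocks (C.Spp i (clamp y)) (C.Spm i (clamp y)) (C.Smp i (clamp y)) (C.Smm i (clamp y))

theorem source_eq_block {K : C.Memory} {h : ℝ} {i i₀ : ℕ}
    {z : ℝ → C.State} {t₀ s x : ℝ} (hi : i ∈ Finset.Icc i₀ C.N) (l : C.Comp i) :
    (C.toNet i₀ K h).source (toFam i₀ z t₀) ⟨⟨i, hi⟩, l⟩ s x =
      ∑ a, C.block i x l a * toFam i₀ z t₀ ⟨⟨i, hi⟩, a⟩ s x := by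
  rcases l with l | l
  · rw [source_inl hi]
    simp [block, Fintype.sum_sum_type, toFam, Matrix.mulVec, dotProduct]
  · rw [source_inr hi]
    simp [block, Fintype.sum_sum_type, toFam, Matrix.mulVec, dotProduct]

theorem continuous_block (hC : C.Standing) {i : ℕ} (hi : i ∈ Finset.Icc 1 C.N) (a b) :
    Continuous fun y => C.block i y a b := by
  rcases a with a | a <;> rcases b with b | b
  · exact continuous_comp_clamp (hC.Spp_cont i hi) a b
  · exact continuous_comp_clamp (hC.Spm_cont i hi) a b
  · exact continuous_comp_clamp (hC.Smp_cont i hi) a b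
  · exact continuous_comp_clamp (hC.Smm_cont i hi) a b

theorem exists_bound_block (hC : C.Standing) {i : ℕ} (hi : i ∈ Finset.Icc 1 C.N) :
    ∃ M, 0 < M ∧ ∀ a b y, |C.block i y a b| ≤ M := by
  obtain ⟨M, h0, hM⟩ := exists_bound_of_finite (X := ℝ) (f := fun (p : C.Comp i × C.Comp i) y =>
      C.block i y p.1 p.2) fun p => by
    obtain ⟨B, hB⟩ := isCompact_Icc.exists_bound_of_continuousOn (s := Icc (0 : ℝ) 1)
      (continuous_block hC hi p.1 p.2).continuousOn
    refine ⟨B, fun y => ?_⟩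
    have := hB (clamp y) (clamp_mem y)
    rwa [block, clamp_of_mem (clamp_mem y)] at this
  exact ⟨M, h0, fun a b y => hM (a, b) y⟩

/-- The difference of two signals of states. -/
def signalSub (z z' : ℝ → C.State) (r : ℝ) : C.State where
  u i x k := (z r).u i x k - (z' r).u i x k
  v i x k := (z r).v i x k - (z' r).v i x k

theorem toFam_signalSub {z z' : ℝ → C.State} {i : ℕ} (t : ℝ) (j : C.Idx i) (s x : ℝ) :
    toFam i (signalSub z z') t j s x = toFam i z t j s x - toFam i z' t j s x := by
  rcases j with ⟨j, l | l⟩ <;> rfl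

/-- Sideways uniqueness for one subsystem. -/
theorem IsSol.sideways (hC : C.Standing) {U U' : ℝ → Fin (C.n 1) → ℝ} {z z' : ℝ → C.State}
    (hz : C.IsSol 1 0 (Ici 0) U z) (hz' : C.IsSol 1 0 (Ici 0) U' z') {i : ℕ}
    (hi : i ∈ Finset.Icc 1 C.N) {a b : ℝ} (ha : 0 ≤ a)
    (hu : ∀ s, a < s → s ≤ b → (z s).u i 1 = (z' s).u i 1)
    (hv : ∀ s, a < s → s ≤ b → (z s).v i 1 = (z' s).v i 1) {s x : ℝ} (hx : x ∈ Icc 0 1)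
    (hs : a + 1 / C.mu1 i < s) (hs' : s ≤ b - 1 / C.lam1 i) :
    (z s).u i x = (z' s).u i x ∧ (z s).v i x = (z' s).v i x := by
  obtain ⟨_, hP⟩ := exists_regular hC le_rfl (MemKernel.zero (C := C) 1)
  obtain ⟨M, hM0, hM⟩ := exists_bound_block hC hi
  set P := C.toNet 1 (fun _ _ => 0) 0 with hPdef
  have hJ : Icc (0 : ℝ) (0 + b) ⊆ Ici 0 := fun t ht => ht.1
  have ht := hz.tame hJ
  have ht' := hz'.tame hJ
  have hw := Net.Regular.charEq_sub hP (hz.charEq hC le_rfl hJ) (hz'.charEq hC le_rfl hJ) ht ht'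
  simp only [← toFam_signalSub] at hw
  obtain ⟨B, hB⟩ := ht.bdd
  obtain ⟨B', hB'⟩ := ht'.bdd
  set w := toFam 1 (signalSub z z') 0 with hwdef
  let e : C.Comp i → C.Idx 1 := fun j => ⟨⟨i, hi⟩, j⟩
  have hl := lam1_pos hC hi
  have hmu := mu1_pos hC hi
  have hcabs : ∀ j, (P.c (e j) < 0 → 1 / |P.c (e j)| ≤ 1 / C.mu1 i) ∧
      (0 < P.c (e j) → 1 / |P.c (e j)| ≤ 1 / C.lam1 i) := by
    rintro (k | k)
    · have := lam1_le hC hi k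
      have hk : P.c (e (Sum.inl k)) = C.lam i k := rfl
      rw [hk, abs_of_pos (by linarith)]
      exact ⟨fun h => by linarith, fun _ => one_div_le_one_div_of_le hl this⟩
    · have := mu1_le hC hi k
      have hk : P.c (e (Sum.inr k)) = -C.mu i k := rfl
      rw [hk, abs_neg, abs_of_pos (by linarith)]
      exact ⟨fun _ => one_div_le_one_div_of_le hmu this, fun h => by linarith⟩
  have hA0 : 0 ≤ 1 / C.mu1 i := by positivity
  have hB0 : 0 ≤ 1 / C.lam1 i := by positivity
  have key : ∀ j, w (e j) s x = 0 := fun j => by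
    refine sideways_eq_zero (c := fun j => P.c (e j)) (w := fun j => w (e j))
      (g := fun j => P.source w (e j)) (a := a) (b := b) (A := 1 / C.mu1 i) (B := 1 / C.lam1 i)
      (M := Fintype.card (C.Comp i) * M)
      (fun j => hP.c_ne _) (fun j => (hcabs j).1) (fun j => (hcabs j).2)
      (mul_nonneg (Nat.cast_nonneg _) hM0.le) hA0 hB0 ?_ ?_ ?_ ?_ j hx
      (lt_of_le_of_lt (by nlinarith [hx.1, hx.2]) hs) (hs'.trans (by nlinarith [hx.1, hx.2]))
    · intro j s x hx h1 h2 h3 h4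
      have hc := hP.c_ne (e j)
      rw [hw.to_end hc hx (by linarith) h2 (by linarith) h4]
      congr 1
      have := intervalIntegral.integral_comp_div_sub (a := x) (b := 1)
        (fun ρ => P.source w (e j) (s + ρ) (x + P.c (e j) * ρ)) hc (x / P.c (e j))
      rw [sub_self, ← sub_div, smul_eq_mul] at this
      rw [← mul_right_inj' hc, ← this, ← mul_assoc, mul_one_div_cancel hc, one_mul]
      refine integral_congr fun y _ => ?_
      have h6 : x + P.c (e j) * (y / P.c (e j) - x / P.c (e j)) = y := by field_simp; ring
      simp only [h6, sub_div]
    · intro j s x N h1 h2 hx hN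
      rw [hwdef, hPdef, source_eq_block hi]
      refine (abs_sum_le_sum_abs _ _).trans ?_
      calc _ ≤ ∑ _l : C.Comp i, M * N := sum_le_sum fun l _ => by
            rw [abs_mul]
            exact mul_le_mul (hM _ _ _) (hN l) (abs_nonneg _) hM0.le
        _ = _ := by simp [mul_assoc]
    · rintro (k | k) s h1 h2 <;>
      simp [w, signalSub, toFam, e, hu s h1 h2, hv s h1 h2]
    · refine ⟨B + B', fun j s x h1 h2 hx => ?_⟩
      rw [hwdef, toFam_signalSub]
      exact (abs_sub _ _).trans (add_le_add (hB _ _ _ (by linarith) h2 hx)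
        (hB' _ _ _ (by linarith) h2 hx))
  constructor <;> funext k
  · have := key (Sum.inl k)
    simpa only [w, signalSub, toFam, e, Sum.elim_inl, zero_add, sub_eq_zero] using this
  · have := key (Sum.inr k)
    simpa only [w, signalSub, toFam, e, Sum.elim_inr, zero_add, sub_eq_zero] using this

/-- The output determines the state, after and before the largest transport times of the whole
chain. -/
theorem IsSol.agree_of_output (hC : C.Standing)
    (hobs : ∀ i ∈ Finset.Ico 1 C.N, (C.Q i).rank = C.n i)
    {U U' : ℝ → Fin (C.n 1) → ℝ} {z z' : ℝ → C.State}
    (hz : C.IsSol 1 0 (Ici 0) U z) (hz' : C.IsSol 1 0 (Ici 0) U' z') {a b : ℝ} (ha : 0 ≤ a)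
    (hy : ∀ s, a < s → s ≤ b → C.output z s = C.output z' s) {s : ℝ}
    (hs : a + ∑ j ∈ Finset.Icc 1 C.N, 1 / C.mu1 j < s)
    (hs' : s ≤ b - ∑ j ∈ Finset.Icc 1 C.N, 1 / C.lam1 j) : (z s).Agree 1 (z' s) := by
  have claim : ∀ d i, i + d = C.N + 1 → 1 ≤ i → ∀ s, a + ∑ j ∈ Finset.Icc i C.N, 1 / C.mu1 j < s →
      s ≤ b - ∑ j ∈ Finset.Icc i C.N, 1 / C.lam1 j → (z s).Agree i (z' s) := by
    intro d
    induction d with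
    | zero =>
      intro i hi _ s _ _ j hj
      rw [Finset.mem_Icc] at hj
      omega
    | succ d ih =>
      intro i hid hi1 s hs hs'
      have hi : i ∈ Finset.Icc 1 C.N := Finset.mem_Icc.2 ⟨hi1, by omega⟩
      have hiN : i ≤ C.N := by omega
      rw [sum_Icc_eq_add hiN] at hs hs'
      set a' := a + ∑ j ∈ Finset.Icc (i + 1) C.N, 1 / C.mu1 j with ha'
      set b' := b - ∑ j ∈ Finset.Icc (i + 1) C.N, 1 / C.lam1 j with hb'
      have hsub : ∀ j ∈ Finset.Icc (i + 1) C.N, j ∈ Finset.Icc 1 C.N := fun j hj =>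
        Icc_subset_Icc_left (by omega) hj
      have hm0 : 0 ≤ ∑ j ∈ Finset.Icc (i + 1) C.N, 1 / C.mu1 j := sum_nonneg fun j hj =>
        (one_div_pos.2 (mu1_pos hC (hsub j hj))).le
      have hl0 : 0 ≤ ∑ j ∈ Finset.Icc (i + 1) C.N, 1 / C.lam1 j := sum_nonneg fun j hj =>
        (one_div_pos.2 (lam1_pos hC (hsub j hj))).le
      have hm1 := one_div_pos.2 (mu1_pos hC hi)
      have hl1 := one_div_pos.2 (lam1_pos hC hi)
      have hnext := ih (i + 1) (by omega) (by omega)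
      have hu : ∀ s, a' < s → s ≤ b' → (z s).u i 1 = (z' s).u i 1 := by
        intro s h1 h2
        have hs0 : 0 < s := by linarith
        rcases hiN.lt_or_eq with hlt | rfl
        · have hIco : i ∈ Finset.Ico 1 C.N := Finset.mem_Ico.2 ⟨hi1, hlt⟩
          have h3 := hnext s h1 h2 (i + 1) (Finset.mem_Icc.2 ⟨le_rfl, hlt⟩) 0 (by simp)
          have e1 := hz.left i hIco s hs0.le hs0
          have e2 := hz'.left i hIco s hs0.le hs0
          rw [h3.1, h3.2] at e1
          rw [e1] at e2
          exact mulVec_injective_of_rank (hobs i hIco) (add_left_cancel e2)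
        · exact hy s (by linarith) (by linarith)
      have hv : ∀ s, a' < s → s ≤ b' → (z s).v i 1 = (z' s).v i 1 := by
        intro s h1 h2
        have hs0 : 0 < s := by linarith
        rcases hiN.lt_or_eq with hlt | rfl
        · have hIco : i ∈ Finset.Ico 1 C.N := Finset.mem_Ico.2 ⟨hi1, hlt⟩
          have h3 := hnext s h1 h2 (i + 1) (Finset.mem_Icc.2 ⟨le_rfl, hlt⟩) 0 (by simp)
          rw [hz.right i hIco s hs0.le hs0, hz'.right i hIco s hs0.le hs0, h3.2, hu s h1 h2]
        · rw [hz.right_end s hs0.le hs0, hz'.right_end s hs0.le hs0, hu s h1 h2]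
      intro j hj x hx
      rw [Finset.mem_Icc] at hj
      rcases hj.1.eq_or_lt with rfl | hlt
      · exact hz.sideways hC hz' hi (by linarith) hu hv hx (by linarith) (by linarith)
      · exact hnext s (by linarith) (by linarith) j (Finset.mem_Icc.2 ⟨hlt, hj.2⟩) x hx
  exact claim C.N 1 (by omega) le_rfl s hs hs'

/-- The observer returns the delayed state of any solution that is compatible with the
measurement up to the current time. -/
theorem exists_delayedObserver (hC : C.Standing)
    (hobs : ∀ i ∈ Finset.Ico 1 C.N, (C.Q i).rank = C.n i) {τ : ℝ}
    (hτ : ∑ j ∈ Finset.Icc 1 C.N, 1 / C.lam1 j < τ) : ∃ O, C.IsDelayedObserver τ O := by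
  classical
  let S : (ℝ → Fin (C.n C.N) → ℝ) → ℝ → (ℝ → C.State) → Prop := fun y t z =>
    (∃ U, C.IsSol 1 0 (Ici 0) U z) ∧ ∀ s ∈ Icc 0 t, C.output z s = y s
  have : Nonempty (ℝ → C.State) := ⟨fun _ => ⟨fun _ _ _ => 0, fun _ _ _ => 0⟩⟩
  refine ⟨fun y t => (Classical.epsilon (S y t)) (t - τ), fun t y y' h => ?_, fun U z hz t ht => ?_⟩
  · have : S y t = S y' t := by
      funext z
      refine propext (and_congr_right fun _ => forall₂_congr fun s hs => ?_)
      rw [h s hs]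
    simp only [this]
    exact fun _ _ _ _ => ⟨rfl, rfl⟩
  · obtain ⟨⟨U', hz'⟩, hy⟩ := Classical.epsilon_spec (p := S (C.output z) t)
      ⟨z, ⟨U, hz⟩, fun _ _ => rfl⟩
    exact hz'.agree_of_output hC hobs hz le_rfl (b := t) (fun s h1 h2 => hy s ⟨h1.le, h2⟩)
      (by linarith) (by linarith)

end Chain

/-! ### Existence of the backstepping kernels -/

/-- The triangle `0 ≤ x ≤ y ≤ 1`. -/
def InTriangle (x y : ℝ) : Prop := 0 ≤ x ∧ x ≤ y ∧ y ≤ 1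

/-- One row of the kernel equations.  The components `f l` are transported with speed `(lam, c l)`;
as `x` increases each characteristic leaves the triangle after the time `σ l x y`, and `f l` is
prescribed at the exit point: either given, or a combination of other components, which in turn
(`hD`) have given exit values.  The source contains the trace of `f` on the diagonal. -/
theorem exists_row {J : Type} [Fintype J] {lam M : ℝ} (hlam : 0 < lam) (hM : 0 ≤ M) {c : J → ℝ}
    {σ h d : J → ℝ → ℝ → ℝ} {A : J → J → ℝ → ℝ} {D H : J → J → ℝ → ℝ → ℝ} (S : J → Prop)
    (hσm : ∀ l, Measurable fun p : ℝ × ℝ => σ l p.1 p.2)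
    (hσ : ∀ l x y, InTriangle x y → 0 ≤ σ l x y)
    (hT : ∀ l x y s, InTriangle x y → 0 ≤ s → s ≤ σ l x y → InTriangle (x + lam * s) (y + c l * s))
    (hA : ∀ l a, Measurable (A l a)) (hAM : ∀ l a y, |A l a y| ≤ M)
    (hH : ∀ l a, Measurable fun p : ℝ × ℝ => H l a p.1 p.2) (hHM : ∀ l a x y, |H l a x y| ≤ M)
    (hDm : ∀ l a, Measurable fun p : ℝ × ℝ => D l a p.1 p.2) (hDM : ∀ l a x y, |D l a x y| ≤ M)
    (hD : ∀ l a x y, ¬ S l ∨ S a → D l a x y = 0)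
    (hh : ∀ l, Measurable fun p : ℝ × ℝ => h l p.1 p.2) (hhM : ∀ l x y, |h l x y| ≤ M)
    (hd : ∀ l, Measurable fun p : ℝ × ℝ => d l p.1 p.2) (hdM : ∀ l x y, |d l x y| ≤ M)
    (hσadd : ∀ l x y s, InTriangle x y → 0 ≤ s → InTriangle (x + lam * s) (y + c l * s) →
      s ≤ σ l x y ∧ σ l (x + lam * s) (y + c l * s) = σ l x y - s)
    (hDadd : ∀ l a x y s, InTriangle x y → 0 ≤ s → InTriangle (x + lam * s) (y + c l * s) →
      D l a (x + lam * s) (y + c l * s) = D l a x y)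
    (hdadd : ∀ l x y s, InTriangle x y → 0 ≤ s → InTriangle (x + lam * s) (y + c l * s) →
      d l (x + lam * s) (y + c l * s) = d l x y) :
    ∃ f : J → ℝ → ℝ → ℝ, (∀ l, Measurable fun p : ℝ × ℝ => f l p.1 p.2) ∧
      (∃ B, ∀ l x y, |f l x y| ≤ B) ∧
      (∀ l x y s, InTriangle x y → 0 ≤ s → InTriangle (x + lam * s) (y + c l * s) →
        f l (x + lam * s) (y + c l * s) = f l x y +
          ∫ r in 0..s, (∑ a, (A l a (y + c l * r) * f a (x + lam * r) (y + c l * r) +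
            H l a (x + lam * r) (y + c l * r) * f a (x + lam * r) (x + lam * r)) +
            h l (x + lam * r) (y + c l * r))) ∧
      ∀ l x y, InTriangle x y → σ l x y = 0 → f l x y = ∑ a, D l a x y * f a x y + d l x y := by
  classical
  let _ : MeasurableSpace J := ⊤
  set n : ℝ := (Fintype.card J : ℝ) with hn
  have hn0 : 0 ≤ n := Nat.cast_nonneg _
  set R : ℝ := 4 * n * M + 1 with hR
  have hR1 : 1 ≤ R := by
    rw [hR]; linarith [mul_nonneg (mul_nonneg (by norm_num : (0:ℝ) ≤ 4) hn0) hM]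
  set β : ℝ := 8 * n * M * R / lam + 1 with hβ
  have hβ0 : 0 < β := by positivity
  let ρ : J → ℝ := fun l => if S l then R else 1
  have hρ1 : ∀ l, 1 ≤ ρ l := fun l => by simp only [ρ]; split_ifs <;> linarith
  have hρR : ∀ l, ρ l ≤ R := fun l => by simp only [ρ]; split_ifs <;> linarith
  let ω : J × ℝ × ℝ → ℝ := fun p => ρ p.1 * exp (β * (1 - p.2.1))
  have hω : ∀ p, 0 < ω p := fun p => mul_pos (by linarith [hρ1 p.1]) (exp_pos _)
  have hωR : ∀ a x y, ω (a, x, y) ≤ R * exp (β * (1 - x)) := fun a x y =>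
    mul_le_mul_of_nonneg_right (hρR a) (exp_pos _).le
  let src : (J × ℝ × ℝ → ℝ) → J → ℝ → ℝ → ℝ := fun f l x y =>
    ∑ a, (A l a y * f (a, x, y) + H l a x y * f (a, x, x)) + h l x y
  let Ψ : (J × ℝ × ℝ → ℝ) → J → ℝ → ℝ → ℝ := fun f l x y =>
    ∑ a, D l a x y * f (a, x + lam * σ l x y, y + c l * σ l x y) + d l x y -
      ∫ s in 0..σ l x y, src f l (x + lam * s) (y + c l * s)
  let T : Set (ℝ × ℝ) := {p | 0 ≤ p.1 ∧ p.1 ≤ p.2 ∧ p.2 ≤ 1}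
  have hTm : MeasurableSet T := (measurableSet_le measurable_const measurable_fst).inter
    ((measurableSet_le measurable_fst measurable_snd).inter
      (measurableSet_le measurable_snd measurable_const))
  let Φ : (J × ℝ × ℝ → ℝ) → J × ℝ × ℝ → ℝ := fun f p => if p.2 ∈ T then Ψ f p.1 p.2.1 p.2.2 else 0
  have hsec : ∀ f : J × ℝ × ℝ → ℝ, Measurable f → ∀ a, Measurable fun p : ℝ × ℝ =>
      f (a, p.1, p.2) :=
    fun f hf a => hf.comp (measurable_const.prodMk (by fun_prop))
  have hsrcm : ∀ f : J × ℝ × ℝ → ℝ, Measurable f → ∀ l,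
      Measurable fun p : ℝ × ℝ => src f l p.1 p.2 := by
    intro f hf l
    refine Measurable.add (measurable_sum _ fun a _ => Measurable.add
      (((hA l a).comp measurable_snd).mul (hsec f hf a)) ((hH l a).mul ?_)) (hh l)
    exact (hsec f hf a).comp (by fun_prop : Measurable fun p : ℝ × ℝ => (p.1, p.1))
  have hint : ∀ f : J × ℝ × ℝ → ℝ, Measurable f → (∃ N, ∀ p, |f p| ≤ N * ω p) → ∀ l x y,
      InTriangle x y → IntervalIntegrable (fun s => src f l (x + lam * s) (y + c l * s)) volume 0
        (σ l x y) := by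
    rintro f hf ⟨N, hN⟩ l x y hxy
    have hb : ∀ a x y, InTriangle x y → |f (a, x, y)| ≤ |N| * (R * exp β) := by
      intro a x y hxy
      refine (hN _).trans (mul_le_mul (le_abs_self _) ((hωR a x y).trans ?_) (hω _).le
          (abs_nonneg _))
      refine mul_le_mul_of_nonneg_left (exp_le_exp.2 ?_) (by linarith)
      nlinarith [hxy.1]
    refine intervalIntegrable_of_abs_le (M := n * (M * (|N| * (R * exp β)) +
      M * (|N| * (R * exp β))) + M) ?_ fun s hs => ?_
    · exact (hsrcm f hf l).comp (by fun_prop : Measurable fun s : ℝ => (x + lam * s, y + c l * s))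
    · rw [uIcc_of_le (hσ l x y hxy)] at hs
      have ht := hT l x y s hxy hs.1 hs.2
      refine (abs_add_le _ _).trans (add_le_add ((abs_sum_le_sum_abs _ _).trans ?_) (hhM _ _ _))
      rw [hn, ← nsmul_eq_mul, ← Finset.card_univ, ← Finset.sum_const]
      refine sum_le_sum fun a _ => (abs_add_le _ _).trans (add_le_add ?_ ?_)
      · rw [abs_mul]
        exact mul_le_mul (hAM _ _ _) (hb _ _ _ ht) (abs_nonneg _) hM
      · rw [abs_mul]
        exact mul_le_mul (hHM _ _ _ _) (hb _ _ _ ⟨ht.1, le_rfl, ht.2.1.trans ht.2.2⟩)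
          (abs_nonneg _) hM
  have hlamσ : ∀ l x y, InTriangle x y → lam * σ l x y ≤ 1 := fun l x y hxy => by
    have := hT l x y _ hxy (hσ l x y hxy) le_rfl
    linarith [this.2.1, this.2.2, hxy.1]
  obtain ⟨f, hfm, ⟨N, hfN⟩, hf⟩ := exists_fixedPoint_of_weight ω hω Φ (M + M / lam) (by
      intro f hf _
      refine measurable_from_prod_countable_right fun l => ?_
      refine Measurable.ite hTm ?_ measurable_const
      refine Measurable.sub (Measurable.add (measurable_sum _ fun a _ =>
        (hDm l a).mul ?_) (hd l)) ?_
      · have hexit : Measurable fun p : ℝ × ℝ =>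
            (p.1 + lam * σ l p.1 p.2, p.2 + c l * σ l p.1 p.2) :=
          (measurable_fst.add ((hσm l).const_mul _)).prodMk
            (measurable_snd.add ((hσm l).const_mul _))
        exact (hsec f hf a).comp hexit
      · refine measurable_intervalIntegral (α := ℝ × ℝ) ?_ measurable_const (hσm l)
        exact (hsrcm f hf l).comp (by fun_prop : Measurable fun p : (ℝ × ℝ) × ℝ =>
          (p.1.1 + lam * p.2, p.1.2 + c l * p.2))) (by
      rintro ⟨l, x, y⟩
      by_cases hp : (x, y) ∈ T
      · simp only [Φ, Ψ, src, if_pos hp, mul_zero, add_zero, sum_const_zero, zero_add]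
        have h1 := abs_intervalIntegral_le (hσ l x y hp) fun s _ =>
          hhM l (x + lam * s) (y + c l * s)
        have h2 : M * (σ l x y - 0) ≤ M / lam := by
          rw [sub_zero, div_eq_mul_one_div]
          refine mul_le_mul_of_nonneg_left ?_ hM
          rw [le_div_iff₀ hlam]; linarith [hlamσ l x y hp]
        have h3 : 1 ≤ ω (l, x, y) := by
          refine one_le_mul_of_one_le_of_one_le (hρ1 l) (one_le_exp ?_)
          have := hp.2.1.trans hp.2.2
          exact mul_nonneg hβ0.le (by linarith)
        refine (abs_sub _ _).trans ((add_le_add (hdM l x y) (h1.trans h2)).trans ?_)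
        exact le_mul_of_one_le_right (by positivity) h3
      · simp only [Φ, if_neg hp, abs_zero]
        have := hω (l, x, y)
        positivity) (by
      rintro f g hf hg hbf hbg N hN hfg ⟨l, x, y⟩
      have hω' := hω (l, x, y)
      by_cases hp : (x, y) ∈ T
      swap
      · simp only [Φ, if_neg hp, sub_zero, abs_zero]
        positivity
      have e : Φ f (l, x, y) - Φ g (l, x, y) = ∑ a, D l a x y *
          (f (a, x + lam * σ l x y, y + c l * σ l x y) -
            g (a, x + lam * σ l x y, y + c l * σ l x y)) -
          ∫ s in 0..σ l x y, (src f l (x + lam * s) (y + c l * s) -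
            src g l (x + lam * s) (y + c l * s)) := by
        simp only [Φ, Ψ, if_pos hp, mul_sub, sum_sub_distrib]
        rw [intervalIntegral.integral_sub (hint f hf hbf l x y hp) (hint g hg hbg l x y hp)]
        ring
      set E := exp (β * (1 - x)) with hE
      have hE0 : 0 < E := exp_pos _
      have hσ0 := hσ l x y hp
      have e1 : |∑ a, D l a x y * (f (a, x + lam * σ l x y, y + c l * σ l x y) -
            g (a, x + lam * σ l x y, y + c l * σ l x y))| ≤ N / 4 * (ρ l * E) := by
        by_cases hSl : S l
        · refine (abs_sum_le_sum_abs _ _).trans ?_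
          calc _ ≤ ∑ _a : J, M * (N * E) := sum_le_sum fun a _ => by
                by_cases hSa : S a
                · rw [hD l a x y (Or.inr hSa), zero_mul, abs_zero]; positivity
                · rw [abs_mul]
                  refine mul_le_mul (hDM _ _ _ _) ((hfg _).trans ?_) (abs_nonneg _) hM
                  refine mul_le_mul_of_nonneg_left ?_ hN.le
                  simp only [ω, ρ, if_neg hSa, one_mul, hE]
                  refine exp_le_exp.2 (mul_le_mul_of_nonneg_left ?_ hβ0.le)
                  linarith [mul_nonneg hlam.le hσ0]
            _ = n * M * (N * E) := by simp [hn]; ring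
            _ ≤ (R / 4) * (N * E) := mul_le_mul_of_nonneg_right (by rw [hR]; linarith)
                (by positivity)
            _ = _ := by simp only [ρ, if_pos hSl]; ring
        · rw [sum_eq_zero fun a _ => by rw [hD l a x y (Or.inl hSl), zero_mul], abs_zero]
          have := hρ1 l
          positivity
      have e2 : |∫ s in 0..σ l x y, (src f l (x + lam * s) (y + c l * s) -
            src g l (x + lam * s) (y + c l * s))| ≤ N / 4 * (ρ l * E) := by
        have hm : ∀ s ∈ Icc 0 (σ l x y), |src f l (x + lam * s) (y + c l * s) -
            src g l (x + lam * s) (y + c l * s)| ≤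
              2 * n * M * (N * R) * exp (β * (1 - x) - β * lam * s) := by
          intro s hs
          have hb : ∀ a y', |f (a, x + lam * s, y') - g (a, x + lam * s, y')| ≤
              N * (R * exp (β * (1 - x) - β * lam * s)) := fun a y' => by
            refine (hfg _).trans (mul_le_mul_of_nonneg_left
                ((hωR a _ y').trans (le_of_eq ?_)) hN.le)
            congr 2
            ring
          have : src f l (x + lam * s) (y + c l * s) - src g l (x + lam * s) (y + c l * s) =
              ∑ a, (A l a (y + c l * s) * (f (a, x + lam * s, y + c l * s) -
                g (a, x + lam * s, y + c l * s)) + H l a (x + lam * s) (y + c l * s) *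
                (f (a, x + lam * s, x + lam * s) - g (a, x + lam * s, x + lam * s))) := by
            simp only [src, add_sub_add_right_eq_sub, ← sum_sub_distrib]
            exact sum_congr rfl fun a _ => by ring
          rw [this]
          refine (abs_sum_le_sum_abs _ _).trans ?_
          calc _ ≤ ∑ _a : J, (M * (N * (R * exp (β * (1 - x) - β * lam * s))) +
                M * (N * (R * exp (β * (1 - x) - β * lam * s)))) :=
                sum_le_sum fun a _ => (abs_add_le _ _).trans (add_le_add
                  (by rw [abs_mul]; exact mul_le_mul (hAM _ _ _) (hb _ _) (abs_nonneg _) hM)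
                  (by rw [abs_mul]; exact mul_le_mul (hHM _ _ _ _) (hb _ _) (abs_nonneg _) hM))
            _ = _ := by simp [hn]; ring
        have hcont : Continuous fun s =>
            2 * n * M * (N * R) * exp (β * (1 - x) - β * lam * s) := by fun_prop
        rw [← Real.norm_eq_abs]
        refine (intervalIntegral.norm_integral_le_of_norm_le hσ0 (ae_of_all _ fun s hs =>
          hm s ⟨hs.1.le, hs.2⟩) (hcont.intervalIntegrable _ _)).trans ?_
        rw [intervalIntegral.integral_const_mul]
        have h1 := integral_exp_sub_mul_le (c := β * (1 - x)) (a := σ l x y)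
          (by positivity : 0 < β * lam)
        calc _ ≤ 2 * n * M * (N * R) * (E / (β * lam)) :=
              mul_le_mul_of_nonneg_left h1 (by positivity)
          _ = (2 * n * M * R / (β * lam)) * (N * E) := by ring
          _ ≤ 1 / 4 * (N * E) := by
              refine mul_le_mul_of_nonneg_right ?_ (by positivity)
              rw [div_le_iff₀ (by positivity), hβ]
              have : (8 * n * M * R / lam + 1) * lam = 8 * n * M * R + lam := by field_simp
              rw [this]; linarith
          _ ≤ 1 / 4 * (N * (ρ l * E)) := by
              have := le_mul_of_one_le_left hE0.le (hρ1 l)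
              gcongr
          _ = _ := by ring
      rw [e]
      refine (abs_sub _ _).trans ((add_le_add e1 e2).trans (le_of_eq ?_))
      simp only [ω]
      ring)
  have hfix : ∀ l x y, f (l, x, y) = if (x, y) ∈ T then Ψ f l x y else 0 := fun l x y =>
    (congrFun hf (l, x, y)).symm
  refine ⟨fun l x y => f (l, x, y), hsec f hfm, ⟨|N| * (R * exp β), fun l x y => ?_⟩,
    fun l x y s hxy hs hxs => ?_, fun l x y hxy h0 => ?_⟩
  · by_cases hp : (x, y) ∈ T
    · refine (hfN _).trans (mul_le_mul (le_abs_self _) ((hωR l x y).trans ?_) (hω _).le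
        (abs_nonneg _))
      refine mul_le_mul_of_nonneg_left (exp_le_exp.2 ?_) (by linarith)
      nlinarith [hp.1]
    · refine (congrArg abs ((hfix l x y).trans (if_neg hp))).le.trans ?_
      rw [abs_zero]
      positivity
  · have hTf : ∀ x y, InTriangle x y → f (l, x, y) = Ψ f l x y := fun x y hxy =>
      (hfix l x y).trans (if_pos hxy)
    obtain ⟨h1, h2⟩ := hσadd l x y s hxy hs hxs
    have e1 : x + lam * s + lam * (σ l x y - s) = x + lam * σ l x y := by ring
    have e2 : y + c l * s + c l * (σ l x y - s) = y + c l * σ l x y := by ring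
    have hi := hint f hfm ⟨N, hfN⟩ l x y hxy
    change f (l, _, _) = f (l, x, y) + _
    rw [hTf _ _ hxs, hTf _ _ hxy]
    simp only [Ψ, h2, e1, e2, hDadd l _ x y s hxy hs hxs, hdadd l x y s hxy hs hxs]
    have i1 := hi.mono_set (c := 0) (d := s) (by
      rw [uIcc_of_le hs, uIcc_of_le (hs.trans h1)]; exact Icc_subset_Icc_right h1)
    have i2 := hi.mono_set (c := s) (d := σ l x y) (by
      rw [uIcc_of_le h1, uIcc_of_le (hs.trans h1)]; exact Icc_subset_Icc_left hs)
    rw [← integral_add_adjacent_intervals i1 i2]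
    have h3 := intervalIntegral.integral_comp_add_right (a := 0) (b := σ l x y - s)
      (fun r => src f l (x + lam * r) (y + c l * r)) s
    rw [zero_add, sub_add_cancel] at h3
    rw [← h3]
    have h4 : ∀ r, src f l (x + lam * s + lam * r) (y + c l * s + c l * r) =
        src f l (x + lam * (r + s)) (y + c l * (r + s)) := fun r => by congr 1 <;> ring
    simp only [h4]
    simp only [src]
    ring
  · have := (hfix l x y).trans (if_pos hxy)
    simpa only [Ψ, h0, mul_zero, add_zero, integral_same, sub_zero] using this

/-- Recursive construction of rows, from the last one upwards. -/
theorem exists_rows {n : ℕ} {X : Type*} [Nonempty X] (P : Fin n → (Fin n → X) → Prop)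
    (hcongr : ∀ k f g, (∀ j, k ≤ j → f j = g j) → P k f → P k g)
    (hstep : ∀ k f, (∀ j, k < j → P j f) → ∃ a, P k (Function.update f k a)) :
    ∃ f, ∀ k, P k f := by
  have claim : ∀ d ≤ n, ∃ f, ∀ k : Fin n, n - d ≤ k.1 → P k f := by
    intro d
    induction d with
    | zero => exact fun _ => ⟨fun _ => Classical.arbitrary X, fun k hk => absurd k.2 (by omega)⟩
    | succ d ih =>
      intro hd
      obtain ⟨f, hf⟩ := ih (by omega)
      let k : Fin n := ⟨n - (d + 1), by omega⟩
      obtain ⟨a, ha⟩ := hstep k f fun j hj => hf j (by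
        have : n - (d + 1) < j.1 := hj
        omega)
      refine ⟨Function.update f k a, fun j hj => ?_⟩
      rcases (show k ≤ j from hj).eq_or_lt with rfl | hlt
      · exact ha
      · refine hcongr j f _ (fun l hl => ?_) (hf j (by
          have : n - (d + 1) < j.1 := hlt
          omega))
        rw [Function.update_of_ne (hlt.trans_le hl).ne']
  obtain ⟨f, hf⟩ := claim n le_rfl
  exact ⟨f, fun k => hf k (by omega)⟩

/-- The rows `f j` below row `k`, completed by zero rows. -/
theorem exists_cutoff {n : ℕ} {L : Type*} [Finite L] {f : Fin n → L → ℝ → ℝ → ℝ} {k : Fin n}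
    (hm : ∀ j, k < j → ∀ l, Measurable fun p : ℝ × ℝ => f j l p.1 p.2)
    (hb : ∀ j, k < j → ∃ B, ∀ l x y, |f j l x y| ≤ B) :
    ∃ F : Fin n → L → ℝ → ℝ → ℝ, (∀ j l, Measurable fun p : ℝ × ℝ => F j l p.1 p.2) ∧
      (∃ M, 0 < M ∧ ∀ j l x y, |F j l x y| ≤ M) ∧
      ∀ j l x y, F j l x y = if k < j then f j l x y else 0 := by
  refine ⟨fun j l x y => if k < j then f j l x y else 0, fun j l => ?_, ?_, fun _ _ _ _ => rfl⟩
  · dsimp only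
    split_ifs with hj
    · exact hm j hj l
    · exact measurable_const
  · obtain ⟨M, h0, hM⟩ := exists_bound_of_finite (X := L × ℝ × ℝ)
      (f := fun j q => if k < j then f j q.1 q.2.1 q.2.2 else 0) fun j => by
        split_ifs with hj
        · exact (hb j hj).imp fun B hB q => hB _ _ _
        · exact ⟨0, fun q => abs_zero.le⟩
    exact ⟨M, h0, fun j l x y => hM j (l, x, y)⟩

theorem mem_Icc_add_mul {x c r s : ℝ} (h : x ∈ Icc 0 1) (h' : x + c * s ∈ Icc 0 1)
    (h0 : 0 ≤ r) (hr : r ≤ s) : x + c * r ∈ Icc 0 1 := by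
  rcases le_total c 0 with hc | hc
  · have := mul_nonpos_of_nonpos_of_nonneg hc h0
    have := mul_le_mul_of_nonpos_left hr hc
    constructor <;> linarith [h.1, h.2, h'.1, h'.2]
  · have := mul_nonneg hc h0
    have := mul_le_mul_of_nonneg_left hr hc
    constructor <;> linarith [h.1, h.2, h'.1, h'.2]

/-- A characteristic of speed `(lam, c)` leaves the triangle through the diagonal, not through the
side `y = 1`. -/
def ViaDiag (lam c x y : ℝ) : Prop := c < lam ∧ (c ≤ 0 ∨ (y - x) / (lam - c) ≤ (1 - y) / c)

open Classical in
/-- The time after which a characteristic of speed `(lam, c)` leaves the triangle. -/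
def exitTime (lam c x y : ℝ) : ℝ := if ViaDiag lam c x y then (y - x) / (lam - c) else (1 - y) / c

theorem measurableSet_viaDiag (lam c : ℝ) : MeasurableSet {p : ℝ × ℝ | ViaDiag lam c p.1 p.2} := by
  unfold ViaDiag
  by_cases h1 : c < lam
  · by_cases h2 : c ≤ 0
    · simp [h1, h2]
    · simp only [h1, h2, true_and, false_or]
      exact measurableSet_le (by fun_prop) (by fun_prop)
  · simp [h1]

theorem measurable_exitTime (lam c : ℝ) : Measurable fun p : ℝ × ℝ => exitTime lam c p.1 p.2 :=
  Measurable.ite (measurableSet_viaDiag lam c) (by fun_prop) (by fun_prop)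

theorem pos_of_not_viaDiag {lam c x y : ℝ} (hlam : 0 < lam) (h : ¬ ViaDiag lam c x y) : 0 < c := by
  unfold ViaDiag at h
  by_contra hc
  exact h ⟨by linarith, Or.inl (not_lt.1 hc)⟩

theorem exitTime_nonneg {lam c x y : ℝ} (hlam : 0 < lam) (hT : InTriangle x y) :
    0 ≤ exitTime lam c x y := by
  unfold exitTime
  split_ifs with h
  · exact div_nonneg (by linarith [hT.2.1]) (by linarith [h.1])
  · exact div_nonneg (by linarith [hT.2.2]) (pos_of_not_viaDiag hlam h).le

theorem inTriangle_add {lam c x y s : ℝ} (hlam : 0 < lam) (hT : InTriangle x y) (hs : 0 ≤ s)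
    (hsσ : s ≤ exitTime lam c x y) : InTriangle (x + lam * s) (y + c * s) := by
  have h0 := mul_nonneg hlam.le hs
  refine ⟨by linarith [hT.1], ?_, ?_⟩
  · rcases le_or_gt lam c with h | h
    · linarith [mul_le_mul_of_nonneg_right h hs, hT.2.1]
    · have : s ≤ (y - x) / (lam - c) := by
        refine hsσ.trans ?_
        unfold exitTime
        split_ifs with hv
        · exact le_rfl
        · unfold ViaDiag at hv
          push Not at hv
          exact (hv h).2.le
      rw [le_div_iff₀ (by linarith)] at this
      linarith
  · rcases le_or_gt c 0 with h | h
    · linarith [mul_nonpos_of_nonpos_of_nonneg h hs, hT.2.2]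
    · have : s ≤ (1 - y) / c := by
        refine hsσ.trans ?_
        unfold exitTime
        split_ifs with hv
        · exact hv.2.resolve_left (not_le.2 h)
        · exact le_rfl
      rw [le_div_iff₀ h] at this
      linarith

theorem viaDiag_add {lam c x y s : ℝ} :
    ViaDiag lam c (x + lam * s) (y + c * s) ↔ ViaDiag lam c x y := by
  unfold ViaDiag
  refine and_congr_right fun h => or_congr_right' fun hc => ?_
  have h1 : lam - c ≠ 0 := by linarith
  have h2 : c ≠ 0 := by linarith [not_le.1 hc]
  have e1 : (y + c * s - (x + lam * s)) / (lam - c) = (y - x) / (lam - c) - s := by field_simp; ring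
  have e2 : (1 - (y + c * s)) / c = (1 - y) / c - s := by field_simp; ring
  rw [e1, e2, sub_le_sub_iff_right]

theorem exitTime_add {lam c x y s : ℝ} (hlam : 0 < lam) :
    exitTime lam c (x + lam * s) (y + c * s) = exitTime lam c x y - s := by
  unfold exitTime
  by_cases h : ViaDiag lam c x y
  · rw [if_pos h, if_pos (viaDiag_add.2 h)]
    have h1 : lam - c ≠ 0 := by linarith [h.1]
    field_simp; ring
  · rw [if_neg h, if_neg (mt viaDiag_add.1 h)]
    have h2 := (pos_of_not_viaDiag hlam h).ne'
    field_simp; ring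

namespace Chain

variable (C : Chain) (i : ℕ)

/-- The speed of propagation in `y` of the components of a row of `(K^{uu}, K^{uv})`. -/
def rowSpeed : C.Comp i → ℝ := Sum.elim (C.lam i) fun l => -C.mu i l

/-- The right-hand side of the kernel equations for row `k`; `f k` stands for row `k` of
`(K^{uu}, K^{uv})`. -/
def rowSource (f : Fin (C.n i) → C.Comp i → ℝ → ℝ → ℝ) (k : Fin (C.n i))
    (l : C.Comp i) (x y : ℝ) : ℝ :=
  ∑ a, -C.block i y a l * f k a x y +
    ∑ j, if k < j then (C.Spp i (clamp x) k j + (C.lam i j - C.lam i k) * f k (Sum.inl j) x x) *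
      f j l x y else 0

/-- Row `k` of the kernel equations of subsystem `i`, given the rows below. -/
structure IsRow (k : Fin (C.n i)) (f : Fin (C.n i) → C.Comp i → ℝ → ℝ → ℝ) : Prop where
  meas : ∀ l, Measurable fun p : ℝ × ℝ => f k l p.1 p.2
  bdd : ∃ B, ∀ l x y, |f k l x y| ≤ B
  char : ∀ l x y s, InTriangle x y → 0 ≤ s →
    InTriangle (x + C.lam i k * s) (y + C.rowSpeed i l * s) →
    f k l (x + C.lam i k * s) (y + C.rowSpeed i l * s) = f k l x y +
      ∫ r in 0..s, C.rowSource i f k l (x + C.lam i k * r) (y + C.rowSpeed i l * r)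
  diag : ∀ l, C.rowSpeed i l < C.lam i k → ∀ x ∈ Icc (0 : ℝ) 1,
    f k l x x = Sum.elim (C.Spp i x k) (C.Spm i x k) l / (C.lam i k - C.rowSpeed i l)
  right : ∀ l x, x ∈ Icc 0 1 → x < 1 ∨ k ≤ l →
    f k (Sum.inl l) x 1 * C.lam i l = ∑ a, f k (Sum.inr a) x 1 * C.mu i a * C.Rd i a l

variable {C} {i}

theorem IsRow.congr {k : Fin (C.n i)} {f g : Fin (C.n i) → C.Comp i → ℝ → ℝ → ℝ}
    (h : ∀ j, k ≤ j → f j = g j) (hf : C.IsRow i k f) : C.IsRow i k g := by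
  have e : C.rowSource i f k = C.rowSource i g k := by
    funext l x y
    unfold rowSource
    rw [h k le_rfl]
    congr 1
    refine sum_congr rfl fun j _ => ?_
    split_ifs with hj
    · rw [h j hj.le]
    · rfl
  refine ⟨?_, ?_, ?_, ?_, ?_⟩ <;> rw [← h k le_rfl]
  · exact hf.meas
  · exact hf.bdd
  · rw [← e]; exact hf.char
  · exact hf.diag
  · exact hf.right

theorem exists_isRow (hC : C.Standing) (hi : i ∈ Finset.Icc 1 C.N) (k : Fin (C.n i))
    (f : Fin (C.n i) → C.Comp i → ℝ → ℝ → ℝ)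
    (hf : ∀ j, k < j → C.IsRow i j f) : ∃ g, C.IsRow i k (Function.update f k g) := by
  classical
  set lam := C.lam i k with hlam_def
  have hlam : 0 < lam := hC.lam_pos i hi k
  set c := C.rowSpeed i with hc_def
  let σ : C.Comp i → ℝ → ℝ → ℝ := fun l => exitTime lam (c l)
  obtain ⟨F, hFm, ⟨MF, hMF, hFM⟩, hF⟩ := exists_cutoff (k := k) (fun j hj => (hf j hj).meas)
    fun j hj => (hf j hj).bdd
  let D₀ : C.Comp i → C.Comp i → ℝ := Sum.elim
    (fun l => Sum.elim 0 fun a => C.mu i a * C.Rd i a l / C.lam i l) 0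
  obtain ⟨M1, hM1, h1⟩ := exists_bound_block hC hi
  obtain ⟨M2, hM2, h2⟩ := exists_bound_of_finite (X := Unit) (f := fun a _ => c a - lam)
    fun _ => ⟨_, fun _ => le_rfl⟩
  obtain ⟨M3, hM3, h3⟩ := exists_bound_of_finite (X := Unit) (f := fun a _ => (lam - c a)⁻¹)
    fun _ => ⟨_, fun _ => le_rfl⟩
  obtain ⟨M4, hM4, h4⟩ := exists_bound_of_finite (X := Unit)
    (f := fun (p : C.Comp i × C.Comp i) _ => D₀ p.1 p.2)
    fun _ => ⟨_, fun _ => le_rfl⟩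
  have m1 := mul_pos hM2 hMF
  have m2 := mul_nonneg (C.n i).cast_nonneg (mul_pos hM1 hMF).le
  have m3 := mul_pos hM1 hM3
  have cb := fun a l => (continuous_block hC hi a l).measurable
  have hσm : ∀ l, Measurable fun p : ℝ × ℝ => σ l p.1 p.2 := fun l => measurable_exitTime _ _
  obtain ⟨g, hgm, hgb, hgc, hgx⟩ := exists_row (c := c) (σ := σ)
    (A := fun l a y => -C.block i y a l)
    (H := fun l a x y => (c a - lam) * Sum.elim (fun j => F j l x y) 0 a)
    (h := fun l x y => ∑ j, C.block i x (Sum.inl k) (Sum.inl j) * F j l x y)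
    (D := fun l a x y => if ViaDiag lam (c l) x y then 0 else D₀ l a)
    (d := fun l x y => if ViaDiag lam (c l) x y then
      C.block i (x + lam * σ l x y) (Sum.inl k) l * (lam - c l)⁻¹ else 0)
    (M := M1 + M2 * MF + C.n i * (M1 * MF) + M4 + M1 * M3) hlam (by positivity)
    (fun l => l.isLeft = true) hσm
    (fun l x y hT => exitTime_nonneg hlam hT) (fun l x y s hT h0 hs => inTriangle_add hlam hT h0 hs)
    (fun l a => (cb a l).neg) (fun l a y => by rw [abs_neg]; linarith [h1 a l y])
    (fun l a => by
      rcases a with j | j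
      · exact (hFm j l).const_mul _
      · exact measurable_const.const_mul _)
    (fun l a x y => by
      rw [abs_mul]
      have : |Sum.elim (fun j => F j l x y) 0 a| ≤ MF := by
        rcases a with j | j
        · exact hFM j l x y
        · exact abs_zero.trans_le hMF.le
      linarith [mul_le_mul (h2 a ()) this (abs_nonneg _) hM2.le])
    (fun l a => Measurable.ite (measurableSet_viaDiag _ _) measurable_const measurable_const)
    (fun l a x y => by
      split_ifs
      · rw [abs_zero]; positivity
      · linarith [h4 (l, a) ()])
    (by
      rintro (l | l) (a | a) x y hS
      · simp [D₀]
      · simp at hS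
      · simp [D₀]
      · simp [D₀])
    (fun l => measurable_sum _ fun j _ => ((cb _ _).comp measurable_fst).mul (hFm j l))
    (fun l x y => by
      have : ∑ _j : Fin (C.n i), M1 * MF = C.n i * (M1 * MF) := by simp
      refine ((abs_sum_le_sum_abs _ _).trans (sum_le_sum fun j _ => (abs_mul _ _).trans_le
        (mul_le_mul (h1 _ _ _) (hFM j l x y) (abs_nonneg _) hM1.le))).trans ?_
      linarith)
    (fun l => Measurable.ite (measurableSet_viaDiag _ _)
      (((cb _ _).comp (measurable_fst.add ((hσm l).const_mul _))).mul_const _) measurable_const)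
    (fun l x y => by
      split_ifs
      · rw [abs_mul]
        linarith [mul_le_mul (h1 (Sum.inl k) l (x + lam * σ l x y)) (h3 l ()) (abs_nonneg _) hM1.le]
      · rw [abs_zero]; positivity)
    (fun l x y s hT h0 hT' => by
      have e := exitTime_add (c := c l) (x := x) (y := y) (s := s) hlam
      have := exitTime_nonneg (c := c l) hlam hT'
      exact ⟨by simp only [σ]; linarith, e⟩)
    (fun l a x y s _ _ _ => by simp only [viaDiag_add])
    (fun l x y s _ _ _ => by
      simp only [viaDiag_add, σ, exitTime_add hlam]
      rw [show x + lam * s + lam * (exitTime lam (c l) x y - s) =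
        x + lam * exitTime lam (c l) x y by ring])
  have hup : Function.update f k g k = g := Function.update_self ..
  have hne : ∀ j, k < j → Function.update f k g j = f j := fun j hj =>
    Function.update_of_ne hj.ne' _ _
  refine ⟨g, ?_, ?_, ?_, ?_, ?_⟩ <;> simp only [hup]
  · exact hgm
  · exact hgb
  · intro l x y s hT h0 hT'
    rw [hgc l x y s hT h0 hT']
    congr 1
    refine integral_congr fun r _ => ?_
    simp only [rowSource, hup]
    rw [sum_add_distrib, add_assoc]
    congr 1
    simp only [Fintype.sum_sum_type, Sum.elim_inl, Sum.elim_inr, Pi.zero_apply, mul_zero, zero_mul,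
      sum_const_zero, add_zero, ← sum_add_distrib, hF]
    refine sum_congr rfl fun j _ => ?_
    split_ifs with hj
    · rw [hne j hj]
      simp only [block, Matrix.fromBlocks_apply₁₁, hc_def, rowSpeed, Sum.elim_inl]
      ring
    · ring
  · intro l hl x hx
    have hv : ViaDiag lam (c l) x x := by
      refine ⟨hl, ?_⟩
      rcases le_or_gt (c l) 0 with h | h
      · exact Or.inl h
      · right
        rw [sub_self, zero_div]
        exact div_nonneg (by linarith [hx.2]) h.le
    have h0 : σ l x x = 0 := by simp only [σ, exitTime, if_pos hv, sub_self, zero_div]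
    rw [hgx l x x ⟨hx.1, le_rfl, hx.2⟩ h0]
    simp only [if_pos hv, zero_mul, sum_const_zero, zero_add, h0, mul_zero, add_zero, block,
      clamp_of_mem hx, div_eq_mul_inv]
    rcases l with l | l <;> rfl
  · intro l x hx hxl
    have hl := hC.lam_pos i hi l
    have hcl : c (Sum.inl l) = C.lam i l := rfl
    have hv : ¬ ViaDiag lam (c (Sum.inl l)) x 1 := by
      rintro ⟨h1, h2⟩
      rw [hcl] at h1 h2
      have hlk : ¬ k ≤ l := fun h => by
        linarith [(hC.lam_mono i hi).monotone h]
      rcases h2 with h2 | h2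
      · linarith
      · rw [sub_self, zero_div, div_le_iff₀ (by linarith), zero_mul] at h2
        have := hxl.resolve_right hlk
        linarith
    have h0 : σ (Sum.inl l) x 1 = 0 := by simp only [σ, exitTime, if_neg hv, sub_self, zero_div]
    rw [hgx (Sum.inl l) x 1 ⟨hx.1, hx.2, le_rfl⟩ h0]
    simp only [D₀, if_neg hv, add_zero, Fintype.sum_sum_type, Sum.elim_inl, Sum.elim_inr,
      Pi.zero_apply, zero_mul, sum_const_zero, zero_add, sum_mul]
    refine sum_congr rfl fun a _ => ?_
    field_simp

end Chain

namespace Chain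

variable {C : Chain} {i : ℕ}

/-- Row `k` of the equations of the kernel `F`, for given `G` and boundary values `φ` at `y = 0`. -/
structure IsFRow (i : ℕ) (G : ℝ → Matrix (Fin (C.n i)) (Fin (C.n i)) ℝ)
    (φ : ℝ → Matrix (Fin (C.n i)) (Fin (C.m (i + 1))) ℝ) (k : Fin (C.n i))
    (f : Fin (C.n i) → Fin (C.m (i + 1)) → ℝ → ℝ → ℝ) : Prop where
  meas : ∀ l, Measurable fun p : ℝ × ℝ => f k l p.1 p.2
  bdd : ∃ B, ∀ l x y, |f k l x y| ≤ B
  char : ∀ l x y s, 0 ≤ x → 0 ≤ y → y ≤ x / C.lam1 i → 0 ≤ s → x + C.lam i k * s ≤ 1 →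
    f k l (x + C.lam i k * s) (y + s) = f k l x y +
      ∫ r in 0..s, ∑ j, G (x + C.lam i k * r) k j * f j l (x + C.lam i k * r) (y + r)
  init : ∀ l, ∀ x ∈ Icc (0 : ℝ) 1, 0 < x ∨ k = C.fst i → f k l x 0 = φ x k l
  hyp : ∀ l, k ≠ C.fst i → ∀ x ∈ Icc (0 : ℝ) 1, f k l x (x / C.lam1 i) = 0

theorem exists_isFRow (hC : C.Standing) (hi : i ∈ Finset.Icc 1 C.N)
    {G : ℝ → Matrix (Fin (C.n i)) (Fin (C.n i)) ℝ}
    {φ : ℝ → Matrix (Fin (C.n i)) (Fin (C.m (i + 1))) ℝ} {M : ℝ} (hM : 0 ≤ M)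
    (hG : ∀ x k j, ¬ k < j → G x k j = 0) (hGm : ∀ k j, Measurable fun x => G x k j)
    (hGM : ∀ x k j, |G x k j| ≤ M) (hφm : ∀ k l, Measurable fun x => φ x k l)
    (hφM : ∀ x k l, |φ x k l| ≤ M) (k : Fin (C.n i))
    (f : Fin (C.n i) → Fin (C.m (i + 1)) → ℝ → ℝ → ℝ) (hf : ∀ j, k < j → C.IsFRow i G φ j f) :
    ∃ g, C.IsFRow i G φ k (Function.update f k g) := by
  classical
  set lam := C.lam i k with hlam
  set lam1 := C.lam1 i with hlam1
  have h1 : 0 < lam1 := lam1_pos hC hi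
  have hle : lam1 ≤ lam := lam1_le hC hi k
  have hlt : k ≠ C.fst i → lam1 < lam := fun hk =>
    hC.lam_mono i hi (lt_of_le_of_ne (Nat.zero_le _) (fun h => hk h.symm))
  obtain ⟨F, hFm, ⟨MF, hMF, hFM⟩, hF⟩ := exists_cutoff (k := k) (fun j hj => (hf j hj).meas)
    fun j hj => (hf j hj).bdd
  -- the source, in terms of the known rows
  let src : Fin (C.m (i + 1)) → ℝ → ℝ → ℝ := fun l x y => ∑ j, G x k j * F j l x y
  have hsrcm : ∀ l, Measurable fun p : ℝ × ℝ => src l p.1 p.2 := fun l =>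
    measurable_sum _ fun j _ => ((hGm k j).comp measurable_fst).mul (hFm j l)
  set B := ∑ _j : Fin (C.n i), M * MF
  have hB0 : 0 ≤ B := by positivity
  have hB : ∀ l (q : ℝ × ℝ), |src l q.1 q.2| ≤ B := fun l q => (abs_sum_le_sum_abs _ _).trans
    (sum_le_sum fun j _ => (abs_mul _ _).trans_le
      (mul_le_mul (hGM _ _ _) (hFM _ _ _ _) (abs_nonneg _) hM))
  -- the backward characteristic ends at `y = 0`, or on the line `y = x / lam1`
  let P : ℝ → ℝ → Prop := fun x y => 0 < x - lam * y ∨ k = C.fst i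
  let σ : ℝ → ℝ → ℝ := fun x y => if P x y then y else (x - lam1 * y) / (lam - lam1)
  let Dom : Set (ℝ × ℝ) := {p | p.1 ∈ Icc 0 1 ∧ 0 ≤ p.2 ∧ p.2 ≤ p.1 / lam1}
  have hPm : MeasurableSet {p : ℝ × ℝ | P p.1 p.2} := (measurableSet_lt measurable_const
      (by fun_prop : Measurable fun p : ℝ × ℝ => p.1 - lam * p.2)).union (MeasurableSet.const _)
  have hDm : MeasurableSet Dom := (measurable_fst measurableSet_Icc).inter
    ((measurableSet_le measurable_const measurable_snd).inter
      (measurableSet_le measurable_snd (by fun_prop)))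
  have hσm : Measurable fun p : ℝ × ℝ => σ p.1 p.2 :=
    Measurable.ite hPm measurable_snd (by fun_prop)
  let g : Fin (C.m (i + 1)) → ℝ → ℝ → ℝ := fun l x y => if (x, y) ∈ Dom then
    (if P x y then φ (x - lam * y) k l else 0) +
      ∫ r in 0..σ x y, src l (x - lam * σ x y + lam * r) (y - σ x y + r) else 0
  have hσ : ∀ x y, (x, y) ∈ Dom → 0 ≤ σ x y ∧ σ x y ≤ 1 / lam1 := by
    rintro x y ⟨⟨hx0, hx1⟩, hy0, hy1⟩
    have hy2 : y ≤ 1 / lam1 := hy1.trans (div_le_div_of_nonneg_right hx1 h1.le)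
    simp only [σ]
    split_ifs with hp
    · exact ⟨hy0, hy2⟩
    · simp only [P, not_or, not_lt] at hp
      have h2 := hlt hp.2
      have hy3 := (le_div_iff₀ h1).1 hy1
      refine ⟨div_nonneg (by linarith) (by linarith), le_trans ?_ hy2⟩
      rw [div_le_iff₀ (by linarith)]
      linarith [hp.1]
  have hup : Function.update f k g k = g := Function.update_self ..
  have hsrc : ∀ l x y, ∑ j, G x k j * Function.update f k g j l x y = src l x y := fun l x y =>
    sum_congr rfl fun j _ => by
      by_cases hj : k < j
      · rw [Function.update_of_ne hj.ne', hF, if_pos hj]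
      · rw [hG _ _ _ hj, zero_mul, zero_mul]
  refine ⟨g, ?_, ?_, ?_, ?_, ?_⟩ <;> simp only [hup]
  · intro l
    refine Measurable.ite hDm (Measurable.add (Measurable.ite hPm ?_ measurable_const) ?_)
      measurable_const
    · exact (hφm k l).comp (by fun_prop : Measurable fun p : ℝ × ℝ => p.1 - lam * p.2)
    · refine measurable_intervalIntegral (α := ℝ × ℝ) ?_ measurable_const hσm
      have hσ' : Measurable fun p : (ℝ × ℝ) × ℝ => σ p.1.1 p.1.2 := hσm.comp measurable_fst
      have e : Measurable fun p : (ℝ × ℝ) × ℝ =>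
          (p.1.1 - lam * σ p.1.1 p.1.2 + lam * p.2, p.1.2 - σ p.1.1 p.1.2 + p.2) :=
        (((by fun_prop : Measurable fun p : (ℝ × ℝ) × ℝ => p.1.1).sub (hσ'.const_mul _)).add
          (measurable_snd.const_mul _)).prodMk
          (((by fun_prop : Measurable fun p : (ℝ × ℝ) × ℝ => p.1.2).sub hσ').add measurable_snd)
      exact (hsrcm l).comp e
  · refine ⟨M + B * (1 / lam1), fun l x y => ?_⟩
    have hp : 0 ≤ M + B * (1 / lam1) := by positivity
    simp only [g]
    split_ifs with hd hv
    · refine (abs_add_le _ _).trans (add_le_add (hφM _ _ _) ?_)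
      refine (abs_intervalIntegral_le (hσ x y hd).1 fun r _ => hB l (_, _)).trans ?_
      rw [sub_zero]
      exact mul_le_mul_of_nonneg_left (hσ x y hd).2 hB0
    · rw [zero_add]
      refine (abs_intervalIntegral_le (hσ x y hd).1 fun r _ => hB l (_, _)).trans ?_
      rw [sub_zero]
      have := mul_le_mul_of_nonneg_left (hσ x y hd).2 hB0
      linarith
    · rwa [abs_zero]
  · intro l x y s hx hy hyx hs hxs
    simp only [hsrc]
    simp only [← hlam, ← hlam1] at hxs hyx ⊢
    have h0 : 0 ≤ lam * s := mul_nonneg (by linarith) hs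
    have hd : (x, y) ∈ Dom := ⟨⟨hx, by linarith⟩, hy, hyx⟩
    have hd' : (x + lam * s, y + s) ∈ Dom := by
      refine ⟨⟨by simp only; linarith, hxs⟩, by simp only; linarith, ?_⟩
      simp only
      rw [le_div_iff₀ h1] at hyx ⊢
      linarith [mul_le_mul_of_nonneg_right hle hs]
    have hPe : P (x + lam * s) (y + s) = P x y := by
      simp only [P]
      rw [show x + lam * s - lam * (y + s) = x - lam * y by ring]
    have hσe : σ (x + lam * s) (y + s) = σ x y + s := by
      simp only [σ, hPe]
      split_ifs with hp
      · rfl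
      · simp only [P, not_or, not_lt] at hp
        have h2 : lam - lam1 ≠ 0 := by linarith [hlt hp.2]
        field_simp; ring
    have hi : ∀ a b, IntervalIntegrable (fun r => src l (x - lam * σ x y + lam * r) (y - σ x y + r))
        volume a b := fun a b => intervalIntegrable_of_abs_le (M := B)
      ((hsrcm l).comp (by fun_prop : Measurable fun r : ℝ =>
        (x - lam * σ x y + lam * r, y - σ x y + r))) fun r _ => hB l (_, _)
    have h2 := intervalIntegral.integral_comp_add_right (a := 0) (b := s)
      (fun r => src l (x - lam * σ x y + lam * r) (y - σ x y + r)) (σ x y)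
    simp only [zero_add] at h2
    have h3 : ∀ r, src l (x - lam * σ x y + lam * (r + σ x y)) (y - σ x y + (r + σ x y)) =
        src l (x + lam * r) (y + r) := fun r => by congr 1 <;> ring
    simp only [h3] at h2
    simp only [g, if_pos hd, if_pos hd', hPe, hσe]
    rw [show x + lam * s - lam * (σ x y + s) = x - lam * σ x y by ring,
      show y + s - (σ x y + s) = y - σ x y by ring,
      show x + lam * s - lam * (y + s) = x - lam * y by ring, h2, add_comm (σ x y) s,
      ← integral_add_adjacent_intervals (hi 0 (σ x y)) (hi _ (s + σ x y)),
      ← add_assoc]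
  · intro l x hx hxk
    have hd : (x, (0 : ℝ)) ∈ Dom := ⟨hx, le_rfl, div_nonneg hx.1 h1.le⟩
    have hp : P x 0 := by simpa [P] using hxk
    simp only [g, if_pos hd, if_pos hp, σ, mul_zero, sub_zero, integral_same, add_zero]
  · intro l hk x hx
    simp only [← hlam1]
    have hd : (x, x / lam1) ∈ Dom := ⟨hx, div_nonneg hx.1 h1.le, le_rfl⟩
    have hp : ¬ P x (x / lam1) := by
      simp only [P, hk, or_false, not_lt, sub_nonpos]
      rw [← mul_div_assoc, le_div_iff₀ h1, mul_comm]
      exact mul_le_mul_of_nonneg_right hle hx.1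
    have h0 : σ x (x / lam1) = 0 := by
      simp only [σ, if_neg hp]
      rw [mul_div_cancel₀ _ h1.ne', sub_self, zero_div]
    simp only [g, if_pos hd, if_neg hp, h0, integral_same, add_zero]

theorem IsFRow.congr {G : ℝ → Matrix (Fin (C.n i)) (Fin (C.n i)) ℝ}
    {φ : ℝ → Matrix (Fin (C.n i)) (Fin (C.m (i + 1))) ℝ} (hG : ∀ x k j, ¬ k < j → G x k j = 0)
    {k : Fin (C.n i)} {f g : Fin (C.n i) → Fin (C.m (i + 1)) → ℝ → ℝ → ℝ}
    (h : ∀ j, k ≤ j → f j = g j) (hf : C.IsFRow i G φ k f) : C.IsFRow i G φ k g := by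
  have e : ∀ l x y, ∑ j, G x k j * g j l x y = ∑ j, G x k j * f j l x y := fun l x y =>
    sum_congr rfl fun j _ => by
      by_cases hj : k < j
      · rw [h j hj.le]
      · rw [hG _ _ _ hj, zero_mul, zero_mul]
  refine ⟨?_, ?_, ?_, ?_, ?_⟩ <;> rw [← h k le_rfl]
  · exact hf.meas
  · exact hf.bdd
  · simp only [e]; exact hf.char
  · exact hf.init
  · exact hf.hyp

/-- Row `k` of `(K^{uu}, K^{uv})`. -/
def Kernels.row (D : C.Kernels) (i : ℕ) (k : Fin (C.n i)) (l : C.Comp i)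
    (x y : ℝ) : ℝ := Sum.elim (fun l => D.Kuu i x y k l) (fun l => D.Kuv i x y k l) l

theorem Kernels.integral_rowSource (D : C.Kernels) (k : Fin (C.n i))
    (l : C.Comp i) {x y s : ℝ} (h : InTriangle x y) (hs : 0 ≤ s)
    (h' : InTriangle (x + C.lam i k * s) (y + C.rowSpeed i l * s)) :
    ∫ r in 0..s, C.rowSource i (D.row i) k l (x + C.lam i k * r) (y + C.rowSpeed i l * r) =
      ∫ r in 0..s, (fun X Y => Sum.elim
        ((-(D.Kuu i X Y * C.Spp i Y + D.Kuv i X Y * C.Smp i Y) + D.G i X * D.Kuu i X Y) k)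
        ((-(D.Kuu i X Y * C.Spm i Y + D.Kuv i X Y * C.Smm i Y) + D.G i X * D.Kuv i X Y) k) l)
        (x + C.lam i k * r) (y + C.rowSpeed i l * r) := by
  refine integral_congr_Icc hs fun r hr => ?_
  obtain ⟨a1, a2, a3⟩ := h
  obtain ⟨b1, b2, b3⟩ := h'
  have hx := mem_Icc_add_mul (c := C.lam i k) ⟨a1, a2.trans a3⟩ ⟨b1, b2.trans b3⟩ hr.1 hr.2
  have hy := mem_Icc_add_mul (c := C.rowSpeed i l) ⟨a1.trans a2, a3⟩ ⟨b1.trans b2, b3⟩ hr.1 hr.2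
  rcases l with l | l <;>
  · simp only [Matrix.add_apply, Matrix.neg_apply, Matrix.mul_apply, rowSource, block,
      clamp_of_mem hx, clamp_of_mem hy, Fintype.sum_sum_type, Matrix.fromBlocks_apply₁₁,
      Matrix.fromBlocks_apply₁₂, Matrix.fromBlocks_apply₂₁, Matrix.fromBlocks_apply₂₂, Kernels.G,
      Kernels.row, Sum.elim_inl, Sum.elim_inr, neg_mul, sum_neg_distrib, ite_mul, zero_mul, neg_add]
    simp only [mul_comm]

theorem Kernels.measurable_G (D : C.Kernels) (hC : C.Standing) (hi : i ∈ Finset.Icc 1 C.N)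
    {k j : Fin (C.n i)} (h : Measurable fun p : ℝ × ℝ => D.Kuu i p.1 p.2 k j) :
    Measurable fun x => D.G i (clamp x) k j := by
  unfold Kernels.G
  split_ifs
  · exact (continuous_comp_clamp (hC.Spp_cont i hi) k j).measurable.add ((h.comp
      (continuous_clamp.measurable.prodMk continuous_clamp.measurable)).const_mul _)
  · exact measurable_const

theorem Kernels.exists_bound_G (D : C.Kernels) (hC : C.Standing) (hi : i ∈ Finset.Icc 1 C.N)
    (h : ∀ k, ∃ B, ∀ j x, |D.Kuu i (clamp x) (clamp x) k j| ≤ B) :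
    ∃ M, 0 < M ∧ ∀ k j x, |D.G i (clamp x) k j| ≤ M := by
  obtain ⟨M1, hM1, h1⟩ := exists_bound_block hC hi
  obtain ⟨M, h0, hM⟩ := exists_bound_of_finite (X := ℝ)
    (f := fun (p : Fin (C.n i) × Fin (C.n i)) x => D.G i (clamp x) p.1 p.2) fun p => by
    obtain ⟨B, hB⟩ := h p.1
    refine ⟨M1 + |C.lam i p.2 - C.lam i p.1| * |B|, fun x => ?_⟩
    have hp : 0 ≤ M1 + |C.lam i p.2 - C.lam i p.1| * |B| := by positivity
    unfold Kernels.G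
    split_ifs
    · refine (abs_add_le _ _).trans (add_le_add (h1 (Sum.inl p.1) (Sum.inl p.2) x) ?_)
      rw [abs_mul]
      exact mul_le_mul_of_nonneg_left ((hB _ _).trans (le_abs_self _)) (abs_nonneg _)
    · rwa [abs_zero]
  exact ⟨M, h0, fun k j x => hM (k, j) x⟩

/-- Backstepping kernels exist. -/
theorem exists_kernels (hC : C.Standing) : ∃ D : C.Kernels, D.Solve := by
  classical
  have hrow : ∀ i, i ∈ Finset.Icc 1 C.N → ∃ f, ∀ k, C.IsRow i k f := fun i hi =>
    exists_rows _ (fun k f g h => IsRow.congr h) fun k f hf => exists_isRow hC hi k f hf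
  choose! K hK using hrow
  let D₀ : C.Kernels := ⟨fun i x y => Matrix.of fun k l => K i k (Sum.inl l) x y,
      fun i x y => Matrix.of fun k l => K i k (Sum.inr l) x y, fun _ _ _ => 0⟩
  have hF : ∀ i, i ∈ Finset.Icc 1 C.N → ∃ f, ∀ k, C.IsFRow i (fun x => D₀.G i (clamp x))
      (fun x => -(D₀.Kuv i x 1 * Matrix.diagonal (C.mu i) * C.R i)) k f := by
    intro i hi
    have hGk : ∀ x k j, ¬ k < j → D₀.G i (clamp x) k j = 0 := fun x k j h => by
      simp only [Kernels.G, if_neg h]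
    obtain ⟨M2, hM2, h2⟩ := D₀.exists_bound_G hC hi fun k => (hK i hi k).bdd.imp
      fun B hB j x => hB (Sum.inl j) _ _
    obtain ⟨M3, hM3, h3⟩ := exists_bound_of_finite (X := ℝ)
      (f := fun (p : Fin (C.n i) × Fin (C.m (i + 1))) x =>
        (-(D₀.Kuv i x 1 * Matrix.diagonal (C.mu i) * C.R i)) p.1 p.2) (by
        rintro ⟨k, l⟩
        obtain ⟨B, hB⟩ := (hK i hi k).bdd
        refine ⟨∑ a, B * |C.mu i a| * |C.R i a l|, fun x => ?_⟩
        rw [Matrix.neg_apply, abs_neg, Matrix.mul_apply]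
        refine (abs_sum_le_sum_abs _ _).trans (sum_le_sum fun a _ => ?_)
        rw [Matrix.mul_diagonal, abs_mul, abs_mul]
        exact mul_le_mul_of_nonneg_right (mul_le_mul_of_nonneg_right (hB _ _ _) (abs_nonneg _))
          (abs_nonneg _))
    refine exists_rows _ (fun k f g h => IsFRow.congr hGk h) fun k f hf =>
      exists_isFRow hC hi (M := M2 + M3) (by positivity) hGk
        (fun k j => D₀.measurable_G hC hi ((hK i hi k).meas (Sum.inl j)))
        (fun x k j => by linarith [h2 k j x]) (fun k l => ?_)
        (fun x k l => by linarith [h3 (k, l) x]) k f hf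
    · have e : ∀ x, (-(D₀.Kuv i x 1 * Matrix.diagonal (C.mu i) * C.R i)) k l =
          -∑ a, K i k (Sum.inr a) x 1 * C.mu i a * C.R i a l := fun x => by
        rw [Matrix.neg_apply, Matrix.mul_apply]
        simp only [Matrix.mul_diagonal]
        rfl
      simp only [e]
      refine (measurable_sum _ fun a _ => ((Measurable.mul_const ?_ _).mul_const _)).neg
      exact ((hK i hi k).meas (Sum.inr a)).comp (by fun_prop : Measurable fun x : ℝ => (x, (1 : ℝ)))
  choose! F hF using hF
  let D : C.Kernels := ⟨D₀.Kuu, D₀.Kuv, fun i x y => Matrix.of fun k l => F i k l x y⟩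
  have hGD : ∀ i x, D.G i x = D₀.G i x := fun i x => rfl
  have hIco : ∀ i, i ∈ Finset.Ico 1 C.N → i ∈ Finset.Icc 1 C.N := fun i hi =>
    Finset.Ico_subset_Icc_self hi
  have hK' := fun i hi k => (show D.row i = K i by
    funext k l x y; rcases l with l | l <;> rfl) ▸ (hK i hi k).char
  refine ⟨D, fun i hi k l => (hK i hi k).meas (Sum.inl l), fun i hi k l =>
      (hK i hi k).meas (Sum.inr l),
    fun i hi k l => (hF i (hIco i hi) k).meas l, ?_, ?_, ?_, ?_, ?_, ?_, ?_, ?_, ?_, ?_⟩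
  · obtain ⟨M, _, hM⟩ := exists_bound_of_finite (X := ℝ × ℝ)
      (f := fun (p : Σ i : Finset.Icc 1 C.N, Fin (C.n i) × C.Comp i) q =>
        K p.1 p.2.1 p.2.2 q.1 q.2) fun p => by
      obtain ⟨B, hB⟩ := (hK p.1 p.1.2 p.2.1).bdd
      exact ⟨B, fun q => hB _ _ _⟩
    exact ⟨M, fun i hi x y _ _ _ => ⟨fun k l => hM ⟨⟨i, hi⟩, k, Sum.inl l⟩ (x, y),
      fun k l => hM ⟨⟨i, hi⟩, k, Sum.inr l⟩ (x, y)⟩⟩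
  · obtain ⟨M, _, hM⟩ := exists_bound_of_finite (X := ℝ × ℝ)
      (f := fun (p : Σ i : Finset.Icc 1 C.N, Fin (C.n i) × (Fin (C.m (i + 1)))) q =>
        F p.1 p.2.1 p.2.2 q.1 q.2) fun p => by
      obtain ⟨B, hB⟩ := (hF p.1 p.1.2 p.2.1).bdd
      exact ⟨B, fun q => hB _ _ _⟩
    exact ⟨M, fun i hi x y _ _ _ _ k l => hM ⟨⟨i, hIco i hi⟩, k, l⟩ (x, y)⟩
  · intro i hi k l x y s hx hxy hs h1 h2
    have hk := hC.lam_pos i hi k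
    have hT : InTriangle x y := ⟨hx, hxy, by nlinarith [hC.lam_pos i hi l]⟩
    have hT' : InTriangle (x + C.lam i k * s) (y + C.rowSpeed i (Sum.inl l) * s) :=
      ⟨by positivity, h1, h2⟩
    exact (hK' i hi k (Sum.inl l) x y s hT hs hT').trans
      (congrArg _ (D.integral_rowSource k (Sum.inl l) hT hs hT'))
  · intro i hi k l x y s hx hy hs h1
    have hk := hC.lam_pos i hi k
    have := mul_nonneg hk.le hs
    have := mul_nonneg (hC.mu_pos i hi l).le hs
    have hT : InTriangle x y := ⟨hx, by linarith, by linarith⟩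
    have hT' : InTriangle (x + C.lam i k * s) (y + C.rowSpeed i (Sum.inr l) * s) :=
      ⟨by linarith, by simpa [rowSpeed, ← sub_eq_add_neg] using h1,
        by simp only [rowSpeed, Sum.elim_inr]; linarith⟩
    simpa only [rowSpeed, Kernels.row, Sum.elim_inr, neg_mul, ← sub_eq_add_neg] using
      (hK' i hi k (Sum.inr l) x y s hT hs hT').trans
        (congrArg _ (D.integral_rowSource k (Sum.inr l) hT hs hT'))
  · intro i hi k l hlk x hx
    exact (hK i hi k).diag (Sum.inl l) (hC.lam_mono i hi hlk) x hx
  · intro i hi k l x hx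
    have hk := hC.lam_pos i hi k
    have hl := hC.mu_pos i hi l
    have : D.Kuv i x x k l = C.Spm i x k l / (C.lam i k - -C.mu i l) :=
      (hK i hi k).diag (Sum.inr l) (by simp only [rowSpeed, Sum.elim_inr]; linarith) x hx
    rw [this]
    have : C.lam i k - -C.mu i l ≠ 0 := by linarith
    field_simp
    ring
  · intro i hi k l x hx hxk
    rw [Matrix.mul_diagonal]
    refine ((hK i hi k).right l x hx hxk).trans ?_
    rw [Matrix.mul_apply]
    exact sum_congr rfl fun a _ => by rw [Matrix.mul_diagonal]; rfl
  · intro i hi k l x y s hx hy hyx hs hxs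
    have hk := hC.lam_pos i (hIco i hi) k
    refine ((hF i (hIco i hi) k).char l x y s hx hy hyx hs hxs).trans ?_
    congr 1
    refine integral_congr_Icc hs fun r hr => ?_
    have := mul_nonneg hk.le hs
    simp only [clamp_of_mem (mem_Icc_add_mul ⟨hx, by linarith⟩ ⟨by linarith, hxs⟩ hr.1 hr.2)]
    rfl
  · exact fun i hi k l x hx hxk => (hF i (hIco i hi) k).init l x hx hxk
  · exact fun i hi k l hk x hx => (hF i (hIco i hi) k).hyp l hk x hx

end Chain

/-! ### The backstepping transformation -/

/-- Green's formula for a product of two functions transported with the same speed. -/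
theorem green_mul {f gf q gq : ℝ → ℝ → ℝ} {c l₀ l₁ r₀ r₁ S M : ℝ} (hS : 0 ≤ S)
    (hf : Measurable fun p : ℝ × ℝ => f p.1 p.2) (hgf : Measurable fun p : ℝ × ℝ => gf p.1 p.2)
    (hq : Measurable fun p : ℝ × ℝ => q p.1 p.2) (hgq : Measurable fun p : ℝ × ℝ => gq p.1 p.2)
    (h0 : l₀ ≤ r₀) (h1 : l₀ + l₁ * S ≤ r₀ + r₁ * S)
    (hM : ∀ s y, 0 ≤ s → s ≤ S → l₀ + l₁ * s ≤ y → y ≤ r₀ + r₁ * s →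
      (|f s y| ≤ M ∧ |gf s y| ≤ M) ∧ |q s y| ≤ M ∧ |gq s y| ≤ M)
    (hft : ∀ s y h, 0 ≤ s → 0 ≤ h → s + h ≤ S → l₀ + l₁ * s ≤ y → y ≤ r₀ + r₁ * s →
      l₀ + l₁ * (s + h) ≤ y + c * h → y + c * h ≤ r₀ + r₁ * (s + h) →
      f (s + h) (y + c * h) = f s y + ∫ r in 0..h, gf (s + r) (y + c * r))
    (hqt : ∀ s y h, 0 ≤ s → 0 ≤ h → s + h ≤ S → l₀ + l₁ * s ≤ y → y ≤ r₀ + r₁ * s →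
      l₀ + l₁ * (s + h) ≤ y + c * h → y + c * h ≤ r₀ + r₁ * (s + h) →
      q (s + h) (y + c * h) = q s y + ∫ r in 0..h, gq (s + r) (y + c * r)) :
    (∫ y in l₀ + l₁ * S..r₀ + r₁ * S, f S y * q S y) - ∫ y in l₀..r₀, f 0 y * q 0 y =
      ∫ s in 0..S, ((c - l₁) * (f s (l₀ + l₁ * s) * q s (l₀ + l₁ * s)) -
        (c - r₁) * (f s (r₀ + r₁ * s) * q s (r₀ + r₁ * s)) +
        ∫ y in l₀ + l₁ * s..r₀ + r₁ * s, (gf s y * q s y + f s y * gq s y)) ∧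
    IntervalIntegrable (fun s => (c - l₁) * (f s (l₀ + l₁ * s) * q s (l₀ + l₁ * s)) -
        (c - r₁) * (f s (r₀ + r₁ * s) * q s (r₀ + r₁ * s)) +
        ∫ y in l₀ + l₁ * s..r₀ + r₁ * s, (gf s y * q s y + f s y * gq s y)) volume 0 S := by
  have hM0 : 0 ≤ M := (abs_nonneg _).trans (hM 0 l₀ le_rfl hS (by simp) (by simpa using h0)).1.1
  have hφM : ∀ s y, 0 ≤ s → s ≤ S → l₀ + l₁ * s ≤ y → y ≤ r₀ + r₁ * s →
      |f s y * q s y| ≤ M * M + M * M ∧ |gf s y * q s y + f s y * gq s y| ≤ M * M + M * M := by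
    intro s y a1 a2 a3 a4
    obtain ⟨⟨b1, b2⟩, b3, b4⟩ := hM s y a1 a2 a3 a4
    have hh := mul_nonneg hM0 hM0
    refine ⟨?_, (abs_add_le _ _).trans (add_le_add ?_ ?_)⟩ <;> rw [abs_mul]
    · have := mul_le_mul b1 b3 (abs_nonneg _) hM0
      linarith
    · exact mul_le_mul b2 b3 (abs_nonneg _) hM0
    · exact mul_le_mul b1 b4 (abs_nonneg _) hM0
  have hgm : Measurable fun p : ℝ × ℝ => gf p.1 p.2 * q p.1 p.2 + f p.1 p.2 * gq p.1 p.2 :=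
    (hgf.mul hq).add (hf.mul hgq)
  have hw : ∀ s, 0 ≤ s → s ≤ S → l₀ + l₁ * s ≤ r₀ + r₁ * s := by
    intro s hs hs'
    rcases hS.eq_or_lt with h | h
    · have : s = 0 := le_antisymm (h ▸ hs') hs
      simpa [this] using h0
    · nlinarith [mul_nonneg hs (sub_nonneg.2 h1), mul_nonneg (sub_nonneg.2 hs') (sub_nonneg.2 h0)]
  refine ⟨green hS (hf.mul hq) hgm h0 h1 (fun s y a1 a2 a3 a4 => (hφM s y a1 a2 a3 a4).1)
    (fun s y a1 a2 a3 a4 => (hφM s y a1 a2 a3 a4).2) fun s y h hs hh hsh a1 a2 a3 a4 => ?_, ?_⟩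
  · have hreg : ∀ r ∈ Icc 0 h, l₀ + l₁ * (s + r) ≤ y + c * r ∧ y + c * r ≤ r₀ + r₁ * (s + r) := by
      intro r hr
      rcases hh.eq_or_lt with h' | h'
      · have : r = 0 := le_antisymm (h' ▸ hr.2) hr.1
        subst this; simpa using ⟨a1, a2⟩
      · have e1 := mul_nonneg hr.1 (sub_nonneg.2 a3)
        have e2 := mul_nonneg (sub_nonneg.2 hr.2) (sub_nonneg.2 a1)
        have e3 := mul_nonneg hr.1 (sub_nonneg.2 a4)
        have e4 := mul_nonneg (sub_nonneg.2 hr.2) (sub_nonneg.2 a2)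
        constructor <;> refine le_of_mul_le_mul_left ?_ h' <;> linarith
    have hb : ∀ r ∈ Icc 0 h, _ := fun r hr => hM (s + r) (y + c * r) (by linarith [hr.1])
      (by linarith [hr.2]) (hreg r hr).1 (hreg r hr).2
    have hline : Measurable fun r : ℝ => ((s + r, y + c * r) : ℝ × ℝ) := by fun_prop
    rw [hft s y h hs hh hsh a1 a2 a3 a4, hqt s y h hs hh hsh a1 a2 a3 a4,
      mul_integral_eq_add_integral (f' := fun r => gf (s + r) (y + c * r))
        (g' := fun r => gq (s + r) (y + c * r)) hh (hgf.comp hline) (hgq.comp hline)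
        (fun r hr => (hb r hr).1.2) (fun r hr => (hb r hr).2.2)]
    congr 1
    refine integral_congr_Icc hh fun r hr => ?_
    have hr' := hreg r hr
    rw [hft s y r hs hr.1 (by linarith [hr.2]) a1 a2 hr'.1 hr'.2,
      hqt s y r hs hr.1 (by linarith [hr.2]) a1 a2 hr'.1 hr'.2]
  · refine intervalIntegrable_of_abs_le (M := |c - l₁| * (M * M + M * M) +
      |c - r₁| * (M * M + M * M) + (M * M + M * M) * (|r₀ - l₀| + |r₁ - l₁| * S)) ?_ fun s hs => ?_
    · have m1 := (hf.mul hq).comp (by fun_prop : Measurable fun s : ℝ => ((s, l₀ + l₁ * s) : ℝ × ℝ))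
      have m2 := (hf.mul hq).comp (by fun_prop : Measurable fun s : ℝ => ((s, r₀ + r₁ * s) : ℝ × ℝ))
      exact ((m1.const_mul _).sub (m2.const_mul _)).add
        (measurable_intervalIntegral hgm (by fun_prop) (by fun_prop))
    · rw [uIcc_of_le hS] at hs
      have hw' := hw s hs.1 hs.2
      refine (abs_add_le _ _).trans (add_le_add ((abs_sub _ _).trans (add_le_add ?_ ?_)) ?_)
      · rw [abs_mul]
        exact mul_le_mul_of_nonneg_left (hφM s _ hs.1 hs.2 le_rfl hw').1 (abs_nonneg _)
      · rw [abs_mul]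
        exact mul_le_mul_of_nonneg_left (hφM s _ hs.1 hs.2 hw' le_rfl).1 (abs_nonneg _)
      · refine (abs_intervalIntegral_le hw' fun y hy => (hφM s y hs.1 hs.2 hy.1 hy.2).2).trans ?_
        refine mul_le_mul_of_nonneg_left ?_ (by positivity)
        have e1 : r₀ + r₁ * s - (l₀ + l₁ * s) = (r₀ - l₀) + (r₁ - l₁) * s := by ring
        rw [e1]
        refine add_le_add (le_abs_self _) ((mul_le_mul_of_nonneg_right (le_abs_self _)
            hs.1).trans ?_)
        exact mul_le_mul_of_nonneg_left hs.2 (abs_nonneg _)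

namespace Chain

variable {C : Chain} {i : ℕ}

/-- The part of the transformation that involves subsystem `i + 1`. -/
def Kernels.tail (D : C.Kernels) (z : ℝ → C.State) (i : ℕ) (t x : ℝ) (k : Fin (C.n i)) : ℝ :=
  if i < C.N then ∫ y in 0..x / C.lam1 i, (D.F i x y *ᵥ (z (t - y)).v (i + 1) 0) k else 0

/-- The transformed state `α_i`. -/
def Kernels.alpha (D : C.Kernels) (z : ℝ → C.State) (i : ℕ) (t x : ℝ) (k : Fin (C.n i)) : ℝ :=
  (z t).u i x k + D.tail z i t x k +
    ∫ y in x..1, ((D.Kuu i x y *ᵥ (z t).u i y) k + (D.Kuv i x y *ᵥ (z t).v i y) k)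

theorem Kernels.Solve.measurable_row {D : C.Kernels} (hD : D.Solve) (hi : i ∈ Finset.Icc 1 C.N)
    (k l) : Measurable fun p : ℝ × ℝ => D.row i k l p.1 p.2 := by
  rcases l with l | l
  · exact hD.meas_uu i hi k l
  · exact hD.meas_uv i hi k l

theorem Kernels.Solve.measurable_rowSource {D : C.Kernels} (hD : D.Solve) (hC : C.Standing)
    (hi : i ∈ Finset.Icc 1 C.N) (k l) :
    Measurable fun p : ℝ × ℝ => C.rowSource i (D.row i) k l p.1 p.2 := by
  unfold rowSource
  refine Measurable.add (measurable_sum _ fun a _ => Measurable.mul ?_ (hD.measurable_row hi k a))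
    (measurable_sum _ fun j _ => ?_)
  · exact ((continuous_block hC hi a l).measurable.comp measurable_snd).neg
  · split_ifs
    · refine Measurable.mul (Measurable.add ?_ (Measurable.const_mul ?_ _))
        (hD.measurable_row hi j l)
      · exact (continuous_comp_clamp (hC.Spp_cont i hi) k j).measurable.comp measurable_fst
      · exact (hD.measurable_row hi k (Sum.inl j)).comp
          (by fun_prop : Measurable fun p : ℝ × ℝ => (p.1, p.1))
    · exact measurable_const

theorem Kernels.Solve.exists_bound_row {D : C.Kernels} (hD : D.Solve) (hC : C.Standing)
    (hi : i ∈ Finset.Icc 1 C.N) : ∃ M, 0 < M ∧ ∀ k l x y, InTriangle x y →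
      |D.row i k l x y| ≤ M ∧ |C.rowSource i (D.row i) k l x y| ≤ M := by
  obtain ⟨M1, hM1⟩ := hD.bdd_K
  obtain ⟨M2, hM2, h2⟩ := exists_bound_block hC hi
  have hrow : ∀ k l x y, InTriangle x y → |D.row i k l x y| ≤ |M1| := by
    rintro k (l | l) x y h
    · exact ((hM1 i hi x y h.1 h.2.1 h.2.2).1 k l).trans (le_abs_self _)
    · exact ((hM1 i hi x y h.1 h.2.1 h.2.2).2 k l).trans (le_abs_self _)
  obtain ⟨M4, hM4, h4⟩ := exists_bound_of_finite (X := Unit)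
    (f := fun (p : Fin (C.n i) × Fin (C.n i)) _ => C.lam i p.1 - C.lam i p.2)
    fun p => ⟨_, fun _ => le_rfl⟩
  set B := ∑ _a : C.Comp i, M2 * |M1| + ∑ _j : Fin (C.n i), (M2 + M4 * |M1|) * |M1| with hB
  have hB0 : 0 ≤ B := by positivity
  refine ⟨|M1| + B + 1, by positivity, fun k l x y h => ⟨by linarith [hrow k l x y h], ?_⟩⟩
  have : |C.rowSource i (D.row i) k l x y| ≤ B := by
    unfold rowSource
    refine (abs_add_le _ _).trans (add_le_add ((abs_sum_le_sum_abs _ _).trans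
      (sum_le_sum fun a _ => ?_)) ((abs_sum_le_sum_abs _ _).trans
      (sum_le_sum fun j _ => ?_)))
    · rw [abs_mul, abs_neg]
      exact mul_le_mul (h2 a l y) (hrow _ _ _ _ h) (abs_nonneg _) hM2.le
    · have hp : 0 ≤ (M2 + M4 * |M1|) * |M1| := by positivity
      split_ifs
      · rw [abs_mul]
        refine mul_le_mul ((abs_add_le _ _).trans (add_le_add (h2 (Sum.inl k) (Sum.inl j) _) ?_))
            (hrow _ _ _ _ h)
          (abs_nonneg _) (by positivity)
        rw [abs_mul]
        exact mul_le_mul (h4 (j, k) ()) (hrow _ _ _ _ ⟨h.1, le_rfl, h.2.1.trans h.2.2⟩)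
          (abs_nonneg _) hM4.le
      · rwa [abs_zero]
  linarith [abs_nonneg M1]

theorem Kernels.Solve.row_char {D : C.Kernels} (hD : D.Solve) (hC : C.Standing)
    (hi : i ∈ Finset.Icc 1 C.N) (k l) {x y s : ℝ} (h : InTriangle x y) (hs : 0 ≤ s)
    (h' : InTriangle (x + C.lam i k * s) (y + C.rowSpeed i l * s)) :
    D.row i k l (x + C.lam i k * s) (y + C.rowSpeed i l * s) = D.row i k l x y + ∫ r in 0..s,
        C.rowSource i (D.row i) k l (x + C.lam i k * r) (y + C.rowSpeed i l * r) := by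
  rw [D.integral_rowSource k l h hs h']
  rcases l with l | l
  · exact hD.eq_uu i hi k l x y s h.1 h.2.1 hs h'.2.1 h'.2.2
  · have e := hD.eq_uv i hi k l x y s h.1 h.2.2 hs
    simp only [sub_eq_add_neg, ← neg_mul] at e
    exact e h'.2.1

/-- The kernel equations cancel the source terms of the system, up to the coupling `G`. -/
theorem sum_rowSource_mul (D : C.Kernels) (k : Fin (C.n i)) {x : ℝ} (hx : x ∈ Icc 0 1) (y : ℝ)
    (w : C.Comp i → ℝ) :
    ∑ l, (C.rowSource i (D.row i) k l x y * w l + D.row i k l x y * ∑ a, C.block i y l a * w a) =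
      ∑ j, D.G i x k j * ∑ l, D.row i j l x y * w l := by
  have h1 : ∀ l, C.rowSource i (D.row i) k l x y =
      -∑ a, C.block i y a l * D.row i k a x y + ∑ j, D.G i x k j * D.row i j l x y := by
    intro l
    unfold rowSource
    rw [← sum_neg_distrib]
    refine congrArg₂ _ (sum_congr rfl fun a _ => neg_mul _ _) (sum_congr rfl fun j _ => ?_)
    rw [Kernels.G, clamp_of_mem hx, ite_mul, zero_mul]
    rfl
  simp only [h1, add_mul, neg_mul, sum_mul, Finset.mul_sum, sum_add_distrib, sum_neg_distrib]
  rw [Finset.sum_comm (f := fun l a => C.block i y a l * D.row i k a x y * w l),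
    Finset.sum_comm (f := fun l j => D.G i x k j * D.row i j l x y * w l)]
  have h2 : ∑ a, ∑ l, C.block i y a l * D.row i k a x y * w l =
      ∑ l, ∑ a, D.row i k l x y * (C.block i y l a * w a) :=
    sum_congr rfl fun a _ => sum_congr rfl fun l _ => by ring
  rw [h2, neg_add_eq_sub, sub_add_cancel]
  exact sum_congr rfl fun a _ => sum_congr rfl fun l _ => by ring

end Chain

namespace Chain

variable {C : Chain} {i : ℕ}

theorem _root_.intervalIntegrable_sum {ι : Type*} {s : Finset ι} {f : ι → ℝ → ℝ} {a b : ℝ}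
    (h : ∀ i ∈ s, IntervalIntegrable (f i) volume a b) :
    IntervalIntegrable (fun x => ∑ i ∈ s, f i x) volume a b := by
  simpa only [Finset.sum_fn] using IntervalIntegrable.sum s h

theorem Kernels.Solve.exists_bound_G {D : C.Kernels} (hD : D.Solve) (hC : C.Standing)
    (hi : i ∈ Finset.Icc 1 C.N) : ∃ M, 0 < M ∧ ∀ k j x, |D.G i (clamp x) k j| ≤ M := by
  obtain ⟨M, _, h⟩ := hD.exists_bound_row hC hi
  exact D.exists_bound_G hC hi fun k =>
    ⟨M, fun j x => (h k (Sum.inl j) _ _ ⟨(clamp_mem x).1, le_rfl, (clamp_mem x).2⟩).1⟩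

section

variable {D : C.Kernels} {z : ℝ → C.State} {U : ℝ → Fin (C.n 1) → ℝ} {t x s : ℝ}

set_option maxHeartbeats 1000000 in
/-- Evolution of the integral of `K^{uu} u + K^{uv} v` along a characteristic. -/
theorem Kernels.Solve.exists_row_deriv (hD : D.Solve) (hC : C.Standing)
    (hz : C.IsSol 1 0 (Ici 0) U z) (hi : i ∈ Finset.Icc 1 C.N) (k : Fin (C.n i)) (ht : 0 ≤ t)
    (hx : 0 ≤ x) (hs : 0 ≤ s) (hxs : x + C.lam i k * s ≤ 1) :
    ∃ e : ℝ → ℝ, IntervalIntegrable e volume 0 s ∧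
      (∫ y in x + C.lam i k * s..1, ∑ l, D.row i k l (x + C.lam i k * s) y *
          toFam 1 z 0 ⟨⟨i, hi⟩, l⟩ (t + s) y) -
        (∫ y in x..1, ∑ l, D.row i k l x y * toFam 1 z 0 ⟨⟨i, hi⟩, l⟩ t y) = ∫ r in 0..s, e r ∧
      ∀ r ∈ Icc 0 s, e r = ∑ l, ((C.rowSpeed i l - C.lam i k) *
          (D.row i k l (x + C.lam i k * r) (x + C.lam i k * r) *
            toFam 1 z 0 ⟨⟨i, hi⟩, l⟩ (t + r) (x + C.lam i k * r)) -
          C.rowSpeed i l * (D.row i k l (x + C.lam i k * r) 1 *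
            toFam 1 z 0 ⟨⟨i, hi⟩, l⟩ (t + r) 1)) +
        ∑ j, D.G i (x + C.lam i k * r) k j * ∫ y in x + C.lam i k * r..1,
          ∑ l, D.row i j l (x + C.lam i k * r) y * toFam 1 z 0 ⟨⟨i, hi⟩, l⟩ (t + r) y := by
  set w : C.Comp i → ℝ → ℝ → ℝ := fun l => toFam 1 z 0 ⟨⟨i, hi⟩, l⟩ with hw
  set lam := C.lam i k with hlam
  have hlam0 : 0 < lam := hC.lam_pos i hi k
  have hJ : Icc (0 : ℝ) (0 + (t + s)) ⊆ Ici 0 := fun t ht => ht.1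
  have hchar := hz.charEq (K := fun _ _ => 0) (h := 0) (L := t + s) hC le_rfl hJ
  obtain ⟨B, hB⟩ := (hz.tame (L := t + s) hJ).bdd
  obtain ⟨M1, hM1, h1⟩ := hD.exists_bound_row hC hi
  obtain ⟨M2, hM2, h2⟩ := exists_bound_block hC hi
  have hwm : ∀ l, Measurable fun p : ℝ × ℝ => w l p.1 p.2 := fun l =>
    measurable_toFam 0 hz.meas_u hz.meas_v _
  have hwB : ∀ l t' y, 0 ≤ t' → t' ≤ t + s → y ∈ Icc 0 1 → |w l t' y| ≤ |B| :=
    fun l t' y a1 a2 a3 => (hB _ t' y a1 a2 a3).trans (le_abs_self _)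
  let gw : C.Comp i → ℝ → ℝ → ℝ := fun l r y =>
    ∑ a, C.block i y l a * w a (t + r) y
  have hline : ∀ c' : ℝ, Measurable fun p : ℝ × ℝ => (t + p.1, p.2) := fun _ => by fun_prop
  have hXl : Measurable fun p : ℝ × ℝ => (x + lam * p.1, p.2) := by fun_prop
  have hgwm : ∀ l, Measurable fun p : ℝ × ℝ => gw l p.1 p.2 := fun l =>
    measurable_sum _ fun a _ => ((continuous_block hC hi l a).measurable.comp
      measurable_snd).mul ((hwm a).comp (hline 0))
  set M := M1 + |B| + ∑ _a : C.Comp i, M2 * |B| with hM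
  have hsum0 : 0 ≤ ∑ _a : C.Comp i, M2 * |B| := by positivity
  have hgwB : ∀ l r y, 0 ≤ r → r ≤ s → y ∈ Icc 0 1 →
      |gw l r y| ≤ ∑ _a : C.Comp i, M2 * |B| := fun l r y a1 a2 a3 =>
    (abs_sum_le_sum_abs _ _).trans (sum_le_sum fun a _ => by
      rw [abs_mul]
      exact mul_le_mul (h2 _ _ _) (hwB a _ y (by linarith) (by linarith) a3) (abs_nonneg _) hM2.le)
  have := mul_nonneg hlam0.le hs
  have hX : ∀ r, 0 ≤ r → r ≤ s → x + lam * r ∈ Icc 0 1 := fun r =>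
    mem_Icc_add_mul ⟨hx, by linarith⟩ ⟨by linarith, hxs⟩
  have key : ∀ l, _ := fun l => green_mul (f := fun r y => D.row i k l (x + lam * r) y)
    (gf := fun r y => C.rowSource i (D.row i) k l (x + lam * r) y) (q := fun r y => w l (t + r) y)
    (gq := gw l) (c := C.rowSpeed i l) (l₀ := x) (l₁ := lam) (r₀ := 1) (r₁ := 0) (S := s) (M := M)
    hs ((hD.measurable_row hi k l).comp hXl) ((hD.measurable_rowSource hC hi k l).comp hXl)
    ((hwm l).comp (hline 0)) (hgwm l) (by linarith [mul_nonneg hlam0.le hs]) (by linarith)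
    (fun r y a1 a2 a3 a4 => by
      have hy : y ≤ 1 := by linarith
      have hT : InTriangle (x + lam * r) y := ⟨(hX r a1 a2).1, a3, hy⟩
      have hy01 : y ∈ Icc 0 1 := ⟨by linarith [(hX r a1 a2).1], hy⟩
      have b1 := h1 k l _ _ hT
      have b2 := hwB l (t + r) y (by linarith) (by linarith) hy01
      have b3 := hgwB l r y a1 a2 hy01
      have := abs_nonneg B
      refine ⟨⟨?_, ?_⟩, ?_, ?_⟩ <;> linarith [b1.1, b1.2])
    (fun r y h a1 a2 a3 a4 a5 a6 a7 => by
      have e : x + lam * (r + h) = x + lam * r + lam * h := by ring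
      have := hD.row_char hC hi k l (x := x + lam * r) (y := y) (s := h)
        ⟨(hX r a1 (by linarith)).1, a4, by linarith⟩ a2 ⟨by
          rw [← hlam, ← e]; exact (hX _ (by linarith) a3).1, by rw [← hlam, ← e]; exact
              a6, by linarith⟩
      simp only [e]
      rw [this]
      congr 1
      refine integral_congr fun ρ _ => ?_
      simp only [← hlam]
      congr 1; ring)
    (fun r y h a1 a2 a3 a4 a5 a6 a7 => by
      have b1 := (hX r a1 (by linarith)).1
      have b2 := (hX _ (by linarith) a3).1
      have := hchar ⟨⟨i, hi⟩, l⟩ (t + r) y h (by linarith) a2 (by linarith)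
        ⟨by linarith, by linarith⟩ (by
          show y + C.rowSpeed i l * h ∈ Icc 0 1
          exact ⟨b2.trans a6, by linarith⟩)
      rw [← add_assoc]
      refine this.trans ?_
      congr 1
      refine integral_congr fun ρ _ => ?_
      simp only [source_eq_block, gw, ← add_assoc]
      rfl)
  have hIrow : ∀ j l r, 0 ≤ r → r ≤ s → IntervalIntegrable
      (fun y => D.row i j l (x + lam * r) y * w l (t + r) y) volume (x + lam * r) 1 := by
    intro j l r a1 a2
    refine intervalIntegrable_of_abs_le (M := M1 * |B|) ?_ fun y hy => ?_
    · exact ((hD.measurable_row hi j l).comp measurable_prodMk_left).mul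
        ((hwm l).comp measurable_prodMk_left)
    · rw [uIcc_of_le (hX r a1 a2).2] at hy
      have hy01 : y ∈ Icc 0 1 := ⟨by linarith [(hX r a1 a2).1, hy.1], hy.2⟩
      rw [abs_mul]
      exact mul_le_mul (h1 j l _ _ ⟨(hX r a1 a2).1, hy.1, hy.2⟩).1
        (hwB l _ y (by linarith) (by linarith) hy01) (abs_nonneg _) hM1.le
  have hIg : ∀ l r, 0 ≤ r → r ≤ s → IntervalIntegrable (fun y =>
      C.rowSource i (D.row i) k l (x + lam * r) y * w l (t + r) y +
        D.row i k l (x + lam * r) y * gw l r y) volume (x + lam * r) 1 := by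
    intro l r a1 a2
    refine intervalIntegrable_of_abs_le (M := M1 * |B| +
      M1 * ∑ _a : C.Comp i, M2 * |B|) ?_ fun y hy => ?_
    · exact (((hD.measurable_rowSource hC hi k l).comp measurable_prodMk_left).mul
        ((hwm l).comp measurable_prodMk_left)).add (((hD.measurable_row hi k l).comp
          measurable_prodMk_left).mul ((hgwm l).comp measurable_prodMk_left))
    · rw [uIcc_of_le (hX r a1 a2).2] at hy
      have hy01 : y ∈ Icc 0 1 := ⟨by linarith [(hX r a1 a2).1, hy.1], hy.2⟩
      have hT : InTriangle (x + lam * r) y := ⟨(hX r a1 a2).1, hy.1, hy.2⟩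
      refine (abs_add_le _ _).trans (add_le_add ?_ ?_) <;> rw [abs_mul]
      · exact mul_le_mul (h1 k l _ _ hT).2 (hwB l _ y (by linarith) (by linarith) hy01)
          (abs_nonneg _) hM1.le
      · exact mul_le_mul (h1 k l _ _ hT).1 (hgwB l r y a1 a2 hy01) (abs_nonneg _) hM1.le
  simp only [zero_mul, add_zero, sub_zero, mul_zero] at key
  refine ⟨fun r => ∑ l, ((C.rowSpeed i l - lam) *
      (D.row i k l (x + lam * r) (x + lam * r) * w l (t + r) (x + lam * r)) -
      C.rowSpeed i l * (D.row i k l (x + lam * r) 1 * w l (t + r) 1) +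
      ∫ y in x + lam * r..1, (C.rowSource i (D.row i) k l (x + lam * r) y * w l (t + r) y +
        D.row i k l (x + lam * r) y * gw l r y)), ?_, ?_, ?_⟩
  · exact intervalIntegrable_sum fun l _ => (key l).2
  · rw [integral_finsetSum fun l _ => (key l).2,
      integral_finsetSum fun l _ => hIrow k l s hs le_rfl]
    have h0 := fun l => hIrow k l 0 le_rfl hs
    simp only [mul_zero, add_zero] at h0
    rw [integral_finsetSum fun l _ => h0 l, ← sum_sub_distrib]
    exact sum_congr rfl fun l _ => (key l).1
  · intro r hr
    simp only
    rw [sum_add_distrib]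
    congr 1
    rw [← integral_finsetSum fun l _ => hIg l r hr.1 hr.2]
    have : ∀ y, ∑ l, (C.rowSource i (D.row i) k l (x + lam * r) y * w l (t + r) y +
        D.row i k l (x + lam * r) y * gw l r y) =
        ∑ j, D.G i (x + lam * r) k j * ∑ l, D.row i j l (x + lam * r) y * w l (t + r) y := fun y =>
      sum_rowSource_mul D k (hX r hr.1 hr.2) y fun l => w l (t + r) y
    simp only [this]
    rw [integral_finsetSum fun j _ => IntervalIntegrable.const_mul
      (intervalIntegrable_sum fun l _ => hIrow j l r hr.1 hr.2) _]
    simp only [intervalIntegral.integral_const_mul]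
    rfl

/-- Evolution of the part of the transformation that involves the next subsystem. -/
theorem Kernels.Solve.exists_tail_deriv (hD : D.Solve) (hC : C.Standing)
    (hz : C.IsSol 1 0 (Ici 0) U z) (hi : i ∈ Finset.Ico 1 C.N) (k : Fin (C.n i))
    (ht : 1 / C.lam1 i ≤ t) (hx : 0 ≤ x) (hs : 0 ≤ s) (hxs : x + C.lam i k * s ≤ 1) :
    ∃ e : ℝ → ℝ, IntervalIntegrable e volume 0 s ∧
      D.tail z i (t + s) (x + C.lam i k * s) k - D.tail z i t x k = ∫ r in 0..s, e r ∧
      ∀ r ∈ Icc 0 s, e r = (D.F i (x + C.lam i k * r) 0 *ᵥ (z (t + r)).v (i + 1) 0) k +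
        ∑ j, D.G i (x + C.lam i k * r) k j * D.tail z i (t + r) (x + C.lam i k * r) j := by
  have hi' : i ∈ Finset.Icc 1 C.N := Finset.Ico_subset_Icc_self hi
  have hi1 : i + 1 ∈ Finset.Icc 1 C.N := by
    rw [Finset.mem_Ico] at hi; rw [Finset.mem_Icc]; omega
  have hiN : i < C.N := (Finset.mem_Ico.1 hi).2
  set lam := C.lam i k with hlam
  set lam1 := C.lam1 i with hlam1
  have hlam0 : 0 < lam := hC.lam_pos i hi' k
  have h10 : 0 < lam1 := lam1_pos hC hi'
  have hle : lam1 ≤ lam := lam1_le hC hi' k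
  set w : Fin (C.m (i + 1)) → ℝ → ℝ := fun l t' => (z t').v (i + 1) 0 l with hw
  have hwm : ∀ l, Measurable (w l) := fun l => (hz.meas_v _ hi1 l).comp measurable_prodMk_right
  obtain ⟨B, hB⟩ := hz.bdd (t + s)
  obtain ⟨M1, hM1⟩ := hD.bdd_F
  obtain ⟨M2, hM2, h2⟩ := hD.exists_bound_G hC hi'
  have hwB : ∀ l t', 0 ≤ t' → t' ≤ t + s → |w l t'| ≤ |B| := fun l t' a1 a2 =>
    ((hB t' a1 a2 _ hi1 0 (by simp)).2 l).trans (le_abs_self _)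
  have hF : ∀ x' y l j, 0 ≤ x' → x' ≤ 1 → 0 ≤ y → y ≤ x' / lam1 → |D.F i x' y j l| ≤ |M1| :=
    fun x' y l j a1 a2 a3 a4 => (hM1 i hi x' y a1 a2 a3 a4 j l).trans (le_abs_self _)
  have := mul_nonneg hlam0.le hs
  have hX : ∀ r, 0 ≤ r → r ≤ s → x + lam * r ∈ Icc 0 1 := fun r =>
    mem_Icc_add_mul ⟨hx, by linarith⟩ ⟨by linarith, hxs⟩
  have hdiv : ∀ r, x / lam1 + lam / lam1 * r = (x + lam * r) / lam1 := fun r => by ring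
  have hX1 : ∀ r, 0 ≤ r → r ≤ s → 0 ≤ (x + lam * r) / lam1 ∧ (x + lam * r) / lam1 ≤ t :=
    fun r a1 a2 => ⟨div_nonneg (hX r a1 a2).1 h10.le,
      (div_le_div_of_nonneg_right (hX r a1 a2).2 h10.le).trans ht⟩
  have hXl : Measurable fun p : ℝ × ℝ => (x + lam * p.1, p.2) := by fun_prop
  set M := |M1| + |B| + ∑ _j : Fin (C.n i), M2 * |M1| with hM
  have hsum0 : 0 ≤ ∑ _j : Fin (C.n i), M2 * |M1| := by positivity
  have key : ∀ l, _ := fun l => green_mul (f := fun r y => D.F i (x + lam * r) y k l)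
    (gf := fun r y => ∑ j, D.G i (clamp (x + lam * r)) k j * D.F i (x + lam * r) y j l)
    (q := fun r y => w l (t + r - y)) (gq := fun _ _ => 0) (c := 1) (l₀ := 0) (l₁ := 0)
    (r₀ := x / lam1) (r₁ := lam / lam1) (S := s) (M := M) hs
    ((hD.meas_F i hi k l).comp hXl)
    (measurable_sum _ fun j _ => ((D.measurable_G hC hi' (hD.meas_uu i hi' k j)).comp
      (by fun_prop : Measurable fun p : ℝ × ℝ => x + lam * p.1)).mul
          ((hD.meas_F i hi j l).comp hXl))
    ((hwm l).comp (by fun_prop : Measurable fun p : ℝ × ℝ => t + p.1 - p.2)) measurable_const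
    (div_nonneg hx h10.le)
    (by rw [hdiv, zero_mul, add_zero]; exact (hX1 s hs le_rfl).1)
    (fun r y a1 a2 a3 a4 => by
      rw [hdiv] at a4
      have hy0 : 0 ≤ y := by linarith
      have b1 := hX r a1 a2
      have b2 := hX1 r a1 a2
      have := abs_nonneg B
      have := abs_nonneg M1
      refine ⟨⟨?_, ?_⟩, ?_, ?_⟩
      · linarith [hF _ y l k b1.1 b1.2 hy0 a4]
      · refine (abs_sum_le_sum_abs _ _).trans ?_
        refine (sum_le_sum (g := fun _ => M2 * |M1|) fun j _ => ?_).trans (by linarith)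
        rw [abs_mul]
        exact mul_le_mul (h2 _ _ _) (hF _ y l j b1.1 b1.2 hy0 a4) (abs_nonneg _) hM2.le
      · linarith [hwB l (t + r - y) (by linarith) (by linarith)]
      · rw [abs_zero]; linarith)
    (fun r y h a1 a2 a3 a4 a5 a6 a7 => by
      rw [hdiv] at a5
      have e : x + lam * (r + h) = x + lam * r + lam * h := by ring
      have b1 := hX r a1 (by linarith)
      have := hD.eq_F i hi k l (x + lam * r) y h b1.1 (by linarith) a5 a2
        (by rw [← hlam, ← e]; exact (hX _ (by linarith) a3).2)
      rw [one_mul, e, this]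
      congr 1
      refine integral_congr_Icc a2 fun ρ hρ => ?_
      have e2 : x + lam * (r + ρ) = x + lam * r + lam * ρ := by ring
      rw [← hlam, Matrix.mul_apply]
      simp only [one_mul, ← e2, clamp_of_mem (hX (r + ρ) (by linarith [hρ.1])
          (by linarith [hρ.2]))])
    (fun r y h _ _ _ _ _ _ _ => by
      simp only [one_mul, intervalIntegral.integral_zero, add_zero]
      congr 1; ring)
  simp only [zero_mul, add_zero, sub_zero, mul_zero, one_mul, hdiv] at key
  have hIF : ∀ j l r, 0 ≤ r → r ≤ s → IntervalIntegrable
      (fun y => D.F i (x + lam * r) y j l * w l (t + r - y)) volume 0 ((x + lam * r) / lam1) := by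
    intro j l r a1 a2
    refine intervalIntegrable_of_abs_le (M := |M1| * |B|) ?_ fun y hy => ?_
    · exact ((hD.meas_F i hi j l).comp measurable_prodMk_left).mul ((hwm l).comp (by fun_prop))
    · rw [uIcc_of_le (hX1 r a1 a2).1] at hy
      rw [abs_mul]
      exact mul_le_mul (hF _ y l j (hX r a1 a2).1 (hX r a1 a2).2 hy.1 hy.2)
        (hwB l _ (by linarith [hy.2, (hX1 r a1 a2).2]) (by linarith [hy.1])) (abs_nonneg _)
        (abs_nonneg _)
  have htail : ∀ j r, 0 ≤ r → r ≤ s → D.tail z i (t + r) (x + lam * r) j =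
      ∑ l, ∫ y in 0..(x + lam * r) / lam1, D.F i (x + lam * r) y j l * w l (t + r - y) := by
    intro j r a1 a2
    rw [← integral_finsetSum fun l _ => hIF j l r a1 a2, Kernels.tail, if_pos hiN]
    rfl
  refine ⟨fun r => ∑ l, (D.F i (x + lam * r) 0 k l * w l (t + r) -
      (1 - lam / lam1) * (D.F i (x + lam * r) ((x + lam * r) / lam1) k l *
        w l (t + r - (x + lam * r) / lam1)) + ∫ y in 0..(x + lam * r) / lam1,
        (∑ j, D.G i (clamp (x + lam * r)) k j * D.F i (x + lam * r) y j l) * w l (t + r - y)),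
    intervalIntegrable_sum fun l _ => (key l).2, ?_, fun r hr => ?_⟩
  · have h0 := htail k 0 le_rfl hs
    simp only [mul_zero, add_zero] at h0
    rw [htail k s hs le_rfl, h0, integral_finsetSum fun l _ => (key l).2, ← sum_sub_distrib]
    exact sum_congr rfl fun l _ => (key l).1
  · have hXr := hX r hr.1 hr.2
    have hzero : ∀ l, (1 - lam / lam1) * (D.F i (x + lam * r) ((x + lam * r) / lam1) k l *
        w l (t + r - (x + lam * r) / lam1)) = 0 := by
      intro l
      by_cases hk : k = C.fst i
      · have : lam = lam1 := by rw [hlam, hk]; rfl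
        rw [this, div_self h10.ne', sub_self, zero_mul]
      · rw [hD.hyp_F i hi k l hk _ hXr, zero_mul, mul_zero]
    simp only [hzero, sub_zero, clamp_of_mem hXr]
    rw [sum_add_distrib]
    congr 1
    have : ∀ l, ∫ y in 0..(x + lam * r) / lam1,
        (∑ j, D.G i (x + lam * r) k j * D.F i (x + lam * r) y j l) * w l (t + r - y) =
        ∑ j, D.G i (x + lam * r) k j * ∫ y in 0..(x + lam * r) / lam1,
          D.F i (x + lam * r) y j l * w l (t + r - y) := by
      intro l
      simp only [sum_mul, mul_assoc]
      rw [integral_finsetSum fun j _ => (hIF j l r hr.1 hr.2).const_mul _]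
      simp only [intervalIntegral.integral_const_mul]
    simp only [this]
    rw [Finset.sum_comm]
    refine sum_congr rfl fun j _ => ?_
    rw [htail j r hr.1 hr.2, Finset.mul_sum]

/-- The transformed state solves the target system. -/
theorem Kernels.Solve.alpha_char (hD : D.Solve) (hC : C.Standing)
    (hz : C.IsSol 1 0 (Ici 0) U z) (hi : i ∈ Finset.Icc 1 C.N) (k : Fin (C.n i))
    (ht : 1 / C.lam1 i ≤ t) (hx : 0 ≤ x) (hs : 0 ≤ s) (hxs : x + C.lam i k * s ≤ 1) :
    D.alpha z i (t + s) (x + C.lam i k * s) k = D.alpha z i t x k +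
      ∫ r in 0..s, ∑ j, D.G i (x + C.lam i k * r) k j *
        D.alpha z i (t + r) (x + C.lam i k * r) j := by
  have ht0 : 0 < t := (one_div_pos.2 (lam1_pos hC hi)).trans_le ht
  have hlam0 : 0 < C.lam i k := hC.lam_pos i hi k
  obtain ⟨e1, he1, h1, h1'⟩ := hD.exists_row_deriv hC hz hi k ht0.le hx hs hxs
  have hα : ∀ t' x' j, D.alpha z i t' x' j = (z t').u i x' j + D.tail z i t' x' j +
      ∫ y in x'..1, ∑ l, D.row i j l x' y * toFam 1 z 0 ⟨⟨i, hi⟩, l⟩ t' y := by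
    intro t' x' j
    unfold Kernels.alpha
    congr 1
    refine integral_congr fun y _ => ?_
    simp [Kernels.row, toFam, Fintype.sum_sum_type, Matrix.mulVec, dotProduct]
  have h2 : ∃ e : ℝ → ℝ, IntervalIntegrable e volume 0 s ∧
      D.tail z i (t + s) (x + C.lam i k * s) k - D.tail z i t x k = ∫ r in 0..s, e r ∧
      ∀ r ∈ Icc 0 s, e r = (if i < C.N then
        (D.F i (x + C.lam i k * r) 0 *ᵥ (z (t + r)).v (i + 1) 0) k else 0) +
        ∑ j, D.G i (x + C.lam i k * r) k j * D.tail z i (t + r) (x + C.lam i k * r) j := by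
    by_cases hiN : i < C.N
    · simp only [if_pos hiN]
      exact hD.exists_tail_deriv hC hz (Finset.mem_Ico.2 ⟨(Finset.mem_Icc.1 hi).1, hiN⟩) k ht
          hx hs hxs
    · refine ⟨fun _ => 0, by simp, ?_, fun r _ => ?_⟩ <;> simp [Kernels.tail, hiN]
  obtain ⟨e2, he2, h2, h2'⟩ := h2
  have hJ : Icc (0 : ℝ) (0 + (t + s)) ⊆ Ici 0 := fun t ht => ht.1
  have := mul_nonneg hlam0.le hs
  have hX : ∀ r, 0 ≤ r → r ≤ s → x + C.lam i k * r ∈ Icc 0 1 := fun r =>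
    mem_Icc_add_mul ⟨hx, by linarith⟩ ⟨by linarith, hxs⟩
  have hx1 : x ≤ 1 := by simpa using (hX 0 le_rfl hs).2
  obtain ⟨M, hP⟩ := exists_regular hC le_rfl (MemKernel.zero (C := C) 1)
  have hu := hz.charEq (K := fun _ _ => 0) (h := 0) (L := t + s) hC le_rfl hJ
    ⟨⟨i, hi⟩, Sum.inl k⟩ t x s ht0.le hs (by simp) ⟨hx, hx1⟩
    (show x + C.lam i k * s ∈ Icc 0 1 from hX s hs le_rfl)
  have hui := hP.intervalIntegrable_char (hz.tame hJ) ⟨⟨i, hi⟩, Sum.inl k⟩ ht0.le hs (by simp)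
    ⟨hx, hx1⟩ (show x + C.lam i k * s ∈ Icc 0 1 from hX s hs le_rfl)
  have hc : (C.toNet 1 (fun _ _ => 0) 0).c ⟨⟨i, hi⟩, Sum.inl k⟩ = C.lam i k := rfl
  simp only [source_eq_block, hc] at hu hui
  have hu' : (z (t + s)).u i (x + C.lam i k * s) k = (z t).u i x k + ∫ r in 0..s,
      ∑ a, C.block i (x + C.lam i k * r) (Sum.inl k) a *
        toFam 1 z 0 ⟨⟨i, hi⟩, a⟩ (t + r) (x + C.lam i k * r) := by
    simpa only [toFam, Sum.elim_inl, zero_add] using hu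
  rw [hα, hα, hu', ← sub_eq_zero]
  have hsum := congrArg₂ (· + ·) h1 h2
  rw [← intervalIntegral.integral_add he1 he2] at hsum
  have h3 := congrArg (fun y => (∫ r in 0..s, ∑ a, C.block i (x + C.lam i k * r) (Sum.inl k) a *
        toFam 1 z 0 ⟨⟨i, hi⟩, a⟩ (t + r) (x + C.lam i k * r)) + y) hsum
  rw [← intervalIntegral.integral_add hui (he1.add he2)] at h3
  have h4 : ∫ r in 0..s, (∑ a, C.block i (x + C.lam i k * r) (Sum.inl k) a *
        toFam 1 z 0 ⟨⟨i, hi⟩, a⟩ (t + r) (x + C.lam i k * r) + (e1 r + e2 r)) =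
      ∫ r in 0..s, ∑ j, D.G i (x + C.lam i k * r) k j *
        D.alpha z i (t + r) (x + C.lam i k * r) j := by
    -- the corner values at the two end points are not controlled
    refine intervalIntegral.integral_congr_Ioo_of_le hs fun r hr => ?_
    have hr' : r ∈ Icc 0 s := ⟨hr.1.le, hr.2.le⟩
    have hX0 : 0 < x + C.lam i k * r := by linarith [mul_pos hlam0 hr.1]
    have hX1 : x + C.lam i k * r < 1 := by linarith [mul_lt_mul_of_pos_left hr.2 hlam0]
    set X := x + C.lam i k * r with hXdef
    have hXm : X ∈ Icc 0 1 := ⟨hX0.le, hX1.le⟩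
    rw [h1' r hr', h2' r hr']
    simp only [hα, mul_add, sum_add_distrib, ← hXdef]
    rw [sum_sub_distrib]
    -- on the diagonal
    have hdiag : ∑ a, C.block i X (Sum.inl k) a * toFam 1 z 0 ⟨⟨i, hi⟩, a⟩ (t + r) X +
        ∑ l, (C.rowSpeed i l - C.lam i k) * (D.row i k l X X *
          toFam 1 z 0 ⟨⟨i, hi⟩, l⟩ (t + r) X) = ∑ j, D.G i X k j * (z (t + r)).u i X j := by
      rw [← sum_add_distrib, Fintype.sum_sum_type]
      rw [sum_eq_zero (f := fun l => C.block i X (Sum.inl k) (Sum.inr l) * _ + _)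
        fun l _ => ?_, add_zero]
      · refine sum_congr rfl fun j _ => ?_
        simp only [block, Matrix.fromBlocks_apply₁₁, rowSpeed, Sum.elim_inl, Kernels.row, toFam,
          zero_add, Kernels.G, clamp_of_mem hXm]
        rw [← mul_assoc, ← add_mul]
        rcases lt_trichotomy k j with hkj | rfl | hkj
        · rw [if_pos hkj]
        · rw [hC.Spp_diag i hi X hXm, if_neg (lt_irrefl _)]; ring
        · rw [if_neg hkj.le.not_gt, hD.diag_uu i hi k j hkj X hXm]
          have : C.lam i k - C.lam i j ≠ 0 := (sub_pos.2 (hC.lam_mono i hi hkj)).ne'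
          field_simp; ring
      · have := hD.diag_uv i hi k l X hXm
        simp only [block, Matrix.fromBlocks_apply₁₂, rowSpeed, Sum.elim_inr, Kernels.row, toFam,
          zero_add, clamp_of_mem hXm]
        rw [← this]; ring
    -- at `y = 1`
    have htop : ∑ l, C.rowSpeed i l * (D.row i k l X 1 * toFam 1 z 0 ⟨⟨i, hi⟩, l⟩ (t + r) 1) =
        if i < C.N then (D.F i X 0 *ᵥ (z (t + r)).v (i + 1) 0) k else 0 := by
      have htr : 0 < t + r := by linarith [hr.1]
      rw [Fintype.sum_sum_type]
      have e1 : ∑ l, C.rowSpeed i (Sum.inl l) * (D.row i k (Sum.inl l) X 1 *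
          toFam 1 z 0 ⟨⟨i, hi⟩, Sum.inl l⟩ (t + r) 1) =
          ((D.Kuv i X 1 * Matrix.diagonal (C.mu i)) *ᵥ (C.Rd i *ᵥ (z (t + r)).u i 1)) k := by
        rw [Matrix.mulVec_mulVec]
        refine sum_congr rfl fun l _ => ?_
        beta_reduce
        rw [← hD.right_K i hi k l X hXm (Or.inl hX1), Matrix.mul_diagonal]
        simp only [rowSpeed, Sum.elim_inl, Kernels.row, toFam, zero_add]
        ring
      have e2 : ∑ l, C.rowSpeed i (Sum.inr l) * (D.row i k (Sum.inr l) X 1 *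
          toFam 1 z 0 ⟨⟨i, hi⟩, Sum.inr l⟩ (t + r) 1) =
          -((D.Kuv i X 1 * Matrix.diagonal (C.mu i)) *ᵥ (z (t + r)).v i 1) k := by
        rw [Matrix.mulVec, dotProduct, ← sum_neg_distrib]
        refine sum_congr rfl fun l _ => ?_
        rw [Matrix.mul_diagonal]
        simp only [rowSpeed, Sum.elim_inr, Kernels.row, toFam, zero_add]
        ring
      rw [e1, e2]
      have hiI := Finset.mem_Icc.1 hi
      by_cases hiN : i < C.N
      · have hIco : i ∈ Finset.Ico 1 C.N := Finset.mem_Ico.2 ⟨hiI.1, hiN⟩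
        have hF : D.F i X 0 *ᵥ (z (t + r)).v (i + 1) 0 =
            -((D.Kuv i X 1 * Matrix.diagonal (C.mu i)) *ᵥ (C.R i *ᵥ (z (t + r)).v (i + 1) 0)) := by
          rw [Matrix.mulVec_mulVec, ← Matrix.neg_mulVec]
          congr 1
          funext j l
          exact hD.init_F i hIco j l X hXm (Or.inl hX0)
        rw [if_pos hiN, hF, hz.right i hIco _ htr.le htr, Matrix.mulVec_add]
        simp only [Pi.add_apply, Pi.neg_apply]
        ring
      · have hiN' : i = C.N := by omega
        rw [if_neg hiN]
        subst hiN'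
        rw [hz.right_end _ htr.le htr]
        ring
    rw [htop]
    linarith [hdiag]
  rw [h4] at h3
  linarith [h3]

end

end Chain

namespace Chain

/-! ### The flatness-based parametrization -/

variable {C : Chain} {i : ℕ} {D : C.Kernels} {ζ ζ' : ℝ → Fin (C.n i) → ℝ}

theorem sum_G_mul (D : C.Kernels) (k : Fin (C.n i)) (x : ℝ) (a : Fin (C.n i) → ℝ) :
    ∑ j, D.G i x k j * a j = ∑ l : {l : Fin (C.n i) // k < l}, D.G i x k l.1 * a l.1 := by
  rw [← Finset.sum_subtype (Finset.univ.filter (k < ·)) (by simp) (fun l => D.G i x k l * a l)]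
  refine (Finset.sum_filter_of_ne fun l _ hl => ?_).symm
  by_contra hkl
  exact hl (by simp [Kernels.G, hkl])

/-- The characteristic of component `k` through `x` stays in `[0,1]` until it reaches `1`. -/
theorem char_mem (hC : C.Standing) (hi : i ∈ Finset.Icc 1 C.N) (k : Fin (C.n i)) {x r : ℝ}
    (hx : x ∈ Icc 0 1) (hr : r ∈ Icc 0 ((1 - x) / C.lam i k)) :
    x + C.lam i k * r ∈ Icc 0 1 := by
  have h := hC.lam_pos i hi k
  have h1 := mul_nonneg h.le hr.1
  have h2 := mul_le_mul_of_nonneg_left hr.2 h.le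
  rw [mul_div_cancel₀ _ h.ne'] at h2
  exact ⟨by linarith [hx.1], by linarith⟩

theorem exit_nonneg (hC : C.Standing) (hi : i ∈ Finset.Icc 1 C.N) (k : Fin (C.n i)) {x : ℝ}
    (hx : x ∈ Icc 0 1) : 0 ≤ (1 - x) / C.lam i k :=
  div_nonneg (by linarith [hx.2]) (hC.lam_pos i hi k).le

theorem exit_le (hC : C.Standing) (hi : i ∈ Finset.Icc 1 C.N) (k : Fin (C.n i)) {x r : ℝ}
    (hx : x ∈ Icc 0 1) (hr : r ∈ Icc 0 ((1 - x) / C.lam i k)) :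
    r + (1 - (x + C.lam i k * r)) / C.lam1 i ≤ (1 - x) / C.lam1 i := by
  have h1 := lam1_pos hC hi
  have := mul_le_mul_of_nonneg_right (lam1_le hC hi k) hr.1
  rw [le_div_iff₀ h1, add_mul, div_mul_cancel₀ _ h1.ne']
  linarith

/-- The boundary values on the right are determined by the parametrized values on the left. -/
theorem Kernels.flat_injective (hC : C.Standing) (hi : i ∈ Finset.Icc 1 C.N) {r₀ : ℝ}
    (h : ∀ k, ∀ r ≥ r₀, D.flat i ζ k r 0 = D.flat i ζ' k r 0) (k : Fin (C.n i)) :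
    (∀ r ≥ r₀ + 1 / C.lam i k, ζ r k = ζ' r k) ∧ ∀ s, ∀ x ∈ Icc (0 : ℝ) 1,
      r₀ + x / C.lam i k ≤ s → D.flat i ζ k s x = D.flat i ζ' k s x := by
  induction k using WellFoundedGT.induction with
  | _ k ih =>
    have hk := hC.lam_pos i hi k
    have key : ∀ s, ∀ x ∈ Icc (0 : ℝ) 1, r₀ + x / C.lam i k ≤ s →
        ∫ r in 0..(1 - x) / C.lam i k, ∑ l : {l : Fin (C.n i) // k < l},
          D.G i (x + C.lam i k * r) k l.1 * D.flat i ζ l.1 (s + r) (x + C.lam i k * r) =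
        ∫ r in 0..(1 - x) / C.lam i k, ∑ l : {l : Fin (C.n i) // k < l},
          D.G i (x + C.lam i k * r) k l.1 * D.flat i ζ' l.1 (s + r) (x + C.lam i k * r) := by
      intro s x hx hs
      refine integral_congr_Icc (exit_nonneg hC hi k hx) fun r hr => ?_
      have hm := char_mem hC hi k hx hr
      refine sum_congr rfl fun l _ => ?_
      rw [(ih l.1 l.2).2 _ _ hm]
      have h1 : (x + C.lam i k * r) / C.lam i l.1 ≤ (x + C.lam i k * r) / C.lam i k :=
        div_le_div_of_nonneg_left hm.1 hk (hC.lam_mono i hi l.2).le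
      rw [add_div _ _ (C.lam i k), mul_div_cancel_left₀ _ hk.ne'] at h1
      linarith
    have h1 : ∀ r ≥ r₀ + 1 / C.lam i k, ζ r k = ζ' r k := by
      intro r hr
      have h2 := h k (r - 1 / C.lam i k) (by linarith)
      rw [Kernels.flat, Kernels.flat, key _ 0 (by simp) (by rw [zero_div]; linarith)] at h2
      simpa using h2
    refine ⟨h1, fun s x hx hs => ?_⟩
    rw [Kernels.flat, Kernels.flat, key s x hx hs, h1]
    rw [sub_div]
    linarith

/-- The transformed state is parametrized by its values at the right end. -/
theorem Kernels.Solve.alpha_eq_flat (hD : D.Solve) (hC : C.Standing) {z : ℝ → C.State}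
    {U : ℝ → Fin (C.n 1) → ℝ} (hz : C.IsSol 1 0 (Ici 0) U z) (hi : i ∈ Finset.Icc 1 C.N) (τ : ℝ)
    (k : Fin (C.n i)) : ∀ {s x : ℝ}, x ∈ Icc 0 1 → 1 / C.lam1 i ≤ s - τ →
      D.alpha z i (s - τ) x k = D.flat i (fun r => D.alpha z i (r - τ) 1) k s x := by
  induction k using WellFoundedGT.induction with
  | _ k ih =>
    intro s x hx hs
    have hk := hC.lam_pos i hi k
    have e : x + C.lam i k * ((1 - x) / C.lam i k) = 1 := by
      rw [mul_div_cancel₀ _ hk.ne']; ring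
    have h1 := hD.alpha_char hC hz hi k hs hx.1 (exit_nonneg hC hi k hx) e.le
    rw [e] at h1
    rw [Kernels.flat, show s + (1 - x) / C.lam i k - τ = s - τ + (1 - x) / C.lam i k by ring, h1,
      eq_sub_iff_add_eq]
    congr 1
    refine integral_congr_Icc (exit_nonneg hC hi k hx) fun r hr => ?_
    rw [sum_G_mul]
    refine sum_congr rfl fun l _ => ?_
    rw [← ih l.1 l.2 (char_mem hC hi k hx hr) (by linarith [hr.1]), add_sub_right_comm]

theorem Kernels.flat_clamp (hC : C.Standing) (hi : i ∈ Finset.Icc 1 C.N) (k : Fin (C.n i))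
    (s : ℝ) {x : ℝ} (hx : x ∈ Icc 0 1) :
    D.flat i ζ k s x = ζ (s + (1 - x) / C.lam i k) k - ∫ r in 0..(1 - x) / C.lam i k,
      ∑ l : {l : Fin (C.n i) // k < l}, D.G i (clamp (x + C.lam i k * r)) k l.1 *
        D.flat i ζ l.1 (s + r) (clamp (x + C.lam i k * r)) := by
  rw [Kernels.flat]
  congr 1
  refine integral_congr_Icc (exit_nonneg hC hi k hx) fun r hr => ?_
  simp only [clamp_of_mem (char_mem hC hi k hx hr)]

theorem Kernels.Solve.measurable_flat (hD : D.Solve) (hC : C.Standing)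
    (hi : i ∈ Finset.Icc 1 C.N) (hζ : ∀ k, Measurable fun r => ζ r k) (k : Fin (C.n i)) :
    Measurable fun p : ℝ × ℝ => D.flat i ζ k p.1 (clamp p.2) := by
  induction k using WellFoundedGT.induction with
  | _ k ih =>
    simp only [Kernels.flat_clamp hC hi k _ (clamp_mem _)]
    have hc := continuous_clamp.measurable
    have hT : Measurable fun p : ℝ × ℝ => (1 - clamp p.2) / C.lam i k :=
      ((hc.comp measurable_snd).const_sub 1).div_const _
    refine ((hζ k).comp (measurable_fst.add hT)).sub
      (measurable_intervalIntegral (α := ℝ × ℝ) ?_ measurable_const hT)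
    have hX : Measurable fun q : (ℝ × ℝ) × ℝ => clamp q.1.2 + C.lam i k * q.2 :=
      (hc.comp (by fun_prop : Measurable fun q : (ℝ × ℝ) × ℝ => q.1.2)).add
        (measurable_snd.const_mul _)
    refine measurable_sum _ fun l _ => ((D.measurable_G hC hi (hD.meas_uu i hi k l.1)).comp
        hX).mul ?_
    exact (ih l.1 l.2).comp ((by fun_prop : Measurable fun q : (ℝ × ℝ) × ℝ =>
        q.1.1 + q.2).prodMk hX)

/-- The size of the parametrized signal. -/
theorem Kernels.Solve.exists_flat_bd (hD : D.Solve) (hC : C.Standing)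
    (hi : i ∈ Finset.Icc 1 C.N) (k : Fin (C.n i)) : ∃ A, 0 ≤ A ∧ ∀ (ν : ParamNorm ℝ)
      (ζ : ℝ → Fin (C.n i) → ℝ) (a Ω : ℝ), (∀ k, Measurable fun r => ζ r k) → 0 < Ω →
      (∀ k, ∀ r ≤ a, ν.Bd (fun t => ζ (t + r) k) Ω) → ∀ s x, x ∈ Icc 0 1 →
        s + (1 - x) / C.lam1 i ≤ a → ν.Bd (fun t => D.flat i ζ k (t + s) x) (A * Ω) := by
  obtain ⟨M, hM, hG⟩ := hD.exists_bound_G hC hi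
  induction k using WellFoundedGT.induction with
  | _ k ih =>
    choose A hA0 hA using fun l : {l : Fin (C.n i) // k < l} => ih l.1 l.2
    have hk := hC.lam_pos i hi k
    set m := ∑ l : {l : Fin (C.n i) // k < l}, M * A l + 1 with hm
    have hm0 : 0 < m := by
      have : 0 ≤ ∑ l : {l : Fin (C.n i) // k < l}, M * A l :=
        sum_nonneg fun l _ => mul_nonneg hM.le (hA0 l)
      linarith
    refine ⟨1 + 1 / C.lam i k * m, by positivity, fun ν ζ a Ω hζ hΩ hbd s x hx hs => ?_⟩
    have hex := exit_nonneg hC hi k hx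
    have hc := continuous_clamp.measurable
    simp only [Kernels.flat_clamp hC hi k _ hx, sub_eq_add_neg, ← neg_one_mul (∫ _ in _.._, _)]
    have h1 : ν.Bd (fun t => ζ (t + s + (1 + -x) / C.lam i k) k) Ω := by
      have := exit_le hC hi k hx ⟨hex, le_rfl⟩
      rw [mul_div_cancel₀ _ hk.ne', add_sub_cancel, sub_self, zero_div] at this
      simpa only [add_assoc, sub_eq_add_neg] using hbd k (s + (1 - x) / C.lam i k) (by linarith)
    have hX : Measurable fun q : ℝ × ℝ => x + C.lam i k * q.2 := by fun_prop
    have h2 := ν.integral (g := fun t r => ∑ l : {l : Fin (C.n i) // k < l},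
        D.G i (clamp (x + C.lam i k * r)) k l.1 *
          D.flat i ζ l.1 (t + s + r) (clamp (x + C.lam i k * r))) (m := fun _ => m * Ω)
      (a := (1 - x) / C.lam i k) hex
      (measurable_sum _ fun l _ => ((D.measurable_G hC hi (hD.meas_uu i hi k l.1)).comp hX).mul
        ((hD.measurable_flat hC hi hζ l.1).comp
          ((by fun_prop : Measurable fun q : ℝ × ℝ => q.1 + s + q.2).prodMk hX)))
      continuous_const (fun _ => by positivity) (fun r hr => by
        have hmem := char_mem hC hi k hx hr
        simp only [clamp_of_mem hmem]
        refine ν.mono (ν.sum Finset.univ (M := fun l => M * (A l * Ω)) fun l _ => ?_) ?_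
        · have e := hA l ν ζ a Ω hζ hΩ hbd (s + r) _ hmem (by linarith [exit_le hC hi k hx hr])
          simp only [← add_assoc] at e
          refine ν.mono (ν.smul _ e) (mul_le_mul_of_nonneg_right ?_ (mul_nonneg (hA0 l) hΩ.le))
          have := hG k l.1 (x + C.lam i k * r)
          rwa [clamp_of_mem hmem] at this
        · rw [hm, add_mul, sum_mul]
          simp only [mul_assoc]
          linarith)
    simp only [sub_eq_add_neg] at h2
    refine ν.mono (ν.add h1 (ν.smul (-1) h2)) ?_
    rw [intervalIntegral.integral_const, smul_eq_mul, abs_neg, abs_one, one_mul, add_mul, one_mul]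
    have : (1 + -x - 0) / C.lam i k ≤ 1 / C.lam i k := by
      have := hx.1; gcongr; linarith
    rw [sub_zero] at this
    have := mul_le_mul_of_nonneg_right this (mul_pos hm0 hΩ).le
    simp only [sub_eq_add_neg] at this ⊢
    linarith

end Chain

namespace Chain

/-! ### Predictions -/

variable {C : Chain} {i : ℕ} {D : C.Kernels} {τ t : ℝ}

/-- The length of the memory of the input of subsystem `i`. -/
def memLen (C : Chain) : ℕ → ℝ
  | 0 => 0
  | 1 => 0
  | j + 2 => 1 / C.lam1 (j + 1)

/-- The density of the memory of the input of subsystem `i`. -/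
def Kernels.memK (D : C.Kernels) : C.Memory
  | 0 => 0
  | 1 => 0
  | j + 2 => fun y => C.Q (j + 1) * D.F (j + 1) 1 y

theorem pred_mem {j : ℕ} (hi : j + 2 ∈ Finset.Icc 1 C.N) :
    j + 1 ∈ Finset.Ico 1 C.N ∧ j + 1 ∈ Finset.Icc 1 C.N := by
  rw [Finset.mem_Icc] at *
  rw [Finset.mem_Ico]
  omega

theorem Kernels.Solve.memKernel (hD : D.Solve) (hC : C.Standing) (hi : i ∈ Finset.Icc 1 C.N) :
    C.MemKernel i D.memK (C.memLen i) := by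
  match i, hi with
  | 0, hi => simp at hi
  | 1, hi => exact ⟨le_rfl, fun _ _ => measurable_const, 0, fun y _ k l => by simp [memK]⟩
  | j + 2, hi =>
    obtain ⟨h1, h2⟩ := pred_mem hi
    have hl := lam1_pos hC h2
    obtain ⟨M, hM⟩ := hD.bdd_F
    obtain ⟨M', hM'0, hM'⟩ := exists_bound_of_finite (X := Unit)
      (f := fun (p : Fin (C.n (j + 2)) × Fin (C.n (j + 1))) _ => C.Q (j + 1) p.1 p.2) fun p =>
          ⟨_, fun _ => le_rfl⟩
    refine ⟨(one_div_pos.2 hl).le, fun k l => ?_, ∑ _a : Fin (C.n (j + 1)), M' * M,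
      fun y hy k l => ?_⟩
    · simp only [memK, Matrix.mul_apply]
      exact measurable_sum _ fun a _ =>
        ((hD.meas_F _ h1 a l).comp measurable_prodMk_left).const_mul _
    · simp only [memK, Matrix.mul_apply]
      refine (abs_sum_le_sum_abs _ _).trans (sum_le_sum fun a _ => ?_)
      rw [abs_mul]
      exact mul_le_mul (hM' (k, a) ()) (hM _ h1 1 y zero_le_one le_rfl hy.1 hy.2 a l)
        (abs_nonneg _) hM'0.le

theorem Kernels.Solve.memory_eq (hD : D.Solve) (hi : i ∈ Finset.Icc 1 C.N) {p : ℝ → C.State}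
    {r B : ℝ} (hm : ∀ l, Measurable fun r => (p r).v i 0 l)
    (hB : ∀ y ∈ Icc 0 (C.memLen i), ∀ l, |(p (r - y)).v i 0 l| ≤ B) (hh : 0 ≤ C.memLen i) :
    D.memory p r i = memTerm D.memK (C.memLen i) p i r := by
  match i, hi with
  | 0, hi => simp at hi
  | 1, hi => funext k; simp [memory, memTerm, memLen]
  | j + 2, hi =>
    obtain ⟨h1, h2⟩ := pred_mem hi
    obtain ⟨M, hM⟩ := hD.bdd_F
    funext k
    have hint : ∀ a, IntervalIntegrable
        (fun y => (D.F (j + 1) 1 y *ᵥ (p (r - y)).v (j + 2) 0) a) volume 0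
            (1 / C.lam1 (j + 1)) := by
      refine fun a => intervalIntegrable_sum (s := Finset.univ)
        (f := fun l y => D.F (j + 1) 1 y a l * (p (r - y)).v (j + 2) 0 l) fun l _ =>
        intervalIntegrable_of_abs_le (M := |M| * |B|) ?_ fun y hy => ?_
      · exact ((hD.meas_F _ h1 a l).comp measurable_prodMk_left).mul ((hm l).comp (by fun_prop))
      · rw [uIcc_of_le (show 0 ≤ 1 / C.lam1 (j + 1) from hh)] at hy
        rw [abs_mul]
        exact mul_le_mul ((hM _ h1 1 y zero_le_one le_rfl hy.1 hy.2 a l).trans (le_abs_self _))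
          ((hB y hy l).trans (le_abs_self _)) (abs_nonneg _) (abs_nonneg _)
    simp only [memory, memTerm, memLen, memK, ← Matrix.mulVec_mulVec]
    rw [Matrix.mulVec, dotProduct]
    simp only [← intervalIntegral.integral_const_mul]
    rw [← integral_finsetSum fun a _ => (hint a).const_mul _]
    rfl

section

variable (hC : C.Standing)
include hC

theorem delay_nonneg {j : ℕ} (hj : j ∈ Finset.Icc 1 C.N) : 0 ≤ C.delay j :=
  add_nonneg (one_div_pos.2 (lam1_pos hC hj)).le (one_div_pos.2 (mu1_pos hC hj)).le

theorem memLen_nonneg (hi : i ∈ Finset.Icc 1 C.N) : 0 ≤ C.memLen i := by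
  match i, hi with
  | 0, hi => simp at hi
  | 1, hi => exact le_rfl
  | j + 2, hi => exact (one_div_pos.2 (lam1_pos hC (pred_mem hi).2)).le

theorem theta_succ (hi : 1 ≤ i) : C.theta τ (i + 1) = C.theta τ i + 1 / C.lam1 i := by
  rw [theta, theta, Finset.sum_Ico_succ_top hi, add_assoc]

theorem memLen_add_le_theta (hi : i ∈ Finset.Icc 1 C.N) : τ + C.memLen i ≤ C.theta τ i := by
  match i, hi with
  | 0, hi => simp at hi
  | 1, hi => simp [memLen, theta]
  | j + 2, hi =>
    rw [theta_succ hC (by omega), memLen, theta]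
    have : 0 ≤ ∑ k ∈ Finset.Ico 1 (j + 1), 1 / C.lam1 k := sum_nonneg fun k hk =>
      (one_div_pos.2 (lam1_pos hC (by
        rw [Finset.mem_Ico] at hk; rw [Finset.mem_Icc] at *; omega))).le
    linarith

/-- The delayed estimates that the predictions use are exact. -/
theorem lt_of_startTime (hτ : 0 < τ) (ht : C.startTime τ ≤ t) {j : ℕ}
    (hj : j ∈ Finset.Icc 1 C.N) {r : ℝ} (hr : t - C.delay j ≤ r) :
    τ + ∑ j ∈ Finset.Icc 1 C.N, 1 / C.mu1 j < r ∧ τ < r := by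
  have h1 : C.delay j ≤ ∑ j ∈ Finset.Icc 1 C.N, C.delay j :=
    single_le_sum (fun j hj => delay_nonneg hC hj) hj
  have h2 : ∑ j ∈ Finset.Icc 1 C.N, 1 / C.mu1 j ≤ ∑ j ∈ Finset.Icc 1 C.N, C.delay j :=
    sum_le_sum fun j hj => by
      have := one_div_pos.2 (lam1_pos hC hj)
      rw [delay]; linarith
  have h3 : 0 ≤ ∑ j ∈ Finset.Icc 1 C.N, 1 / C.mu1 j :=
    sum_nonneg fun j hj => (one_div_pos.2 (mu1_pos hC hj)).le
  rw [startTime, ← Finset.mul_sum] at ht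
  constructor <;> linarith

theorem exists_delay_ge_memLen (hi : i ∈ Finset.Icc 1 C.N) :
    ∃ j ∈ Finset.Icc 1 C.N, C.memLen i ≤ C.delay j := by
  match i, hi with
  | 0, hi => simp at hi
  | 1, hi => exact ⟨1, hi, delay_nonneg hC hi⟩
  | j + 2, hi =>
    refine ⟨j + 1, (pred_mem hi).2, ?_⟩
    have := one_div_pos.2 (mu1_pos hC (pred_mem hi).2)
    rw [delay, memLen]; linarith

/-- A delayed solution, restricted to the subsystems `i, …, N`. -/
theorem IsSol.delayed {U : ℝ → Fin (C.n 1) → ℝ} {z : ℝ → C.State} (hz : C.IsSol 1 0 (Ici 0) U z)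
    (hi : i ∈ Finset.Icc 1 C.N) {J : Set ℝ} {b : ℝ → Fin (C.n i) → ℝ} (hJ : J ⊆ Ici τ)
    (hτt : τ ≤ t) (hb : ∀ r ∈ J, t < r → (z (r - τ)).u i 0 = C.Qd i *ᵥ (z (r - τ)).v i 0 + b r) :
    C.IsSol i t J b (fun r => z (r - τ)) := by
  have hi1 := (Finset.mem_Icc.1 hi).1
  have hJ' : ∀ r ∈ J, r - τ ∈ Ici (0 : ℝ) := fun r hr => mem_Ici.2 (sub_nonneg.2 (hJ hr))
  have hsub : ∀ {j}, j ∈ Finset.Icc i C.N → j ∈ Finset.Icc 1 C.N := fun hj =>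
    Icc_subset_Icc_left hi1 hj
  have hsub' : ∀ {j}, j ∈ Finset.Ico i C.N → j ∈ Finset.Ico 1 C.N := fun hj =>
    Finset.Ico_subset_Ico_left hi1 hj
  refine ⟨fun j hj k => (hz.meas_u j (hsub hj) k).comp
    (by fun_prop : Measurable fun q : ℝ × ℝ => (q.1 - τ, q.2)),
    fun j hj k => (hz.meas_v j (hsub hj) k).comp
    (by fun_prop : Measurable fun q : ℝ × ℝ => (q.1 - τ, q.2)), fun T => ?_,
    fun j hj k r hr x hx s hs hrs hxs => ?_, fun j hj k r hr x hx s hs hrs hxs => ?_, hb,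
    fun j hj r hr htr => hz.left j (hsub' hj) _ (hJ' r hr) (by linarith),
    fun j hj r hr htr => hz.right j (hsub' hj) _ (hJ' r hr) (by linarith),
    fun r hr htr => hz.right_end _ (hJ' r hr) (by linarith)⟩
  · obtain ⟨M, hM⟩ := hz.bdd (T - τ)
    exact ⟨M, fun r hr hrT j hj => hM _ (hJ' r hr) (by linarith) j (hsub hj)⟩
  · simp only [add_sub_right_comm]
    exact hz.eq_u j (hsub hj) k _ (hJ' r hr) x hx s hs
      (by rw [← add_sub_right_comm]; exact hJ' _ hrs) hxs
  · simp only [add_sub_right_comm]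
    exact hz.eq_v j (hsub hj) k _ (hJ' r hr) x hx s hs
      (by rw [← add_sub_right_comm]; exact hJ' _ hrs) hxs

end

section

variable {z : ℝ → C.State} {U : ℝ → Fin (C.n 1) → ℝ} {p p' : ℝ → C.State}
  {W : C.Inputs}

theorem Kernels.IsPrediction.agree_past (hp : D.IsPrediction τ (fun r => z (r - τ)) W i t p)
    (hC : C.Standing) (hi : i ∈ Finset.Icc 1 C.N) {r : ℝ} (hr : r ∈ Icc (t - C.memLen i) t) :
    (p r).Agree i (z (r - τ)) := by
  obtain ⟨j, hj, hle⟩ := exists_delay_ge_memLen hC hi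
  exact hp.past j hj r ⟨by linarith [hr.1], hr.2⟩

variable (hD : D.Solve) (hC : C.Standing) (hz : C.IsSol 1 0 (Ici 0) U z) (hτ : 0 < τ)
  (ht : C.startTime τ ≤ t) (hi : i ∈ Finset.Icc 1 C.N)
include hD hC hz hτ ht hi

theorem Kernels.IsPrediction.exists_bound (hp : D.IsPrediction τ (fun r => z (r - τ)) W i t p) :
    ∃ B, ∀ r ∈ Icc (t - C.memLen i) (t + C.theta τ i), ∀ j ∈ Finset.Icc i C.N,
      ∀ x ∈ Icc (0 : ℝ) 1, (∀ k, |(p r).u j x k| ≤ B) ∧ ∀ k, |(p r).v j x k| ≤ B := by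
  obtain ⟨B1, h1⟩ := hz.bdd (t - τ)
  obtain ⟨B2, h2⟩ := hp.future.bdd (t + C.theta τ i)
  obtain ⟨a, ha, hle⟩ := exists_delay_ge_memLen hC hi
  refine ⟨max B1 B2, fun r hr j hj x hx => ?_⟩
  rcases le_total r t with h | h
  · have e := hp.agree_past hC hi ⟨hr.1, h⟩ j hj x hx
    have := h1 (r - τ) (sub_nonneg.2 (lt_of_startTime hC hτ ht ha (by linarith [hr.1])).2.le)
      (by linarith) j (Icc_subset_Icc_left (Finset.mem_Icc.1 hi).1 hj) x hx
    rw [e.1, e.2]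
    exact ⟨fun k => (this.1 k).trans (le_max_left _ _), fun k => (this.2 k).trans (le_max_left _ _)⟩
  · have := h2 r ⟨h, hr.2⟩ hr.2 j hj x hx
    exact ⟨fun k => (this.1 k).trans (le_max_right _ _), fun k =>
        (this.2 k).trans (le_max_right _ _)⟩

theorem Kernels.IsPrediction.memory_eq (hp : D.IsPrediction τ (fun r => z (r - τ)) W i t p)
    {r : ℝ} (hr : r ∈ Icc t (t + C.theta τ i)) :
    D.memory p r i = memTerm D.memK (C.memLen i) p i r := by
  obtain ⟨B, hB⟩ := hp.exists_bound hD hC hz hτ ht hi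
  have hii := Finset.left_mem_Icc.2 (Finset.mem_Icc.1 hi).2
  exact hD.memory_eq hi (fun l => (hp.future.meas_v i hii l).comp measurable_prodMk_right)
    (fun y hy l => (hB _ ⟨by linarith [hr.1, hy.2], by linarith [hr.2, hy.1]⟩ i hii 0
      (by simp)).2 l) (memLen_nonneg hC hi)

theorem Kernels.IsPrediction.isSol (hp : D.IsPrediction τ (fun r => z (r - τ)) W i t p) :
    C.IsSol i t (Icc t (t + C.theta τ i))
      (fun r => W i (r - C.theta τ i) - memTerm D.memK (C.memLen i) p i r) p :=
  hp.future.congr_input subset_rfl fun r hr _ => by rw [hp.memory_eq hD hC hz hτ ht hi hr]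

/-- The prediction is unique. -/
theorem Kernels.IsPrediction.agree (hp : D.IsPrediction τ (fun r => z (r - τ)) W i t p)
    (hp' : D.IsPrediction τ (fun r => z (r - τ)) W i t p') {r : ℝ}
    (hr : r ∈ Icc (t - C.memLen i) (t + C.theta τ i)) : (p r).Agree i (p' r) := by
  have hpast : ∀ r ∈ Icc (t - C.memLen i) t, (p r).Agree i (p' r) := fun r hr j hj x hx => by
    have h1 := hp.agree_past hC hi hr j hj x hx
    have h2 := hp'.agree_past hC hi hr j hj x hx
    exact ⟨h1.1.trans h2.1.symm, h1.2.trans h2.2.symm⟩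
  have hh := memLen_nonneg hC hi
  rcases le_total r t with h | h
  · exact hpast r ⟨hr.1, h⟩
  · refine (hp.isSol hD hC hz hτ ht hi).unique (β := fun i r => W i (r - C.theta τ i)) hC
      (Finset.mem_Icc.1 hi).1 (hD.memKernel hC hi) (hp'.isSol hD hC hz hτ ht hi) subset_rfl
      subset_rfl (hpast t ⟨by linarith, le_rfl⟩)
      (fun r h1 h2 => hpast _ ⟨by linarith, by linarith⟩) ?_ r ⟨h, hr.2⟩
    obtain ⟨B, hB⟩ := hp.exists_bound hD hC hz hτ ht hi
    refine ⟨B, ?_⟩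
    rintro ⟨⟨j, hj⟩, k | k⟩ r h1 h2
    · exact (hB (t + r) ⟨by linarith, by linarith [hr.2]⟩ j hj _ (Net.xout_mem _)).1 k
    · exact (hB (t + r) ⟨by linarith, by linarith [hr.2]⟩ j hj _ (Net.xout_mem _)).2 k

/-- The value of the law does not depend on the choice of the prediction. -/
theorem Kernels.IsPrediction.virtualInput_eq (hp : D.IsPrediction τ (fun r => z (r - τ)) W i t p)
    (hp' : D.IsPrediction τ (fun r => z (r - τ)) W i t p') :
    D.virtualInput τ W i t p = D.virtualInput τ W i t p' := by
  have hag := fun r hr => hp.agree hD hC hz hτ ht hi hp' (r := r) hr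
  have hii := Finset.left_mem_Icc.2 (Finset.mem_Icc.1 hi).2
  have hh := memLen_nonneg hC hi
  have hth := memLen_add_le_theta hC (τ := τ) hi
  have htop : t + C.theta τ i ∈ Icc t (t + C.theta τ i) := ⟨by linarith, le_rfl⟩
  have e := hag _ ⟨by linarith [htop.1], le_rfl⟩ i hii
  have hM : D.memory p (t + C.theta τ i) i = D.memory p' (t + C.theta τ i) i := by
    rw [hp.memory_eq hD hC hz hτ ht hi htop, hp'.memory_eq hD hC hz hτ ht hi htop]
    funext k
    refine integral_congr_Icc hh fun y hy => ?_
    rw [(hag _ ⟨by linarith [hy.2], by linarith [hy.1]⟩ i hii 0 (by simp)).2]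
  funext k
  unfold virtualInput
  rw [hM, (e 0 (by simp)).2]
  congr 2
  refine integral_congr_Icc zero_le_one fun y hy => ?_
  rw [(e y hy).1, (e y hy).2]

end

/-! ### The closed loop reaches zero in finite time -/

/-- Once the input of subsystem `i` is the one of the law, the predictions are exact and the
transformed state follows the parametrization of the reference; hence the reference is attained
at the right end. -/
theorem Kernels.Solve.reference_eq_alpha (hD : D.Solve) (hC : C.Standing) (hτ : 0 < τ)
    (hi : i ∈ Finset.Icc 1 C.N) {z : ℝ → C.State} {W : C.Inputs}
    {U : ℝ → Fin (C.n 1) → ℝ} (hz : C.IsSol 1 0 (Ici 0) U z)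
    (hW : D.IsFeedback τ (fun r => z (r - τ)) W) {T : ℝ} (hT : C.startTime τ ≤ T)
    (hin : ∀ r, T ≤ r → (z (r - τ)).u i 0 = C.Qd i *ᵥ (z (r - τ)).v i 0 +
        (W i (r - C.theta τ i) - D.memory (fun r => z (r - τ)) r i)) {r : ℝ}
    (hr : T + C.theta τ i + 1 / C.lam1 i ≤ r) :
    C.reference τ W i r = D.alpha z i (r - τ) 1 := by
  have hlam := one_div_pos.2 (lam1_pos hC hi)
  have hθ : 0 < C.theta τ i := by
    linarith [memLen_nonneg hC hi, memLen_add_le_theta hC (τ := τ) hi]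
  have h0 : ∀ k, ∀ r ≥ T + C.theta τ i, D.flat i (C.reference τ W i) k r 0 =
      D.flat i (fun r => D.alpha z i (r - τ) 1) k r 0 := by
    intro k r hr
    have ht : C.startTime τ ≤ r - C.theta τ i := by linarith
    have htau := (lt_of_startTime hC hτ ht hi (by linarith [delay_nonneg hC hi] :
      r - C.theta τ i - C.delay i ≤ r - C.theta τ i)).2
    have hpred : D.IsPrediction τ (fun r => z (r - τ)) W i (r - C.theta τ i) (fun r => z (r - τ)) :=
      ⟨fun _ _ _ _ _ _ _ _ => ⟨rfl, rfl⟩, hz.delayed hC hi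
        (fun ρ hρ => mem_Ici.2 (by linarith [hρ.1])) htau.le
        fun ρ hρ _ => hin ρ (by linarith [hρ.1])⟩
    obtain ⟨p, hp, hWp⟩ := hW.after i hi _ ht
    have h1 := congrFun (hWp.trans (hp.virtualInput_eq hD hC hz hτ ht hi hpred)) k
    simp only [virtualInput, sub_add_cancel] at h1
    have h2 := congrFun (hin r (by linarith)) k
    simp only [Pi.add_apply, Pi.sub_apply] at h2
    rw [← hD.alpha_eq_flat hC hz hi τ k (by simp)]
    · simp only [alpha, tail, zero_div, integral_same, ite_self]
      linarith
    · have h3 := one_div_pos.2 (mu1_pos hC hi)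
      have := (lt_of_startTime hC hτ ht hi le_rfl).2
      rw [delay] at this
      linarith
  funext k
  refine (flat_injective hC hi h0 k).1 r ?_
  have : 1 / C.lam i k ≤ 1 / C.lam1 i := one_div_le_one_div_of_le (lam1_pos hC hi) (lam1_le hC hi k)
  linarith

/-- After some time, the subsystems receive the inputs of the law. -/
theorem Kernels.Solve.exists_tracking_time (hD : D.Solve) (hC : C.Standing)
    (hcontrol : ∀ i ∈ Finset.Ico 1 C.N, (C.Q i).rank = C.n (i + 1)) (hτ : 0 < τ) :
    ∀ i, 1 ≤ i → i ≤ C.N → ∃ T, C.startTime τ ≤ T ∧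
      ∀ (z : ℝ → C.State) (W : C.Inputs), C.IsSol 1 0 (Ici 0) (W 1) z →
      D.IsFeedback τ (fun r => z (r - τ)) W →
      ∀ r, T ≤ r → (z (r - τ)).u i 0 = C.Qd i *ᵥ (z (r - τ)).v i 0 +
        (W i (r - C.theta τ i) - D.memory (fun r => z (r - τ)) r i) := by
  intro i hi
  induction i, hi using Nat.le_induction with
  | base =>
    intro h1
    have hi : 1 ∈ Finset.Icc 1 C.N := Finset.mem_Icc.2 ⟨le_rfl, h1⟩
    refine ⟨_, le_rfl, fun z W hz _ r hr => ?_⟩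
    have := (lt_of_startTime hC hτ hr hi (by linarith [delay_nonneg hC hi] : r - C.delay 1 ≤ r)).2
    rw [hz.left_in (r - τ) (mem_Ici.2 (by linarith)) (by linarith)]
    simp [memory, theta]
  | succ i hi1 ih =>
    intro hiN
    obtain ⟨T, hT, h⟩ := ih (by omega)
    have hi : i ∈ Finset.Icc 1 C.N := Finset.mem_Icc.2 ⟨hi1, by omega⟩
    have hIco : i ∈ Finset.Ico 1 C.N := Finset.mem_Ico.2 ⟨hi1, by omega⟩
    have hlam := one_div_pos.2 (lam1_pos hC hi)
    have hθ : 0 < C.theta τ i := by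
      linarith [memLen_nonneg hC hi, memLen_add_le_theta hC (τ := τ) hi]
    refine ⟨T + C.theta τ i + 1 / C.lam1 i, by linarith, fun z W hz hW r hr => ?_⟩
    have h1 := hD.reference_eq_alpha hC hτ hi hz hW hT (h z W hz hW) hr
    have htau := (lt_of_startTime hC hτ (by linarith : C.startTime τ ≤ r) hi
      (by linarith [delay_nonneg hC hi] : r - C.delay i ≤ r)).2
    rw [hz.left i hIco (r - τ) (mem_Ici.2 (by linarith)) (by linarith)]
    congr 1
    have hdet : IsUnit (C.Q i * (C.Q i)ᵀ).det := by
      rw [← Matrix.isUnit_iff_isUnit_det, ← Matrix.mulVec_injective_iff_isUnit]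
      exact mulVec_injective_of_rank (by rw [Matrix.rank_self_mul_transpose, hcontrol i hIco])
    have h2 := congrArg (C.Q i *ᵥ ·) h1
    simp only [reference, if_pos (by omega : i < C.N), Matrix.mulVec_mulVec] at h2
    rw [← Matrix.mul_assoc, Matrix.mul_nonsing_inv _ hdet, Matrix.one_mulVec] at h2
    rw [h2, eq_sub_iff_add_eq]
    obtain ⟨j, rfl⟩ : ∃ j, i = j + 1 := ⟨i - 1, by omega⟩
    rw [memory, ← Matrix.mulVec_add]
    congr 1
    funext k
    simp only [alpha, tail, if_pos (by omega : j + 1 < C.N), integral_same, add_zero, Pi.add_apply]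
    simp only [sub_right_comm]

/-- The closed loop is at rest after a time that does not depend on the initial state. -/
theorem Kernels.Solve.exists_rest_time (hD : D.Solve) (hC : C.Standing)
    (hcontrol : ∀ i ∈ Finset.Ico 1 C.N, (C.Q i).rank = C.n (i + 1))
    (hobs : ∀ i ∈ Finset.Ico 1 C.N, (C.Q i).rank = C.n i) (hτ : 0 < τ) :
    ∃ T, 0 < T ∧ ∀ (z : ℝ → C.State) (W : C.Inputs),
      C.IsSol 1 0 (Ici 0) (W 1) z → D.IsFeedback τ (fun r => z (r - τ)) W →
      ∀ t, T ≤ t → ∀ i ∈ Finset.Icc 1 C.N, ∀ x ∈ Icc (0 : ℝ) 1, (z t).u i x = 0 ∧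
          (z t).v i x = 0 := by
  have hN : C.N ∈ Finset.Icc 1 C.N := Finset.mem_Icc.2 ⟨hC.N_pos, le_rfl⟩
  obtain ⟨T, hT, h⟩ := hD.exists_tracking_time hC hcontrol hτ C.N hC.N_pos le_rfl
  have hlam := one_div_pos.2 (lam1_pos hC hN)
  have hθ : 0 < C.theta τ C.N := by
    linarith [memLen_nonneg hC hN, memLen_add_le_theta hC (τ := τ) hN]
  have hT0 := (lt_of_startTime hC hτ hT hN
    (by linarith [delay_nonneg hC hN] : T - C.delay C.N ≤ T)).2
  set a := T + C.theta τ C.N + 1 / C.lam1 C.N - τ with ha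
  have hmu : 0 ≤ ∑ j ∈ Finset.Icc 1 C.N, 1 / C.mu1 j :=
    sum_nonneg fun j hj => (one_div_pos.2 (mu1_pos hC hj)).le
  refine ⟨a + ∑ j ∈ Finset.Icc 1 C.N, 1 / C.mu1 j + 1, by linarith, fun z W hz hW t ht => ?_⟩
  have hzero : C.IsSol 1 0 (Ici 0) (fun _ => 0) (fun _ => ⟨fun _ _ => 0, fun _ _ => 0⟩) := by
    have hm : ∀ {a b} (A : Matrix (Fin a) (Fin b) ℝ), (A *ᵥ fun _ => 0) = fun _ => 0 :=
      fun A => Matrix.mulVec_zero A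
    have hp : ∀ a, ((fun _ => 0) + fun _ => 0 : Fin a → ℝ) = fun _ => 0 := fun a => zero_add _
    constructor <;> intros <;> simp [hm, hp]
    exact ⟨0, fun _ _ _ _ _ _ _ _ _ => ⟨fun _ => le_rfl, fun _ => le_rfl⟩⟩
  have := hz.agree_of_output hC hobs hzero (a := a)
    (b := t + ∑ j ∈ Finset.Icc 1 C.N, 1 / C.lam1 j) (by linarith) (fun s h1 h2 => ?_)
    (s := t) (by linarith) (by linarith)
  · exact this
  · have h3 := hD.reference_eq_alpha hC hτ hN hz hW hT (h z W hz hW) (r := s + τ) (by linarith)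
    funext k
    have h4 := congrFun h3 k
    simp only [reference, lt_irrefl, if_false, alpha, tail, integral_same,
      add_zero, add_sub_cancel_right] at h4
    exact h4.symm

end Chain

/-- If bounds `w k * Ω` can be replaced by `w k * (Ω / 2 + R)`, then `w k * (2 R)` are bounds. -/
theorem ParamNorm.of_half_weight {Θ ι : Type*} [MeasurableSpace Θ] (ν : ParamNorm Θ)
    {f : ι → Θ → ℝ} {w : ι → ℝ} (hw : ∀ k, 0 < w k) {R : ℝ}
    (h0 : ∃ Ω, 0 < Ω ∧ ∀ k, ν.Bd (f k) (w k * Ω)) (hR : 0 ≤ R)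
    (hstep : ∀ Ω, 0 < Ω → (∀ k, ν.Bd (f k) (w k * Ω)) → ∀ k, ν.Bd (f k) (w k * (Ω / 2 + R)))
    (k : ι) : ν.Bd (f k) (w k * (2 * R)) := by
  obtain ⟨Ω, hΩ, h0⟩ := h0
  have claim : ∀ n : ℕ, ∀ k, ν.Bd (f k) (w k * (2 * R + Ω / 2 ^ n)) := by
    intro n
    induction n with
    | zero => exact fun k => ν.mono (h0 k) (mul_le_mul_of_nonneg_left (by simp; linarith) (hw k).le)
    | succ n ih =>
      intro k
      refine ν.mono (hstep _ (by positivity) ih k) (le_of_eq ?_)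
      rw [pow_succ]; ring
  refine ν.closed fun ε hε => ?_
  obtain ⟨n, hn⟩ := pow_unbounded_of_one_lt (w k * Ω / ε) (by norm_num : (1 : ℝ) < 2)
  rw [div_lt_iff₀ hε] at hn
  have : w k * (Ω / 2 ^ n) ≤ ε := by
    rw [← mul_div_assoc, div_le_iff₀ (by positivity)]
    linarith
  exact ν.mono (claim n k) (by linarith)

theorem ParamNorm.of_half {Θ ι : Type*} [MeasurableSpace Θ] (ν : ParamNorm Θ) {f : ι → Θ → ℝ}
    {R : ℝ} (hR : 0 ≤ R) (h0 : ∃ Ω, 0 < Ω ∧ ∀ k, ν.Bd (f k) Ω)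
    (hstep : ∀ Ω, 0 < Ω → (∀ k, ν.Bd (f k) Ω) → ∀ k, ν.Bd (f k) (Ω / 2 + R)) (k : ι) :
    ν.Bd (f k) (2 * R) := by
  have := ν.of_half_weight (f := f) (w := fun _ => 1) (R := R) (fun _ => one_pos)
  simp only [one_mul] at this
  exact this h0 hR hstep k

namespace Net

variable {J ι : Type} [Fintype ι]

/-- Coefficients of a linear functional of a solution of a network on a time interval `[0,θ]`:
`A` acts on the final outflow, `R` on the final profiles, and `F` on the outflow at the last
times. -/
structure Functional (ι : Type) where
  A : ι → ℝ
  R : ι → ℝ → ℝ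
  F : ι → ℝ → ℝ

namespace Functional

/-- The value of the functional on the components `e` of a solution `q`. -/
def eval (Φ : Functional ι) (P : Net J) (e : ι → J) (θ : ℝ) (q : J → ℝ → ℝ → ℝ) : ℝ :=
  (∑ a, Φ.A a * q (e a) θ (P.xout (e a))) + (∫ y in 0..1, ∑ a, Φ.R a y * q (e a) θ y) +
    ∫ y in 0..P.h, ∑ a, Φ.F a y * q (e a) (θ - y) (P.xout (e a))

/-- The coefficients are Borel and bounded by `M`. -/
structure Bounded (Φ : Functional ι) (h M : ℝ) : Prop where
  nonneg : 0 ≤ M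
  A_le : ∀ a, |Φ.A a| ≤ M
  R_meas : ∀ a, Measurable (Φ.R a)
  R_le : ∀ a, ∀ y ∈ Icc (0 : ℝ) 1, |Φ.R a y| ≤ M
  F_meas : ∀ a, Measurable (Φ.F a)
  F_le : ∀ a, ∀ y ∈ Icc 0 h, |Φ.F a y| ≤ M

variable {Φ : Functional ι} {P : Net J} {e : ι → J} {θ M M' : ℝ}

theorem eval_sub (hΦ : Φ.Bounded P.h M) (hh : 0 ≤ P.h) (hθ : P.h ≤ θ) {q q' : J → ℝ → ℝ → ℝ}
    (hq : Tame q θ) (hq' : Tame q' θ) :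
    Φ.eval P e θ q - Φ.eval P e θ q' = Φ.eval P e θ fun j s x => q j s x - q' j s x := by
  have i1 : ∀ q : J → ℝ → ℝ → ℝ, Tame q θ →
      IntervalIntegrable (fun y => ∑ a, Φ.R a y * q (e a) θ y) volume 0 1 ∧
      IntervalIntegrable (fun y => ∑ a, Φ.F a y * q (e a) (θ - y) (P.xout (e a))) volume 0 P.h := by
    rintro q ⟨hqm, B, hqB⟩
    constructor
    · refine intervalIntegrable_sum fun a _ => intervalIntegrable_of_abs_le (M := M * B)
        ((hΦ.R_meas a).mul ((hqm _).comp measurable_prodMk_left)) fun y hy => ?_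
      rw [uIcc_of_le zero_le_one] at hy
      rw [abs_mul]
      exact mul_le_mul (hΦ.R_le a y hy) (hqB _ _ _ (by linarith) le_rfl hy) (abs_nonneg _) hΦ.nonneg
    · refine intervalIntegrable_sum fun a _ => intervalIntegrable_of_abs_le (M := M * B)
        ((hΦ.F_meas a).mul ((hqm (e a)).comp
          (by fun_prop : Measurable fun y : ℝ => (θ - y, P.xout (e a))))) fun y hy => ?_
      rw [uIcc_of_le hh] at hy
      rw [abs_mul]
      exact mul_le_mul (hΦ.F_le a y hy) (hqB _ _ _ (by linarith [hy.2]) (by linarith [hy.1])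
        (xout_mem _)) (abs_nonneg _) hΦ.nonneg
  obtain ⟨a1, a2⟩ := i1 q hq
  obtain ⟨b1, b2⟩ := i1 q' hq'
  simp only [eval, mul_sub, sum_sub_distrib]
  rw [intervalIntegral.integral_sub a1 b1, intervalIntegral.integral_sub a2 b2]
  ring

variable {Θ : Type*} [MeasurableSpace Θ] {q : Θ → J → ℝ → ℝ → ℝ}

theorem measurable_eval (hΦ : Φ.Bounded P.h M)
    (hqm : ∀ j, Measurable fun p : Θ × ℝ × ℝ => q p.1 j p.2.1 p.2.2) :
    Measurable fun t => Φ.eval P e θ (q t) := by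
  refine ((measurable_sum _ fun a _ => Measurable.const_mul ?_ _).add
    (measurable_intervalIntegral (measurable_sum _ fun a _ =>
      ((hΦ.R_meas a).comp measurable_snd).mul ?_) measurable_const measurable_const)).add
    (measurable_intervalIntegral (measurable_sum _ fun a _ =>
      ((hΦ.F_meas a).comp measurable_snd).mul ?_) measurable_const measurable_const)
  · exact (hqm (e a)).comp (by fun_prop : Measurable fun t : Θ => (t, θ, P.xout (e a)))
  · exact (hqm (e a)).comp (by fun_prop : Measurable fun p : Θ × ℝ => (p.1, θ, p.2))
  · exact (hqm (e a)).comp (by fun_prop : Measurable fun p : Θ × ℝ => (p.1, θ - p.2, P.xout (e a)))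

/-- The functional only sees the solution away from the inflow ends, except on small sets, where
the weight `exp (β s - κ pos)` is small. -/
theorem eval_bd (ν : ParamNorm Θ) (hΦ : Φ.Bounded P.h M) (hh : 0 ≤ P.h)
    (hθ : P.h ≤ θ) {κ β N : ℝ} (hκ : 0 < κ) (hβ : 0 ≤ β) (hN : 0 < N)
    (hqm : ∀ j, Measurable fun p : Θ × ℝ × ℝ => q p.1 j p.2.1 p.2.2)
    (hq : ∀ j s x, 0 ≤ s → s ≤ θ → x ∈ Icc 0 1 →
      ν.Bd (fun t => q t j s x) (N * exp (β * s - κ * P.pos j x))) :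
    ν.Bd (fun t => Φ.eval P e θ (q t))
      (Fintype.card ι * (M + 1) * (3 + P.h) / κ * (N * exp (β * θ))) := by
  set w := N * exp (β * θ) with hw
  have hw0 : 0 < w := by positivity
  have hM := hΦ.nonneg
  set n : ℝ := (Fintype.card ι : ℝ) with hn
  have hn0 : 0 ≤ n := by positivity
  have hek : exp (-κ) ≤ 1 / κ := by
    rw [Real.exp_neg, ← one_div]
    exact one_div_le_one_div_of_le hκ (by linarith [Real.add_one_le_exp κ])
  have hout : ∀ a s, 0 ≤ s → s ≤ θ → ν.Bd (fun t => q t (e a) s (P.xout (e a))) (1 / κ * w) := by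
    intro a s h1 h2
    refine ν.mono (hq _ _ _ h1 h2 (xout_mem _)) ?_
    rw [pos_xout, mul_one, sub_eq_add_neg, exp_add, mul_comm (exp _), mul_left_comm]
    refine mul_le_mul hek ?_ (by positivity) (by positivity)
    exact mul_le_mul_of_nonneg_left (exp_le_exp.2 (mul_le_mul_of_nonneg_left h2 hβ)) hN.le
  have h1 := ν.sum_mul (A := M) (by positivity) hΦ.A_le fun a => hout a θ (by linarith) le_rfl
  have hqR : Measurable fun p : Θ × ℝ => ∑ a, Φ.R a p.2 * q p.1 (e a) θ p.2 :=
    measurable_sum _ fun a _ => ((hΦ.R_meas a).comp measurable_snd).mul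
      ((hqm (e a)).comp (by fun_prop : Measurable fun p : Θ × ℝ => (p.1, θ, p.2)))
  have hqF : Measurable fun p : Θ × ℝ => ∑ a, Φ.F a p.2 * q p.1 (e a) (θ - p.2) (P.xout (e a)) :=
    measurable_sum _ fun a _ => ((hΦ.F_meas a).comp measurable_snd).mul
      ((hqm (e a)).comp (by fun_prop : Measurable fun p : Θ × ℝ => (p.1, θ - p.2, P.xout (e a))))
  have hM1 : (0 : ℝ) < n + 1 := by positivity
  -- the bounds of the integrands have to be positive, also if there are no components
  have hstrict : ∀ r : ℝ, 0 < r → ∀ δ, 0 < δ → 0 < n * (M * r) + δ := fun r hr δ hδ => by positivity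
  refine ν.closed fun δ hδ => ?_
  have h2 := ν.integral (m := fun y => n * (M * (w * (exp (0 - κ * y) +
      exp (-κ + κ * y)))) + δ / 2) (a := 1) zero_le_one hqR (by fun_prop)
    (fun r => hstrict _ (by positivity) _ (by positivity)) fun y hy => by
      refine ν.mono (ν.sum_mul (A := M) (M := w * (exp (0 - κ * y) + exp (-κ + κ * y)))
        (by positivity) (fun a => hΦ.R_le a y hy)
        fun a => ν.mono (hq (e a) θ y (by linarith) le_rfl hy) ?_) (by linarith)
      rw [sub_eq_add_neg, exp_add, ← mul_assoc]
      refine mul_le_mul_of_nonneg_left ?_ hw0.le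
      unfold pos
      split_ifs
      · rw [zero_sub]; linarith [exp_pos (-κ + κ * y)]
      · rw [show -(κ * (1 - y)) = -κ + κ * y by ring]; linarith [exp_pos (0 - κ * y)]
  have h3 := ν.integral (m := fun _ => n * (M * (1 / κ * w)) + δ / (2 * (P.h + 1)))
      (a := P.h) hh hqF
    continuous_const (fun r => hstrict _ (by positivity) _ (by positivity)) fun y hy =>
      ν.mono (ν.sum_mul (A := M) (by positivity) (fun a => hΦ.F_le a y hy)
        fun a => hout a (θ - y) (by linarith [hy.2]) (by linarith [hy.1]))
        (by linarith [show 0 < δ / (2 * (P.h + 1)) by positivity])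
  refine ν.mono (ν.add (ν.add h1 h2) h3) ?_
  have c1 : Continuous fun y => exp (0 - κ * y) := by fun_prop
  have c2 : Continuous fun y => exp (-κ + κ * y) := by fun_prop
  rw [intervalIntegral.integral_const, smul_eq_mul, sub_zero, intervalIntegral.integral_add
    (Continuous.intervalIntegrable (by fun_prop) _ _) (by simp)]
  simp only [intervalIntegral.integral_const_mul, intervalIntegral.integral_const, smul_eq_mul]
  rw [intervalIntegral.integral_add (c1.intervalIntegrable _ _) (c2.intervalIntegrable _ _)]
  have e1 := integral_exp_sub_mul_le (c := 0) (a := 1) hκ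
  have e2 := integral_exp_add_mul_le (c := -κ) (a := 1) hκ
  rw [exp_zero] at e1
  rw [mul_one, neg_add_cancel, exp_zero] at e2
  have e3 := mul_le_mul_of_nonneg_left (add_le_add e1 e2) (by positivity : 0 ≤ n * M * w)
  have e4 : P.h * (δ / (2 * (P.h + 1))) ≤ δ / 2 := by
    rw [mul_div_assoc', div_le_div_iff₀ (by positivity) (by positivity)]
    nlinarith
  have e5 : n * (M + 1) * (3 + P.h) / κ * w = n * M * (3 + P.h) / κ * w +
      n * (3 + P.h) / κ * w := by
    ring
  have e6 : 0 ≤ n * (3 + P.h) / κ * w := by positivity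
  have e7 : n * M * (3 + P.h) / κ * w = n * (M * (1 / κ * w)) + n * M * w * (1 / κ + 1 / κ) +
      P.h * (n * (M * (1 / κ * w))) := by ring
  linarith

end Functional

end Net

namespace Chain

/-! ### Families of predictions -/

variable {C : Chain} {i : ℕ} {D : C.Kernels} {τ : ℝ}

/-- The part of the control law for component `k` of `Û_i` that depends on the prediction. -/
def Kernels.lawFun (D : C.Kernels) (i : ℕ) (k : Fin (C.n i)) : Net.Functional (C.Comp i) where
  A := Sum.elim 0 fun l => -C.Qd i k l
  R a y := -D.row i k a 0 y
  F a y := Sum.elim 0 (fun l => D.memK i y k l) a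

/-- The network for the predictions of the subsystems `i, …, N`. -/
abbrev Kernels.predNet (D : C.Kernels) (i : ℕ) : Net (C.Idx i) := C.toNet i D.memK (C.memLen i)

/-- The value of the functional `lawFun` at the end of the prediction horizon. -/
def Kernels.lawVal (D : C.Kernels) (τ : ℝ) (hii : i ∈ Finset.Icc i C.N)
    (q : C.Idx i → ℝ → ℝ → ℝ) (k : Fin (C.n i)) : ℝ :=
  (D.lawFun i k).eval (D.predNet i) (fun a => ⟨⟨i, hii⟩, a⟩) (C.theta τ i) q

theorem Kernels.Solve.exists_lawFun_bounded (hD : D.Solve) (hC : C.Standing)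
    (hi : i ∈ Finset.Icc 1 C.N) : ∃ M, ∀ k, (D.lawFun i k).Bounded (C.memLen i) M := by
  obtain ⟨M1, hM1, h1⟩ := hD.exists_bound_row hC hi
  obtain ⟨-, hm, M2, h2⟩ := hD.memKernel hC hi
  obtain ⟨M3, hM3, h3⟩ := exists_bound_of_finite (X := Unit)
    (f := fun (p : Fin (C.n i) × Fin (C.m i)) _ => C.Qd i p.1 p.2) fun p => ⟨_, fun _ => le_rfl⟩
  have h0 := abs_nonneg M2
  refine ⟨M1 + |M2| + M3, fun k => ⟨by positivity, ?_, fun a => ?_, fun a y hy => ?_, ?_, ?_⟩⟩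
  · rintro (a | a)
    · simp only [lawFun, Sum.elim_inl, Pi.zero_apply, abs_zero]; positivity
    · simp only [lawFun, Sum.elim_inr, abs_neg]
      linarith [h3 (k, a) ()]
  · exact ((hD.measurable_row hi k a).comp measurable_prodMk_left).neg
  · simp only [lawFun, abs_neg]
    linarith [(h1 k a 0 y ⟨le_rfl, hy.1, hy.2⟩).1]
  · rintro (a | a)
    · exact measurable_const
    · exact hm k a
  · rintro (a | a) y hy
    · simp only [lawFun, Sum.elim_inl, Pi.zero_apply, abs_zero]; positivity
    · simp only [lawFun, Sum.elim_inr]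
      linarith [h2 y hy k a, le_abs_self M2]

/-- The law in terms of the components of a prediction. -/
theorem Kernels.IsPrediction.virtualInput_eq_lawVal {t : ℝ} {z : ℝ → C.State}
    {U : ℝ → Fin (C.n 1) → ℝ} {p : ℝ → C.State} {W : C.Inputs}
    (hp : D.IsPrediction τ (fun r => z (r - τ)) W i t p) (hD : D.Solve) (hC : C.Standing)
    (hz : C.IsSol 1 0 (Ici 0) U z) (hτ : 0 < τ) (ht : C.startTime τ ≤ t)
    (hi : i ∈ Finset.Icc 1 C.N) (hii : i ∈ Finset.Icc i C.N) (k : Fin (C.n i)) :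
    D.virtualInput τ W i t p k = D.flat i (C.reference τ W i) k (t + C.theta τ i) 0 +
      D.lawVal τ hii (toFam i p t) k := by
  have hi1 := (Finset.mem_Icc.1 hi).1
  have hθ : t ≤ t + C.theta τ i := by
    linarith [memLen_nonneg hC hi, memLen_add_le_theta hC (τ := τ) hi]
  have e2 : (∫ y in 0..1, ∑ a, (D.lawFun i k).R a y *
      toFam i p t ⟨⟨i, hii⟩, a⟩ (C.theta τ i) y) = -∫ y in 0..1,
        ((D.Kuu i 0 y *ᵥ (p (t + C.theta τ i)).u i y) k +
          (D.Kuv i 0 y *ᵥ (p (t + C.theta τ i)).v i y) k) := by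
    rw [← intervalIntegral.integral_neg]
    refine integral_congr fun y _ => ?_
    simp only [lawFun, Kernels.row, toFam, Fintype.sum_sum_type, Matrix.mulVec, dotProduct,
      Sum.elim_inl, Sum.elim_inr, neg_mul, sum_neg_distrib, neg_add]
  unfold lawVal Net.Functional.eval
  rw [e2]
  unfold virtualInput
  rw [hp.memory_eq hD hC hz hτ ht hi ⟨hθ, le_rfl⟩]
  simp only [Fintype.sum_sum_type, xout_inr hC hi1 hii, lawFun, Sum.elim_inl, Sum.elim_inr,
    Pi.zero_apply, zero_mul, sum_const_zero, zero_add, memTerm, Matrix.mulVec, dotProduct,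
    toFam, neg_mul, sum_neg_distrib, add_sub_assoc]
  change _ = _ + (_ + _ + ∫ y in 0..C.memLen i, _)
  ring

/-- The input of the prediction that starts at time `t`, cut off at the end of the horizon. -/
def predInput (C : Chain) (τ : ℝ) (i : ℕ) (W : C.Inputs) (t : ℝ)
    (j : ℕ) (r : ℝ) : Fin (C.n j) → ℝ :=
  if r ≤ t + C.theta τ i then W j (r - C.theta τ i) else 0

/-- `q t` is, for every starting time `t`, the prediction with initial values `q₀ t`, past
outflow `past t`, and virtual input `W`. -/
structure Kernels.PredFam (D : C.Kernels) (τ : ℝ) (i : ℕ) (q₀ past : ℝ → C.Idx i → ℝ → ℝ)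
    (W : C.Inputs) (q : ℝ → C.Idx i → ℝ → ℝ → ℝ) : Prop where
  meas : ∀ j, Measurable fun p : ℝ × ℝ × ℝ => q p.1 j p.2.1 p.2.2
  meas_past : ∀ j, Measurable fun p : ℝ × ℝ => past p.1 j p.2
  bdd : ∀ H L, ∃ B, ∀ t ≤ H, ∀ j s x, 0 ≤ s → s ≤ L → x ∈ Icc 0 1 → |q t j s x| ≤ B
  bdd_past : ∀ t, ∃ B, ∀ j s, -C.memLen i ≤ s → s < 0 → |past t j s| ≤ B
  eq : ∀ t j s x, 0 ≤ s → x ∈ Icc 0 1 → q t j s x =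
    (D.predNet i).mild (q₀ t) (past t) (netInput i (C.predInput τ i W t) t) (q t) j s x

variable {q₀ past q₀' past' : ℝ → C.Idx i → ℝ → ℝ} {W W' : C.Inputs}
  {q q' : ℝ → C.Idx i → ℝ → ℝ → ℝ}

theorem Kernels.PredFam.tame (hq : D.PredFam τ i q₀ past W q) (t L : ℝ) : Net.Tame (q t) L :=
  ⟨fun j => (hq.meas j).comp (by fun_prop : Measurable fun p : ℝ × ℝ => (t, p.1, p.2)),
    (hq.bdd t L).imp fun _ hB => hB t le_rfl⟩

theorem Kernels.PredFam.tamePast (hq : D.PredFam τ i q₀ past W q) (t : ℝ) :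
    (D.predNet i).TamePast (past t) :=
  ⟨fun j => (hq.meas_past j).comp measurable_prodMk_left, hq.bdd_past t⟩

theorem Kernels.PredFam.sub (hq : D.PredFam τ i q₀ past W q) (hq' : D.PredFam τ i q₀' past' W' q')
    (hD : D.Solve) (hC : C.Standing) (hi : i ∈ Finset.Icc 1 C.N) :
    D.PredFam τ i (fun t j x => q₀ t j x - q₀' t j x) (fun t j s => past t j s - past' t j s)
      (fun j r => W j r - W' j r) (fun t j s x => q t j s x - q' t j s x) := by
  obtain ⟨M, hP⟩ := exists_regular hC (Finset.mem_Icc.1 hi).1 (hD.memKernel hC hi)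
  refine ⟨fun j => (hq.meas j).sub (hq'.meas j), fun j => (hq.meas_past j).sub (hq'.meas_past j),
    fun t L => ?_, fun t => ?_, fun t j s x hs hx => ?_⟩
  · obtain ⟨B, hB⟩ := hq.bdd t L
    obtain ⟨B', hB'⟩ := hq'.bdd t L
    exact ⟨B + B', fun t ht j s x h1 h2 h3 =>
      (abs_sub _ _).trans (add_le_add (hB t ht j s x h1 h2 h3) (hB' t ht j s x h1 h2 h3))⟩
  · obtain ⟨B, hB⟩ := hq.bdd_past t
    obtain ⟨B', hB'⟩ := hq'.bdd_past t
    exact ⟨B + B', fun j s h1 h2 => (abs_sub _ _).trans (add_le_add (hB j s h1 h2) (hB' j s h1 h2))⟩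
  · rw [hq.eq t j s x hs hx, hq'.eq t j s x hs hx, hP.mild_sub (hq.tame t s) (hq'.tame t s)
      (hq.tamePast t) (hq'.tamePast t) j hs le_rfl hx]
    congr 1
    funext j s
    rcases j with ⟨⟨j, hj⟩, k | k⟩
    · simp only [netInput, Sum.elim_inl, predInput]
      split_ifs <;> simp
    · simp [netInput]

theorem abs_netInput_le {t s B : ℝ} (hB : 0 ≤ B) (h : ∀ k, |W i (t + s) k| ≤ B) (j : C.Idx i) :
    |netInput i W t j s| ≤ B := by
  rcases j with ⟨⟨j, hj⟩, k | k⟩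
  · simp only [netInput, Sum.elim_inl]
    split_ifs with h1
    · subst h1; exact h k
    · simpa using hB
  · simpa [netInput] using hB

/-- Existence of the predictions, with a bound by a monotone weight. -/
theorem Kernels.Solve.exists_predFam (hD : D.Solve) (hC : C.Standing) (hi : i ∈ Finset.Icc 1 C.N)
    {ω : ℝ → ℝ} (hω : ∀ t, 0 < ω t) (hmono : Monotone ω) {A Ω : ℝ} (hA : 0 ≤ A) (hΩ : 0 ≤ Ω)
    (hm₀ : ∀ j, Measurable fun p : ℝ × ℝ => q₀ p.1 j p.2)
    (hmp : ∀ j, Measurable fun p : ℝ × ℝ => past p.1 j p.2) (hW : Measurable (W i))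
    (hq₀ : ∀ t j x, x ∈ Icc 0 1 → |q₀ t j x| ≤ A * ω t)
    (hpast : ∀ t j s, -C.memLen i ≤ s → s < 0 → |past t j s| ≤ A * ω t)
    (hWΩ : ∀ t k, |W i t k| ≤ Ω * ω t) :
    ∃ q, D.PredFam τ i q₀ past W q ∧ ∃ N, ∀ t j s x, 0 ≤ s → s ≤ C.theta τ i →
      x ∈ Icc 0 1 → |q t j s x| ≤ N * ω t := by
  obtain ⟨M, hP⟩ := exists_regular hC (Finset.mem_Icc.1 hi).1 (hD.memKernel hC hi)
  obtain ⟨κ, β, -, he⟩ := hP.exists_exponents 0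
  have hβ : 0 ≤ β := by linarith [he.one_le]
  obtain ⟨q, hqm, ⟨G, hG0, hqB⟩, hq⟩ := hP.exists_family (Θ := ℝ) (q₀ := q₀) (past := past)
    (b := fun t => netInput i (C.predInput τ i W t) t) (d := ω) he hA hΩ hω hmp
    (fun j => by
      rcases j with ⟨⟨j, hj⟩, k | k⟩
      · simp only [netInput, Sum.elim_inl, predInput]
        by_cases h1 : j = i
        · subst h1
          simp only [if_true, ite_apply, Pi.zero_apply]
          have e : Measurable fun p : ℝ × ℝ => W j (p.1 + p.2 - C.theta τ j) k :=
            (measurable_pi_iff.1 hW k).comp (by fun_prop)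
          exact Measurable.ite (measurableSet_le
            (by fun_prop : Measurable fun p : ℝ × ℝ => p.1 + p.2)
            (by fun_prop : Measurable fun p : ℝ × ℝ => p.1 + C.theta τ j)) e measurable_const
        · simp only [if_neg h1]; exact measurable_const
      · exact measurable_const)
    hm₀ hq₀ hpast fun t j s hs => by
      have h0 : 0 ≤ Ω * ω t := mul_nonneg hΩ (hω t).le
      refine (abs_netInput_le h0 (fun k => ?_) j).trans ?_
      · unfold predInput
        split_ifs with h1
        · exact (hWΩ _ k).trans (mul_le_mul_of_nonneg_left (hmono (by linarith)) hΩ)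
        · simpa using h0
      have := one_le_exp (by positivity : 0 ≤ β * s)
      have := mul_le_mul_of_nonneg_left this (mul_nonneg hΩ (hω t).le)
      linarith
  have hb : ∀ L t j s x, 0 ≤ s → s ≤ L → x ∈ Icc 0 1 →
      |q t j s x| ≤ G * exp (β * L) * ω t := fun L t j s x h1 h2 h3 =>
    (hqB t j s x h1 h3).trans (mul_le_mul_of_nonneg_right (mul_le_mul_of_nonneg_left
      (exp_le_exp.2 (mul_le_mul_of_nonneg_left h2 hβ)) hG0) (hω t).le)
  exact ⟨q, ⟨hqm, hmp, fun H L => ⟨_, fun t ht j s x h1 h2 h3 => (hb L t j s x h1 h2 h3).trans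
    (mul_le_mul_of_nonneg_left (hmono ht) (by positivity))⟩, fun t => ⟨_, hpast t⟩, hq⟩, _, hb _⟩

/-- The functional `lawVal` of predictions is at most `Ω / 4 + G A` if the virtual input has size
`Ω` with respect to the weight `exp (β t)` and the initial values have size `A`. -/
def Kernels.LawBd (D : C.Kernels) (τ : ℝ) (hii : i ∈ Finset.Icc i C.N) (β G : ℝ) : Prop :=
  ∀ (ν : ParamNorm ℝ) (q₀ past : ℝ → C.Idx i → ℝ → ℝ) (W : C.Inputs)
    (q : ℝ → C.Idx i → ℝ → ℝ → ℝ) (N A Ω : ℝ), D.PredFam τ i q₀ past W q → 0 < Ω → 0 ≤ A →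
    (∀ j s x, 0 ≤ s → s ≤ C.theta τ i → x ∈ Icc 0 1 → ν.Bd (fun t => q t j s x) N) →
    (∀ j x, x ∈ Icc 0 1 → ν.Bd (fun t => q₀ t j x) A) →
    (∀ j s, -C.memLen i ≤ s → s < 0 → ν.Bd (fun t => past t j s) A) →
    (∀ k a, 0 ≤ a → ν.Bd (fun t => W i (t - a) k) (Ω * exp (-β * a))) →
    ∀ k, ν.Bd (fun t => D.lawVal τ hii (q t) k) (Ω / 4 + G * A)

theorem Kernels.LawBd.mono {hii : i ∈ Finset.Icc i C.N} {β β' G G' : ℝ} (h : D.LawBd τ hii β G)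
    (hβ : β ≤ β') (hG : G ≤ G') : D.LawBd τ hii β' G' :=
  fun ν q₀ past W q N A Ω hq hΩ hA hN hq₀ hpast hW k => ν.mono
    (h ν q₀ past W q N A Ω hq hΩ hA hN hq₀ hpast (fun k a ha => ν.mono (hW k a ha)
      (mul_le_mul_of_nonneg_left (exp_le_exp.2 (by nlinarith)) hΩ.le)) k)
    (by nlinarith [mul_le_mul_of_nonneg_right hG hA])

/-- The influence of the virtual input on the law, within the prediction, is small; the influence of
the initial values is bounded. -/
theorem Kernels.Solve.exists_law_bd (hD : D.Solve) (hC : C.Standing) (hτ : 0 < τ)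
    (hi : i ∈ Finset.Icc 1 C.N) (hii : i ∈ Finset.Icc i C.N) :
    ∃ β G, 0 ≤ β ∧ 0 ≤ G ∧ D.LawBd τ hii β G := by
  obtain ⟨M, hP⟩ := exists_regular hC (Finset.mem_Icc.1 hi).1 (hD.memKernel hC hi)
  obtain ⟨M', hΦ⟩ := hD.exists_lawFun_bounded hC hi
  have hh := memLen_nonneg hC hi
  have hθ := memLen_add_le_theta hC (τ := τ) hi
  set cst := (Fintype.card (C.Comp i) : ℝ) * (M' + 1) * (3 + C.memLen i) with hcst
  have hM'0 := (hΦ (C.fst i)).nonneg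
  have hcst0 : 0 ≤ cst := by positivity
  obtain ⟨κ, β, hκ', he⟩ := hP.exists_exponents (8 * cst + 1)
  have hβ1 := he.one_le
  have hκ0 : 0 < κ := by linarith
  have hκ1 : cst / κ ≤ 1 / 8 := by rw [div_le_iff₀ hκ0]; linarith
  have hgain := hP.gain_nonneg κ
  refine ⟨β, (D.predNet i).gain M κ * exp (β * C.theta τ i), by linarith, by positivity,
    fun ν q₀ past W q N A Ω hq hΩ hA hN hq₀ hpast hW k => ?_⟩
  have hin : ∀ j s, 0 < s → s ≤ C.theta τ i → ν.Bd (fun t => netInput i (C.predInput τ i W t) t j s)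
      (Ω * exp (-β * C.theta τ i) * exp (β * s)) := by
    rintro ⟨⟨j, hj⟩, l | l⟩ s h1 h2
    · simp only [netInput, Sum.elim_inl, predInput, add_le_add_iff_left, if_pos h2]
      split_ifs with h3
      · subst h3
        have e := hW l (C.theta τ j - s) (by linarith)
        rw [mul_assoc, ← exp_add, show -β * C.theta τ j + β * s = -β * (C.theta τ j - s) by ring]
        refine (congrArg (ν.Bd · _) (funext fun t => ?_)).mp e
        rw [← sub_add, sub_add_eq_add_sub]
      · exact ν.mono ν.zero (by positivity)
    · exact ν.mono ν.zero (by positivity)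
  have key := hP.family_bd ν (L := C.theta τ i) (N₀ := N) he hA hq.meas hq.meas_past
    (fun j s x h1 h2 h3 t => hq.eq t j s x h1 h3) hN hq₀ hpast hin (by positivity)
  have hpos : 0 < 2 * (Ω * exp (-β * C.theta τ i) + (D.predNet i).gain M κ * A) := by positivity
  refine ν.mono (Net.Functional.eval_bd ν (P := D.predNet i) (hΦ k) hh
    (show C.memLen i ≤ _ by linarith) hκ0
    (by linarith) hpos hq.meas key) ?_
  have e1 : exp (-β * C.theta τ i) * exp (β * C.theta τ i) = 1 := by
    rw [← exp_add]; simp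
  calc _ = cst / κ * (2 * (Ω * (exp (-β * C.theta τ i) * exp (β * C.theta τ i)) +
        (D.predNet i).gain M κ * A * exp (β * C.theta τ i))) := by
          rw [hcst, show C.memLen i = (D.predNet i).h from rfl]; ring
    _ ≤ 1 / 8 * (2 * (Ω * (exp (-β * C.theta τ i) * exp (β * C.theta τ i)) +
        (D.predNet i).gain M κ * A * exp (β * C.theta τ i))) :=
          mul_le_mul_of_nonneg_right hκ1 (by rw [e1]; positivity)
    _ ≤ _ := by
      rw [e1]
      have : 0 ≤ (D.predNet i).gain M κ * A * exp (β * C.theta τ i) := by positivity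
      linarith

end Chain

/-- The norm `ν` only sees the values on the window `[T,H]`, it is finite on bounded functions, and
a delay by `a` of a function that vanishes before `T` gains the factor `exp (-β a)`. -/
structure ParamNorm.OnWindow (ν : ParamNorm ℝ) (T H β : ℝ) : Prop where
  congr : ∀ {f g : ℝ → ℝ} {M : ℝ}, Measurable g → (∀ t ∈ Icc T H, f t = g t) → ν.Bd f M → ν.Bd g M
  fin : ∀ M : ℝ, ∃ N, ∀ {f : ℝ → ℝ}, Measurable f → (∀ t ∈ Icc T H, |f t| ≤ M) → ν.Bd f N
  shift : ∀ {f : ℝ → ℝ} {M a : ℝ}, Measurable f → (∀ t < T, f t = 0) → 0 ≤ a → ν.Bd f M →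
    ν.Bd (fun t => f (t - a)) (M * exp (-β * a))

theorem ParamNorm.onWindow_sup {T H β : ℝ} :
    (ParamNorm.sup (fun t => exp (β * t)) (Icc T H)).OnWindow T H β where
  congr _ h hf t ht hd := by rw [← h t ht]; exact hf t ht hd
  fin M := by
    refine ⟨|M| * exp (|β| * (|T| + |H|)), fun {f} _ h t ht _ => ?_⟩
    have h1 : |t| ≤ |T| + |H| := by
      rcases abs_cases t with ⟨e, _⟩ | ⟨e, _⟩ <;>
      linarith [ht.1, ht.2, neg_abs_le T, le_abs_self H, abs_nonneg T, abs_nonneg H]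
    have h2 : 0 ≤ |β| * (|T| + |H|) + β * t := by
      have := mul_le_mul_of_nonneg_left h1 (abs_nonneg β)
      rw [← abs_mul] at this
      linarith [neg_abs_le (β * t)]
    rw [mul_assoc, ← exp_add]
    exact (h t ht).trans ((le_abs_self M).trans
      (le_mul_of_one_le_right (abs_nonneg M) (one_le_exp h2)))
  shift {f M a} _ h0 ha hf t ht _ := by
    show |f (t - a)| ≤ M * exp (-β * a) * exp (β * t)
    by_cases h : t - a < T
    · rw [h0 _ h, abs_zero]
      have : 0 ≤ M * exp (β * T) :=
        (abs_nonneg _).trans (hf T ⟨le_rfl, ht.1.trans ht.2⟩ (exp_pos _).le)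
      have : 0 ≤ M := nonneg_of_mul_nonneg_left this (exp_pos _)
      positivity
    · have : |f (t - a)| ≤ M * exp (β * (t - a)) :=
        hf (t - a) ⟨not_lt.1 h, by linarith [ht.2]⟩ (exp_pos _).le
      rwa [show β * (t - a) = -β * a + β * t by ring, exp_add, ← mul_assoc] at this

namespace Chain

variable {C : Chain} {i : ℕ} {D : C.Kernels} {τ : ℝ}

theorem Kernels.Solve.flat_sub (hD : D.Solve) (hC : C.Standing) (hi : i ∈ Finset.Icc 1 C.N)
    {ζ ζ' : ℝ → Fin (C.n i) → ℝ} (hζ : ∀ k, Measurable fun r => ζ r k)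
    (hζ' : ∀ k, Measurable fun r => ζ' r k) {b B : ℝ} (hB : ∀ r ≤ b, ∀ k, |ζ r k| ≤ B)
    (hB' : ∀ r ≤ b, ∀ k, |ζ' r k| ≤ B) (k : Fin (C.n i)) : ∀ {s x : ℝ}, x ∈ Icc 0 1 →
    s + (1 - x) / C.lam1 i ≤ b →
    D.flat i ζ k s x - D.flat i ζ' k s x = D.flat i (fun r => ζ r - ζ' r) k s x := by
  obtain ⟨M, hM, hG⟩ := hD.exists_bound_G hC hi
  have hbd : ∀ l, ∃ A, ∀ ζ : ℝ → Fin (C.n i) → ℝ, (∀ k, Measurable fun r => ζ r k) →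
      (∀ r ≤ b, ∀ k, |ζ r k| ≤ B) → ∀ s x, x ∈ Icc 0 1 → s + (1 - x) / C.lam1 i ≤ b →
      |D.flat i ζ l s x| ≤ A := by
    intro l
    obtain ⟨A, -, hA⟩ := hD.exists_flat_bd hC hi l
    refine ⟨A * (|B| + 1), fun ζ hm hb s x hx hs => ?_⟩
    have := hA (ParamNorm.sup (fun _ => 1) {0}) ζ b (|B| + 1) hm (by positivity)
      (fun k r hr t ht _ => by
        show |ζ (t + r) k| ≤ (|B| + 1) * 1
        rw [mem_singleton_iff.1 ht, zero_add, mul_one]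
        linarith [hb r hr k, le_abs_self B]) s x hx hs 0 rfl zero_le_one
    simpa using this
  induction k using WellFoundedGT.induction with
  | _ k ih =>
    intro s x hx hs
    have hint : ∀ ζ : ℝ → Fin (C.n i) → ℝ, (∀ k, Measurable fun r => ζ r k) →
        (∀ r ≤ b, ∀ k, |ζ r k| ≤ B) → IntervalIntegrable (fun r =>
          ∑ l : {l : Fin (C.n i) // k < l}, D.G i (clamp (x + C.lam i k * r)) k l.1 *
            D.flat i ζ l.1 (s + r) (clamp (x + C.lam i k * r))) volume 0 ((1 - x) / C.lam i k) := by
      intro ζ hm hb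
      refine intervalIntegrable_sum fun l _ => ?_
      obtain ⟨A, hA⟩ := hbd l.1
      have hX : Measurable fun r : ℝ => x + C.lam i k * r := by fun_prop
      refine intervalIntegrable_of_abs_le (M := M * A)
          (((D.measurable_G hC hi (hD.meas_uu i hi k l.1)).comp hX).mul
        ((hD.measurable_flat hC hi hm l.1).comp ((measurable_id.const_add s).prodMk hX)))
        fun r hr => ?_
      rw [uIcc_of_le (exit_nonneg hC hi k hx)] at hr
      have hmem := char_mem hC hi k hx hr
      rw [abs_mul]
      refine mul_le_mul (hG _ _ _) ?_ (abs_nonneg _) hM.le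
      rw [clamp_of_mem hmem]
      exact hA ζ hm hb _ _ hmem (by linarith [exit_le hC hi k hx hr])
    rw [flat_clamp hC hi k s hx, flat_clamp hC hi k s hx, flat_clamp hC hi k s hx,
      sub_sub_sub_comm, ← intervalIntegral.integral_sub (hint ζ hζ hB) (hint ζ' hζ' hB')]
    congr 1
    refine integral_congr_Icc (exit_nonneg hC hi k hx) fun r hr => ?_
    have hmem := char_mem hC hi k hx hr
    simp only [← sum_sub_distrib, ← mul_sub, clamp_of_mem hmem]
    refine sum_congr rfl fun l _ => ?_
    rw [ih l.1 l.2 hmem (by linarith [exit_le hC hi k hx hr])]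

/-! ### The control law as a linear relation -/

/-- The components of the delayed signal `z (· - τ)` around the time `t`; zero before the law is
active. -/
def delayedFam (C : Chain) (τ : ℝ) (i : ℕ) (z : ℝ → C.State) (t : ℝ) (j : C.Idx i) (s x : ℝ) : ℝ :=
  if C.startTime τ ≤ t then toFam i (fun r => z (r - τ)) t j s x else 0

theorem exists_delayedFam_eq (h : 1 ≤ i) (j : C.Idx i) : ∃ j' : C.Idx 1,
    ∀ (z : ℝ → C.State) (t s x : ℝ), C.delayedFam τ i z t j s x =
      if C.startTime τ ≤ t then toFam 1 z 0 j' (t + s - τ) x else 0 := by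
  rcases j with ⟨⟨j, hj⟩, l⟩
  exact ⟨⟨⟨j, Icc_subset_Icc_left h hj⟩, l⟩, fun z t s x => by
    simp only [delayedFam, toFam, zero_add]⟩

/-- The regularity of virtual inputs: they are Borel, locally bounded, and zero before the law is
active. -/
structure IsVirtualInput (C : Chain) (τ : ℝ) (W : C.Inputs) : Prop where
  meas : ∀ i ∈ Finset.Icc 1 C.N, Measurable (W i)
  bdd : ∀ T : ℝ, ∃ M : ℝ, ∀ i ∈ Finset.Icc 1 C.N, ∀ t ≤ T, ∀ k, |W i t k| ≤ M
  before : ∀ i ∈ Finset.Icc 1 C.N, ∀ t < C.startTime τ, W i t = 0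

/-- `V` is computed by the right-hand side of the control law from the virtual inputs `W` and the
signal `z`, in terms of families of predictions. -/
def Kernels.Response (D : C.Kernels) (τ : ℝ) (z : ℝ → C.State) (W V : C.Inputs) : Prop :=
  ∀ i ∈ Finset.Icc 1 C.N, ∀ hii : i ∈ Finset.Icc i C.N, ∃ q, D.PredFam τ i
    (fun t j x => C.delayedFam τ i z t j 0 x)
    (fun t j s => C.delayedFam τ i z t j s ((D.predNet i).xout j)) W q ∧
    ∀ t, C.startTime τ ≤ t → ∀ k, V i t k =
      D.flat i (C.reference τ W i) k (t + C.theta τ i) 0 + D.lawVal τ hii (q t) k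

/-- `W` is the response of the control law to the signal `z`. -/
structure Kernels.Law (D : C.Kernels) (τ : ℝ) (z : ℝ → C.State)
    (W : C.Inputs) : Prop extends C.IsVirtualInput τ W where
  eq : D.Response τ z W W

variable {z z' : ℝ → C.State} {W W' V V' : C.Inputs}

theorem measurable_reference (hW : ∀ i ∈ Finset.Icc 1 C.N, Measurable (W i)) (k : Fin (C.n i)) :
    Measurable fun r => C.reference τ W i r k := by
  unfold reference
  split_ifs with h
  · simp only [Matrix.mulVec, dotProduct]
    exact measurable_sum _ fun l _ => ((measurable_pi_iff.1 (hW (i + 1)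
      (Finset.mem_Icc.2 ⟨by omega, h⟩)) l).comp
      (by fun_prop : Measurable fun r : ℝ => r - C.theta τ (i + 1))).const_mul _
  · exact measurable_const

/-- The size of the reference signals. -/
theorem exists_reference_bd (C : Chain) (τ : ℝ) (i : ℕ) : ∃ A, 0 ≤ A ∧ ∀ (ν : ParamNorm ℝ)
    (W : C.Inputs) (Ω r : ℝ), 0 ≤ Ω →
    (i < C.N → ∀ k, ν.Bd (fun t => W (i + 1) (t + r - C.theta τ (i + 1)) k) Ω) →
    ∀ k, ν.Bd (fun t => C.reference τ W i (t + r) k) (A * Ω) := by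
  obtain ⟨M, hM0, hM⟩ := exists_bound_of_finite (X := Unit)
    (f := fun (p : Fin (C.n i) × Fin (C.n (i + 1))) _ =>
      ((C.Q i)ᵀ * (C.Q i * (C.Q i)ᵀ)⁻¹) p.1 p.2) fun p => ⟨_, fun _ => le_rfl⟩
  refine ⟨Fintype.card (Fin (C.n (i + 1))) * M, by positivity, fun ν W Ω r hΩ h k => ?_⟩
  unfold reference
  split_ifs with hi
  · rw [mul_assoc]
    exact ν.sum_mul hΩ (fun l => hM (k, l) ()) (h hi)
  · exact ν.mono ν.zero (by positivity)

theorem reference_sub : (fun r => C.reference τ W i r - C.reference τ W' i r) =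
      C.reference τ (fun j r => W j r - W' j r) i := by
  funext r
  unfold reference
  split_ifs
  · rw [Matrix.mulVec_sub]
  · rw [sub_self]

theorem IsVirtualInput.exists_reference_bound (hW : C.IsVirtualInput τ W) (b : ℝ) :
    ∃ B, ∀ r ≤ b, ∀ k, |C.reference τ W i r k| ≤ B := by
  obtain ⟨A, hA0, hA⟩ := exists_reference_bd C τ i
  obtain ⟨M, hM⟩ := hW.bdd (b - C.theta τ (i + 1))
  refine ⟨A * |M|, fun r hr k => ?_⟩
  have := hA (ParamNorm.sup (fun _ => 1) {0}) W |M| r (abs_nonneg _) (fun hi k t ht _ => by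
    show |W (i + 1) (t + r - C.theta τ (i + 1)) k| ≤ |M| * 1
    rw [mem_singleton_iff.1 ht, zero_add, mul_one]
    exact (hM (i + 1) (Finset.mem_Icc.2 ⟨by omega, hi⟩) _ (by linarith) k).trans (le_abs_self _))
    k 0 rfl zero_le_one
  simpa using this

theorem delayedFam_signalSub (h : 1 ≤ i) (t : ℝ) (j : C.Idx i) (s x : ℝ) :
    C.delayedFam τ i (signalSub z z') t j s x =
      C.delayedFam τ i z t j s x - C.delayedFam τ i z' t j s x := by
  obtain ⟨j', hj'⟩ := exists_delayedFam_eq (τ := τ) h j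
  simp only [hj', toFam_signalSub]
  split_ifs <;> simp

theorem IsVirtualInput.sub (h : C.IsVirtualInput τ W) (h' : C.IsVirtualInput τ W') :
    C.IsVirtualInput τ fun j r => W j r - W' j r := by
  refine ⟨fun i hi => (h.meas i hi).sub (h'.meas i hi), fun T => ?_, fun i hi t ht => by
    rw [h.before i hi t ht, h'.before i hi t ht, sub_self]⟩
  obtain ⟨M, hM⟩ := h.bdd T
  obtain ⟨M', hM'⟩ := h'.bdd T
  exact ⟨M + M', fun i hi t ht k =>
    (abs_sub _ _).trans (add_le_add (hM i hi t ht k) (hM' i hi t ht k))⟩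

theorem Kernels.Response.sub (h : D.Response τ z W V) (h' : D.Response τ z' W' V')
    (hW : C.IsVirtualInput τ W) (hW' : C.IsVirtualInput τ W') (hD : D.Solve) (hC : C.Standing)
    (hτ : 0 < τ) : D.Response τ (signalSub z z') (fun j r => W j r - W' j r)
      fun j r => V j r - V' j r := by
  intro i hi hii
  obtain ⟨q, hq, e⟩ := h i hi hii
  obtain ⟨q', hq', e'⟩ := h' i hi hii
  have hsub := hq.sub hq' hD hC hi
  simp only [← delayedFam_signalSub (Finset.mem_Icc.1 hi).1] at hsub
  refine ⟨_, hsub, fun t ht k => ?_⟩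
  obtain ⟨B, hB⟩ := hW.exists_reference_bound (i := i) (t + C.theta τ i + (1 - 0) / C.lam1 i)
  obtain ⟨B', hB'⟩ := hW'.exists_reference_bound (i := i) (t + C.theta τ i + (1 - 0) / C.lam1 i)
  obtain ⟨M', hΦ⟩ := hD.exists_lawFun_bounded hC hi
  have hlaw := Net.Functional.eval_sub (P := D.predNet i) (e := fun a => ⟨⟨i, hii⟩, a⟩) (hΦ k)
    (memLen_nonneg hC hi) (show C.memLen i ≤ C.theta τ i by
      linarith [memLen_add_le_theta hC (τ := τ) hi]) (hq.tame t _) (hq'.tame t _)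
  show (V i t - V' i t) k = _
  rw [Pi.sub_apply, e t ht k, e' t ht k, ← reference_sub,
    ← hD.flat_sub hC hi (measurable_reference hW.meas) (measurable_reference hW'.meas)
    (B := max B B') (fun r hr k => (hB r hr k).trans (le_max_left _ _))
    (fun r hr k => (hB' r hr k).trans (le_max_right _ _)) k (by simp) le_rfl]
  unfold lawVal
  rw [← hlaw]
  ring

theorem Kernels.Law.sub (h : D.Law τ z W) (h' : D.Law τ z' W') (hD : D.Solve) (hC : C.Standing)
    (hτ : 0 < τ) : D.Law τ (signalSub z z') fun j r => W j r - W' j r :=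
  ⟨h.toIsVirtualInput.sub h'.toIsVirtualInput,
    h.eq.sub h'.eq h.toIsVirtualInput h'.toIsVirtualInput hD hC hτ⟩

/-- The size of the delayed signal before the starting times of the predictions. -/
def DelayedBd (C : Chain) (τ : ℝ) (ν : ParamNorm ℝ) (z : ℝ → C.State) (A : ℝ) : Prop :=
  ∀ i ∈ Finset.Icc 1 C.N, ∀ (j : C.Idx i) (s x : ℝ), -C.memLen i ≤ s → s ≤ 0 →
    x ∈ Icc 0 1 → ν.Bd (fun t => C.delayedFam τ i z t j s x) A

/-- The right-hand side of the law depends only weakly on the virtual input itself. -/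
theorem Kernels.Solve.exists_response_bd (hD : D.Solve) (hC : C.Standing) (hτ : 0 < τ) :
    ∃ β₀ R, 0 ≤ β₀ ∧ 0 ≤ R ∧ ∀ β, β₀ ≤ β → ∀ (ν : ParamNorm ℝ) (H : ℝ),
      ν.OnWindow (C.startTime τ) H β → ∀ (z : ℝ → C.State) (W V : C.Inputs),
      C.IsVirtualInput τ W → (∀ i ∈ Finset.Icc 1 C.N, Measurable (V i)) → D.Response τ z W V →
      ∀ A Ω Ω', 0 ≤ A → 0 < Ω → 0 < Ω' → C.DelayedBd τ ν z A → ∀ i ∈ Finset.Icc 1 C.N,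
          (∀ k, ν.Bd (fun t => W i t k) Ω) →
      (i < C.N → ∀ k, ν.Bd (fun t => W (i + 1) t k) Ω') →
      ∀ k, ν.Bd (fun t => V i t k) (Ω / 4 + R * (Ω' + A)) := by
  choose β₀ G hβ₀ hG hlaw using fun i : Finset.Icc 1 C.N => hD.exists_law_bd hC hτ i.2
    (Finset.left_mem_Icc.2 (Finset.mem_Icc.1 i.2).2)
  choose A1 hA1 href using exists_reference_bd C τ
  choose A2 hA2 hflat using fun (i : Finset.Icc 1 C.N) k => hD.exists_flat_bd hC i.2 k
  have hR : ∀ i k, 0 ≤ A2 i k * (A1 i + 1) := fun i k =>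
    mul_nonneg (hA2 i k) (by linarith [hA1 i])
  refine ⟨∑ i, β₀ i, ∑ i, (∑ k, A2 i k * (A1 i + 1) + G i), sum_nonneg fun i _ => hβ₀ i,
    sum_nonneg fun i _ => add_nonneg (sum_nonneg fun k _ => hR i k) (hG i),
    fun β hβ ν H hν z W V hW hV hV' A Ω Ω' hA hΩ hΩ' hz i hi hWΩ hWΩ' k => ?_⟩
  obtain ⟨hi1, hiN⟩ := Finset.mem_Icc.1 hi
  have hβi := (single_le_sum (fun i _ => hβ₀ i) (Finset.mem_univ
      (⟨i, hi⟩ : Finset.Icc 1 C.N))).trans hβ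
  have hβ0 := (hβ₀ _).trans hβi
  have hshift : ∀ j ∈ Finset.Icc 1 C.N, ∀ k M a, 0 ≤ a → ν.Bd (fun t => W j t k) M →
      ν.Bd (fun t => W j (t - a) k) (M * exp (-β * a)) := fun j hj k M a ha h =>
    hν.shift (measurable_pi_iff.1 (hW.meas j hj) k) (fun t ht => by rw [hW.before j hj t ht]; rfl)
      ha h
  -- the reference
  have h1 : ν.Bd (fun t => D.flat i (C.reference τ W i) k (t + C.theta τ i) 0)
      (A2 ⟨i, hi⟩ k * ((A1 i + 1) * Ω')) := by
    have := hA1 i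
    refine hflat ⟨i, hi⟩ k ν _ (C.theta τ i + 1 / C.lam1 i) _ (measurable_reference hW.meas)
      (by positivity) (fun k r hr => ?_) _ 0 (by simp) (by rw [sub_zero])
    refine ν.mono (href i ν W Ω' r hΩ'.le (fun h k => ?_) k) (by linarith)
    rw [← theta_succ hC hi1] at hr
    have := hshift (i + 1) (Finset.mem_Icc.2 ⟨by omega, h⟩) k _ (C.theta τ (i + 1) - r)
      (by linarith) (hWΩ' h k)
    simp only [← sub_add, sub_add_eq_add_sub] at this
    refine ν.mono this (mul_le_of_le_one_right hΩ'.le (exp_le_one_iff.2 ?_))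
    nlinarith
  -- the prediction
  obtain ⟨q, hq, e⟩ := hV' i hi (Finset.left_mem_Icc.2 hiN)
  obtain ⟨B, hB⟩ := hq.bdd H (C.theta τ i)
  obtain ⟨N, hN⟩ := hν.fin B
  have h2 := (hlaw ⟨i, hi⟩).mono hβi le_rfl ν _ _ W q N A Ω hq hΩ hA
    (fun j s x h1 h2 h3 => hN ((hq.meas j).comp (by fun_prop : Measurable fun t : ℝ => (t, s, x)))
      fun t ht => hB t ht.2 j s x h1 h2 h3)
    (fun j x hx => hz i hi j 0 x (by linarith [memLen_nonneg hC hi]) le_rfl hx)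
    (fun j s h3 h4 => hz i hi j s _ h3 h4.le (Net.xout_mem _))
    (fun k a ha => hshift i hi k Ω a ha (hWΩ k)) k
  refine hν.congr (measurable_pi_iff.1 (hV i hi) k) (fun t ht => (e t ht.1 k).symm)
    (ν.mono (ν.add h1 h2) ?_)
  have h3 := single_le_sum (fun k _ => hR ⟨i, hi⟩ k) (Finset.mem_univ k)
  have h4 := single_le_sum (f := fun i => ∑ k, A2 i k * (A1 i + 1) + G i)
    (fun i _ => add_nonneg (sum_nonneg fun k _ => hR i k) (hG i))
    (Finset.mem_univ (⟨i, hi⟩ : Finset.Icc 1 C.N))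
  have h5 := mul_le_mul_of_nonneg_right h4 (by positivity : 0 ≤ Ω' + A)
  have h6 := mul_le_mul_of_nonneg_right h3 hΩ'.le
  have h7 := mul_nonneg (hG ⟨i, hi⟩) hΩ'.le
  have h8 := mul_nonneg (sum_nonneg fun k (_ : k ∈ Finset.univ) => hR ⟨i, hi⟩ k) hA
  dsimp only at h5 h6
  linarith

/-- The size of the response of the control law, in terms of the size of the delayed signal. -/
theorem Kernels.Solve.exists_law_stability (hD : D.Solve) (hC : C.Standing) (hτ : 0 < τ) :
    ∃ β₀ c, 0 ≤ β₀ ∧ 0 ≤ c ∧ ∀ β, β₀ ≤ β → ∀ (ν : ParamNorm ℝ) (H : ℝ),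
      ν.OnWindow (C.startTime τ) H β → ∀ (z : ℝ → C.State) (W : C.Inputs),
      D.Law τ z W → ∀ A, 0 < A → C.DelayedBd τ ν z A →
      ∀ i ∈ Finset.Icc 1 C.N, ∀ k, ν.Bd (fun t => W i t k) (c * A) := by
  obtain ⟨β₀, R, hβ₀, hR, hresp⟩ := hD.exists_response_bd hC hτ
  refine ⟨β₀, (4 * R + 1) ^ (C.N + 1), hβ₀, by positivity,
    fun β hβ ν H hν z W hL A hA hz i hi => ?_⟩
  have main : ∀ n i, i ∈ Finset.Icc 1 C.N → C.N < i + n →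
      ∀ k, ν.Bd (fun t => W i t k) ((4 * R + 1) ^ n * A) := by
    intro n
    induction n with
    | zero => intro i hi h; rw [Finset.mem_Icc] at hi; omega
    | succ n ih =>
      intro i hi hn k
      obtain ⟨M, hM⟩ := hL.bdd H
      obtain ⟨N0, hN0⟩ := hν.fin M
      have hn1 : 1 ≤ (4 * R + 1) ^ n := one_le_pow₀ (by linarith)
      refine ν.mono (ν.of_half (R := R * ((4 * R + 1) ^ n * A + A)) (by positivity)
        (f := fun k t => W i t k) ⟨|N0| + 1, by positivity, fun k => ν.mono
          (hN0 (measurable_pi_iff.1 (hL.meas i hi) k) fun t ht => hM i hi t ht.2 k)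
          (by linarith [le_abs_self N0])⟩ (fun Ω hΩ hW k => ν.mono (hresp β hβ ν H hν z W W
            hL.toIsVirtualInput hL.meas hL.eq A Ω _ hA.le hΩ (by positivity) hz i hi hW
            (fun h => ih (i + 1) (Finset.mem_Icc.2 ⟨by omega, h⟩) (by omega)) k)
                (by linarith)) k) ?_
      rw [pow_succ]
      nlinarith [mul_le_mul_of_nonneg_right hn1 (mul_nonneg hR hA.le), mul_nonneg hR hA.le]
  exact main _ i hi (by omega)

end Chain

theorem Net.Regular.mild_zero {J : Type} [Fintype J] {P : Net J} {M : ℝ} (hP : P.Regular M)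
    (q₀ past b : J → ℝ → ℝ) (q : J → ℝ → ℝ → ℝ) (j : J) {x : ℝ} (hx : x ∈ Icc 0 1) :
    P.mild q₀ past b q j 0 x = q₀ j x := by
  have := hP.age_nonneg (j := j) hx
  simp [mild, this]

/-- A locally bounded family of functions has a monotone bound. -/
theorem exists_monotone_bound {A : ℝ → Set ℝ} (h : ∀ T, ∃ M, ∀ t ≤ T, ∀ a ∈ A t, a ≤ M) :
    ∃ ω : ℝ → ℝ, (∀ t, 0 < ω t) ∧ Monotone ω ∧ ∀ t, ∀ a ∈ A t, a ≤ ω t := by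
  choose M hM using fun n : ℕ => h n
  refine ⟨fun t => 1 + ∑ n ∈ Finset.range (⌈t⌉₊ + 1), |M n|, fun t => ?_, fun s t hst => ?_,
    fun t a ha => ?_⟩
  · have : 0 ≤ ∑ n ∈ Finset.range (⌈t⌉₊ + 1), |M n| := sum_nonneg fun _ _ => abs_nonneg _
    linarith
  · simp only [add_le_add_iff_left]
    exact Finset.sum_le_sum_of_subset_of_nonneg (Finset.range_mono (by gcongr))
      fun _ _ _ => abs_nonneg _
  · have h1 := hM ⌈t⌉₊ t (Nat.le_ceil t) a ha
    have h2 := single_le_sum (f := fun n => |M n|) (fun n _ => abs_nonneg _)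
      (Finset.self_mem_range_succ ⌈t⌉₊)
    have h3 := le_abs_self (M ⌈t⌉₊)
    linarith

namespace Chain

variable {C : Chain} {i : ℕ} {D : C.Kernels} {τ : ℝ} {z z' : ℝ → C.State}
  {W W' : C.Inputs} {U : ℝ → Fin (C.n 1) → ℝ}

/-! ### The law in terms of families of predictions -/

theorem measurable_delayedFam (hi : 1 ≤ i)
    (hz : ∀ j : C.Idx 1, Measurable fun p : ℝ × ℝ => toFam 1 z 0 j p.1 p.2) (j : C.Idx i) :
    Measurable fun p : ℝ × ℝ × ℝ => C.delayedFam τ i z p.1 j p.2.1 p.2.2 := by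
  obtain ⟨j', hj'⟩ := exists_delayedFam_eq (τ := τ) hi j
  simp only [hj']
  exact Measurable.ite (measurableSet_le measurable_const measurable_fst)
    ((hz j').comp (by fun_prop : Measurable fun p : ℝ × ℝ × ℝ => (p.1 + p.2.1 - τ, p.2.2)))
    measurable_const

theorem abs_delayedFam_le (hC : C.Standing) (hτ : 0 < τ) (hi : i ∈ Finset.Icc 1 C.N)
    {t s x B : ℝ} (hB : 0 ≤ B) (hs : -C.memLen i ≤ s)
    (hz : ∀ j : C.Idx 1, 0 ≤ t + s - τ → |toFam 1 z 0 j (t + s - τ) x| ≤ B) (j : C.Idx i) :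
    |C.delayedFam τ i z t j s x| ≤ B := by
  obtain ⟨j', hj'⟩ := exists_delayedFam_eq (τ := τ) (Finset.mem_Icc.1 hi).1 j
  rw [hj']
  split_ifs with h
  · obtain ⟨a, ha, hle⟩ := exists_delay_ge_memLen hC hi
    have := (lt_of_startTime hC hτ h ha (r := t + s) (by linarith)).2
    exact hz j' (by linarith)
  · simpa using hB

theorem Kernels.Solve.exists_delayedPred (hD : D.Solve) (hC : C.Standing) (hτ : 0 < τ)
    (hi : i ∈ Finset.Icc 1 C.N) {ω : ℝ → ℝ} (hω : ∀ t, 0 < ω t) (hmono : Monotone ω) {A Ω : ℝ}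
    (hA : 0 ≤ A) (hΩ : 0 ≤ Ω)
    (hzm : ∀ j : C.Idx 1, Measurable fun p : ℝ × ℝ => toFam 1 z 0 j p.1 p.2)
    (hz : ∀ (j : C.Idx 1) s x, 0 ≤ s → x ∈ Icc 0 1 → |toFam 1 z 0 j s x| ≤ A * ω s)
    (hW : Measurable (W i)) (hWΩ : ∀ t k, |W i t k| ≤ Ω * ω t) :
    ∃ q, D.PredFam τ i (fun t j x => C.delayedFam τ i z t j 0 x)
      (fun t j s => C.delayedFam τ i z t j s ((D.predNet i).xout j)) W q ∧
      ∃ N, ∀ t j s x, 0 ≤ s → s ≤ C.theta τ i → x ∈ Icc 0 1 → |q t j s x| ≤ N * ω t := by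
  have hm := fun j : C.Idx i => measurable_delayedFam (τ := τ) (Finset.mem_Icc.1 hi).1 hzm j
  have hb : ∀ t (j : C.Idx i) s x, -C.memLen i ≤ s → s ≤ 0 → x ∈ Icc 0 1 →
      |C.delayedFam τ i z t j s x| ≤ A * ω t := fun t j s x h1 h2 hx =>
    abs_delayedFam_le hC hτ hi (by have := hω t; positivity) h1 (fun j' h => (hz j' _ x h hx).trans
        (mul_le_mul_of_nonneg_left (hmono (by linarith)) hA)) j
  exact hD.exists_predFam hC hi hω hmono hA hΩ
    (fun j => (hm j).comp (by fun_prop : Measurable fun p : ℝ × ℝ => (p.1, (0 : ℝ), p.2)))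
    (fun j => (hm j).comp
      (by fun_prop : Measurable fun p : ℝ × ℝ => (p.1, p.2, (D.predNet i).xout j))) hW
    (fun t j x hx => hb t j 0 x (by linarith [memLen_nonneg hC hi]) le_rfl hx)
    (fun t j s h1 h2 => hb t j s _ h1 h2.le (Net.xout_mem _)) hWΩ

/-- The members of a family of predictions of the delayed state are the predictions of the law. -/
theorem Kernels.PredFam.exists_prediction {q : ℝ → C.Idx i → ℝ → ℝ → ℝ}
    (hq : D.PredFam τ i (fun t j x => C.delayedFam τ i z t j 0 x)
      (fun t j s => C.delayedFam τ i z t j s ((D.predNet i).xout j)) W q)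
    (hD : D.Solve) (hC : C.Standing) (hτ : 0 < τ) (hz : C.IsSol 1 0 (Ici 0) U z)
    (hi : i ∈ Finset.Icc 1 C.N) (hii : i ∈ Finset.Icc i C.N) {t : ℝ} (ht : C.startTime τ ≤ t) :
    ∃ p, D.IsPrediction τ (fun r => z (r - τ)) W i t p ∧ ∀ k, D.virtualInput τ W i t p k =
      D.flat i (C.reference τ W i) k (t + C.theta τ i) 0 + D.lawVal τ hii (q t) k := by
  obtain ⟨hi1, hiN⟩ := Finset.mem_Icc.1 hi
  have hK := hD.memKernel hC hi
  have hh := memLen_nonneg hC hi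
  have hθ := memLen_add_le_theta hC (τ := τ) hi
  obtain ⟨M, hP⟩ := exists_regular hC hi1 hK
  set w : ℝ → C.State := fun r => z (r - τ) with hw
  set p := glue i w (q t) t with hp
  have hsub : ∀ {j}, j ∈ Finset.Icc i C.N → j ∈ Finset.Icc 1 C.N := fun hj =>
    Icc_subset_Icc_left hi1 hj
  have hwu : ∀ j ∈ Finset.Icc i C.N, ∀ k, Measurable fun q : ℝ × ℝ => (w q.1).u j q.2 k :=
    fun j hj k => (hz.meas_u j (hsub hj) k).comp
      (by fun_prop : Measurable fun q : ℝ × ℝ => (q.1 - τ, q.2))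
  have hwv : ∀ j ∈ Finset.Icc i C.N, ∀ k, Measurable fun q : ℝ × ℝ => (w q.1).v j q.2 k :=
    fun j hj k => (hz.meas_v j (hsub hj) k).comp
      (by fun_prop : Measurable fun q : ℝ × ℝ => (q.1 - τ, q.2))
  have hsol := isSol_glue (β := C.predInput τ i W t) hC hi1 hiN hK hwu hwv (hq.tame t)
    (hq.tamePast t) (fun j r _ _ => if_pos ht) (hq.eq t)
  have hmem : ∀ r ∈ Icc t (t + C.theta τ i),
      D.memory p r i = memTerm D.memK (C.memLen i) p i r := by
    intro r hr
    obtain ⟨B1, hB1⟩ := hsol.bdd r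
    obtain ⟨B2, hB2⟩ := hz.bdd (t - τ)
    obtain ⟨a, ha, hle⟩ := exists_delay_ge_memLen hC hi
    refine hD.memory_eq (B := max B1 B2) hi
      (fun l => (hsol.meas_v i hii l).comp measurable_prodMk_right) (fun y hy l => ?_) hh
    rcases lt_or_ge (r - y) t with h | h
    · rw [hp, glue_of_lt h]
      have := (lt_of_startTime hC hτ ht ha (r := r - y) (by linarith [hr.1, hy.2])).2
      exact ((hB2 _ (mem_Ici.2 (by linarith)) (by linarith) i hi 0 (by simp)).2 l).trans
        (le_max_right _ _)
    · exact ((hB1 _ h (by linarith [hy.1]) i hii 0 (by simp)).2 l).trans (le_max_left _ _)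
  have hpred : D.IsPrediction τ w W i t p := by
    refine ⟨fun j hj r hr => ?_, hsol.congr_input Icc_subset_Ici_self fun r hr _ => ?_⟩
    · rcases hr.2.lt_or_eq with h | h
      · rw [hp, glue_of_lt h]
        exact fun _ _ _ _ => ⟨rfl, rfl⟩
      · rw [h, ← add_zero t]
        refine agree_iff_toFam.2 fun j x hx => ?_
        rw [hp, toFam_glue j x le_rfl, hq.eq t j 0 x le_rfl hx, hP.mild_zero _ _ _ _ _ hx,
          delayedFam, if_pos ht]
    · rw [hmem r hr, predInput, if_pos hr.2]
  refine ⟨p, hpred, fun k => ?_⟩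
  rw [hpred.virtualInput_eq_lawVal hD hC hz hτ ht hi hii]
  congr 1
  unfold lawVal Net.Functional.eval
  have hθ0 : 0 ≤ C.theta τ i := by linarith
  congr 1
  · simp only [hp, toFam_glue _ _ hθ0]
  · refine integral_congr_Icc (show 0 ≤ (D.predNet i).h from hh) fun y hy => ?_
    have hy2 : y ≤ C.memLen i := hy.2
    simp only [hp, toFam_glue _ _ (by linarith : 0 ≤ C.theta τ i - y)]

theorem Kernels.IsFeedback.law (h : D.IsFeedback τ (fun r => z (r - τ)) W) (hD : D.Solve)
    (hC : C.Standing) (hτ : 0 < τ) (hz : C.IsSol 1 0 (Ici 0) U z) : D.Law τ z W := by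
  refine ⟨⟨h.meas, h.bdd, h.before⟩, fun i hi hii => ?_⟩
  obtain ⟨ω, hω, hmono, hb⟩ := exists_monotone_bound (A := fun t => {a | (∃ i ∈ Finset.Icc 1 C.N,
      ∃ k, a = |W i t k|) ∨ 0 ≤ t ∧ ∃ (j : C.Idx 1), ∃ x ∈ Icc (0 : ℝ) 1, a = |toFam 1 z 0 j t x|})
    (fun T => by
      obtain ⟨M, hM⟩ := h.bdd T
      obtain ⟨M', hM'⟩ := (hz.tame (L := T) Icc_subset_Ici_self).bdd
      refine ⟨max M M', fun t ht a ha => ?_⟩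
      rcases ha with ⟨i, hi, k, rfl⟩ | ⟨h0, j, x, hx, rfl⟩
      · exact (hM i hi t ht k).trans (le_max_left _ _)
      · exact (hM' j t x h0 ht hx).trans (le_max_right _ _))
  obtain ⟨q, hq, -⟩ := hD.exists_delayedPred hC hτ hi hω hmono zero_le_one zero_le_one
    (measurable_toFam 0 hz.meas_u hz.meas_v)
    (fun j s x hs hx => by rw [one_mul]; exact hb s _ (Or.inr ⟨hs, j, x, hx, rfl⟩)) (h.meas i hi)
    (fun t k => by rw [one_mul]; exact hb t _ (Or.inl ⟨i, hi, k, rfl⟩))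
  refine ⟨q, hq, fun t ht k => ?_⟩
  obtain ⟨p, hp, hW⟩ := h.after i hi t ht
  obtain ⟨p', hp', e⟩ := hq.exists_prediction hD hC hτ hz hi hii ht
  rw [hW, hp.virtualInput_eq hD hC hz hτ ht hi hp', e]

theorem Kernels.Law.isFeedback (h : D.Law τ z W) (hD : D.Solve)
    (hC : C.Standing) (hτ : 0 < τ) (hz : C.IsSol 1 0 (Ici 0) U z) :
    D.IsFeedback τ (fun r => z (r - τ)) W := by
  refine ⟨h.meas, h.bdd, h.before, fun i hi t ht => ?_⟩
  have hii := Finset.left_mem_Icc.2 (Finset.mem_Icc.1 hi).2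
  obtain ⟨q, hq, e⟩ := h.eq i hi hii
  obtain ⟨p, hp, e'⟩ := hq.exists_prediction hD hC hτ hz hi hii ht
  exact ⟨p, hp, funext fun k => by rw [e t ht k, e' k]⟩

/-- The law only uses the estimates at the times when they are exact. -/
theorem Kernels.IsFeedback.congr {w w' : ℝ → C.State} (h : D.IsFeedback τ w W) (hC : C.Standing)
    (hτ : 0 < τ) (hw : ∀ r, τ + ∑ j ∈ Finset.Icc 1 C.N, 1 / C.mu1 j < r → (w r).Agree 1 (w' r)) :
    D.IsFeedback τ w' W := by
  refine ⟨h.meas, h.bdd, h.before, fun i hi t ht => ?_⟩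
  obtain ⟨p, hp, e⟩ := h.after i hi t ht
  refine ⟨p, ⟨fun j hj r hr l hl x hx => ?_, hp.future⟩, e⟩
  have h1 := hp.past j hj r hr l hl x hx
  have h2 := hw r (lt_of_startTime hC hτ ht hj hr.1).1 l
    (Icc_subset_Icc_left (Finset.mem_Icc.1 hi).1 hl) x hx
  exact ⟨h1.1.trans h2.1, h1.2.trans h2.2⟩

theorem startTime_pos (hC : C.Standing) (hτ : 0 < τ) : 0 < C.startTime τ := by
  have : 0 ≤ ∑ j ∈ Finset.Icc 1 C.N, 2 * C.delay j :=
    sum_nonneg fun j hj => mul_nonneg zero_le_two (delay_nonneg hC hj)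
  rw [startTime]
  linarith

theorem abs_delayedFam_le_mul_exp (hC : C.Standing) (hτ : 0 < τ) (hi : i ∈ Finset.Icc 1 C.N)
    {β E s x : ℝ} (hβ : 0 ≤ β) (hE : 0 ≤ E) (hs : -C.memLen i ≤ s) (hs0 : s ≤ 0)
    (hz : ∀ (j : C.Idx 1) r, 0 ≤ r → |toFam 1 z 0 j r x| ≤ E * exp (β * r)) (t : ℝ) (j : C.Idx i) :
    |C.delayedFam τ i z t j s x| ≤ E * exp (-β * τ) * exp (β * t) := by
  refine abs_delayedFam_le hC hτ hi (by positivity) hs (fun j' h => (hz j' _ h).trans ?_) j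
  rw [mul_assoc, ← exp_add]
  exact mul_le_mul_of_nonneg_left (exp_le_exp.2 (by nlinarith)) hE

/-- The initial state determines the closed loop, by induction over steps of length `τ`. -/
theorem Kernels.Law.unique (h : D.Law τ z W) (h' : D.Law τ z' W') (hD : D.Solve) (hC : C.Standing)
    (hτ : 0 < τ) (hz : C.IsSol 1 0 (Ici 0) (W 1) z) (hz' : C.IsSol 1 0 (Ici 0) (W' 1) z')
    (h0 : (z 0).Agree 1 (z' 0)) (t : ℝ) (ht : 0 ≤ t) :
    (z t).Agree 1 (z' t) ∧ W 1 t = W' 1 t := by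
  obtain ⟨β₀, c, -, hc, hstab⟩ := hD.exists_law_stability hC hτ
  have hN1 : 1 ∈ Finset.Icc 1 C.N := Finset.mem_Icc.2 ⟨le_rfl, hC.N_pos⟩
  have hstate : ∀ T, (∀ t ≤ T, W 1 t = W' 1 t) → ∀ t, 0 ≤ t → t ≤ T → (z t).Agree 1 (z' t) :=
    fun T hT t h1 h2 => IsSol.unique_of_input (L := T) hC le_rfl hz hz'
      (by rw [zero_add]; exact Icc_subset_Ici_self) (by rw [zero_add]; exact Icc_subset_Ici_self)
      (fun r _ hr => hT r (by linarith)) h0 t ⟨h1, by linarith⟩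
  have main : ∀ n : ℕ, ∀ i ∈ Finset.Icc 1 C.N, ∀ t ≤ n * τ, W i t = W' i t := by
    intro n
    induction n with
    | zero =>
      intro i hi t ht
      have : t < C.startTime τ := by
        have := startTime_pos hC hτ
        simp only [Nat.cast_zero, zero_mul] at ht
        linarith
      rw [h.before i hi t this, h'.before i hi t this]
    | succ n ih =>
      intro i hi t ht
      rcases lt_or_ge t (C.startTime τ) with h1 | h1
      · rw [h.before i hi t h1, h'.before i hi t h1]
      have hst := hstate (n * τ) (ih 1 hN1)
      funext k
      refine sub_eq_zero.1 (abs_nonpos_iff.1 (le_of_forall_pos_le_add fun ε hε => ?_))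
      set A := ε / ((c + 1) * exp (β₀ * t)) with hA
      have hA0 : 0 < A := by positivity
      have key : |W i t k - W' i t k| ≤ c * A * exp (β₀ * t) :=
        hstab β₀ le_rfl (ParamNorm.sup (fun t => exp (β₀ * t)) (Icc (C.startTime τ) t)) t
        ParamNorm.onWindow_sup _ _ (h.sub h' hD hC hτ) A hA0 (fun i hi j s x h2 h3 hx r hr _ => ?_)
        i hi k t ⟨h1, le_rfl⟩ (exp_pos _).le
      · refine key.trans ?_
        rw [hA, zero_add, mul_div_assoc', div_mul_eq_mul_div, div_le_iff₀ (by positivity)]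
        have : 0 ≤ ε * exp (β₀ * t) := by positivity
        nlinarith
      · have : 0 ≤ A * exp (β₀ * r) := by positivity
        refine abs_delayedFam_le hC hτ hi this h2 (fun j' h4 => ?_) j
        push_cast at ht
        have e := agree_iff_toFam.1 ((zero_add (r + s - τ)).symm ▸
          hst (r + s - τ) h4 (by linarith [hr.2])) j' x hx
        rw [toFam_signalSub, e, sub_self, abs_zero]
        exact this
  obtain ⟨n, hn⟩ := exists_nat_ge (t / τ)
  rw [div_le_iff₀ hτ] at hn
  exact ⟨hstate (n * τ) (main n 1 hN1) t ht hn, main n 1 hN1 t hn⟩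

end Chain

namespace Chain

variable {C : Chain} {i : ℕ} {D : C.Kernels} {τ : ℝ} {z z' : ℝ → C.State}
  {W W' : C.Inputs}

/-! ### Existence of the closed loop -/

/-- The mild equation of a solution for the whole chain. -/
theorem IsSol.toFam_mild_zero (hC : C.Standing) (hz : C.IsSol 1 0 (Ici 0) (W 1) z) (j : C.Idx 1)
    {s x : ℝ} (hs : 0 ≤ s) (hx : x ∈ Icc 0 1) :
    toFam 1 z 0 j s x = (C.toNet 1 (fun _ _ => 0) 0).mild (fun j x => toFam 1 z 0 j 0 x)
      (fun _ _ => 0) (netInput 1 W 0) (toFam 1 z 0) j s x :=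
  IsSol.toFam_mild (L := s) hC le_rfl (MemKernel.zero (C := C) 1)
    (hz.congr_input subset_rfl fun t _ _ => by rw [memTerm_zero, sub_zero]) Icc_subset_Ici_self
    (Net.tamePast_zero _) (fun _ _ h1 h2 => by linarith) j hs le_rfl hx

/-- A Cauchy problem for the whole chain whose input has exponential growth. -/
theorem exists_isSol (hC : C.Standing) {z₀ : C.State} (hz₀ : z₀.Admissible) : ∃ β₀, 0 ≤ β₀ ∧
    ∀ β, β₀ ≤ β → ∀ (W : C.Inputs) (M : ℝ), 0 ≤ M → Measurable (W 1) →
      (∀ t k, |W 1 t k| ≤ M * exp (β * t)) →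
      ∃ z, C.IsSol 1 0 (Ici 0) (W 1) z ∧ (z 0).Agree 1 z₀ ∧
        ∃ B, 0 ≤ B ∧ ∀ (j : C.Idx 1) s x, 0 ≤ s → x ∈ Icc 0 1 →
          |toFam 1 z 0 j s x| ≤ B * exp (β * s) := by
  have hK := MemKernel.zero (C := C) 1
  obtain ⟨M', hP⟩ := exists_regular hC le_rfl hK
  obtain ⟨κ, β₀, -, he⟩ := hP.exists_exponents 0
  have hβ₀ : 0 ≤ β₀ := by linarith [he.one_le]
  refine ⟨β₀, hβ₀, fun β hle W M hM hWm hW => ?_⟩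
  obtain ⟨B₀, hB₀⟩ := hz₀.bdd
  have hm₀ : ∀ j : C.Idx 1, Measurable fun x => toFam 1 (fun _ => z₀) 0 j 0 x := by
    rintro ⟨⟨j, hj⟩, k | k⟩
    · exact hz₀.meas_u j hj k
    · exact hz₀.meas_v j hj k
  have hb₀ : ∀ (j : C.Idx 1) x, x ∈ Icc 0 1 → |toFam 1 (fun _ => z₀) 0 j 0 x| ≤ |B₀| := by
    rintro ⟨⟨j, hj⟩, k | k⟩ x hx
    · exact ((hB₀ j hj x hx).1 k).trans (le_abs_self _)
    · exact ((hB₀ j hj x hx).2 k).trans (le_abs_self _)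
  obtain ⟨q, hqm, ⟨G, hG0, hqB⟩, hq⟩ := hP.exists_family (Θ := Unit)
    (q₀ := fun _ j x => toFam 1 (fun _ => z₀) 0 j 0 x) (past := fun _ _ _ => 0)
    (b := fun _ => netInput 1 W 0) (d := fun _ => 1) (he.mono hP hle) (abs_nonneg B₀) hM
    (fun _ => one_pos) (fun _ => measurable_const) (fun j => by
      rcases j with ⟨⟨j, hj⟩, k | k⟩
      · simp only [netInput, Sum.elim_inl]
        split_ifs with h
        · subst h
          exact (measurable_pi_iff.1 hWm k).comp (by fun_prop)
        · exact measurable_const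
      · exact measurable_const)
    (fun j => (hm₀ j).comp measurable_snd) (fun _ j x hx => by rw [mul_one]; exact hb₀ j x hx)
    (fun _ _ _ _ _ => by simp) (fun _ j s _ => by
      rw [mul_one]
      exact abs_netInput_le (by positivity) (fun k => by rw [zero_add]; exact hW s k) j)
  simp only [mul_one] at hqB
  have hsol := isSol_glue (zp := fun _ => ⟨0, 0⟩) (β := W) (q := q ()) (past := fun _ _ => 0) hC
    le_rfl hC.N_pos hK (fun _ _ _ => measurable_const) (fun _ _ _ => measurable_const)
    (fun L => ⟨fun j => (hqm j).comp (by fun_prop : Measurable fun p : ℝ × ℝ => ((), p.1, p.2)),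
      G * exp (β * L), fun j s x h1 h2 h3 => (hqB () j s x h1 h3).trans (mul_le_mul_of_nonneg_left
        (exp_le_exp.2 (mul_le_mul_of_nonneg_left h2 (hβ₀.trans hle))) hG0)⟩)
    (Net.tamePast_zero _) (fun _ _ h1 h2 => by linarith) (hq ())
  refine ⟨_, hsol.congr_input subset_rfl fun t _ _ => by rw [memTerm_zero, sub_zero], ?_, G, hG0,
    fun j s x hs hx => by rw [toFam_glue j x hs]; exact hqB () j s x hs hx⟩
  have := (agree_iff_toFam (i₀ := 1) (a := glue 1 (fun _ => ⟨0, 0⟩) (q ()) 0)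
    (b := fun _ => z₀) (t := 0) (s := 0)).2 fun j x hx => by
    rw [toFam_glue j x le_rfl, hq () j 0 x le_rfl hx, hP.mild_zero _ _ _ _ _ hx]
  rwa [add_zero] at this

/-- The influence of the input on the solution. -/
theorem exists_isSol_stability (hC : C.Standing) : ∃ β₀, 0 ≤ β₀ ∧
    ∀ β, β₀ ≤ β → ∀ (W W' : C.Inputs) (z z' : ℝ → C.State) (M : ℝ), 0 ≤ M →
      C.IsSol 1 0 (Ici 0) (W 1) z → C.IsSol 1 0 (Ici 0) (W' 1) z' → (z 0).Agree 1 (z' 0) →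
      (∀ t k, |W 1 t k - W' 1 t k| ≤ M * exp (β * t)) →
      ∀ (j : C.Idx 1) s x, 0 ≤ s → x ∈ Icc 0 1 →
        |toFam 1 z 0 j s x - toFam 1 z' 0 j s x| ≤ 2 * M * exp (β * s) := by
  obtain ⟨M', hP⟩ := exists_regular hC le_rfl (MemKernel.zero (C := C) 1)
  obtain ⟨κ, β₀, -, he⟩ := hP.exists_exponents 0
  refine ⟨β₀, by linarith [he.one_le], fun β hle W W' z z' M hM hz hz' h0 hW j s x hs hx => ?_⟩
  have e0 := agree_iff_toFam.1 ((zero_add (0 : ℝ)).symm ▸ h0)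
  refine hP.abs_sub_le_of_mild (he.mono hP hle) (hz.tame Icc_subset_Ici_self)
    (hz'.tame Icc_subset_Ici_self) (Net.tamePast_zero _)
    (fun j r y h1 _ h2 => hz.toFam_mild_zero hC j h1 h2)
    (fun j r y h1 _ h2 => (hz'.toFam_mild_zero hC j h1 h2).trans
      (hP.mild_congr (fun j y hy => (e0 j y hy).symm) j h1 h2)) hM
    (fun j r _ _ => ?_) j s x hs le_rfl hx
  have h0 : 0 ≤ M * exp (β * r) := by positivity
  rcases j with ⟨⟨j, hj⟩, k | k⟩
  · simp only [netInput, Sum.elim_inl, zero_add]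
    split_ifs with h
    · subst h
      exact hW r k
    · simpa using h0
  · simpa [netInput] using h0

/-- The data of the fixed-point problem for the closed loop. -/
theorem Kernels.Solve.exists_response (hD : D.Solve) (hC : C.Standing) (hτ : 0 < τ)
    {z₀ : C.State} (hz₀ : z₀.Admissible) : ∃ β₀, 0 ≤ β₀ ∧ ∀ β, β₀ ≤ β →
      ∀ (W : C.Inputs) (M : ℝ), 0 < M → C.IsVirtualInput τ W →
      (∀ i ∈ Finset.Icc 1 C.N, ∀ t k, |W i t k| ≤ M * exp (β * t)) →
      ∃ z V, C.IsSol 1 0 (Ici 0) (W 1) z ∧ (z 0).Agree 1 z₀ ∧ D.Response τ z W V ∧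
        C.IsVirtualInput τ V ∧ ∃ B, 0 ≤ B ∧ ∀ i ∈ Finset.Icc 1 C.N, ∀ t k,
          |V i t k| ≤ B * exp (β * t) := by
  obtain ⟨β₁, hβ₁, hsol⟩ := exists_isSol hC hz₀
  obtain ⟨β₂, R, hβ₂, hR, hlaw⟩ := hD.exists_response_bd hC hτ
  refine ⟨max β₁ β₂, hβ₁.trans (le_max_left _ _), fun β hβ W M hM hWv hW => ?_⟩
  have hN1 : 1 ∈ Finset.Icc 1 C.N := Finset.mem_Icc.2 ⟨le_rfl, hC.N_pos⟩
  obtain ⟨z, hz, h0, B, hB, hzB⟩ := hsol β ((le_max_left _ _).trans hβ) W M hM.le (hWv.meas 1 hN1)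
    (hW 1 hN1)
  have hβ0 : 0 ≤ β := hβ₁.trans ((le_max_left _ _).trans hβ)
  have hmono : Monotone fun t => exp (β * t) := fun s t h => exp_le_exp.2 (by gcongr)
  have hpred := fun i hi => hD.exists_delayedPred (z := z) (W := W) (i := i) hC hτ hi
    (fun t => exp_pos (β * t)) hmono hB hM.le (measurable_toFam 0 hz.meas_u hz.meas_v) hzB
    (hWv.meas i hi) (hW i hi)
  choose q hq N hN using hpred
  let V : C.Inputs := fun i t k =>
    if h : i ∈ Finset.Icc 1 C.N then if C.startTime τ ≤ t then
      D.flat i (C.reference τ W i) k (t + C.theta τ i) 0 +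
        D.lawVal τ (Finset.left_mem_Icc.2 (Finset.mem_Icc.1 h).2) (q i h t) k else 0 else 0
  have hV : D.Response τ z W V := fun i hi hii =>
    ⟨q i hi, hq i hi, fun t ht k => by simp only [V, dif_pos hi, if_pos ht]⟩
  have hVm : ∀ i ∈ Finset.Icc 1 C.N, Measurable (V i) := fun i hi => measurable_pi_iff.2 fun k => by
    simp only [V, dif_pos hi]
    obtain ⟨M', hΦ⟩ := hD.exists_lawFun_bounded hC hi
    refine Measurable.ite measurableSet_Ici (Measurable.add ?_ ?_) measurable_const
    · have := (hD.measurable_flat hC hi (measurable_reference (τ := τ) hWv.meas) k).comp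
        (by fun_prop : Measurable fun t : ℝ => (t + C.theta τ i, (0 : ℝ)))
      simpa only [Function.comp_def, clamp_of_mem (by simp : (0 : ℝ) ∈ Icc 0 1)] using this
    · exact Net.Functional.measurable_eval (P := D.predNet i) (hΦ k) (hq i hi).meas
  have hb : ∀ i ∈ Finset.Icc 1 C.N, ∀ t k,
      |V i t k| ≤ (M / 4 + R * (M + B * exp (-β * τ))) * exp (β * t) := fun i hi t k => by
    by_cases ht : C.startTime τ ≤ t
    · exact hlaw β ((le_max_right _ _).trans hβ) (ParamNorm.sup _ _) t ParamNorm.onWindow_sup z W V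
        hWv hVm hV _ M M (by positivity) hM hM (fun i hi j s x h1 h2 hx r _ _ =>
          abs_delayedFam_le_mul_exp hC hτ hi hβ0 hB h1 h2 (fun j r h => hzB j r x h hx) r j) i hi
        (fun k r _ _ => hW i hi r k)
        (fun h k r _ _ => hW (i + 1) (Finset.mem_Icc.2 ⟨by omega, h⟩) r k) k t ⟨ht, le_rfl⟩
        (exp_pos _).le
    · simp only [V, dif_pos hi, if_neg ht, abs_zero]
      positivity
  have hc : 0 ≤ M / 4 + R * (M + B * exp (-β * τ)) := by positivity
  exact ⟨z, V, hz, h0, hV, ⟨hVm, fun T => ⟨_, fun i hi t ht k => (hb i hi t k).trans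
    (mul_le_mul_of_nonneg_left (hmono ht) hc)⟩, fun i hi t ht => funext fun k => by
      simp only [V, dif_pos hi, if_neg (not_le.2 ht), Pi.zero_apply]⟩, _, hc, hb⟩

end Chain

namespace Chain

variable {C : Chain} {D : C.Kernels} {τ : ℝ}

/-- Existence of the closed loop: a fixed point of the law, with the weight
`A ^ (N - i) * exp (β t)` for the virtual input `Û_i`.  The references of subsystem `i` come from
subsystem `i + 1`, which has a smaller weight; the states enter with a delay. -/
theorem Kernels.Solve.exists_closedLoop (hD : D.Solve) (hC : C.Standing) (hτ : 0 < τ)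
    {z₀ : C.State} (hz₀ : z₀.Admissible) :
    ∃ z W, C.IsSol 1 0 (Ici 0) (W 1) z ∧ (z 0).Agree 1 z₀ ∧ D.Law τ z W := by
  classical
  obtain ⟨β₁, hβ₁, hresp⟩ := hD.exists_response hC hτ hz₀
  obtain ⟨β₂, hβ₂, hstab⟩ := exists_isSol_stability hC
  obtain ⟨β₃, R, hβ₃, hR, hcon⟩ := hD.exists_response_bd hC hτ
  have hN1 : 1 ∈ Finset.Icc 1 C.N := Finset.mem_Icc.2 ⟨le_rfl, hC.N_pos⟩
  set A := 8 * R + 1 with hA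
  have hA1 : 1 ≤ A := by linarith
  have hA0 : 0 < A := by linarith
  have hlim : Filter.Tendsto (fun β : ℝ => exp (-(β * τ))) Filter.atTop (nhds 0) :=
    Real.tendsto_exp_neg_atTop_nhds_zero.comp (Filter.tendsto_id.atTop_mul_const hτ)
  obtain ⟨β, hβ4, hβ⟩ := ((hlim.eventually (gt_mem_nhds
    (by positivity : 0 < 1 / (16 * (R + 1) * A ^ C.N)))).and
    (Filter.eventually_ge_atTop (max (max β₁ β₂) β₃))).exists
  simp only [max_le_iff] at hβ
  obtain ⟨⟨hb1, hb2⟩, hb3⟩ := hβ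
  have hβ0 := hβ₁.trans hb1
  let ι := Σ i : Finset.Icc 1 C.N, Fin (C.n i)
  let _ : MeasurableSpace ι := ⊤
  have _ : DiscreteMeasurableSpace ι := ⟨fun _ => trivial⟩
  let X := ι × ℝ
  let ω : X → ℝ := fun p => A ^ (C.N - p.1.1.1) * exp (β * p.2)
  have hω : ∀ p, 0 < ω p := fun p => by positivity
  -- functions on `X` are families of virtual inputs
  let Wf : (X → ℝ) → C.Inputs := fun f i t k =>
    if h : i ∈ Finset.Icc 1 C.N then if C.startTime τ ≤ t then f (⟨⟨i, h⟩, k⟩, t) else 0 else 0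
  have hWf : ∀ f i (h : i ∈ Finset.Icc 1 C.N) t, C.startTime τ ≤ t → ∀ k,
      Wf f i t k = f (⟨⟨i, h⟩, k⟩, t) := fun f i h t ht k => by simp only [Wf, dif_pos h, if_pos ht]
  have hWb : ∀ f i, i ∈ Finset.Icc 1 C.N → ∀ t, t < C.startTime τ → Wf f i t = 0 :=
    fun f i h t ht => funext fun k => by
      simp only [Wf, dif_pos h, if_neg (not_le.2 ht), Pi.zero_apply]
  have hdiff : ∀ f g M, 0 ≤ M → (∀ p, |f p - g p| ≤ M * ω p) → ∀ i ∈ Finset.Icc 1 C.N, ∀ t k,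
      |Wf f i t k - Wf g i t k| ≤ M * A ^ (C.N - i) * exp (β * t) := fun f g M hM h i hi t k => by
    rcases lt_or_ge t (C.startTime τ) with ht | ht
    · rw [hWb f i hi t ht, hWb g i hi t ht, sub_self, abs_zero]; positivity
    · rw [hWf f i hi t ht, hWf g i hi t ht, mul_assoc]
      exact h _
  have hgrow : ∀ f M, 0 ≤ M → (∀ p, |f p| ≤ M * ω p) → ∀ i ∈ Finset.Icc 1 C.N, ∀ t k,
      |Wf f i t k| ≤ M * A ^ C.N * exp (β * t) := fun f M hM h i hi t k => by
    have := hdiff f 0 M hM (by simpa using h) i hi t k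
    rw [show Wf 0 i t k = 0 by simp [Wf], sub_zero] at this
    refine this.trans (mul_le_mul_of_nonneg_right (mul_le_mul_of_nonneg_left
      (pow_le_pow_right₀ hA1 (Nat.sub_le _ _)) hM) (exp_pos _).le)
  have hWv : ∀ f, Measurable f → (∃ M, ∀ p, |f p| ≤ M * ω p) → C.IsVirtualInput τ (Wf f) := by
    rintro f hf ⟨M, hM⟩
    refine ⟨fun i hi => measurable_pi_iff.2 fun k => ?_, fun T => ⟨|M| * A ^ C.N * exp (β * T),
      fun i hi t ht k => (hgrow f |M| (abs_nonneg M) (fun p => (hM p).trans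
        (mul_le_mul_of_nonneg_right (le_abs_self M) (hω p).le)) i hi t k).trans ?_⟩, hWb f⟩
    · simp only [Wf, dif_pos hi]
      exact Measurable.ite measurableSet_Ici (hf.comp measurable_prodMk_left) measurable_const
    · exact mul_le_mul_of_nonneg_left (exp_le_exp.2 (mul_le_mul_of_nonneg_left ht hβ0))
        (by positivity)
  have hex : ∀ f : X → ℝ, ∃ g : X → ℝ, Measurable f → (∃ M, ∀ p, |f p| ≤ M * ω p) →
      Measurable g ∧ (∃ B, ∀ p, |g p| ≤ B * ω p) ∧ (∀ p, p.2 < C.startTime τ → g p = 0) ∧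
      ∃ z, C.IsSol 1 0 (Ici 0) (Wf f 1) z ∧ (z 0).Agree 1 z₀ ∧ D.Response τ z (Wf f) (Wf g) := by
    intro f
    by_cases h : Measurable f ∧ ∃ M, ∀ p, |f p| ≤ M * ω p
    · obtain ⟨hf, M, hM⟩ := h
      obtain ⟨z, V, hz, h0, hV, hVv, B, hB0, hB⟩ := hresp β hb1 (Wf f) ((|M| + 1) * A ^ C.N)
        (by positivity) (hWv f hf ⟨M, hM⟩) (hgrow f _ (by positivity) fun p => (hM p).trans
          (mul_le_mul_of_nonneg_right (by linarith [le_abs_self M]) (hω p).le))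
      refine ⟨fun p => V p.1.1 p.2 p.1.2, fun _ _ => ⟨measurable_from_prod_countable_right fun a =>
        measurable_pi_iff.1 (hVv.meas a.1 a.1.2) a.2, ⟨B, fun p => (hB _ p.1.1.2 p.2 p.1.2).trans
          (mul_le_mul_of_nonneg_left ?_ hB0)⟩, fun p hp => ?_, z, hz, h0, fun i hi hii => ?_⟩⟩
      · exact le_mul_of_one_le_left (exp_pos _).le (one_le_pow₀ hA1)
      · exact congrFun (hVv.before _ p.1.1.2 _ hp) _
      · obtain ⟨q, hq, e⟩ := hV i hi hii
        exact ⟨q, hq, fun t ht k =>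
          (hWf (fun p : X => V p.1.1 p.2 p.1.2) i hi t ht k).trans (e t ht k)⟩
    · exact ⟨0, fun h1 h2 => absurd ⟨h1, h2⟩ h⟩
  choose Φ hΦ using hex
  obtain ⟨M₀, hM₀⟩ := (hΦ (fun _ => 0) measurable_const ⟨0, fun p => by simp⟩).2.1
  obtain ⟨f, hf, hfb, hfix⟩ := exists_fixedPoint_of_weight ω hω Φ M₀
    (fun f h1 h2 => (hΦ f h1 h2).1) hM₀ fun f g hf hg hfb hgb M hM hfg => by
      obtain ⟨hm, hmb, hb, z, hz, h0, hV⟩ := hΦ f hf hfb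
      obtain ⟨hm', hmb', hb', z', hz', h0', hV'⟩ := hΦ g hg hgb
      have hag : (z 0).Agree 1 (z' 0) := fun j hj x hx =>
        ⟨(h0 j hj x hx).1.trans (h0' j hj x hx).1.symm,
          (h0 j hj x hx).2.trans (h0' j hj x hx).2.symm⟩
      have hd := hdiff f g M hM.le hfg
      have hzz := hstab β hb2 (Wf f) (Wf g) z z' (M * A ^ (C.N - 1)) (by positivity) hz hz' hag
        (hd 1 hN1)
      rintro ⟨⟨⟨i, hi⟩, k⟩, t⟩
      show _ ≤ M / 2 * (A ^ (C.N - i) * exp (β * t))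
      rcases lt_or_ge t (C.startTime τ) with ht | ht
      · rw [hb _ ht, hb' _ ht, sub_self, abs_zero]; positivity
      set P := M * A ^ (C.N - i) with hP
      have hP0 : 0 < P := by positivity
      have key := hcon β hb3 (ParamNorm.sup _ _) t ParamNorm.onWindow_sup _ _ _
        ((hWv f hf hfb).sub (hWv g hg hgb))
        (fun i hi => ((hWv _ hm hmb).meas i hi).sub ((hWv _ hm' hmb').meas i hi))
        (hV.sub hV' (hWv f hf hfb) (hWv g hg hgb) hD hC hτ)
        (2 * (M * A ^ (C.N - 1)) * exp (-β * τ)) P (P / A) (by positivity) hP0 (by positivity)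
        (fun i hi j s x h1 h2 hx r _ _ => abs_delayedFam_le_mul_exp hC hτ hi hβ0 (by positivity) h1
          h2 (fun j r h => by rw [toFam_signalSub]; exact hzz j r x h hx) r j) i hi
        (fun k r _ _ => hd i hi r k)
        (fun (h : i < C.N) k r _ _ => (hd (i + 1) (Finset.mem_Icc.2 ⟨by omega, h⟩) r k).trans
          (le_of_eq (by
            rw [hP, show C.N - i = C.N - (i + 1) + 1 by omega, pow_succ]
            field_simp))) k t ⟨ht, le_rfl⟩ (exp_pos _).le
      simp only [Pi.sub_apply, hWf _ i hi t ht] at key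
      refine key.trans ?_
      rw [← mul_assoc (M / 2)]
      refine mul_le_mul_of_nonneg_right ?_ (exp_pos _).le
      have e1 : R * (P / A) ≤ P / 8 := by
        rw [mul_div_assoc', div_le_div_iff₀ hA0 (by norm_num)]
        nlinarith
      have e2 : R * (2 * (M * A ^ (C.N - 1)) * exp (-β * τ)) ≤ P / 8 := by
        have h1 : M ≤ P := le_mul_of_one_le_right hM.le (one_le_pow₀ hA1)
        have h2 : A ^ (C.N - 1) ≤ A ^ C.N := pow_le_pow_right₀ hA1 (Nat.sub_le _ _)
        rw [← neg_mul, lt_div_iff₀ (by positivity)] at hβ4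
        calc R * (2 * (M * A ^ (C.N - 1)) * exp (-β * τ))
            ≤ (R + 1) * (2 * (M * A ^ C.N) * exp (-β * τ)) := by
              gcongr
              linarith
          _ = M / 8 * (exp (-β * τ) * (16 * (R + 1) * A ^ C.N)) := by ring
          _ ≤ M / 8 * 1 := mul_le_mul_of_nonneg_left hβ4.le (by positivity)
          _ ≤ _ := by linarith
      calc _ ≤ P / 4 + P / 8 + P / 8 := by linarith
        _ = M / 2 * A ^ (C.N - i) := by rw [hP]; ring
  obtain ⟨-, -, -, z, hz, h0, hV⟩ := hΦ f hf hfb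
  rw [hfix] at hV
  exact ⟨z, Wf f, hz, h0, hWv f hf hfb, hV⟩

end Chain

/-! ### Weighted `L²` norms -/

theorem eLpNorm_two_le_iff {f : ℝ → ℝ} {M : ENNReal} :
    eLpNorm f 2 volume ≤ M ↔ ∫⁻ t, ‖f t‖ₑ ^ 2 ≤ M ^ 2 := by
  rw [eLpNorm_eq_lintegral_rpow_enorm_toReal (by norm_num) (by norm_num), ENNReal.toReal_ofNat,
    one_div, ENNReal.rpow_inv_le_iff two_pos]
  simp only [ENNReal.rpow_two]

theorem lintegral_comp_add_mul {h : ℝ → ENNReal} (hh : Measurable h) {a : ℝ} (ha : a ≠ 0)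
    (b : ℝ) : ∫⁻ t, h (b + a * t) = ENNReal.ofReal |a⁻¹| * ∫⁻ t, h t := by
  rw [← lintegral_map (f := fun t => h (b + t)) (g := fun t => a * t)
    (hh.comp (measurable_const_add b)) (measurable_const_mul a), Real.map_volume_mul_left ha,
    lintegral_smul_measure, lintegral_add_left_eq_self, smul_eq_mul]

/-- The Cauchy-Schwarz inequality with the weight `m`. -/
theorem sq_lintegral_le {μ : Measure ℝ} {G m : ℝ → ENNReal} (hG : AEMeasurable G μ)
    (hm : AEMeasurable m μ) (h0 : ∀ r, m r ≠ 0) (ht : ∀ r, m r ≠ ⊤) :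
    (∫⁻ r, G r ∂μ) ^ 2 ≤ (∫⁻ r, m r ∂μ) * ∫⁻ r, G r ^ 2 / m r ∂μ := by
  have h := ENNReal.lintegral_mul_le_Lp_mul_Lq μ Real.HolderConjugate.two_two
    (hm.pow_const (1 / 2 : ℝ)) (hG.div (hm.pow_const (1 / 2 : ℝ)))
  have e1 : ∀ r, m r ^ (1 / 2 : ℝ) * (G r / m r ^ (1 / 2 : ℝ)) = G r := fun r =>
    ENNReal.mul_div_cancel (by simp [h0 r]) (by simp [ht r])
  have e2 : ∀ r, (m r ^ (1 / 2 : ℝ)) ^ (2 : ℝ) = m r := fun r => by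
    rw [← ENNReal.rpow_mul]; norm_num
  have e3 : ∀ r, (G r / m r ^ (1 / 2 : ℝ)) ^ (2 : ℝ) = G r ^ 2 / m r := fun r => by
    rw [ENNReal.div_rpow_of_nonneg _ _ zero_le_two, e2, ENNReal.rpow_two]
  simp only [Pi.mul_apply, Pi.div_apply, e1, e2, e3] at h
  calc _ ≤ _ := pow_le_pow_left' h 2
    _ = _ := by
      rw [mul_pow, ← ENNReal.rpow_two, ← ENNReal.rpow_two, ← ENNReal.rpow_mul, ← ENNReal.rpow_mul]
      simp

/-- The weight `exp (-β t)` on the window `[T,H]`. -/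
def expWindow (β T H : ℝ) : ℝ → ℝ := (Icc T H).indicator fun t => exp (-β * t)

theorem measurable_expWindow {β T H : ℝ} : Measurable (expWindow β T H) :=
  (by fun_prop : Measurable fun t : ℝ => exp (-β * t)).indicator measurableSet_Icc

theorem expWindow_of_mem {β T H t : ℝ} (h : t ∈ Icc T H) :
    expWindow β T H t = exp (-β * t) := indicator_of_mem h _

theorem expWindow_of_notMem {β T H t : ℝ} (h : t ∉ Icc T H) : expWindow β T H t = 0 :=
  indicator_of_notMem h _

namespace ParamNorm

/-- The `L²` norm with the weight `exp (-β t)` on the window `[T,H]`.  Minkowski's inequality for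
integrals is obtained from the Cauchy-Schwarz inequality whose weight is the bound `m`. -/
def l2 (β T H : ℝ) : ParamNorm ℝ where
  Bd f M := Measurable f ∧ 0 ≤ M ∧
    eLpNorm (fun t => expWindow β T H t * f t) 2 volume ≤ ENNReal.ofReal M
  zero := ⟨measurable_const, le_rfl, by simp⟩
  mono := fun h hM => ⟨h.1, h.2.1.trans hM, h.2.2.trans (ENNReal.ofReal_le_ofReal hM)⟩
  add := fun hf hg => ⟨hf.1.add hg.1, add_nonneg hf.2.1 hg.2.1, by
    simp only [mul_add]
    refine (eLpNorm_add_le (measurable_expWindow.mul hf.1).aestronglyMeasurable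
      (measurable_expWindow.mul hg.1).aestronglyMeasurable one_le_two).trans ?_
    rw [ENNReal.ofReal_add hf.2.1 hg.2.1]
    exact add_le_add hf.2.2 hg.2.2⟩
  smul := fun {f M} a hf => ⟨hf.1.const_mul a, mul_nonneg (abs_nonneg a) hf.2.1, by
    rw [show (fun t => expWindow β T H t * (a * f t)) =
      a • fun t => expWindow β T H t * f t from funext fun t => mul_left_comm _ _ _,
      eLpNorm_const_smul, ENNReal.ofReal_mul (abs_nonneg a), Real.enorm_eq_ofReal_abs]
    gcongr
    exact hf.2.2⟩
  integral := fun {g m a} ha hg hm hpos h => by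
    refine ⟨measurable_intervalIntegral hg measurable_const measurable_const,
      intervalIntegral.integral_nonneg ha fun r _ => (hpos r).le, ?_⟩
    have em : ∫⁻ r in Ioc 0 a, ENNReal.ofReal (m r) = ENNReal.ofReal (∫ r in 0..a, m r) := by
      rw [integral_of_le ha, ofReal_integral_eq_lintegral_ofReal
        (hm.continuousOn.integrableOn_Icc.mono_set Ioc_subset_Icc_self)
        (ae_of_all _ fun r => (hpos r).le)]
    have hmm : Measurable fun r => ENNReal.ofReal (m r) := hm.measurable.ennreal_ofReal
    have hm0 : ∀ r, ENNReal.ofReal (m r) ≠ 0 := fun r => by simp [hpos r]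
    have hG : Measurable fun p : ℝ × ℝ => ‖expWindow β T H p.1 * g p.1 p.2‖ₑ :=
      ((measurable_expWindow.comp measurable_fst).mul hg).enorm
    have hpt : ∀ t, ‖expWindow β T H t * ∫ r in 0..a, g t r‖ₑ ^ 2 ≤
        ENNReal.ofReal (∫ r in 0..a, m r) *
          ∫⁻ r in Ioc 0 a, ‖expWindow β T H t * g t r‖ₑ ^ 2 / ENNReal.ofReal (m r) := fun t => by
      rw [← em, ← intervalIntegral.integral_const_mul, integral_of_le ha]
      exact (pow_le_pow_left' (enorm_integral_le_lintegral_enorm _) 2).trans (sq_lintegral_le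
        (hG.comp measurable_prodMk_left).aemeasurable hmm.aemeasurable hm0
        fun _ => ENNReal.ofReal_ne_top)
    rw [eLpNorm_two_le_iff, sq (ENNReal.ofReal _)]
    refine (lintegral_mono hpt).trans ?_
    rw [lintegral_const_mul _ (Measurable.lintegral_prod_right
      ((hG.pow_const 2).div (hmm.comp measurable_snd)))]
    gcongr
    rw [lintegral_lintegral_swap ((hG.pow_const 2).div
        (hmm.comp measurable_snd)).aemeasurable, ← em]
    refine setLIntegral_mono hmm fun r hr => ?_
    simp only [div_eq_mul_inv]
    rw [lintegral_mul_const _ (by exact (hG.comp measurable_prodMk_right).pow_const 2),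
      ← div_eq_mul_inv,
      ENNReal.div_le_iff (hm0 r) ENNReal.ofReal_ne_top, ← sq, ← eLpNorm_two_le_iff]
    exact (h r ⟨hr.1.le, hr.2⟩).2.2
  closed := fun {f M} h => by
    have hM : 0 ≤ M := le_of_forall_pos_le_add fun ε hε => (h ε hε).2.1
    refine ⟨(h 1 one_pos).1, hM, ENNReal.le_of_forall_pos_le_add fun ε hε _ => ?_⟩
    rw [← ENNReal.ofReal_coe_nnreal, ← ENNReal.ofReal_add hM (by exact ε.2)]
    exact (h ε hε).2.2

/-- An affine change of the variable. -/
theorem l2_comp {β T H β' T' H' a b M : ℝ} {F h : ℝ → ℝ} (ha : a ≠ 0) (hF : Measurable F)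
    (hh : (l2 β' T' H').Bd h M) (hle : ∀ t ∈ Icc T H, F t ≠ 0 → b + a * t ∈ Icc T' H' ∧
      exp (-β * t) * |F t| ≤ exp (-β' * (b + a * t)) * |h (b + a * t)|) :
    (l2 β T H).Bd F (sqrt |a⁻¹| * M) := by
  refine ⟨hF, mul_nonneg (sqrt_nonneg _) hh.2.1, ?_⟩
  have hm : Measurable fun t => ‖expWindow β' T' H' t * h t‖ₑ ^ 2 :=
    (measurable_expWindow.mul hh.1).enorm.pow_const 2
  have e := eLpNorm_two_le_iff.1 hh.2.2
  rw [eLpNorm_two_le_iff, ENNReal.ofReal_mul (sqrt_nonneg _), mul_pow,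
    ← ENNReal.ofReal_pow (sqrt_nonneg _), Real.sq_sqrt (abs_nonneg _)]
  refine le_trans (lintegral_mono fun t => ?_) ((lintegral_comp_add_mul hm ha b).trans_le
    (mul_le_mul_right e _))
  refine pow_le_pow_left' (enorm_le_iff_norm_le.2 ?_) 2
  by_cases ht : t ∈ Icc T H
  · by_cases h0 : F t = 0
    · rw [h0, mul_zero, norm_zero]; exact norm_nonneg _
    · obtain ⟨h1, h2⟩ := hle t ht h0
      rwa [expWindow_of_mem ht, expWindow_of_mem h1, Real.norm_eq_abs, Real.norm_eq_abs, abs_mul,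
        abs_mul, abs_of_pos (exp_pos _), abs_of_pos (exp_pos _)]
  · rw [expWindow_of_notMem ht, zero_mul, norm_zero]; exact norm_nonneg _

/-- Restriction of a function and of the window. -/
theorem l2_mono {β T H T' H' M : ℝ} {F h : ℝ → ℝ} (hF : Measurable F) (hh : (l2 β T' H').Bd h M)
    (hle : ∀ t ∈ Icc T H, F t ≠ 0 → t ∈ Icc T' H' ∧ F t = h t) : (l2 β T H).Bd F M := by
  have := l2_comp (a := 1) (b := 0) (β := β) (T := T) (H := H) one_ne_zero hF hh fun t ht h0 => by
    rw [zero_add, one_mul, (hle t ht h0).2]; exact ⟨(hle t ht h0).1, le_rfl⟩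
  simpa using this

theorem l2_ite {β T H M : ℝ} {h : ℝ → ℝ} (hh : (l2 β T H).Bd h M) :
    (l2 β T H).Bd (fun t => if 0 < t then h t else 0) M :=
  l2_mono (Measurable.ite measurableSet_Ioi hh.1 measurable_const) hh fun t ht hne => by
    by_cases h0 : 0 < t
    · exact ⟨ht, if_pos h0⟩
    · exact absurd (if_neg h0) hne

theorem onWindow_l2 {β T H : ℝ} : (l2 β T H).OnWindow T H β where
  congr hg h hf := l2_mono hg hf fun t ht _ => ⟨ht, (h t ht).symm⟩
  fin M := by
    have hfin : eLpNorm (fun t => expWindow β T H t * M) 2 volume ≠ ⊤ := by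
      have hc : Continuous fun t : ℝ => exp (-β * t) * M := by fun_prop
      obtain ⟨B, hB⟩ := isCompact_Icc.exists_bound_of_continuousOn (s := Icc T H) hc.continuousOn
      have hmem : MemLp ((Icc T H).indicator fun t => exp (-β * t) * M) 2 volume := by
        rw [memLp_indicator_iff_restrict measurableSet_Icc]
        exact MemLp.of_bound hc.aestronglyMeasurable B
          ((ae_restrict_iff' measurableSet_Icc).2 (ae_of_all _ hB))
      have e : (fun t => expWindow β T H t * M) =
          (Icc T H).indicator fun t => exp (-β * t) * M := funext fun t => by
        by_cases ht : t ∈ Icc T H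
        · rw [expWindow_of_mem ht, indicator_of_mem ht]
        · rw [expWindow_of_notMem ht, indicator_of_notMem ht, zero_mul]
      rw [e]
      exact hmem.eLpNorm_ne_top
    refine ⟨(eLpNorm (fun t => expWindow β T H t * M) 2 volume).toReal, fun {f} hf h =>
      ⟨hf, ENNReal.toReal_nonneg, ?_⟩⟩
    rw [ENNReal.ofReal_toReal hfin]
    refine eLpNorm_mono fun t => ?_
    by_cases ht : t ∈ Icc T H
    · rw [norm_mul, norm_mul]
      exact mul_le_mul_of_nonneg_left ((h t ht).trans (le_abs_self M)) (norm_nonneg _)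
    · rw [expWindow_of_notMem ht, zero_mul, norm_zero]; exact norm_nonneg _
  shift {f M a} hf h0 ha h := by
    have h1 := l2_comp (a := 1) (b := -a) (β := β) (T := T) (H := H)
      (F := fun t => exp (β * a) * f (t - a)) one_ne_zero
      ((hf.comp (measurable_id.sub_const a)).const_mul _) h fun t ht hne => by
        have hT : T ≤ t - a := by
          by_contra hcon
          exact hne (by simp only [h0 _ (not_le.1 hcon), mul_zero])
        rw [one_mul, neg_add_eq_sub]
        refine ⟨⟨hT, by linarith [ht.2]⟩, le_of_eq ?_⟩
        rw [abs_mul, abs_of_pos (exp_pos _), ← mul_assoc, ← exp_add]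
        congr 2; ring
    have h2 := (l2 β T H).smul (exp (-β * a)) h1
    simp only [← mul_assoc, ← exp_add] at h2
    simpa [abs_of_pos (exp_pos _), mul_comm] using h2

end ParamNorm

namespace Net

variable {J : Type} [Fintype J] {P : Net J} {M : ℝ}

/-- The extension of a solution by `0` to negative times and outside `[0,1]`. -/
def ext (q : J → ℝ → ℝ → ℝ) (j : J) (t x : ℝ) : ℝ := if 0 ≤ t ∧ x ∈ Icc 0 1 then q j t x else 0

omit [Fintype J] in
theorem measurable_ext {q : J → ℝ → ℝ → ℝ} (hq : ∀ j, Measurable fun p : ℝ × ℝ => q j p.1 p.2)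
    (j : J) : Measurable fun p : ℝ × ℝ => ext q j p.1 p.2 :=
  Measurable.ite ((measurableSet_le measurable_const measurable_fst).inter
    (measurable_snd measurableSet_Icc)) (hq j) measurable_const

/-- The signal that enters component `j` of a network without memory. -/
def enter (P : Net J) (q : J → ℝ → ℝ → ℝ) (b : J → ℝ → ℝ) (j : J) (s : ℝ) : ℝ :=
  if 0 < s then (∑ l, P.B j l * ext q l s (P.xout l)) + (if 0 < s then b j s else 0) else 0

namespace Regular

variable (hP : P.Regular M) {q : J → ℝ → ℝ → ℝ} {q₀ past b : J → ℝ → ℝ}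
include hP

/-- The equations of a network without memory, in terms of the extended solution; the source is
integrated backwards along the characteristic, over any interval that reaches its foot. -/
theorem mild_eq_ext (hh : P.h = 0) (j : J) {t x R : ℝ} (ht : 0 ≤ t) (hx : x ∈ Icc 0 1)
    (hR : min t (P.age j x) ≤ R) :
    P.mild q₀ past b q j t x = (if t ≤ P.age j x then q₀ j (x - P.c j * t) else 0) +
      P.enter q b j (t - P.age j x) +
      ∫ r in 0..R, ∑ l, P.S (x - P.c j * r) j l * ext q l (t - r) (x - P.c j * r) := by
  set m := min t (P.age j x) with hm
  have hm0 : 0 ≤ m := hP.min_age_nonneg ht hx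
  have e : ∫ r in 0..m, P.source q j (t - m + r) (x - P.c j * m + P.c j * r) =
      ∫ r in 0..R, ∑ l, P.S (x - P.c j * r) j l * ext q l (t - r) (x - P.c j * r) := by
    have := intervalIntegral.integral_comp_sub_left (a := 0) (b := m)
      (fun r => P.source q j (t - m + r) (x - P.c j * m + P.c j * r)) m
    rw [sub_self, sub_zero] at this
    rw [← this, integral_of_le hm0, integral_of_le (hm0.trans hR),
      setIntegral_eq_of_subset_of_forall_sdiff_eq_zero measurableSet_Ioc (Ioc_subset_Ioc_right hR)]
    · refine setIntegral_congr_fun measurableSet_Ioc fun r hr => ?_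
      obtain ⟨f1, f2⟩ := hP.foot_mem (j := j) (r := m - r) ht hx ⟨by linarith [hr.2], by
        rw [← hm]; linarith [hr.1]⟩
      rw [← hm] at f1 f2
      have e1 : t - m + (m - r) = t - r := by ring
      have e2 : x - P.c j * m + P.c j * (m - r) = x - P.c j * r := by ring
      rw [e1] at f2
      rw [e2] at f1
      simp only [source, e1, e2, ext, f1, f2.1, and_self, if_true]
    · rintro r ⟨hr, hr'⟩
      have hmr : m < r := not_le.1 fun h => hr' ⟨hr.1, h⟩
      refine sum_eq_zero fun l _ => ?_
      rw [ext, if_neg, mul_zero]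
      rintro ⟨h1, h2⟩
      rw [sub_eq_add_neg, ← mul_neg, ← pos_mem (P := P) (j := j), pos_add, ← hP.abs_c_mul_age] at h2
      have := hP.abs_c_pos j
      rcases min_lt_iff.1 hmr with h | h
      · linarith
      · nlinarith [h2.1]
  rw [mild, e]
  congr 1
  split_ifs with hc
  · rw [enter, if_neg (by linarith), add_zero]
  · have h0 : 0 < t - P.age j x := sub_pos.2 (not_le.1 hc)
    rw [zero_add, enter, if_pos h0, if_pos h0, inflow, hh]
    simp [ext, h0.le, (xout_mem _).1, (xout_mem _).2]

/-- The entering signal is controlled by the outflow and the input. -/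
theorem enter_bd {β H X Wb : ℝ} (hX : 0 ≤ X) {j : J}
    (hout : ∀ l, (ParamNorm.l2 β 0 H).Bd (fun s => ext q l s (P.xout l)) X)
    (hb : (ParamNorm.l2 β 0 H).Bd (fun s => if 0 < s then b j s else 0) Wb) :
    (ParamNorm.l2 β 0 H).Bd (P.enter q b j) (Fintype.card J * (M * X) + Wb) :=
  ParamNorm.l2_ite (ParamNorm.add _ (ParamNorm.sum_mul _ hX (hP.B_le j) hout) hb)

/-- `L²` estimate in time of the values of a solution at a fixed position. -/
theorem trace_bd (hh : P.h = 0) {κ β H Q Wb Γ : ℝ} (he : P.Exponents M κ β) (hQ : 0 ≤ Q)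
    (hWb : 0 ≤ Wb) (hΓ0 : 0 ≤ Γ) (hΓ : ∀ j, sqrt |(P.c j)⁻¹| ≤ Γ)
    (ht : Tame q H) (hq : ∀ j s x, 0 ≤ s → s ≤ H → x ∈ Icc 0 1 → q j s x = P.mild q₀ past b q j s x)
    (hq₀ : ∀ j, (ParamNorm.l2 0 0 1).Bd (q₀ j) Q)
    (hb : ∀ j, (ParamNorm.l2 β 0 H).Bd (fun s => if 0 < s then b j s else 0) Wb)
    (j : J) {x : ℝ} (hx : x ∈ Icc 0 1) :
    (ParamNorm.l2 β 0 H).Bd (fun t => ext q j t x) (2 * (exp κ * (Γ * Q + Wb))) := by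
  set ν := ParamNorm.l2 β 0 H with hν
  have hw : ν.OnWindow 0 H β := ParamNorm.onWindow_l2
  obtain ⟨hqm, B, hqB⟩ := ht
  have hM := hP.M_pos
  have hκ := he.κ_nonneg
  have hem := measurable_ext hqm
  have hem1 : ∀ j x, Measurable fun t => ext q j t x := fun j x =>
    (hem j).comp measurable_prodMk_right
  set n : ℝ := (Fintype.card J : ℝ) with hn
  have hposm : ∀ (k : J × Icc (0 : ℝ) 1), P.pos k.1 k.2 ∈ Icc 0 1 := fun k => pos_mem.2 k.2.2
  have key := ν.of_half_weight (w := fun k : J × Icc (0 : ℝ) 1 => exp (-(κ * P.pos k.1 k.2)))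
    (R := exp κ * (Γ * Q + Wb)) (f := fun k t => ext q k.1 t k.2) (fun _ => exp_pos _) ?_
    (by positivity) ?_ (j, ⟨x, hx⟩)
  · refine ν.mono key (mul_le_of_le_one_left (by positivity) (exp_le_one_iff.2 ?_))
    have := mul_nonneg hκ (hposm (j, ⟨x, hx⟩)).1
    linarith
  · obtain ⟨N, hN⟩ := hw.fin B
    refine ⟨exp κ * (|N| + 1), by positivity, fun k => ν.mono (hN (hem1 _ _) fun t ht => ?_) ?_⟩
    · rw [ext, if_pos ⟨ht.1, k.2.2⟩]
      exact hqB _ _ _ ht.1 ht.2 k.2.2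
    · rw [← mul_assoc, ← exp_add]
      have := one_le_exp (by nlinarith [(hposm k).2] : 0 ≤ -(κ * P.pos k.1 k.2) + κ)
      nlinarith [le_abs_self N, abs_nonneg N]
  · rintro Ω hΩ hf ⟨j, x, hx⟩
    have hX : ∀ l y, y ∈ Icc 0 1 →
        ν.Bd (fun t => ext q l t y) (exp (-(κ * P.pos l y)) * Ω) := fun l y hy => hf (l, ⟨y, hy⟩)
    have hX' : ∀ l y, y ∈ Icc 0 1 → ν.Bd (fun t => ext q l t y) Ω := fun l y hy =>
      ν.mono (hX l y hy) (mul_le_of_le_one_left hΩ.le (exp_le_one_iff.2 (by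
        have := mul_nonneg hκ (hposm (l, ⟨y, hy⟩)).1
        linarith)))
    have hp := hposm (j, ⟨x, hx⟩)
    dsimp only at hp
    have hage := hP.age_nonneg (j := j) hx
    -- the initial values
    have h1 : ν.Bd (fun t => if 0 ≤ t ∧ t ≤ P.age j x then q₀ j (x - P.c j * t) else 0)
        (Γ * Q) := by
      refine ν.mono (ParamNorm.l2_comp (a := -P.c j) (b := x) (neg_ne_zero.2 (hP.c_ne j))
        (Measurable.ite measurableSet_Icc ((hq₀ j).1.comp (by fun_prop)) measurable_const) (hq₀ j)
        fun t ht hne => ?_) (mul_le_mul_of_nonneg_right ?_ hQ)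
      · have hta : 0 ≤ t ∧ t ≤ P.age j x := by
          by_contra hcon
          exact hne (if_neg hcon)
        have := (hP.foot_mem (j := j) (r := 0) ht.1 hx ⟨le_rfl, le_min ht.1 hage⟩).1
        rw [min_eq_left hta.2, mul_zero, add_zero] at this
        rw [if_pos hta, neg_mul, ← sub_eq_add_neg, neg_zero, zero_mul, exp_zero]
        refine ⟨this, mul_le_mul_of_nonneg_right (exp_le_one_iff.2 ?_) (abs_nonneg _)⟩
        nlinarith [ht.1, he.one_le]
      · rw [inv_neg, abs_neg]; exact hΓ j
    -- the entering signal
    have h2 : ν.Bd (fun t => P.enter q b j (t - P.age j x))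
        ((n * (M * (exp (-κ) * Ω)) + Wb) * exp (-β * P.age j x)) := by
      have := hP.enter_bd (q := q) (X := exp (-κ) * Ω) (by positivity) (fun l => by
        simpa only [pos_xout, mul_one] using hX l _ (xout_mem (P := P) l)) (hb j)
      exact hw.shift this.1 (fun t ht => if_neg (by linarith)) hage this
    -- the source term
    have h3 : ν.Bd (fun t => ∫ r in 0..P.age j x,
        ∑ l, P.S (x - P.c j * r) j l * ext q l (t - r) (x - P.c j * r)) (n * M * Ω / β) := by
      refine ν.mono (ν.integral (m := fun r => n * (M * Ω) * exp (0 - β * r)) hage ?_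
        (by fun_prop) (fun r => ?_) fun r hr => ?_) ?_
      · refine measurable_sum _ fun l _ => ((hP.S_meas j l).comp (by fun_prop)).mul ?_
        exact (hem l).comp (by fun_prop : Measurable fun p : ℝ × ℝ =>
          (p.1 - p.2, x - P.c j * p.2))
      · have : 0 < n := Nat.cast_pos.2 (Fintype.card_pos_iff.2 ⟨j⟩)
        positivity
      · have hmem := (hP.foot_mem (j := j) (r := P.age j x - r) hage hx (by
          rw [min_self]; exact ⟨by linarith [hr.2], by linarith [hr.1]⟩)).1
        rw [min_self, show x - P.c j * P.age j x + P.c j * (P.age j x - r) = x - P.c j * r by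
          ring] at hmem
        refine ν.mono (ν.sum_mul (M := Ω * exp (-β * r)) (by positivity) (hP.S_le _ j)
          fun l => hw.shift (hem1 _ _) (fun t ht => if_neg fun h => by linarith [h.1]) hr.1
            (hX' l _ hmem)) (le_of_eq ?_)
        rw [zero_sub, neg_mul]; ring
      · rw [intervalIntegral.integral_const_mul]
        refine (mul_le_mul_of_nonneg_left (integral_exp_sub_mul_le (by linarith [he.one_le]))
          (by positivity)).trans (le_of_eq ?_)
        rw [exp_zero]; ring
    refine ν.mono (hw.congr (hem1 _ _) (fun t ht => ?_) (ν.add (ν.add h1 h2) h3)) ?_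
    · rw [show ext q j t x = q j t x from if_pos ⟨ht.1, hx⟩, hq j t x ht.1 ht.2 hx,
        hP.mild_eq_ext hh j ht.1 hx (min_le_right _ _)]
      simp only [ht.1, true_and]
    · have a1 : exp (κ * P.pos j x) ≤ exp κ := exp_le_exp.2 (by nlinarith [hp.2])
      have a2 : exp (κ * P.pos j x) * exp (-β * P.age j x) ≤ 1 := by
        rw [← exp_add, exp_le_one_iff, ← hP.abs_c_mul_age]
        nlinarith [mul_le_mul_of_nonneg_right (he.speed j) hage]
      have a3 := (exp_pos (κ * P.pos j x)).le
      have hn0 : 0 ≤ n := Nat.cast_nonneg _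
      have hβ : 0 ≤ β := zero_le_one.trans he.one_le
      rw [Real.exp_neg (κ * P.pos j x), ← div_eq_inv_mul, le_div_iff₀' (exp_pos _)]
      calc exp (κ * P.pos j x) * (Γ * Q + (n * (M * (exp (-κ) * Ω)) + Wb) *
            exp (-β * P.age j x) + n * M * Ω / β)
          = exp (κ * P.pos j x) * (Γ * Q) + (n * (M * (exp (-κ) * Ω)) + Wb) *
            (exp (κ * P.pos j x) * exp (-β * P.age j x)) +
            exp (κ * P.pos j x) * (n * M * Ω / β) := by ring
        _ ≤ exp κ * (Γ * Q) + (n * (M * (exp (-κ) * Ω)) + Wb) * 1 +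
            exp κ * (n * M * Ω / β) := by gcongr
        _ ≤ _ := by
          have hfac' := mul_le_mul_of_nonneg_right he.half hΩ.le
          have h0 : 0 ≤ n * M * exp (-κ) * Ω := by positivity
          have h4 : Wb ≤ exp κ * Wb := le_mul_of_one_le_left hWb (one_le_exp hκ)
          have : factor J M κ β * Ω = 2 * (n * M * exp (-κ) * Ω) +
            exp κ * (n * M * Ω / β) := by rw [factor]; ring
          linarith

end Regular

end Net

namespace Net.Regular

variable {J : Type} [Fintype J] {P : Net J} {M : ℝ} (hP : P.Regular M) {q : J → ℝ → ℝ → ℝ}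
  {q₀ past b : J → ℝ → ℝ}
include hP

/-- `L²` estimate in space of a solution at a fixed time. -/
theorem profile_bd (hh : P.h = 0) {β H Q E Γ : ℝ} (hβ1 : 0 < β)
    (hfac : Fintype.card J * M / β ≤ 1 / 2) (hQ : 0 ≤ Q)
    (hE : 0 ≤ E) (hΓ0 : 0 ≤ Γ) (hΓ : ∀ j, sqrt |P.c j| ≤ Γ)
    (hqt : Tame q H)
    (hq : ∀ j s x, 0 ≤ s → s ≤ H → x ∈ Icc 0 1 → q j s x = P.mild q₀ past b q j s x)
    (hq₀ : ∀ j, (ParamNorm.l2 0 0 1).Bd (q₀ j) Q)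
    (hent : ∀ j, (ParamNorm.l2 β 0 H).Bd (P.enter q b j) E) (j : J) {t : ℝ} (ht : t ∈ Icc 0 H) :
    (ParamNorm.l2 0 0 1).Bd (fun x => ext q j t x)
      (exp (β * H) * (2 * (Q + Γ * exp (β * H) * E))) := by
  set ν := ParamNorm.l2 0 0 1 with hν
  have hw : ν.OnWindow 0 1 0 := ParamNorm.onWindow_l2
  obtain ⟨hqm, B, hqB⟩ := hqt
  have hM := hP.M_pos
  have hem := measurable_ext hqm
  have hem1 : ∀ j t, Measurable fun x => ext q j t x := fun j t =>
    (hem j).comp measurable_prodMk_left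
  set n : ℝ := (Fintype.card J : ℝ) with hn
  have key := ν.of_half_weight (w := fun k : J × Icc (0 : ℝ) H => exp (β * k.2))
    (R := Q + Γ * exp (β * H) * E) (f := fun k x => ext q k.1 k.2 x) (fun _ => exp_pos _) ?_
    (by positivity) ?_ (j, ⟨t, ht⟩)
  · refine ν.mono key (mul_le_mul_of_nonneg_right (exp_le_exp.2 ?_) (by positivity))
    exact mul_le_mul_of_nonneg_left ht.2 hβ1.le
  · obtain ⟨N, hN⟩ := hw.fin B
    refine ⟨|N| + 1, by positivity, fun k => ν.mono (hN (hem1 _ _) fun x hx => ?_) ?_⟩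
    · rw [ext, if_pos ⟨k.2.2.1, hx⟩]
      exact hqB _ _ _ k.2.2.1 k.2.2.2 hx
    · have := one_le_exp (mul_nonneg hβ1.le k.2.2.1)
      nlinarith [le_abs_self N, abs_nonneg N]
  · rintro Ω hΩ hf ⟨j, t, ht⟩
    have hX : ∀ l s, s ∈ Icc 0 H → ν.Bd (fun x => ext q l s x) (exp (β * s) * Ω) :=
      fun l s hs => hf (l, ⟨s, hs⟩)
    have htH : β * t ≤ β * H := mul_le_mul_of_nonneg_left ht.2 hβ1.le
    -- the initial values
    have h1 : ν.Bd (fun x => if t ≤ P.age j x then q₀ j (x - P.c j * t) else 0) Q := by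
      have := ParamNorm.l2_comp (β := 0) (T := 0) (H := 1) (a := 1) (b := -(P.c j * t))
        (F := fun x => if t ≤ P.age j x then q₀ j (x - P.c j * t) else 0) one_ne_zero
        (Measurable.ite (measurableSet_le measurable_const (P.measurable_age j))
          ((hq₀ j).1.comp (by fun_prop)) measurable_const) (hq₀ j) fun x hx hne => by
          have hta : t ≤ P.age j x := by
            by_contra hcon
            exact hne (if_neg hcon)
          have := (hP.foot_mem (j := j) (r := 0) ht.1 hx ⟨le_rfl, le_min ht.1 (hP.age_nonneg hx)⟩).1
          rw [min_eq_left hta, mul_zero, add_zero] at this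
          rw [if_pos hta, one_mul, neg_add_eq_sub, neg_zero, zero_mul, zero_mul]
          exact ⟨this, le_rfl⟩
      simpa using this
    -- the entering signal
    have h2 : ν.Bd (fun x => P.enter q b j (t - P.age j x)) (Γ * exp (β * H) * E) := by
      have hage : ∀ x, t - P.age j x = t - P.age j 0 + -(P.c j)⁻¹ * x := fun x => by
        have := hP.age_add (j := j) 0 ((P.c j)⁻¹ * x)
        rw [zero_add, mul_inv_cancel_left₀ (hP.c_ne j)] at this
        rw [this]; ring
      have := ParamNorm.l2_comp (β := 0) (T := 0) (H := 1)
        (F := fun x => exp (-(β * H)) * P.enter q b j (t - P.age j x))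
        (neg_ne_zero.2 (inv_ne_zero (hP.c_ne j)))
        (((hent j).1.comp (measurable_const.sub (P.measurable_age j))).const_mul _)
        (hent j) fun x hx hne => by
          rw [← hage x]
          have h0 : 0 < t - P.age j x := by
            by_contra hcon
            exact hne (by simp only [enter, if_neg hcon, mul_zero])
          have hH : t - P.age j x ≤ H := by linarith [hP.age_nonneg (j := j) hx, ht.2]
          refine ⟨⟨h0.le, hH⟩, ?_⟩
          rw [neg_zero, zero_mul, exp_zero, one_mul, abs_mul, abs_of_pos (exp_pos _)]
          refine mul_le_mul_of_nonneg_right (exp_le_exp.2 ?_) (abs_nonneg _)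
          nlinarith
      have h3 := ν.smul (exp (β * H)) this
      simp only [← mul_assoc, ← exp_add, add_neg_cancel, exp_zero, one_mul] at h3
      refine ν.mono h3 ?_
      rw [inv_neg, inv_inv, abs_neg, abs_of_pos (exp_pos _), mul_comm (exp _)]
      gcongr
      exact hΓ j
    -- the source term
    have h3 : ν.Bd (fun x => ∫ r in 0..t,
        ∑ l, P.S (x - P.c j * r) j l * ext q l (t - r) (x - P.c j * r))
        (exp (β * t) * (n * M / β * Ω)) := by
      refine ν.mono (ν.integral (m := fun r => n * (M * Ω) * exp (β * t - β * r)) ht.1 ?_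
        (by fun_prop) (fun r => ?_) fun r hr => ?_) ?_
      · refine measurable_sum _ fun l _ => ((hP.S_meas j l).comp (by fun_prop)).mul ?_
        exact (hem l).comp (by fun_prop : Measurable fun p : ℝ × ℝ =>
          (t - p.2, p.1 - P.c j * p.2))
      · have : 0 < n := Nat.cast_pos.2 (Fintype.card_pos_iff.2 ⟨j⟩)
        positivity
      · have hl : ∀ l, ν.Bd (fun x => P.S (x - P.c j * r) j l * ext q l (t - r) (x - P.c j * r))
            (M * (exp (β * (t - r)) * Ω)) := fun l => by
          have hm1 : Measurable fun x => x - P.c j * r := by fun_prop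
          have := ParamNorm.l2_comp (β := 0) (T := 0) (H := 1) (a := 1) (b := -(P.c j * r))
            (F := fun x => P.S (x - P.c j * r) j l * ext q l (t - r) (x - P.c j * r)) one_ne_zero
            (((hP.S_meas j l).comp hm1).mul ((hem1 l (t - r)).comp hm1))
            (ν.smul M (hX l (t - r) ⟨by linarith [hr.2], by linarith [hr.1, ht.2]⟩))
            fun x hx hne => by
              rw [one_mul, neg_add_eq_sub, neg_zero, zero_mul, zero_mul]
              have hmem : x - P.c j * r ∈ Icc 0 1 := by
                by_contra hcon
                exact hne (by simp only [ext, if_neg fun h : _ ∧ _ => hcon h.2, mul_zero])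
              refine ⟨hmem, mul_le_mul_of_nonneg_left ?_ (exp_pos _).le⟩
              rw [abs_mul, abs_mul]
              exact mul_le_mul_of_nonneg_right ((hP.S_le _ j l).trans (le_abs_self M))
                (abs_nonneg _)
          simpa [abs_of_pos hM] using this
        refine ν.mono (ν.sum Finset.univ fun l _ => hl l) (le_of_eq ?_)
        rw [Finset.sum_const, Finset.card_univ, nsmul_eq_mul, mul_sub]; ring
      · rw [intervalIntegral.integral_const_mul]
        refine (mul_le_mul_of_nonneg_left (integral_exp_sub_mul_le hβ1)
          (by positivity)).trans (le_of_eq ?_)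
        ring
    refine ν.mono (hw.congr (hem1 _ _) (fun x hx => ?_) (ν.add (ν.add h1 h2) h3)) ?_
    · rw [show ext q j t x = q j t x from if_pos ⟨ht.1, hx⟩, hq j t x ht.1 ht.2 hx,
        hP.mild_eq_ext hh j ht.1 hx (min_le_left _ _)]
    · rw [mul_add, add_comm]
      refine add_le_add (mul_le_mul_of_nonneg_left ?_ (exp_pos _).le)
        (le_mul_of_one_le_left (by positivity) (one_le_exp (mul_nonneg hβ1.le ht.1)))
      linarith [mul_le_mul_of_nonneg_right hfac hΩ.le]

end Net.Regular

theorem lintegral_expWindow_sq {f : ℝ → ℝ} (hf : Measurable f) {B : ℝ}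
    (hB : ∀ x ∈ Icc (0 : ℝ) 1, |f x| ≤ B) :
    ∫⁻ x, ‖expWindow 0 0 1 x * f x‖ₑ ^ 2 = ENNReal.ofReal (∫ x in 0..1, f x ^ 2) := by
  have hi : IntervalIntegrable (fun x => f x ^ 2) volume 0 1 :=
    intervalIntegrable_of_abs_le (M := B ^ 2) (hf.pow_const 2) fun x hx => by
      rw [uIcc_of_le zero_le_one] at hx
      rw [abs_pow]
      exact pow_le_pow_left₀ (abs_nonneg _) (hB x hx) 2
  rw [integral_of_le zero_le_one, ← integral_Icc_eq_integral_Ioc,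
    ofReal_integral_eq_lintegral_ofReal (by
      rwa [intervalIntegrable_iff_integrableOn_Icc_of_le zero_le_one] at hi)
      (ae_of_all _ fun x => sq_nonneg _), ← lintegral_indicator measurableSet_Icc]
  refine lintegral_congr fun x => ?_
  by_cases hx : x ∈ Icc 0 1
  · rw [expWindow_of_mem hx, indicator_of_mem hx, neg_zero, zero_mul, exp_zero, one_mul,
      ← sq_abs, ENNReal.ofReal_pow (abs_nonneg _), Real.enorm_eq_ofReal_abs]
  · rw [expWindow_of_notMem hx, indicator_of_notMem hx]; simp

theorem ParamNorm.l2_zero_one_bd_iff {f : ℝ → ℝ} (hf : Measurable f) {B A : ℝ}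
    (hB : ∀ x ∈ Icc (0 : ℝ) 1, |f x| ≤ B) (hA : 0 ≤ A) :
    (ParamNorm.l2 0 0 1).Bd f A ↔ ∫ x in 0..1, f x ^ 2 ≤ A ^ 2 := by
  rw [← ENNReal.ofReal_le_ofReal_iff (by positivity), ← lintegral_expWindow_sq hf hB,
    ENNReal.ofReal_pow hA, ← eLpNorm_two_le_iff]
  exact ⟨fun h => h.2.2, fun h => ⟨hf, hA, h⟩⟩

namespace Chain

variable {C : Chain} {i : ℕ} {D : C.Kernels} {τ : ℝ}

/-- The `L²` norm in terms of the scalar components. -/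
theorem l2norm_sq {z : ℝ → C.State} {t B : ℝ}
    (hm : ∀ j : C.Idx 1, Measurable fun x => toFam 1 z 0 j t x)
    (hB : ∀ (j : C.Idx 1), ∀ x ∈ Icc (0 : ℝ) 1, |toFam 1 z 0 j t x| ≤ B) :
    (z t).l2norm ^ 2 = ∑ j : C.Idx 1, ∫ x in 0..1, toFam 1 z 0 j t x ^ 2 := by
  have hi : ∀ j : C.Idx 1, IntervalIntegrable (fun x => toFam 1 z 0 j t x ^ 2) volume 0 1 :=
    fun j => intervalIntegrable_of_abs_le (M := B ^ 2) ((hm j).pow_const 2) fun x hx => by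
      rw [uIcc_of_le zero_le_one] at hx
      rw [abs_pow]
      exact pow_le_pow_left₀ (abs_nonneg _) (hB j x hx) 2
  have hnn : ∀ x : ℝ, ∀ i, 0 ≤ (∑ k, ((z t).u i x k) ^ 2) + ∑ k, ((z t).v i x k) ^ 2 := fun x i =>
    add_nonneg (sum_nonneg fun _ _ => sq_nonneg _) (sum_nonneg fun _ _ => sq_nonneg _)
  rw [State.l2norm, Real.sq_sqrt (sum_nonneg fun i _ =>
    intervalIntegral.integral_nonneg zero_le_one fun x _ => hnn x i), Fintype.sum_sigma,
    ← Finset.sum_coe_sort]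
  refine sum_congr rfl fun i _ => ?_
  rw [Fintype.sum_sum_type, ← integral_finsetSum fun k _ => hi ⟨i, Sum.inl k⟩,
    ← integral_finsetSum fun k _ => hi ⟨i, Sum.inr k⟩,
    ← intervalIntegral.integral_add (intervalIntegrable_sum fun k _ => hi ⟨i, Sum.inl k⟩)
      (intervalIntegrable_sum fun k _ => hi ⟨i, Sum.inr k⟩)]
  simp only [toFam, Sum.elim_inl, Sum.elim_inr, zero_add]

/-- Continuous dependence of the closed loop on the initial state in `L²`, on bounded time
intervals.  The delay `τ` makes the feedback loop a contraction with respect to a weight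
`exp (-β t)` with large `β`. -/
theorem Kernels.Solve.exists_l2_bound (hD : D.Solve) (hC : C.Standing) (hτ : 0 < τ) {H : ℝ}
    (hH : 0 ≤ H) : ∃ c, 0 ≤ c ∧ ∀ (z : ℝ → C.State) (W : C.Inputs),
      C.IsSol 1 0 (Ici 0) (W 1) z → D.Law τ z W →
      ∀ t ∈ Icc 0 H, (z t).l2norm ≤ c * (z 0).l2norm := by
  have hK := MemKernel.zero (C := C) 1
  have hN1 : 1 ∈ Finset.Icc 1 C.N := Finset.mem_Icc.2 ⟨le_rfl, hC.N_pos⟩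
  obtain ⟨M, hP⟩ := exists_regular hC le_rfl hK
  set P := C.toNet 1 (fun _ _ => 0) 0 with hPdef
  have hM := hP.M_pos
  obtain ⟨κ, β₁, -, he⟩ := hP.exists_exponents 0
  have hκ := he.κ_nonneg
  obtain ⟨β₂, c, hβ₂, hc, hlaw⟩ := hD.exists_law_stability hC hτ
  set n : ℝ := (Fintype.card (C.Idx 1) : ℝ) with hn
  -- a weight for which the delay `τ` compensates the gain of the law
  obtain ⟨β₃, hβ₃⟩ : ∃ β₃, c * (2 * exp κ) * exp (-β₃ * τ) ≤ 1 / 2 := by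
    refine ⟨c * (2 * exp κ) * 2 / τ, ?_⟩
    rw [neg_mul, div_mul_cancel₀ _ hτ.ne', Real.exp_neg, ← div_eq_mul_inv, div_le_iff₀ (exp_pos _)]
    linarith [Real.add_one_le_exp (c * (2 * exp κ) * 2)]
  set β := max β₁ (max β₂ β₃) with hβdef
  have hb1 : β₁ ≤ β := le_max_left _ _
  have hb2 : β₂ ≤ β := (le_max_left _ _).trans (le_max_right _ _)
  have hb3 : β₃ ≤ β := (le_max_right _ _).trans (le_max_right _ _)
  replace he := he.mono hP hb1
  have hfac2 : n * M / β ≤ 1 / 2 := by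
    refine le_trans ?_ he.half
    have h0 : 0 < β := by linarith [he.one_le]
    rw [Net.factor, div_eq_mul_one_div]
    refine mul_le_mul_of_nonneg_left ?_ (by positivity)
    have h1 : 1 / β ≤ exp κ / β := by gcongr; exact one_le_exp hκ
    linarith [exp_pos (-κ)]
  have hgain : c * (2 * exp κ) * exp (-β * τ) ≤ 1 / 2 :=
    le_trans (mul_le_mul_of_nonneg_left (exp_le_exp.2 (by nlinarith)) (by positivity)) hβ₃
  obtain ⟨Γ, hΓ0, hΓ⟩ := exists_bound_of_finite (X := Unit) (f := fun (j : C.Idx 1) _ =>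
    sqrt |(P.c j)⁻¹| + sqrt |P.c j|) fun j => ⟨_, fun _ => le_rfl⟩
  have hΓ1 : ∀ j, sqrt |(P.c j)⁻¹| ≤ Γ := fun j => by
    have := (le_abs_self _).trans (hΓ j ())
    linarith [sqrt_nonneg |P.c j|]
  have hΓ2 : ∀ j, sqrt |P.c j| ≤ Γ := fun j => by
    have := (le_abs_self _).trans (hΓ j ())
    linarith [sqrt_nonneg |(P.c j)⁻¹|]
  set E := n * (M * (2 * (exp κ * (Γ + Γ)))) + Γ with hE
  set K := exp (β * H) * (2 * (1 + Γ * exp (β * H) * E)) with hKdef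
  have hΓ0' : 0 ≤ Γ := hΓ0.le
  have hE0 : 0 ≤ E := by positivity
  refine ⟨sqrt n * K, by positivity, fun z W hz hL t ht => ?_⟩
  set q := toFam 1 z 0 with hq
  set Q := (z 0).l2norm with hQ
  have hQ0 : 0 ≤ Q := sqrt_nonneg _
  have hqt : Net.Tame q H := hz.tame fun s hs => hs.1
  have hqm := hqt.meas
  obtain ⟨B, hB⟩ := hqt.bdd
  have hqm1 : ∀ (j : C.Idx 1) s, Measurable fun x => q j s x := fun j s =>
    (hqm j).comp measurable_prodMk_left
  have hmild : ∀ (j : C.Idx 1) s x, 0 ≤ s → s ≤ H → x ∈ Icc 0 1 → q j s x =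
      P.mild (fun j x => q j 0 x) (fun _ _ => 0) (netInput 1 W 0) q j s x :=
    fun j s x h1 _ h3 => hz.toFam_mild_zero hC j h1 h3
  have hint : ∀ (j : C.Idx 1) s, 0 ≤ ∫ x in 0..1, q j s x ^ 2 := fun j s =>
    intervalIntegral.integral_nonneg zero_le_one fun x _ => sq_nonneg _
  have hq₀ : ∀ j, (ParamNorm.l2 0 0 1).Bd (fun x => q j 0 x) Q := fun j => by
    rw [ParamNorm.l2_zero_one_bd_iff (hqm1 j 0) (fun x hx => hB j 0 x le_rfl hH hx) hQ0, hQ,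
      l2norm_sq (fun j => hqm1 j 0) fun j x hx => hB j 0 x le_rfl hH hx]
    exact single_le_sum (f := fun j => ∫ x in 0..1, q j 0 x ^ 2)
      (fun j _ => hint j 0) (Finset.mem_univ j)
  have hin : ∀ Ω, 0 ≤ Ω → (∀ k, (ParamNorm.l2 β 0 H).Bd (fun t => W 1 t k) Ω) → ∀ j,
      (ParamNorm.l2 β 0 H).Bd (fun s => if 0 < s then netInput 1 W 0 j s else 0) Ω := by
    rintro Ω hΩ h ⟨⟨j, hj⟩, k | k⟩
    · simp only [netInput, Sum.elim_inl, zero_add]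
      split_ifs with hj1
      · subst hj1
        exact ParamNorm.l2_ite (h k)
      · simpa using ParamNorm.mono _ (ParamNorm.zero _) hΩ
    · simpa [netInput] using ParamNorm.mono _ (ParamNorm.zero _) hΩ
  have htrace : ∀ Ω, 0 ≤ Ω → (∀ k, (ParamNorm.l2 β 0 H).Bd (fun t => W 1 t k) Ω) → ∀ j x,
      x ∈ Icc 0 1 → (ParamNorm.l2 β 0 H).Bd (fun t => Net.ext q j t x)
        (2 * (exp κ * (Γ * Q + Ω))) := fun Ω hΩ h j x hx =>
    hP.trace_bd rfl he hQ0 hΩ hΓ0' hΓ1 hqt hmild hq₀ (hin Ω hΩ h) j hx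
  -- the input
  have hW : ∀ k, (ParamNorm.l2 β 0 H).Bd (fun t => W 1 t k) (2 * (Γ * Q / 2)) := by
    have hWm : ∀ k, Measurable fun t => W 1 t k := fun k => measurable_pi_iff.1 (hL.meas 1 hN1) k
    refine ParamNorm.of_half _ (by positivity) ?_ fun Ω hΩ h k => ?_
    · obtain ⟨B, hB⟩ := hL.bdd H
      obtain ⟨N, hN⟩ := (ParamNorm.onWindow_l2 (β := β) (T := 0) (H := H)).fin B
      exact ⟨|N| + 1, by positivity, fun k => ParamNorm.mono _ (hN (hWm k) fun t ht =>
        hB 1 hN1 t ht.2 k) (by linarith [le_abs_self N])⟩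
    · set A := exp (-β * τ) * (2 * (exp κ * (Γ * Q + Ω))) with hA
      have hA0 : 0 < A := by positivity
      have key := hlaw β hb2 (ParamNorm.l2 β (C.startTime τ) H) H ParamNorm.onWindow_l2 z W hL A hA0
        (fun i hi j s x hs hs0 hx => ?_) 1 hN1 k
      · refine ParamNorm.mono _ (ParamNorm.l2_mono (hWm k) key fun t ht hne => ⟨⟨not_lt.1 fun hlt =>
          hne (by rw [hL.before 1 hN1 t hlt, Pi.zero_apply]), ht.2⟩, rfl⟩) ?_
        calc c * A = c * (2 * exp κ) * exp (-β * τ) * (Γ * Q + Ω) := by rw [hA]; ring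
          _ ≤ 1 / 2 * (Γ * Q + Ω) := by gcongr
          _ = _ := by ring
      · obtain ⟨j', hj'⟩ := exists_delayedFam_eq (Finset.mem_Icc.1 hi).1 j
        rw [show (fun t => C.delayedFam τ i z t j s x) = fun t =>
          if C.startTime τ ≤ t then q j' (t + s - τ) x else 0 from funext fun t => hj' z t s x]
        have hm1 : Measurable fun t => Net.ext q j' t x :=
          (Net.measurable_ext hqm j').comp measurable_prodMk_right
        have h1 := (ParamNorm.onWindow_l2 (β := β) (T := 0) (H := H)).shift (a := τ - s) hm1
          (fun t ht => if_neg fun h => by linarith [h.1]) (by linarith) (htrace Ω hΩ.le h j' x hx)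
        refine ParamNorm.mono _ (ParamNorm.l2_mono (Measurable.ite measurableSet_Ici
          ((hqm j').comp (by fun_prop : Measurable fun t : ℝ => (t + s - τ, x))) measurable_const)
          h1 fun t ht _ => ?_) ?_
        · obtain ⟨a, ha, hle⟩ := exists_delay_ge_memLen hC hi
          have h0 : 0 ≤ t + s - τ := (sub_pos.2 (lt_of_startTime hC hτ ht.1 ha
            (by linarith : t - C.delay a ≤ t + s)).2).le
          rw [if_pos ht.1, Net.ext, show t - (τ - s) = t + s - τ by ring, if_pos ⟨h0, hx⟩]
          exact ⟨⟨(startTime_pos hC hτ).le.trans ht.1, ht.2⟩, rfl⟩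
        rw [hA, mul_comm]
        refine mul_le_mul_of_nonneg_right (exp_le_exp.2 ?_) (by positivity)
        nlinarith
  have hW' : ∀ k, (ParamNorm.l2 β 0 H).Bd (fun t => W 1 t k) (Γ * Q) := fun k =>
    ParamNorm.mono _ (hW k) (by linarith)
  have hX := htrace (Γ * Q) (by positivity) hW'
  have hprof : ∀ j, (ParamNorm.l2 0 0 1).Bd (fun x => q j t x) (K * Q) := fun j => by
    have := hP.profile_bd rfl (by linarith [he.one_le] : 0 < β) hfac2 hQ0 (E := E * Q)
        (by positivity) hΓ0' hΓ2
      hqt hmild hq₀ (fun j => ParamNorm.mono _ (hP.enter_bd (by positivity)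
        (fun l => hX l _ (Net.xout_mem l)) (hin _ (by positivity) hW' j))
        (le_of_eq (by rw [hE]; ring))) j ht
    refine ParamNorm.onWindow_l2.congr (hqm1 j t) (fun x hx => if_pos ⟨ht.1, hx⟩)
      (ParamNorm.mono _ this (le_of_eq (by rw [hKdef]; ring)))
  have hbt : ∀ (j : C.Idx 1), ∀ x ∈ Icc (0 : ℝ) 1, |q j t x| ≤ B := fun j x hx =>
    hB j t x ht.1 ht.2 hx
  refine abs_le_of_sq_le_sq' ?_ (by positivity) |>.2
  rw [l2norm_sq (fun j => hqm1 j t) hbt]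
  calc _ ≤ ∑ _j : C.Idx 1, (K * Q) ^ 2 := sum_le_sum fun j _ =>
        (ParamNorm.l2_zero_one_bd_iff (hqm1 j t) (hbt j) (by positivity)).1 (hprof j)
    _ = n * (K * Q) ^ 2 := by rw [Finset.sum_const, Finset.card_univ, nsmul_eq_mul]
    _ = _ := by
      rw [mul_assoc (sqrt n), mul_pow (sqrt n), Real.sq_sqrt (Nat.cast_nonneg _)]

end Chain

namespace Chain

variable {C : Chain} {D : C.Kernels} {τ : ℝ}

theorem State.Agree.l2norm_eq {a b : C.State} (h : a.Agree 1 b) : a.l2norm = b.l2norm := by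
  unfold State.l2norm
  congr 1
  refine sum_congr rfl fun i hi => integral_congr_Icc zero_le_one fun x hx => ?_
  simp only [(h i hi x hx).1, (h i hi x hx).2]

/-- In the closed loop the estimate may be replaced by the delayed state. -/
theorem Kernels.IsClosedLoop.law_of_isDelayedObserver {O : (ℝ → Fin (C.n C.N) → ℝ) → ℝ → C.State}
    {z₀ : C.State} {z : ℝ → C.State} {W : C.Inputs}
    (h : D.IsClosedLoop τ O z₀ z W) (hO : C.IsDelayedObserver τ O) (hC : C.Standing) (hτ : 0 < τ) :
    D.IsFeedback τ (fun r => z (r - τ)) W :=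
  h.law.congr hC hτ (hO.exact _ z h.plant)

/-- The state is at rest after a finite time, and until then the closed loop depends continuously
on its initial state. -/
theorem Kernels.Solve.exists_decay (hD : D.Solve) (hC : C.Standing)
    (hcontrol : ∀ i ∈ Finset.Ico 1 C.N, (C.Q i).rank = C.n (i + 1))
    (hobs : ∀ i ∈ Finset.Ico 1 C.N, (C.Q i).rank = C.n i) (hτ : 0 < τ) :
    ∃ c γ : ℝ, 0 < c ∧ 0 < γ ∧ ∀ (z : ℝ → C.State) (W : C.Inputs),
      C.IsSol 1 0 (Ici 0) (W 1) z → D.IsFeedback τ (fun r => z (r - τ)) W →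
      ∀ t, 0 ≤ t → (z t).l2norm ≤ c * exp (-γ * t) * (z 0).l2norm := by
  obtain ⟨T, hT, hrest⟩ := hD.exists_rest_time hC hcontrol hobs hτ
  obtain ⟨c, hc, hbd⟩ := hD.exists_l2_bound hC hτ hT.le
  refine ⟨(c + 1) * exp T, 1, by positivity, one_pos, fun z W hz hW t ht => ?_⟩
  have h0 : 0 ≤ (z 0).l2norm := sqrt_nonneg _
  rcases le_total t T with h | h
  · refine (hbd z W hz (hW.law hD hC hτ hz) t ⟨ht, h⟩).trans (mul_le_mul_of_nonneg_right ?_ h0)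
    rw [mul_assoc, ← exp_add]
    have : 1 ≤ exp (T + -1 * t) := one_le_exp (by linarith)
    nlinarith
  · have hz0 : (z t).Agree 1 ⟨fun _ _ => 0, fun _ _ => 0⟩ := fun i hi x hx =>
      hrest z W hz hW t h i hi x hx
    rw [hz0.l2norm_eq]
    have : State.l2norm (C := C) ⟨fun _ _ => 0, fun _ _ => 0⟩ = 0 := by simp [State.l2norm]
    rw [this]
    positivity

end Chain

end

theorem mainTheorem2 (C : Chain) (hC : C.Standing)
    (hcontrol : ∀ i ∈ Finset.Ico 1 C.N, (C.Q i).rank = C.n (i + 1))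
    (hobs : ∀ i ∈ Finset.Ico 1 C.N, (C.Q i).rank = C.n i)
    (τ : ℝ) (hτ : ∑ j ∈ Finset.Icc 1 C.N, 1 / C.lam1 j < τ) :
    (∃ O, C.IsDelayedObserver τ O) ∧ (∃ D : C.Kernels, D.Solve) ∧
    ∀ O, C.IsDelayedObserver τ O → ∀ D : C.Kernels, D.Solve →
      (∀ z₀ : C.State, z₀.Admissible → ∃ z W, D.IsClosedLoop τ O z₀ z W) ∧
      (∀ (z₀ : C.State) (z z' : ℝ → C.State) (W W' : (i : ℕ) → ℝ → Fin (C.n i) → ℝ),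
        D.IsClosedLoop τ O z₀ z W → D.IsClosedLoop τ O z₀ z' W' →
        ∀ t, 0 ≤ t → (z t).Agree 1 (z' t) ∧ W 1 t = W' 1 t) ∧
      ∃ c γ : ℝ, 0 < c ∧ 0 < γ ∧
        ∀ (z₀ : C.State) (z : ℝ → C.State) (W : (i : ℕ) → ℝ → Fin (C.n i) → ℝ),
          z₀.Admissible → D.IsClosedLoop τ O z₀ z W →
          ∀ t, 0 ≤ t → (z t).l2norm ≤ c * Real.exp (-γ * t) * z₀.l2norm := by
  have hτ0 : 0 < τ := (Finset.sum_nonneg fun j hj =>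
    (one_div_pos.2 (Chain.lam1_pos hC hj)).le).trans_lt hτ
  refine ⟨Chain.exists_delayedObserver hC hobs hτ, Chain.exists_kernels hC, fun O hO D hD =>
    ⟨fun z₀ hz₀ => ?_, fun z₀ z z' W W' h h' => ?_, ?_⟩⟩
  · obtain ⟨z, W, hz, h0, hL⟩ := hD.exists_closedLoop hC hτ0 hz₀
    refine ⟨z, W, h0, hz, (hL.isFeedback hD hC hτ0 hz).congr hC hτ0 fun r hr j hj x hx => ?_⟩
    have := hO.exact _ z hz r hr j hj x hx
    exact ⟨this.1.symm, this.2.symm⟩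
  · refine ((h.law_of_isDelayedObserver hO hC hτ0).law hD hC hτ0 h.plant).unique
      ((h'.law_of_isDelayedObserver hO hC hτ0).law hD hC hτ0 h'.plant) hD hC hτ0 h.plant h'.plant
      fun j hj x hx => ?_
    have a := h.init j hj x hx
    have b := h'.init j hj x hx
    exact ⟨a.1.trans b.1.symm, a.2.trans b.2.symm⟩
  · obtain ⟨c, γ, hc, hγ, hdec⟩ := hD.exists_decay hC hcontrol hobs hτ0
    refine ⟨c, γ, hc, hγ, fun z₀ z W _ h t ht => ?_⟩
    rw [← h.init.l2norm_eq]
    exact hdec z W h.plant (h.law_of_isDelayedObserver hO hC hτ0) t ht
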